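/- **Setting.** Let $(w,z,\zeta)\in\mathbb C\oplus\mathbb C^{s}\oplus\mathbb C^{r}$ and let $$P=z^TH(\zeta,\bar\zeta)\bar z+\Re\big(\bar z^TS(\zeta,\bar\zeta)\bar z\big),$$ where $H$ and $S$ are real analytic near $0$ with values in the Hermitian, respectively symmetric, $s\times s$ matrices, and $H(0,0)$ is invertible. Let $Q(z,\zeta,\bar z,\bar\zeta,\Im w)$ be real valued and real analytic near $0$, with all terms of its power series of weighted degree $>2$ for the weights $\mathrm{wt}(z)=1$, $\mathrm{wt}(\zeta)=0$, $\mathrm{wt}(\Im w)=2$. Put $M=\{\Re w=P+Q\}$ and $M_0=\{\Re w=P\}$. For a CR hypersurface with CR structure $\mathcal H$, let $K_2\subset\mathcal H$ be the Levi kernel and $K_3\subset K_2$ the left kernel of $(X,Y,Y')\mapsto[[X,\bar Y],\bar Y']$ mod $\mathcal H\oplus\overline{\mathcal H}$. *Uniformly $2$-nondegenerate near $0$* means that near $0$ the space $K_2$ has constant rank, $K_2\ne0$ and $K_3=0$. **Frames.** Let $\mathbb C\mathfrak g_-=\mathfrak g_{-2,0}\oplus\mathfrak g_{-1,1}\oplus\mathfrak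 g_{-1,-1}=\mathbb C\oplus\mathbb C^s\oplus\mathbb C^s$ be the Heisenberg algebra with $[v_1,v_2]=2i\,v_1^Tv_2$, and $\mathfrak{csp}$ its algebra of degree preserving derivations, regarded as endomorphisms of $\mathbb C\mathfrak g_{-1}=\mathbb C^s\oplus\mathbb C^s$. The fiber $\mathcal F_p$ consists of the isomorphisms of bigraded Lie algebras $\tilde\phi:\mathbb CT_pM/(\mathcal H\oplus\overline{\mathcal H})\oplus\mathcal H/K_2\oplus\overline{\mathcal H}/\overline{K_2}\to\mathbb C\mathfrak g_-$. Let $\sigma_{\tilde\phi}$ be the antilinear involution of $\mathbb C\mathfrak g_-$, and of endomorphisms of $\mathbb C\mathfrak g_{-1}$, corresponding to complex conjugation. For $v\in K_2$ let $\iota(v):\overline{\mathcal H}/\overline{K_2}\to\mathcal H/K_2$, $w\mapsto[v,w]$ mod $K_2\oplus\overline{\mathcal H}$, and $\iota(\bar v)=\overline{\iota(v)}$. Put $\mathfrak g_{0,2}=\tilde\phi\,\iota(K_2)\tilde\phi^{-1}$ and $\mathfrak g_{0,-2}=\tilde\phi\,\iota(\overline{K_2})\tilde\phi^{-1}$, and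 let $\mathfrak g_{0,0}\subset\mathfrak{csp}$ be the elements that preserve $\mathfrak g_{-1,\pm1}$ and whose commutators preserve $\mathfrak g_{0,\pm2}$. The subspaces $\mathfrak g_{0,\pm2}$ and the involution $\sigma_{\tilde\phi}$ form the bigraded symbol in the frame $\tilde\phi$. **Modified symbols.** Let $\pi$ be a projection of a neighborhood of $p$ onto a local leaf space of the Levi foliation, that is, a submersion whose fibers have complexified tangent spaces $K_2\oplus\overline{K_2}$. For a smooth local section $\tilde\phi$ of $\mathcal F$ around $p$ and $v\in K_2(p)\oplus\overline{K_2}(p)$, let $\iota_{\tilde\phi}(v)$ be the derivative at $p$ in the direction $v$ of the map $q\mapsto\tau(p)\circ\tau(q)^{-1}$ along the leaf, where $\tau(q)^{-1}=\pi_*\circ\tilde\phi(q)^{-1}$ on $\mathbb C\mathfrak g_{-1}$. The modified symbol at $p$ along $\tilde\phi$ is $$\mathfrak g^{\rm mod}(\tilde\phi;p)=\mathbb C\mathfrak g_-\oplus\big(\iota_{\tilde\phi}(K_2\oplus\overline{K_2})+\mathfrak g_{0,0}\big),$$ and its $\sigma$-invariant form is $\mathbb C\mathfrak g_-\oplus\big(\iota_{\tilde\phi}(K_2)+\sigma_{\tilde\phi(p)}(\iota_{\tilde\phi}(K_2))+\mathfrak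 g_{0,0}\big)$. **Normalization.** For a section $V$ of $K_2$ let $S^{0,2}_V$ and $S^{0,-2}_V$ be the matrix functions representing $\iota(V)$ and $\iota(\overline V)$ in the frame $\tilde\phi$. Identify $K_2(p)$ with $\mathfrak g_{0,2}$ by $\iota$. The obstructions $O_{0,\pm2}(\tilde\phi)(p):K_2(p)\otimes\mathfrak g_{0,\pm2}\to\mathfrak{csp}_{0,\pm2}/\mathfrak g_{0,\pm2}$ are the bilinear maps $(X,S^{0,\pm2}_V(p))\mapsto X(S^{0,\pm2}_V)(p)$. The pairs $(O_{0,-2},O_{0,2})$ of all sections with a prescribed value at $p$ form an equivalence class. A *normalization condition* chooses, for every bigraded symbol, one element in every class, and $\tilde\phi$ is *normalized* at $p$ if its pair is the chosen element of its class. A *modified symbol at $\tilde\phi_0\in\mathcal F_p$ with respect to a normalization condition* is the modified symbol at $p$ along a normalized section $\tilde\phi$ with $\tilde\phi(p)=\tilde\phi_0$; likewise for the $\sigma$-invariant form. **Proposition.** Suppose that $M$ is uniformly $2$-nondegenerate near $0$. Then $M_0$ is uniformly $2$-nondegenerate near $0$ (so it is a $2$-nondegenerate model), the fibers $\mathcal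 F_0$ of $M$ and $M_0$ coincide, and $M$ and $M_0$ have the same bigraded symbol at $0$ in every frame $\tilde\phi_0\in\mathcal F_0$. Moreover, for all local leaf space projections of $M$ and of $M_0$ near $0$, every normalization condition and every $\tilde\phi_0\in\mathcal F_0$, the hypersurfaces $M$ and $M_0$ have the same modified symbols at $\tilde\phi_0$ with respect to the normalization condition: a subspace is a modified symbol of $M$ if and only if it is one of $M_0$, and the $\sigma$-invariant form of the modified symbol exists, is unique, and is the same for $M$ and $M_0$. -/

import Mathlib

open Filter Topology Asymptotics
open scoped ContDiff Matrix ComplexConjugate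

noncomputable section

namespace CRSymbol

/-! ### Complex vector fields on a real coordinate space

A `(2n+1)`-dimensional manifold is described in a chart `ι → ℝ` around the point of interest; its
complexified tangent spaces are all `ι → ℂ`. -/

section Fields

variable {ι : Type} [Fintype ι] [DecidableEq ι]

/-- Complex linear extension of the real differential of `f` at `q`:
`V ↦ ∑ i, V i • ∂f/∂x_i (q)`. -/
def cderiv {G : Type} [NormedAddCommGroup G] [NormedSpace ℝ G] [Module ℂ G]
    (f : (ι → ℝ) → G) (q : ι → ℝ) : (ι → ℂ) →ₗ[ℂ] G :=
  Fintype.linearCombination ℂ (fun i => fderiv ℝ f q (Pi.single i 1))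

/-- The Lie bracket of two complex vector fields. -/
def bracket (V W : (ι → ℝ) → ι → ℂ) (q : ι → ℝ) : ι → ℂ :=
  cderiv W q (V q) - cderiv V q (W q)

/-- The complex conjugate of a subspace of the complexified tangent space. -/
def conjSub (D : Submodule ℂ (ι → ℂ)) : Submodule ℂ (ι → ℂ) where
  carrier := {v | star v ∈ D}
  add_mem' {a b} ha hb := by
    simpa only [Set.mem_ofPred_eq, star_add] using D.add_mem ha hb
  zero_mem' := by simp
  smul_mem' c v hv := by
    simpa only [Set.mem_ofPred_eq, star_smul] using D.smul_mem (star c) hv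

/-- `X` is, near `p`, a smooth section of the field of subspaces `D`. -/
def IsSectionNear (D : (ι → ℝ) → Submodule ℂ (ι → ℂ)) (p : ι → ℝ)
    (X : (ι → ℝ) → ι → ℂ) : Prop :=
  ∀ᶠ q in 𝓝 p, ContDiffAt ℝ ∞ X q ∧ X q ∈ D q

lemma cderiv_add {G : Type} [NormedAddCommGroup G] [NormedSpace ℝ G] [Module ℂ G]
    {f g : (ι → ℝ) → G} {q : ι → ℝ} (hf : DifferentiableAt ℝ f q)
    (hg : DifferentiableAt ℝ g q) (v : ι → ℂ) :
    cderiv (fun x => f x + g x) q v = cderiv f q v + cderiv g q v := by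
  have h : fderiv ℝ (fun x => f x + g x) q = fderiv ℝ f q + fderiv ℝ g q := fderiv_add hf hg
  simp [cderiv, Fintype.linearCombination_apply, h, Finset.sum_add_distrib]

lemma cderiv_smul {f : (ι → ℝ) → ι → ℂ} {q : ι → ℝ} (hf : DifferentiableAt ℝ f q)
    (c : ℂ) (v : ι → ℂ) :
    cderiv (fun x => c • f x) q v = c • cderiv f q v := by
  have h : fderiv ℝ (fun x => c • f x) q = c • fderiv ℝ f q := fderiv_const_smul hf c
  simp [cderiv, Fintype.linearCombination_apply, h, Finset.smul_sum, smul_comm c]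

lemma IsSectionNear.differentiableAt {D : (ι → ℝ) → Submodule ℂ (ι → ℂ)} {p : ι → ℝ}
    {X : (ι → ℝ) → ι → ℂ} (h : IsSectionNear D p X) : DifferentiableAt ℝ X p :=
  (h.self_of_nhds.1).differentiableAt (by simp)

end Fields

section CR

variable {ι : Type} [Fintype ι] [DecidableEq ι]

/-- The CR structure `H = ℂTM ∩ T^{1,0}` of a submanifold of `ℂ^κ` parametrized by `E`: the
complex tangent vectors annihilated by the differentials of the conjugate coordinate functions. -/
def crStructure {κ : Type} [Fintype κ] (E : (ι → ℝ) → κ → ℂ) (q : ι → ℝ) :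
    Submodule ℂ (ι → ℂ) :=
  LinearMap.ker (cderiv (fun x j => conj (E x j)) q)

variable (H : (ι → ℝ) → Submodule ℂ (ι → ℂ))

/-- `H ⊕ H̄`, the complexified contact (Levi) distribution. -/
def leviDist (q : ι → ℝ) : Submodule ℂ (ι → ℂ) := H q ⊔ conjSub (H q)

/-- The Levi kernel `K₂`: the left kernel of the Levi form
`(X, Y) ↦ (1/2i) [X, Ȳ] mod H ⊕ H̄`. -/
def leviKernel (q : ι → ℝ) : Submodule ℂ (ι → ℂ) where
  carrier := {v | ∃ X, IsSectionNear H q X ∧ X q = v ∧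
    ∀ Y, IsSectionNear H q Y → bracket X (fun x => star (Y x)) q ∈ leviDist H q}
  add_mem' := by
    rintro a b ⟨X, hX, hXa, hXY⟩ ⟨X', hX', hXb, hXY'⟩
    refine ⟨fun x => X x + X' x, ?_, by simp [hXa, hXb], fun Y hY => ?_⟩
    · filter_upwards [hX, hX'] with x h1 h2
      exact ⟨h1.1.add h2.1, (H x).add_mem h1.2 h2.2⟩
    · have := (leviDist H q).add_mem (hXY Y hY) (hXY' Y hY)
      convert this using 1
      simp only [bracket, cderiv_add hX.differentiableAt hX'.differentiableAt, map_add]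
      abel
  zero_mem' := by
    refine ⟨fun _ => 0, ?_, rfl, fun Y _ => ?_⟩
    · exact Filter.Eventually.of_forall fun x => ⟨contDiffAt_const, (H x).zero_mem⟩
    · have : bracket (fun _ => (0 : ι → ℂ)) (fun x => star (Y x)) q = 0 := by
        simp [bracket, cderiv, Fintype.linearCombination_apply]
      rw [this]
      exact Submodule.zero_mem _
  smul_mem' := by
    rintro c v ⟨X, hX, hXv, hXY⟩
    refine ⟨fun x => c • X x, ?_, by simp [hXv], fun Y hY => ?_⟩
    · filter_upwards [hX] with x h1
      exact ⟨(contDiffAt_const (c := c)).smul h1.1, (H x).smul_mem c h1.2⟩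
    · have := (leviDist H q).smul_mem c (hXY Y hY)
      convert this using 1
      simp only [bracket, cderiv_smul hX.differentiableAt, map_smul, smul_sub]

/-- `K₂ ⊕ K̄₂`, the complexified tangent spaces of the leaves of the Levi foliation. -/
def leafDist (q : ι → ℝ) : Submodule ℂ (ι → ℂ) := leviKernel H q ⊔ conjSub (leviKernel H q)

/-- The next term `K₃` of the Freeman filtration: the left kernel of the second generalized Levi
form `K₂ × H × H → ℂTM / (H ⊕ H̄)`, `(X, Y, Y') ↦ [[X, Ȳ], Ȳ']`. -/
def freemanThree (q : ι → ℝ) : Set (ι → ℂ) :=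
  {v | ∃ X, IsSectionNear (leviKernel H) q X ∧ X q = v ∧
    ∀ Y Y', IsSectionNear H q Y → IsSectionNear H q Y' →
      bracket (bracket X (fun x => star (Y x))) (fun x => star (Y' x)) q ∈ leviDist H q}

/-- Uniform `2`-nondegeneracy on some neighborhood of `p`: the Levi kernel `K₂` has constant rank,
`K₂ ≠ 0`, and `K₃ = 0`. -/
def UniformlyTwoNondegenerate (p : ι → ℝ) : Prop :=
  (∃ k : ℕ, ∀ᶠ q in 𝓝 p, Module.finrank ℂ (leviKernel H q) = k) ∧
  ∀ᶠ q in 𝓝 p, leviKernel H q ≠ ⊥ ∧ ∀ v ∈ freemanThree H q, v = 0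

/-! ### The bundle `F` of graded frames -/

/-- Representatives in `ℂT_pM` of the images under `φ̃⁻¹` of the standard basis of the model
Heisenberg algebra `ℂg₋ = g₋₂,₀ ⊕ g₋₁,₁ ⊕ g₋₁,₋₁ = ℂ ⊕ ℂ^s ⊕ ℂ^s`. -/
structure GradedFrame (ι : Type) (s : ℕ) where
  /-- represents a basis of `ℂTM / (H ⊕ H̄)` -/
  g : ι → ℂ
  /-- represents a basis of `H / K₂` -/
  f : Fin s → ι → ℂ
  /-- represents a basis of `H̄ / K̄₂` -/
  h : Fin s → ι → ℂ

/-- The basis of the degree `-1` part. -/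
def GradedFrame.vec {ι : Type} {s : ℕ} (φ : GradedFrame ι s) : Fin s ⊕ Fin s → ι → ℂ :=
  Sum.elim φ.f φ.h

variable {s : ℕ}

/-- `φ` represents a point of the fiber `F_p`, i.e. an isomorphism `φ̃` of bigraded Lie algebras
from the nondegenerate part `ℂT_pM/(H⊕H̄) ⊕ H/K₂ ⊕ H̄/K̄₂` of the bigraded symbol at `p` (with the
bracket induced by the Lie bracket of vector fields) onto the Heisenberg algebra
`ℂ ⊕ ℂ^s ⊕ ℂ^s` with bracket `[v₁, v₂] = 2i v₁ᵀv₂`. -/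
structure IsGradedFrame (p : ι → ℝ) (φ : GradedFrame ι s) : Prop where
  g_not_mem : φ.g ∉ leviDist H p
  g_span : leviDist H p ⊔ Submodule.span ℂ {φ.g} = ⊤
  f_indep : LinearIndependent ℂ fun j => (leviKernel H p).mkQ (φ.f j)
  f_span : leviKernel H p ⊔ Submodule.span ℂ (Set.range φ.f) = H p
  h_indep : LinearIndependent ℂ fun j => (conjSub (leviKernel H p)).mkQ (φ.h j)
  h_span : conjSub (leviKernel H p) ⊔ Submodule.span ℂ (Set.range φ.h) = conjSub (H p)
  bracket_eq : ∀ j k X Y, IsSectionNear H p X → X p = φ.f j →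
    IsSectionNear (fun q => conjSub (H q)) p Y → Y p = φ.h k →
    bracket X Y p - (if j = k then 2 * Complex.I else 0) • φ.g ∈ leviDist H p

/-- `φ` is a smooth local section of the bundle `F` around `p`. (Every smooth section over the
Levi leaf through `p` is the restriction of such a section.) -/
def IsFrameSection (p : ι → ℝ) (φ : (ι → ℝ) → GradedFrame ι s) : Prop :=
  ∀ᶠ q in 𝓝 p, ContDiffAt ℝ ∞ (fun x => (φ x).g) q ∧
    (∀ j, ContDiffAt ℝ ∞ (fun x => (φ x).f j) q) ∧
    (∀ j, ContDiffAt ℝ ∞ (fun x => (φ x).h j) q) ∧ IsGradedFrame H q (φ q)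

/-! ### The bigraded symbol in a frame -/

/-- `S` is the matrix of `φ̃ ∘ ι(V_p) ∘ φ̃⁻¹ : g₋₁,₋₁ → g₋₁,₁` for the section `V` of `K₂`,
where `ι(v)(w) = [V, W]_p mod K₂ ⊕ H̄`. -/
def IsIotaPlus (p : ι → ℝ) (φ : GradedFrame ι s) (V : (ι → ℝ) → ι → ℂ)
    (S : Matrix (Fin s) (Fin s) ℂ) : Prop :=
  ∀ k Y, IsSectionNear (fun q => conjSub (H q)) p Y → Y p = φ.h k →
    bracket V Y p - ∑ l, S l k • φ.f l ∈ leviKernel H p ⊔ conjSub (H p)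

/-- `T` is the matrix of `φ̃ ∘ ι(V̄_p) ∘ φ̃⁻¹ : g₋₁,₁ → g₋₁,₋₁` for the section `V` of `K₂`,
where `ι(v̄)(w) = [V̄, W]_p mod K̄₂ ⊕ H` is the complex conjugate of `ι(v)`. -/
def IsIotaMinus (p : ι → ℝ) (φ : GradedFrame ι s) (V : (ι → ℝ) → ι → ℂ)
    (T : Matrix (Fin s) (Fin s) ℂ) : Prop :=
  ∀ k X, IsSectionNear H p X → X p = φ.f k →
    bracket (fun x => star (V x)) X p - ∑ l, T l k • φ.h l ∈ conjSub (leviKernel H p) ⊔ H p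

/-- The data of a bigraded symbol written in a frame: the antilinear involution `σ` of
`ℂ ⊕ ℂ^s ⊕ ℂ^s`, acting by `u ↦ eps * ū` in degree `-2` and `v ↦ inv v̄` in degree `-1`, and the
subspaces `g₀,₋₂`, `g₀,₂` of `s × s` matrices. -/
structure BigradedSymbol (s : ℕ) where
  eps : ℂ
  inv : Matrix (Fin s ⊕ Fin s) (Fin s ⊕ Fin s) ℂ
  gMinus : Submodule ℂ (Matrix (Fin s) (Fin s) ℂ)
  gPlus : Submodule ℂ (Matrix (Fin s) (Fin s) ℂ)

/-- `B` is the bigraded symbol at `p` written in the frame `φ`. -/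
structure IsBigradedSymbol (p : ι → ℝ) (φ : GradedFrame ι s) (B : BigradedSymbol s) : Prop where
  eps_eq : star φ.g - B.eps • φ.g ∈ leviDist H p
  inv_eq : ∀ k, star (φ.vec k) - ∑ l, B.inv l k • φ.vec l ∈ leafDist H p
  gMinus_eq : B.gMinus = Submodule.span ℂ
    {T | ∃ V, IsSectionNear (leviKernel H) p V ∧ IsIotaMinus H p φ V T}
  gPlus_eq : B.gPlus = Submodule.span ℂ
    {S | ∃ V, IsSectionNear (leviKernel H) p V ∧ IsIotaPlus H p φ V S}

end CR

/-! ### Linear algebra of the degree zero part -/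

section Algebra

variable {s : ℕ}

/-- The matrix of the symplectic form on `ℂg₋₁ = ℂ^s ⊕ ℂ^s` given by the Heisenberg bracket (up to
the factor `2i`). -/
def sympl (s : ℕ) : Matrix (Fin s ⊕ Fin s) (Fin s ⊕ Fin s) ℂ := Matrix.fromBlocks 0 1 (-1) 0

/-- The space `csp(ℂg₋₁)` of degree preserving derivations of the Heisenberg algebra, as
endomorphisms of `ℂg₋₁`. -/
def csp (s : ℕ) : Submodule ℂ (Matrix (Fin s ⊕ Fin s) (Fin s ⊕ Fin s) ℂ) where
  carrier := {Y | ∃ c : ℂ, Yᵀ * sympl s + sympl s * Y = c • sympl s}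
  add_mem' := by
    rintro a b ⟨c, hc⟩ ⟨d, hd⟩
    refine ⟨c + d, ?_⟩
    rw [add_smul, ← hc, ← hd, Matrix.transpose_add, Matrix.add_mul, Matrix.mul_add]
    abel
  zero_mem' := ⟨0, by simp⟩
  smul_mem' := by
    rintro t a ⟨c, hc⟩
    refine ⟨t * c, ?_⟩
    rw [mul_smul, ← hc, Matrix.transpose_smul, Matrix.smul_mul, Matrix.mul_smul, smul_add]

/-- The endomorphism of `ℂg₋₁` in bidegree `(0, 2)` with matrix `S`. -/
def plusBlock (S : Matrix (Fin s) (Fin s) ℂ) : Matrix (Fin s ⊕ Fin s) (Fin s ⊕ Fin s) ℂ :=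
  Matrix.fromBlocks 0 S 0 0

/-- The endomorphism of `ℂg₋₁` in bidegree `(0, -2)` with matrix `T`. -/
def minusBlock (T : Matrix (Fin s) (Fin s) ℂ) : Matrix (Fin s ⊕ Fin s) (Fin s ⊕ Fin s) ℂ :=
  Matrix.fromBlocks 0 0 T 0

/-- The component `g₀,₀` of a bigraded symbol: the elements of `csp(ℂg₋₁)` that preserve `g₋₁,₁` and
`g₋₁,₋₁` and whose commutators preserve `g₀,₂` and `g₀,₋₂`. -/
def BigradedSymbol.gZero (B : BigradedSymbol s) :
    Submodule ℂ (Matrix (Fin s ⊕ Fin s) (Fin s ⊕ Fin s) ℂ) where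
  carrier := {Y | Y ∈ csp s ∧ Y.toBlocks₁₂ = 0 ∧ Y.toBlocks₂₁ = 0 ∧
    (∀ S ∈ B.gPlus, ∃ S' ∈ B.gPlus, Y * plusBlock S - plusBlock S * Y = plusBlock S') ∧
    (∀ T ∈ B.gMinus, ∃ T' ∈ B.gMinus, Y * minusBlock T - minusBlock T * Y = minusBlock T')}
  add_mem' := by
    rintro a b ⟨h1, h2, h3, h4, h5⟩ ⟨k1, k2, k3, k4, k5⟩
    refine ⟨(csp s).add_mem h1 k1, ?_, ?_, fun S hS => ?_, fun T hT => ?_⟩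
    · ext i j
      have := congrFun (congrFun h2 i) j
      have := congrFun (congrFun k2 i) j
      simp_all [Matrix.toBlocks₁₂]
    · ext i j
      have := congrFun (congrFun h3 i) j
      have := congrFun (congrFun k3 i) j
      simp_all [Matrix.toBlocks₂₁]
    · obtain ⟨S1, m1, e1⟩ := h4 S hS
      obtain ⟨S2, m2, e2⟩ := k4 S hS
      exact ⟨S1 + S2, B.gPlus.add_mem m1 m2, by
        have e : plusBlock (S1 + S2) = plusBlock S1 + plusBlock S2 := by
          simp [plusBlock, Matrix.fromBlocks_add]
        rw [e, ← e1, ← e2, Matrix.add_mul, Matrix.mul_add]; abel⟩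
    · obtain ⟨S1, m1, e1⟩ := h5 T hT
      obtain ⟨S2, m2, e2⟩ := k5 T hT
      exact ⟨S1 + S2, B.gMinus.add_mem m1 m2, by
        have e : minusBlock (S1 + S2) = minusBlock S1 + minusBlock S2 := by
          simp [minusBlock, Matrix.fromBlocks_add]
        rw [e, ← e1, ← e2, Matrix.add_mul, Matrix.mul_add]; abel⟩
  zero_mem' := by
    refine ⟨(csp s).zero_mem, rfl, rfl, fun S _ => ⟨0, B.gPlus.zero_mem, ?_⟩,
      fun T _ => ⟨0, B.gMinus.zero_mem, ?_⟩⟩ <;> simp [plusBlock, minusBlock]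
  smul_mem' := by
    rintro t a ⟨h1, h2, h3, h4, h5⟩
    refine ⟨(csp s).smul_mem t h1, ?_, ?_, fun S hS => ?_, fun T hT => ?_⟩
    · ext i j
      have := congrFun (congrFun h2 i) j
      simp_all [Matrix.toBlocks₁₂]
    · ext i j
      have := congrFun (congrFun h3 i) j
      simp_all [Matrix.toBlocks₂₁]
    · obtain ⟨S1, m1, e1⟩ := h4 S hS
      exact ⟨t • S1, B.gPlus.smul_mem t m1, by
        have e : plusBlock (t • S1) = t • plusBlock S1 := by
          simp [plusBlock, Matrix.fromBlocks_smul]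
        rw [e, ← e1, Matrix.smul_mul, Matrix.mul_smul, smul_sub]⟩
    · obtain ⟨S1, m1, e1⟩ := h5 T hT
      exact ⟨t • S1, B.gMinus.smul_mem t m1, by
        have e : minusBlock (t • S1) = t • minusBlock S1 := by
          simp [minusBlock, Matrix.fromBlocks_smul]
        rw [e, ← e1, Matrix.smul_mul, Matrix.mul_smul, smul_sub]⟩

/-- The involution induced by `σ` on endomorphisms of `ℂg₋₁`, `Y ↦ σ ∘ Y ∘ σ`. -/
def BigradedSymbol.conjEnd (B : BigradedSymbol s)
    (Y : Matrix (Fin s ⊕ Fin s) (Fin s ⊕ Fin s) ℂ) :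
    Matrix (Fin s ⊕ Fin s) (Fin s ⊕ Fin s) ℂ :=
  B.inv * Y.map conj * B.inv.map conj

/-- The space in which modified symbols live, `ℂg₋ ⊕ gl(ℂg₋₁) ⊇ ℂg₋ ⊕ csp(ℂg₋₁)`. -/
abbrev SymbolSpace (s : ℕ) : Type :=
  (ℂ × (Fin s → ℂ) × (Fin s → ℂ)) × Matrix (Fin s ⊕ Fin s) (Fin s ⊕ Fin s) ℂ

/-- Pairs of bilinear maps `(O₀,₋₂, O₀,₂)` with `O₀,±₂ : K₂ ⊗ g₀,±₂ → csp₀,±₂ / g₀,±₂`, where `K₂`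
is identified with `g₀,₂` by `ι`. -/
abbrev Obstruction (B : BigradedSymbol s) : Type :=
  (B.gPlus →ₗ[ℂ] B.gMinus →ₗ[ℂ] Matrix (Fin s) (Fin s) ℂ ⧸ B.gMinus) ×
  (B.gPlus →ₗ[ℂ] B.gPlus →ₗ[ℂ] Matrix (Fin s) (Fin s) ℂ ⧸ B.gPlus)

/-- A normalization condition: for every bigraded symbol, a choice of an element in every
equivalence class of pairs of bilinear maps. -/
structure NormalizationCondition (s : ℕ) where
  choice : (B : BigradedSymbol s) → Set (Obstruction B) → Obstruction B
  choice_mem : ∀ B C, C.Nonempty → choice B C ∈ C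

end Algebra

/-! ### Modified symbols -/

section Modified

variable {ι : Type} [Fintype ι] [DecidableEq ι] {s : ℕ}
  (H : (ι → ℝ) → Submodule ℂ (ι → ℂ))

/-- `O` is the pair `(O₀,₋₂(φ̃)(p), O₀,₂(φ̃)(p))` of the section `φ`, that is
`O₀,±₂(W, S^{0,±2}_V(p)) = W(S^{0,±2}_V)(p) mod g₀,±₂`, where `S^{0,2}_V` and `S^{0,-2}_V` are the
matrix functions representing `φ̃ ∘ ι(V)` and `φ̃ ∘ ι(V̄)` for a section `V` of `K₂`. -/
def HasObstruction (p : ι → ℝ) (B : BigradedSymbol s) (φ : (ι → ℝ) → GradedFrame ι s)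
    (O : Obstruction B) : Prop :=
  ∀ (V W : (ι → ℝ) → ι → ℂ) (A C : (ι → ℝ) → Matrix (Fin s) (Fin s) ℂ)
    (x a : B.gPlus) (b : B.gMinus),
    IsSectionNear (leviKernel H) p V → IsSectionNear (leviKernel H) p W →
    IsIotaPlus H p (φ p) W x →
    (∀ᶠ q in 𝓝 p, IsIotaPlus H q (φ q) V (A q)) →
    (∀ᶠ q in 𝓝 p, IsIotaMinus H q (φ q) V (C q)) →
    A p = a → C p = b →
    O.1 x b = B.gMinus.mkQ (Matrix.of fun i j => cderiv (fun q => C q i j) p (W p)) ∧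
    O.2 x a = B.gPlus.mkQ (Matrix.of fun i j => cderiv (fun q => A q i j) p (W p))

/-- The equivalence class of all `(O₀,₋₂(φ̃)(p), O₀,₂(φ̃)(p))` for local sections `φ̃` of `F` with the
prescribed value at `p`. -/
def obstructionClass (p : ι → ℝ) (B : BigradedSymbol s) (φ₀ : GradedFrame ι s) :
    Set (Obstruction B) :=
  {O | ∃ φ, IsFrameSection H p φ ∧ φ p = φ₀ ∧ HasObstruction H p B φ O}

/-- `φ` is a local section of `F` that is normalized at `p` with respect to `N`. -/
def IsNormalized (N : NormalizationCondition s) (p : ι → ℝ) (B : BigradedSymbol s)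
    (φ : (ι → ℝ) → GradedFrame ι s) : Prop :=
  IsFrameSection H p φ ∧ HasObstruction H p B φ (N.choice B (obstructionClass H p B (φ p)))

/-- A map to real space with its values regarded as complex numbers. -/
def complexify {m : ℕ} (π : (ι → ℝ) → Fin m → ℝ) (x : ι → ℝ) (k : Fin m) : ℂ := (π x k : ℂ)

/-- `π` is, near `p`, the projection onto the local leaf space `N` (in a chart of the
`(2s+1)`-dimensional manifold `N`) of the Levi foliation: a submersion whose fibers have the
complexified tangent spaces `K₂ ⊕ K̄₂`. -/
def IsLeafProjection (p : ι → ℝ) (π : (ι → ℝ) → Fin (2 * s + 1) → ℝ) : Prop :=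
  ∀ᶠ q in 𝓝 p, ContDiffAt ℝ ∞ π q ∧
    LinearMap.ker (cderiv (complexify π) q) = leafDist H q ∧
    Function.Surjective (cderiv (complexify π) q)

/-- `X` is the value `ι_φ̃(v)` at a complex vector `v` tangent to the Levi leaf through `p`: with
`τ(q)⁻¹ = π_* ∘ φ̃(q)⁻¹ : ℂg₋₁ → ℂT_{π(p)}N` for `q` in the leaf, `X` is the derivative at `p` in
the direction `v` of `q ↦ τ(p) ∘ τ(q)⁻¹`. -/
def IsIotaAlong (π : (ι → ℝ) → Fin (2 * s + 1) → ℝ) (p : ι → ℝ)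
    (φ : (ι → ℝ) → GradedFrame ι s) (v : ι → ℂ)
    (X : Matrix (Fin s ⊕ Fin s) (Fin s ⊕ Fin s) ℂ) : Prop :=
  ∀ k, cderiv (fun q => cderiv (complexify π) q ((φ q).vec k)) p v =
    ∑ l, X l k • cderiv (complexify π) p ((φ p).vec l)

/-- The image `ι_φ̃(D)` of a space `D` of vectors tangent to the leaf at `p`. -/
def iotaImage (π : (ι → ℝ) → Fin (2 * s + 1) → ℝ) (p : ι → ℝ)
    (φ : (ι → ℝ) → GradedFrame ι s) (D : Submodule ℂ (ι → ℂ)) :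
    Submodule ℂ (Matrix (Fin s ⊕ Fin s) (Fin s ⊕ Fin s) ℂ) :=
  Submodule.span ℂ {X | ∃ v ∈ D, IsIotaAlong π p φ v X}

/-- The modified symbol at `p` along the section `φ`:
`ℂg₋ ⊕ (ι_φ̃(K₂ ⊕ K̄₂) + g₀,₀)`. -/
def modifiedSymbolAlong (π : (ι → ℝ) → Fin (2 * s + 1) → ℝ) (p : ι → ℝ)
    (B : BigradedSymbol s) (φ : (ι → ℝ) → GradedFrame ι s) : Submodule ℂ (SymbolSpace s) :=
  Submodule.prod ⊤ (iotaImage π p φ (leafDist H p) ⊔ B.gZero)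

/-- The `σ`-invariant form `ℂg₋ ⊕ (g₀,₋ + g₀,₀ + g₀,₊)` of the modified symbol at `p` along `φ`, with
`g₀,₊ = ι_φ̃(K₂)` and `g₀,₋ = σ(g₀,₊)`. -/
def sigmaModifiedSymbolAlong (π : (ι → ℝ) → Fin (2 * s + 1) → ℝ) (p : ι → ℝ)
    (B : BigradedSymbol s) (φ : (ι → ℝ) → GradedFrame ι s) : Submodule ℂ (SymbolSpace s) :=
  Submodule.prod ⊤ (iotaImage π p φ (leviKernel H p) ⊔
    Submodule.span ℂ (B.conjEnd '' (iotaImage π p φ (leviKernel H p))) ⊔ B.gZero)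

/-- `𝔤` is a modified symbol at `φ₀ ∈ F_p` with respect to `N`: it is the modified symbol along a
normalized section through `φ₀`. -/
def IsModifiedSymbol (N : NormalizationCondition s) (π : (ι → ℝ) → Fin (2 * s + 1) → ℝ)
    (p : ι → ℝ) (φ₀ : GradedFrame ι s) (𝔤 : Submodule ℂ (SymbolSpace s)) : Prop :=
  ∃ B φ, IsBigradedSymbol H p φ₀ B ∧ φ p = φ₀ ∧ IsNormalized H N p B φ ∧
    𝔤 = modifiedSymbolAlong H π p B φ

/-- The same with the `σ`-invariant form of the modified symbol. -/
def IsSigmaModifiedSymbol (N : NormalizationCondition s)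
    (π : (ι → ℝ) → Fin (2 * s + 1) → ℝ) (p : ι → ℝ) (φ₀ : GradedFrame ι s)
    (𝔤 : Submodule ℂ (SymbolSpace s)) : Prop :=
  ∃ B φ, IsBigradedSymbol H p φ₀ B ∧ φ p = φ₀ ∧ IsNormalized H N p B φ ∧
    𝔤 = sigmaModifiedSymbolAlong H π p B φ

end Modified

/-! ### Hypersurfaces `Re w = F(z, ζ, Im w)` -/

section Graph

variable {s r : ℕ}

/-- Index set of the real coordinates `(Re z, Im z, Re ζ, Im ζ, Im w)` on a hypersurface
`Re w = F(z, ζ, Im w)` in `ℂ × ℂ^s × ℂ^r`. -/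
abbrev Coord (s r : ℕ) : Type := (Fin s ⊕ Fin s) ⊕ ((Fin r ⊕ Fin r) ⊕ Unit)

def zCoord (x : Coord s r → ℝ) (j : Fin s) : ℂ := ⟨x (.inl (.inl j)), x (.inl (.inr j))⟩

def ζCoord (x : Coord s r → ℝ) (α : Fin r) : ℂ :=
  ⟨x (.inr (.inl (.inl α))), x (.inr (.inl (.inr α)))⟩

def imW (x : Coord s r → ℝ) : ℝ := x (.inr (.inr ()))

/-- The parametrization `(z, ζ, Im w) ↦ (F + i Im w, z, ζ)` of the hypersurface. -/
def graphEmbedding (F : (Coord s r → ℝ) → ℝ) (x : Coord s r → ℝ) : Unit ⊕ Fin s ⊕ Fin r → ℂ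
  | .inl _ => ⟨F x, imW x⟩
  | .inr (.inl j) => zCoord x j
  | .inr (.inr α) => ζCoord x α

/-- The CR structure of the hypersurface `Re w = F(z, ζ, Im w)`. -/
def graphCR (F : (Coord s r → ℝ) → ℝ) : (Coord s r → ℝ) → Submodule ℂ (Coord s r → ℂ) :=
  crStructure (graphEmbedding F)

/-- The right hand side `P = zᵀ H(ζ, ζ̄) z̄ + Re(z̄ᵀ S(ζ, ζ̄) z̄)` of the model equation. -/
def modelFun (H S : (Fin r → ℂ) → Matrix (Fin s) (Fin s) ℂ) (x : Coord s r → ℝ) : ℝ :=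
  (zCoord x ⬝ᵥ (H (ζCoord x) *ᵥ star (zCoord x))).re +
    (star (zCoord x) ⬝ᵥ (S (ζCoord x) *ᵥ star (zCoord x))).re

/-- The weighted dilation `(z, ζ, Im w) ↦ (t z, ζ, t² Im w)`. -/
def dilation (t : ℝ) (x : Coord s r → ℝ) : Coord s r → ℝ
  | .inl j => t * x (.inl j)
  | .inr (.inl α) => x (.inr (.inl α))
  | .inr (.inr _) => t ^ 2 * x (.inr (.inr ()))

/-- For a real analytic `Q`: all terms of the power series of `Q` at `0` have weighted degree
higher than `2` for the weights `wt(z) = 1`, `wt(ζ) = 0`, `wt(Im w) = 2`. -/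
def WeightedOrderGtTwo (Q : (Coord s r → ℝ) → ℝ) : Prop :=
  ∀ᶠ x in 𝓝 (0 : Coord s r → ℝ), (fun t : ℝ => Q (dilation t x)) =O[𝓝 0] fun t => t ^ 3

end Graph

end CRSymbol

end

/-! In the real coordinates `(z, ζ, Im w)` the CR structure of a graph `Re w = F` is carried by the
functions `c_A = F_A / (i - F_u)`: it is spanned by the commuting fields `L_A = ∂_A + c_A ∂_u`. At
the origin the `z`-block of the Levi form is a nonzero multiple of the invertible matrix `H 0`. Near
the origin the Levi kernel therefore lies in the graph of a matrix function `k` (`levK`), with the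
`z`-components given by the `ζ`-components, and it fills this graph exactly where a Schur complement
(`schur`) vanishes. On the Levi kernel `K₃` is cut out by the antiholomorphic first derivatives of
`k`.

Everything is then a matter of weights. A derivative lowers the weight by at most the weight of its
variable, and a function of positive weight vanishes on the set `z = 0`, `Im w = 0`. Passing from `P
+ Q` to `P` changes `c`, the Levi form, `k` and the Schur complement only by terms one weight above
their own weight bounds. For `M` the Schur complement vanishes at `0` by weight, so the constant
rank of `K₂` is `r` and the Schur complement vanishes nearby. That of the model is homogeneous of
degree 2 and now has weight at least 3, so it is zero. The derivatives `L̄_l k_αj` at `0` agree for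
`M` and the model. Their linear independence encodes `K₃ = 0` at `0` and is an open condition. This
is `exists_leafModel`.

Consequently both hypersurfaces have the Levi leaf `z = 0`, `Im w = 0`. Along it `c` and `k` vanish
for both, the Levi `z`-blocks agree, and so do the first derivatives of `k` in directions without
`∂_u` component (`SameLeaf`). The frames, the matrices of `ι`, the involution, the obstructions and
`ι_φ̃` can all be written in these data, and the obstructions and `ι_φ̃` differentiate frames only
along the leaf (`leaf_agree`, `LeafModel.hasObstruction_iff`, `LeafModel.isIotaAlong_iff`). A
section of the frame bundle of `M` need not be one for the model off the leaf, but its restriction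
to the leaf extends to one (`IsLeviAt.exists_isFrameSection`). Hence the obstruction classes
coincide, a normalization condition picks the same element in both, and modified symbols transfer in
both directions.

The obstruction class is nonempty because the matrices of `ι` on the basis of `K₂` are independent,
which makes the obstruction of any section well defined. For uniqueness, let two normalized sections
have the same value. Their `ι_φ̃(v)` differ by a block diagonal element of `csp`, whose commutators
with `g₀,±₂` are the differences of the derivatives that define the obstructions. Equal obstructions
put this element in `g₀,₀` for `v ∈ K₂` (`LeafModel.iotaMat_sub_mem_of_obstruction`). This argument
says nothing about directions in the conjugate of `K₂`, and this is why uniqueness is proved for the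
`σ`-invariant form. That form is built from `ι_φ̃(K₂)` alone, and `σ` preserves `g₀,₀`
(`LeafModel.conjEnd_mem_gZero`). -/

noncomputable section

namespace CRSymbol

/-! ### Calculus of complexified directional derivatives -/

section Calculus

variable {ι : Type} [Fintype ι] [DecidableEq ι]

lemma cderiv_apply {G : Type} [NormedAddCommGroup G] [NormedSpace ℝ G] [Module ℂ G]
    (f : (ι → ℝ) → G) (q : ι → ℝ) (v : ι → ℂ) :
    cderiv f q v = ∑ i, v i • fderiv ℝ f q (Pi.single i 1) := by
  simp [cderiv, Fintype.linearCombination_apply]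

lemma cderiv_congr {G : Type} [NormedAddCommGroup G] [NormedSpace ℝ G] [Module ℂ G]
    {f g : (ι → ℝ) → G} {q : ι → ℝ} (h : f =ᶠ[𝓝 q] g) : cderiv f q = cderiv g q := by
  simp only [cderiv, h.fderiv_eq]

lemma cderiv_const {G : Type} [NormedAddCommGroup G] [NormedSpace ℝ G] [Module ℂ G]
    (a : G) (q : ι → ℝ) (v : ι → ℂ) : cderiv (fun _ => a) q v = 0 := by
  simp [cderiv_apply]

lemma cderiv_neg {f : (ι → ℝ) → ℂ} {q : ι → ℝ} (v : ι → ℂ) :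
    cderiv (fun x => -f x) q v = -cderiv f q v := by
  have h : fderiv ℝ (fun x => -f x) q = -fderiv ℝ f q := fderiv_fun_neg
  simp [cderiv_apply, h]

lemma cderiv_sub {f g : (ι → ℝ) → ℂ} {q : ι → ℝ} (hf : DifferentiableAt ℝ f q)
    (hg : DifferentiableAt ℝ g q) (v : ι → ℂ) :
    cderiv (fun x => f x - g x) q v = cderiv f q v - cderiv g q v := by
  have h : fderiv ℝ (fun x => f x - g x) q = fderiv ℝ f q - fderiv ℝ g q := fderiv_fun_sub hf hg
  simp [cderiv_apply, h, Finset.sum_sub_distrib, mul_sub]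

lemma cderiv_mul {f g : (ι → ℝ) → ℂ} {q : ι → ℝ} (hf : DifferentiableAt ℝ f q)
    (hg : DifferentiableAt ℝ g q) (v : ι → ℂ) :
    cderiv (fun x => f x * g x) q v = cderiv f q v * g q + f q * cderiv g q v := by
  have h : fderiv ℝ (fun x => f x * g x) q = f q • fderiv ℝ g q + g q • fderiv ℝ f q :=
    fderiv_fun_mul hf hg
  simp only [cderiv_apply, h, Finset.sum_mul, Finset.mul_sum, ← Finset.sum_add_distrib]
  refine Finset.sum_congr rfl fun i _ => ?_
  simp
  ring

lemma cderiv_sum {κ : Type} (s : Finset κ) {f : κ → (ι → ℝ) → ℂ} {q : ι → ℝ}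
    (hf : ∀ j ∈ s, DifferentiableAt ℝ (f j) q) (v : ι → ℂ) :
    cderiv (fun x => ∑ j ∈ s, f j x) q v = ∑ j ∈ s, cderiv (f j) q v := by
  have h : fderiv ℝ (fun x => ∑ j ∈ s, f j x) q = ∑ j ∈ s, fderiv ℝ (f j) q := fderiv_fun_sum hf
  simp only [cderiv_apply, h]
  rw [Finset.sum_comm]
  simp [Finset.mul_sum]

/-- The derivative is complex linear in its direction, so conjugation has to act on the direction as
well. This rule turns each formula for fields of type `(1,0)` into its `(0,1)` counterpart. -/
lemma cderiv_conj (f : (ι → ℝ) → ℂ) (q : ι → ℝ) (v : ι → ℂ) :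
    cderiv (fun x => conj (f x)) q v = conj (cderiv f q (star v)) := by
  have h : fderiv ℝ (fun x => conj (f x)) q
      = (Complex.conjCLE : ℂ →L[ℝ] ℂ).comp (fderiv ℝ f q) :=
    Complex.conjCLE.comp_fderiv
  simp [cderiv_apply, h]

lemma cderiv_ofReal_apply {G : Type} [NormedAddCommGroup G] [NormedSpace ℝ G] [Module ℂ G]
    (f : (ι → ℝ) → G) (q : ι → ℝ) (i : ι) :
    cderiv f q (Pi.single i 1) = fderiv ℝ f q (Pi.single i 1) := by
  rw [cderiv_apply, Finset.sum_eq_single i]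
  · simp
  · intro j _ hj; simp [hj]
  · simp

/-- A complex linear map commutes with the complexified derivative. -/
lemma map_cderiv {κ : Type} [Fintype κ] (l : (κ → ℂ) →ₗ[ℂ] ℂ) {W : (ι → ℝ) → κ → ℂ} {q : ι → ℝ}
    (hW : DifferentiableAt ℝ W q) (v : ι → ℂ) :
    l (cderiv W q v) = cderiv (fun x => l (W x)) q v := by
  have h : fderiv ℝ (fun x => l (W x)) q
      = ((LinearMap.toContinuousLinearMap l).restrictScalars ℝ).comp (fderiv ℝ W q) :=
    (((LinearMap.toContinuousLinearMap l).restrictScalars ℝ).hasFDerivAt.comp q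
      hW.hasFDerivAt).fderiv
  simp [cderiv_apply, h]

lemma map_bracket (l : (ι → ℂ) →ₗ[ℂ] ℂ) {V W : (ι → ℝ) → ι → ℂ} {q : ι → ℝ}
    (hV : DifferentiableAt ℝ V q) (hW : DifferentiableAt ℝ W q) :
    l (bracket V W q) = cderiv (fun x => l (W x)) q (V q) - cderiv (fun x => l (V x)) q (W q) := by
  rw [bracket, map_sub, map_cderiv l hW, map_cderiv l hV]

lemma cderiv_pi_apply {κ : Type} [Fintype κ] {W : (ι → ℝ) → κ → ℂ} {q : ι → ℝ}
    (hW : DifferentiableAt ℝ W q) (v : ι → ℂ) (k : κ) :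
    cderiv W q v k = cderiv (fun x => W x k) q v :=
  map_cderiv (LinearMap.proj k) hW v

lemma star_bracket {V W : (ι → ℝ) → ι → ℂ} {q : ι → ℝ}
    (hV : DifferentiableAt ℝ V q) (hW : DifferentiableAt ℝ W q) :
    star (bracket V W q) = bracket (fun x => star (V x)) (fun x => star (W x)) q := by
  have hV' : DifferentiableAt ℝ (fun x => star (V x)) q := hV.star
  have hW' : DifferentiableAt ℝ (fun x => star (W x)) q := hW.star
  funext k
  simp only [bracket, Pi.star_apply, Pi.sub_apply, star_sub, cderiv_pi_apply hV,
    cderiv_pi_apply hW, cderiv_pi_apply hV', cderiv_pi_apply hW']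
  have h1 := cderiv_conj (fun x => W x k) q (star (V q))
  have h2 := cderiv_conj (fun x => V x k) q (star (W q))
  rw [star_star] at h1 h2
  exact congrArg₂ (· - ·) h1.symm h2.symm

lemma contDiffAt_cderiv {f : (ι → ℝ) → ℂ} {W : (ι → ℝ) → ι → ℂ} {q : ι → ℝ} {n : ℕ∞}
    (hf : ContDiffAt ℝ (n + 1 : ℕ∞) f q) (hW : ContDiffAt ℝ n W q) :
    ContDiffAt ℝ n (fun x => cderiv f x (W x)) q := by
  simp only [cderiv_apply, smul_eq_mul]
  refine ContDiffAt.sum fun i _ => ?_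
  exact (contDiffAt_pi.1 hW i).mul
    ((hf.fderiv_right (m := n) (by exact_mod_cast le_rfl)).clm_apply contDiffAt_const)

lemma analyticAt_cderiv {f : (ι → ℝ) → ℂ} {q : ι → ℝ} (hf : AnalyticAt ℝ f q) (v : ι → ℂ) :
    AnalyticAt ℝ (fun x => cderiv f x v) q := by
  simp only [cderiv_apply, smul_eq_mul]
  refine Finset.analyticAt_fun_sum _ fun i _ => analyticAt_const.mul ?_
  exact ((ContinuousLinearMap.apply ℝ ℂ (Pi.single i (1 : ℝ))).analyticAt _).comp hf.fderiv

lemma cderiv_cderiv_const {f : (ι → ℝ) → ℂ} {q : ι → ℝ} (hf : ContDiffAt ℝ 2 f q)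
    (v w : ι → ℂ) :
    cderiv (fun x => cderiv f x v) q w = ∑ i, ∑ j, w i * v j *
      fderiv ℝ (fderiv ℝ f) q (Pi.single i 1) (Pi.single j 1) := by
  have hd : DifferentiableAt ℝ (fderiv ℝ f) q :=
    (hf.fderiv_right (m := 1) (by norm_num)).differentiableAt (by norm_num)
  have h1 : ∀ j : ι, DifferentiableAt ℝ (fun x => fderiv ℝ f x (Pi.single j 1)) q := fun j =>
    hd.clm_apply (differentiableAt_const _)
  have h2 : ∀ i j : ι, fderiv ℝ (fun x => fderiv ℝ f x (Pi.single j 1)) q (Pi.single i 1)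
      = fderiv ℝ (fderiv ℝ f) q (Pi.single i 1) (Pi.single j 1) := by
    intro i j
    rw [fderiv_clm_apply hd (differentiableAt_const _)]
    simp
  simp only [cderiv_apply f, smul_eq_mul]
  rw [cderiv_sum _ fun j _ => (differentiableAt_const _).fun_mul (h1 j)]
  rw [Finset.sum_comm]
  refine Finset.sum_congr rfl fun j _ => ?_
  rw [cderiv_mul (differentiableAt_const _) (h1 j), cderiv_const, cderiv_apply]
  simp only [h2, smul_eq_mul, Finset.mul_sum, zero_mul, zero_add]
  exact Finset.sum_congr rfl fun i _ => by ring

lemma cderiv_comm {f : (ι → ℝ) → ℂ} {q : ι → ℝ} (hf : ContDiffAt ℝ 2 f q) (v w : ι → ℂ) :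
    cderiv (fun x => cderiv f x v) q w = cderiv (fun x => cderiv f x w) q v := by
  rw [cderiv_cderiv_const hf, cderiv_cderiv_const hf, Finset.sum_comm]
  refine Finset.sum_congr rfl fun i _ => Finset.sum_congr rfl fun j _ => ?_
  rw [(hf.isSymmSndFDerivAt (by simp)).eq (Pi.single j 1)]
  ring

lemma differentiableAt_cderiv_const {f : (ι → ℝ) → ℂ} {q : ι → ℝ} (hf : ContDiffAt ℝ 2 f q)
    (v : ι → ℂ) : DifferentiableAt ℝ (fun x => cderiv f x v) q :=
  (contDiffAt_cderiv (n := 1) (W := fun _ => v) (by exact_mod_cast hf)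
    contDiffAt_const).differentiableAt (by simp)

/-- Leibniz rule: one term sees the motion of `W`, the other has `W` frozen at `q`. The frozen term
is symmetric, so it drops out of brackets. It also drops out when two frames with the same value at
`q` are compared. -/
lemma cderiv_cderiv_field {f : (ι → ℝ) → ℂ} {q : ι → ℝ} (hf : ContDiffAt ℝ 2 f q)
    {W : (ι → ℝ) → ι → ℂ} (hW : DifferentiableAt ℝ W q) (v : ι → ℂ) :
    cderiv (fun x => cderiv f x (W x)) q v =
      cderiv f q (cderiv W q v) + cderiv (fun x => cderiv f x (W q)) q v := by
  have h1 : ∀ i : ι, DifferentiableAt ℝ (fun x => cderiv f x (Pi.single i 1)) q := fun i =>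
    differentiableAt_cderiv_const hf _
  have h2 : ∀ i : ι, DifferentiableAt ℝ (fun x => W x i) q := differentiableAt_pi.1 hW
  have e : ∀ x (u : ι → ℂ), cderiv f x u = ∑ i, u i * cderiv f x (Pi.single i 1) := by
    intro x u
    simp only [cderiv_ofReal_apply]
    simp [cderiv_apply]
  rw [show (fun x => cderiv f x (W x)) = fun x => ∑ i, W x i * cderiv f x (Pi.single i 1) from
    funext fun x => e x _, cderiv_sum _ fun i _ => (h2 i).fun_mul (h1 i),
    show (fun x => cderiv f x (W q)) = fun x => ∑ i, W q i * cderiv f x (Pi.single i 1) from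
    funext fun x => e x _, cderiv_sum _ fun i _ => (differentiableAt_const _).fun_mul (h1 i),
    e q (cderiv W q v), ← Finset.sum_add_distrib]
  refine Finset.sum_congr rfl fun i _ => ?_
  rw [cderiv_mul (h2 i) (h1 i), cderiv_mul (differentiableAt_const _) (h1 i), cderiv_const,
    cderiv_pi_apply hW]
  ring

/-- The Lie bracket acts on functions as the commutator. -/
lemma cderiv_bracket {f : (ι → ℝ) → ℂ} {q : ι → ℝ} (hf : ContDiffAt ℝ 2 f q)
    {V W : (ι → ℝ) → ι → ℂ} (hV : DifferentiableAt ℝ V q) (hW : DifferentiableAt ℝ W q) :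
    cderiv f q (bracket V W q) = cderiv (fun x => cderiv f x (W x)) q (V q) -
      cderiv (fun x => cderiv f x (V x)) q (W q) := by
  rw [cderiv_cderiv_field hf hW, cderiv_cderiv_field hf hV, bracket, map_sub,
    cderiv_comm hf (V q) (W q)]
  ring

/-- The complexified chain rule for a real linear substitution. -/
lemma cderiv_comp_clm (f : (ι → ℝ) → ℂ) (e : (ι → ℝ) →L[ℝ] (ι → ℝ)) {q : ι → ℝ}
    (hf : DifferentiableAt ℝ f (e q)) (i : ι) :
    cderiv (fun x => f (e x)) q (Pi.single i 1) = fderiv ℝ f (e q) (e (Pi.single i 1)) := by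
  rw [cderiv_ofReal_apply]
  have : fderiv ℝ (fun x => f (e x)) q = (fderiv ℝ f (e q)).comp e :=
    (hf.hasFDerivAt.comp q e.hasFDerivAt).fderiv
  rw [this]
  rfl

end Calculus

/-! ### Complex coordinates on `ℂ ⊗ ℝ^(2s+2r+1)` -/

section Coordinates

variable {s r : ℕ}

/-- The real part coordinate index of a holomorphic coordinate. -/
def reIx : Fin s ⊕ Fin r → Coord s r
  | .inl j => .inl (.inl j)
  | .inr α => .inr (.inl (.inl α))

/-- The imaginary part coordinate index of a holomorphic coordinate. -/
def imIx : Fin s ⊕ Fin r → Coord s r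
  | .inl j => .inl (.inr j)
  | .inr α => .inr (.inl (.inr α))

/-- The differentials of the holomorphic coordinates. -/
def dz (A : Fin s ⊕ Fin r) : (Coord s r → ℂ) →ₗ[ℂ] ℂ :=
  LinearMap.proj (reIx A) + Complex.I • LinearMap.proj (imIx A)

/-- The differentials of the conjugate coordinates. -/
def dzb (A : Fin s ⊕ Fin r) : (Coord s r → ℂ) →ₗ[ℂ] ℂ :=
  LinearMap.proj (reIx A) - Complex.I • LinearMap.proj (imIx A)

/-- The differential of `Im w`. -/
def du : (Coord s r → ℂ) →ₗ[ℂ] ℂ := LinearMap.proj (.inr (.inr ()))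

/-- The vector with prescribed components. -/
def vecOf (a b : Fin s ⊕ Fin r → ℂ) (e : ℂ) : Coord s r → ℂ
  | .inl (.inl j) => (a (.inl j) + b (.inl j)) / 2
  | .inl (.inr j) => (a (.inl j) - b (.inl j)) / (2 * Complex.I)
  | .inr (.inl (.inl α)) => (a (.inr α) + b (.inr α)) / 2
  | .inr (.inl (.inr α)) => (a (.inr α) - b (.inr α)) / (2 * Complex.I)
  | .inr (.inr _) => e

lemma vecOf_reIx (a b : Fin s ⊕ Fin r → ℂ) (e : ℂ) (A : Fin s ⊕ Fin r) :
    vecOf a b e (reIx A) = (a A + b A) / 2 := by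
  rcases A with j | α <;> rfl

lemma vecOf_imIx (a b : Fin s ⊕ Fin r → ℂ) (e : ℂ) (A : Fin s ⊕ Fin r) :
    vecOf a b e (imIx A) = (a A - b A) / (2 * Complex.I) := by
  rcases A with j | α <;> rfl

@[simp] lemma dz_vecOf (a b : Fin s ⊕ Fin r → ℂ) (e : ℂ) (A : Fin s ⊕ Fin r) :
    dz A (vecOf a b e) = a A := by
  simp only [dz, LinearMap.add_apply, LinearMap.smul_apply, LinearMap.proj_apply, vecOf_reIx,
    vecOf_imIx, smul_eq_mul]
  field_simp
  ring

@[simp] lemma dzb_vecOf (a b : Fin s ⊕ Fin r → ℂ) (e : ℂ) (A : Fin s ⊕ Fin r) :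
    dzb A (vecOf a b e) = b A := by
  simp only [dzb, LinearMap.sub_apply, LinearMap.smul_apply, LinearMap.proj_apply, vecOf_reIx,
    vecOf_imIx, smul_eq_mul]
  field_simp
  ring

@[simp] lemma du_vecOf (a b : Fin s ⊕ Fin r → ℂ) (e : ℂ) : du (vecOf a b e) = e := rfl

lemma dz_star (v : Coord s r → ℂ) (A : Fin s ⊕ Fin r) : dz A (star v) = conj (dzb A v) := by
  simp [dz, dzb]

lemma dzb_star (v : Coord s r → ℂ) (A : Fin s ⊕ Fin r) : dzb A (star v) = conj (dz A v) := by
  simp [dz, dzb]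
  ring

lemma du_star (v : Coord s r → ℂ) : du (star v) = conj (du v) := rfl

lemma vec_ext {v w : Coord s r → ℂ} (h1 : ∀ A, dz A v = dz A w) (h2 : ∀ A, dzb A v = dzb A w)
    (h3 : du v = du w) : v = w := by
  have hre : ∀ A, v (reIx A) = w (reIx A) := by
    intro A
    have e1 := h1 A
    have e2 := h2 A
    simp only [dz, dzb, LinearMap.add_apply, LinearMap.sub_apply, LinearMap.smul_apply,
      LinearMap.proj_apply, smul_eq_mul] at e1 e2
    linear_combination (e1 + e2) / 2
  have him : ∀ A, v (imIx A) = w (imIx A) := by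
    intro A
    have e1 := h1 A
    have e2 := h2 A
    simp only [dz, dzb, LinearMap.add_apply, LinearMap.sub_apply, LinearMap.smul_apply,
      LinearMap.proj_apply, smul_eq_mul] at e1 e2
    have : Complex.I * v (imIx A) = Complex.I * w (imIx A) := by linear_combination (e1 - e2) / 2
    exact mul_left_cancel₀ Complex.I_ne_zero this
  funext i
  rcases i with (j | j) | ((α | α) | u)
  · exact hre (.inl j)
  · exact him (.inl j)
  · exact hre (.inr α)
  · exact him (.inr α)
  · exact h3

lemma vecOf_components (v : Coord s r → ℂ) :
    vecOf (fun A => dz A v) (fun A => dzb A v) (du v) = v :=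
  vec_ext (by simp) (by simp) (by simp)

lemma star_vecOf (a b : Fin s ⊕ Fin r → ℂ) (e : ℂ) :
    star (vecOf a b e) = vecOf (star b) (star a) (star e) :=
  vec_ext (fun A => by simp [dz_star]) (fun A => by simp [dzb_star]) (by simp [du_star])

lemma contDiffAt_vecOf {E : Type} [NormedAddCommGroup E] [NormedSpace ℝ E] {n : ℕ∞ω}
    {a b : E → Fin s ⊕ Fin r → ℂ} {e : E → ℂ} {q : E}
    (ha : ∀ A, ContDiffAt ℝ n (fun x => a x A) q) (hb : ∀ A, ContDiffAt ℝ n (fun x => b x A) q)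
    (he : ContDiffAt ℝ n e q) : ContDiffAt ℝ n (fun x => vecOf (a x) (b x) (e x)) q := by
  refine contDiffAt_pi.2 fun i => ?_
  rcases i with (j | j) | ((α | α) | u)
  · exact ((ha _).add (hb _)).div_const _
  · exact ((ha _).sub (hb _)).div_const _
  · exact ((ha _).add (hb _)).div_const _
  · exact ((ha _).sub (hb _)).div_const _
  · exact he

lemma contDiffAt_linear {E : Type} [NormedAddCommGroup E] [NormedSpace ℝ E] {n : ℕ∞ω}
    (l : (Coord s r → ℂ) →ₗ[ℂ] ℂ) {V : E → Coord s r → ℂ} {q : E}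
    (hV : ContDiffAt ℝ n V q) : ContDiffAt ℝ n (fun x => l (V x)) q :=
  ((LinearMap.toContinuousLinearMap l).restrictScalars ℝ).contDiff.contDiffAt.comp q hV

lemma differentiableAt_linear {E : Type} [NormedAddCommGroup E] [NormedSpace ℝ E]
    (l : (Coord s r → ℂ) →ₗ[ℂ] ℂ) {V : E → Coord s r → ℂ} {q : E}
    (hV : DifferentiableAt ℝ V q) : DifferentiableAt ℝ (fun x => l (V x)) q :=
  ((LinearMap.toContinuousLinearMap l).restrictScalars ℝ).differentiableAt.comp q hV

/-- The coordinate vector fields `∂/∂z_A`. -/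
def hol (A : Fin s ⊕ Fin r) : Coord s r → ℂ := vecOf (Pi.single A 1) 0 0

/-- The coordinate vector field `∂/∂(Im w)`. -/
def uvec : Coord s r → ℂ := vecOf 0 0 1

lemma star_hol (A : Fin s ⊕ Fin r) : star (hol A) = vecOf 0 (Pi.single A 1) 0 := by
  rw [hol, star_vecOf]
  congr 1
  · simp
  · funext B
    rcases eq_or_ne B A with rfl | h <;> simp [*]
  · simp

lemma apply_eq_components {G : Type} [AddCommGroup G] [Module ℂ G]
    (l : (Coord s r → ℂ) →ₗ[ℂ] G) (v : Coord s r → ℂ) :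
    l v = ∑ A, dz A v • l (hol A) + ∑ A, dzb A v • l (star (hol A)) + du v • l uvec := by
  have : v = ∑ A, dz A v • hol A + ∑ A, dzb A v • star (hol A) + du v • uvec := by
    simp only [star_hol]
    refine vec_ext (fun B => ?_) (fun B => ?_) ?_ <;>
      simp [hol, uvec, map_sum, Pi.single_apply, -Fintype.sum_sum_type]
  conv_lhs => rw [this]
  simp [map_sum]

end Coordinates

/-! ### CR structures of hypersurface type in complex coordinates -/

section CRCalculus

variable {s r : ℕ}

/-- The contact form `d(Im w) - ∑ c_A dz_A - ∑ c̄_A dz̄_A`. -/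
def theta (c : Fin s ⊕ Fin r → ℂ) : (Coord s r → ℂ) →ₗ[ℂ] ℂ :=
  du - ∑ A, c A • dz A - ∑ A, conj (c A) • dzb A

lemma theta_apply (c : Fin s ⊕ Fin r → ℂ) (v : Coord s r → ℂ) :
    theta c v = du v - ∑ A, c A * dz A v - ∑ A, conj (c A) * dzb A v := by
  simp [theta]

lemma theta_star (c : Fin s ⊕ Fin r → ℂ) (v : Coord s r → ℂ) :
    theta c (star v) = conj (theta c v) := by
  simp only [theta_apply, dz_star, dzb_star, du_star, map_sub, map_sum, map_mul,
    Complex.conj_conj]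
  ring

/-- The vector of type `(1,0)` with holomorphic components `a`. -/
def crVec (c a : Fin s ⊕ Fin r → ℂ) : Coord s r → ℂ := vecOf a 0 (∑ A, c A * a A)

@[simp] lemma dz_crVec (c a : Fin s ⊕ Fin r → ℂ) (A) : dz A (crVec c a) = a A := by simp [crVec]
@[simp] lemma dzb_crVec (c a : Fin s ⊕ Fin r → ℂ) (A) : dzb A (crVec c a) = 0 := by simp [crVec]
@[simp] lemma du_crVec (c a : Fin s ⊕ Fin r → ℂ) : du (crVec c a) = ∑ A, c A * a A := rfl

@[simp] lemma theta_crVec (c a : Fin s ⊕ Fin r → ℂ) : theta c (crVec c a) = 0 := by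
  simp [theta_apply]

/-- The Levi form `[L_A, L̄_B] = lev_AB ∂/∂(Im w)`. -/
def lev (c : (Coord s r → ℝ) → Fin s ⊕ Fin r → ℂ) (q : Coord s r → ℝ)
    (A B : Fin s ⊕ Fin r) : ℂ :=
  cderiv (fun x => conj (c x B)) q (crVec (c q) (Pi.single A 1)) -
    cderiv (fun x => c x A) q (star (crVec (c q) (Pi.single B 1)))

/-- Near `q`, `H` is a CR structure given by the functions `c`: it is annihilated by `dz̄_A` and by
the contact form, and it is involutive. -/
def IsCRAt (H : (Coord s r → ℝ) → Submodule ℂ (Coord s r → ℂ))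
    (c : (Coord s r → ℝ) → Fin s ⊕ Fin r → ℂ) (q : Coord s r → ℝ) : Prop :=
  ∀ᶠ x in 𝓝 q, (∀ v, v ∈ H x ↔ (∀ A, dzb A v = 0) ∧ theta (c x) v = 0) ∧
    (∀ A, AnalyticAt ℝ (fun y => c y A) x) ∧
    ∀ A B, cderiv (fun y => c y B) x (crVec (c x) (Pi.single A 1)) =
      cderiv (fun y => c y A) x (crVec (c x) (Pi.single B 1))

variable {H : (Coord s r → ℝ) → Submodule ℂ (Coord s r → ℂ)}
  {c : (Coord s r → ℝ) → Fin s ⊕ Fin r → ℂ} {q : Coord s r → ℝ}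

lemma IsCRAt.eventually (h : IsCRAt H c q) : ∀ᶠ x in 𝓝 q, IsCRAt H c x := h.eventually_nhds

lemma IsCRAt.mem_iff (h : IsCRAt H c q) {v : Coord s r → ℂ} :
    v ∈ H q ↔ (∀ A, dzb A v = 0) ∧ theta (c q) v = 0 := h.self_of_nhds.1 v

lemma IsCRAt.analyticAt (h : IsCRAt H c q) (A) : AnalyticAt ℝ (fun y => c y A) q :=
  h.self_of_nhds.2.1 A

lemma IsCRAt.mem_conj_iff (h : IsCRAt H c q) {v : Coord s r → ℂ} :
    v ∈ conjSub (H q) ↔ (∀ A, dz A v = 0) ∧ theta (c q) v = 0 := by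
  change star v ∈ H q ↔ _
  simp [h.mem_iff, dzb_star, theta_star]

lemma IsCRAt.crVec_mem (h : IsCRAt H c q) (a) : crVec (c q) a ∈ H q := by
  simp [h.mem_iff]

lemma IsCRAt.eq_crVec (h : IsCRAt H c q) {v : Coord s r → ℂ} (hv : v ∈ H q) :
    v = crVec (c q) fun A => dz A v := by
  obtain ⟨h1, h2⟩ := h.mem_iff.1 hv
  refine vec_ext (by simp) (by simp [h1]) ?_
  simpa [theta_apply, h1, sub_eq_zero] using h2

lemma star_crVec_mem {D : Submodule ℂ (Coord s r → ℂ)} {v : Coord s r → ℂ} (hv : v ∈ D) :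
    star v ∈ conjSub D := by
  change star (star v) ∈ D
  rwa [star_star]

lemma IsCRAt.mem_leviDist_iff (h : IsCRAt H c q) {v : Coord s r → ℂ} :
    v ∈ leviDist H q ↔ theta (c q) v = 0 := by
  constructor
  · intro hv
    obtain ⟨a, ha, b, hb, rfl⟩ := Submodule.mem_sup.1 hv
    rw [map_add, (h.mem_iff.1 ha).2, (h.mem_conj_iff.1 hb).2, add_zero]
  · intro hv
    have e : v = crVec (c q) (fun A => dz A v) + star (crVec (c q) (fun A => conj (dzb A v))) := by
      refine vec_ext (by simp [dz_star]) (by simp [dzb_star]) ?_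
      rw [theta_apply] at hv
      simp only [map_add, du_crVec, du_star, map_sum, map_mul, Complex.conj_conj]
      linear_combination hv
    rw [e]
    exact Submodule.add_mem_sup (h.crVec_mem _) (star_crVec_mem (h.crVec_mem _))

lemma IsCRAt.contDiffAt (h : IsCRAt H c q) {n : ℕ∞ω} (A) : ContDiffAt ℝ n (fun y => c y A) q :=
  (h.analyticAt A).contDiffAt

lemma IsCRAt.differentiableAt (h : IsCRAt H c q) (A) : DifferentiableAt ℝ (fun y => c y A) q :=
  (h.analyticAt A).differentiableAt

lemma contDiffAt_conj {E : Type} [NormedAddCommGroup E] [NormedSpace ℝ E] {n : ℕ∞ω} {f : E → ℂ}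
    {x : E} (hf : ContDiffAt ℝ n f x) : ContDiffAt ℝ n (fun y => conj (f y)) x :=
  (Complex.conjCLE : ℂ →L[ℝ] ℂ).contDiff.contDiffAt.comp x hf

lemma differentiableAt_conj {E : Type} [NormedAddCommGroup E] [NormedSpace ℝ E] {f : E → ℂ}
    {x : E} (hf : DifferentiableAt ℝ f x) : DifferentiableAt ℝ (fun y => conj (f y)) x :=
  (Complex.conjCLE : ℂ →L[ℝ] ℂ).differentiableAt.comp x hf

lemma IsCRAt.isSection_crVec (h : IsCRAt H c q) {a : (Coord s r → ℝ) → Fin s ⊕ Fin r → ℂ}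
    (ha : ∀ᶠ x in 𝓝 q, ∀ A, ContDiffAt ℝ ∞ (fun y => a y A) x) :
    IsSectionNear H q fun x => crVec (c x) (a x) := by
  filter_upwards [h.eventually, ha] with x hx hax
  refine ⟨contDiffAt_vecOf hax (fun A => contDiffAt_const) ?_, hx.crVec_mem _⟩
  exact ContDiffAt.sum fun A _ => (hx.contDiffAt A).mul (hax A)

lemma IsCRAt.isSection_crVec_const (h : IsCRAt H c q) (a : Fin s ⊕ Fin r → ℂ) :
    IsSectionNear H q fun x => crVec (c x) a :=
  h.isSection_crVec (a := fun _ => a) (Eventually.of_forall fun _ _ => contDiffAt_const)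

lemma IsSectionNear.star {ι : Type} [Fintype ι] [DecidableEq ι]
    {D : (ι → ℝ) → Submodule ℂ (ι → ℂ)} {p : ι → ℝ} {X : (ι → ℝ) → ι → ℂ}
    (h : IsSectionNear D p X) : IsSectionNear (fun q => conjSub (D q)) p fun x => Star.star (X x) := by
  filter_upwards [h] with x hx
  refine ⟨contDiffAt_pi.2 fun i => contDiffAt_conj (contDiffAt_pi.1 hx.1 i), ?_⟩
  change Star.star (Star.star (X x)) ∈ D x
  rw [star_star]
  exact hx.2

/-- A vector in the Levi distribution acts on functions through its components. -/
lemma cderiv_of_theta_eq_zero {c : Fin s ⊕ Fin r → ℂ} {v : Coord s r → ℂ} (hv : theta c v = 0)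
    (f : (Coord s r → ℝ) → ℂ) (q : Coord s r → ℝ) :
    cderiv f q v = ∑ A, dz A v * cderiv f q (crVec c (Pi.single A 1)) +
      ∑ A, dzb A v * cderiv f q (star (crVec c (Pi.single A 1))) := by
  have e : v = ∑ A, dz A v • crVec c (Pi.single A 1) +
      ∑ A, dzb A v • star (crVec c (Pi.single A 1)) := by
    rw [theta_apply] at hv
    refine vec_ext (fun B => ?_) (fun B => ?_) ?_
    · simp [dz_star, Pi.single_apply, -Fintype.sum_sum_type]
    · simp [dzb_star, Pi.single_apply, -Fintype.sum_sum_type]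
    · simp only [map_add, map_sum, map_smul, du_crVec, du_star, smul_eq_mul]
      simp only [Pi.single_apply, mul_ite, mul_one, mul_zero, Finset.sum_ite_eq', Finset.mem_univ,
        if_true, apply_ite (starRingEnd ℂ), map_zero]
      simp only [mul_comm (dz _ _), mul_comm (dzb _ _)]
      linear_combination hv
  conv_lhs => rw [e]
  simp [map_sum]

/-- The contact form on a bracket of fields in the Levi distribution. -/
lemma IsCRAt.theta_bracket (h : IsCRAt H c q) {Z W : (Coord s r → ℝ) → Coord s r → ℂ}
    (hZ : DifferentiableAt ℝ Z q) (hW : DifferentiableAt ℝ W q)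
    (hZ0 : ∀ᶠ x in 𝓝 q, theta (c x) (Z x) = 0) (hW0 : ∀ᶠ x in 𝓝 q, theta (c x) (W x) = 0) :
    theta (c q) (bracket Z W q) =
      ∑ A, ∑ B, (dz A (Z q) * dzb B (W q) - dz A (W q) * dzb B (Z q)) * lev c q A B := by
  have hc := h.differentiableAt
  -- A field in the kernel of the contact form has its `∂_u` component determined by the others, and
  -- this identity can be differentiated.
  have key : ∀ {V : (Coord s r → ℝ) → Coord s r → ℂ}, DifferentiableAt ℝ V q →
      (∀ᶠ x in 𝓝 q, theta (c x) (V x) = 0) → ∀ w, cderiv (fun x => du (V x)) q w =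
      ∑ A, (cderiv (fun x => c x A) q w * dz A (V q) + c q A * cderiv (fun x => dz A (V x)) q w) +
      ∑ A, (cderiv (fun x => conj (c x A)) q w * dzb A (V q) +
        conj (c q A) * cderiv (fun x => dzb A (V x)) q w) := by
    intro V hV hV0 w
    have e : (fun x => du (V x)) =ᶠ[𝓝 q] fun x => (∑ A, c x A * dz A (V x)) +
        ∑ A, conj (c x A) * dzb A (V x) := by
      filter_upwards [hV0] with x hx
      rw [theta_apply] at hx
      linear_combination hx
    have d1 : ∀ A, DifferentiableAt ℝ (fun x => c x A * dz A (V x)) q := fun A =>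
      (hc A).fun_mul (differentiableAt_linear _ hV)
    have d2 : ∀ A, DifferentiableAt ℝ (fun x => conj (c x A) * dzb A (V x)) q := fun A =>
      (differentiableAt_conj (hc A)).fun_mul (differentiableAt_linear _ hV)
    rw [cderiv_congr e, cderiv_add (DifferentiableAt.fun_sum fun A _ => d1 A)
      (DifferentiableAt.fun_sum fun A _ => d2 A), cderiv_sum _ (fun A _ => d1 A),
      cderiv_sum _ (fun A _ => d2 A)]
    congr 1
    · exact Finset.sum_congr rfl fun A _ => cderiv_mul (hc A) (differentiableAt_linear _ hV) _
    · exact Finset.sum_congr rfl fun A _ =>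
        cderiv_mul (differentiableAt_conj (hc A)) (differentiableAt_linear _ hV) _
  have step : theta (c q) (bracket Z W q) =
      ∑ A, (cderiv (fun x => c x A) q (Z q) * dz A (W q) -
        cderiv (fun x => c x A) q (W q) * dz A (Z q) +
        (cderiv (fun x => conj (c x A)) q (Z q) * dzb A (W q) -
        cderiv (fun x => conj (c x A)) q (W q) * dzb A (Z q))) := by
    rw [theta_apply]
    simp only [map_bracket _ hZ hW]
    rw [key hZ hZ0, key hW hW0]
    simp only [Finset.sum_add_distrib, Finset.sum_sub_distrib, mul_sub]
    ring
  rw [step]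
  -- Involutivity and its conjugate make the terms of pure type symmetric, so they cancel in the
  -- bracket. Only the mixed terms survive, and they assemble into `lev`.
  have inv := h.self_of_nhds.2.2
  have inv' : ∀ A B, cderiv (fun y => conj (c y B)) q (star (crVec (c q) (Pi.single A 1))) =
      cderiv (fun y => conj (c y A)) q (star (crVec (c q) (Pi.single B 1))) := by
    intro A B
    rw [cderiv_conj, cderiv_conj, star_star, star_star, inv]
  simp only [cderiv_of_theta_eq_zero hZ0.self_of_nhds, cderiv_of_theta_eq_zero hW0.self_of_nhds,
    lev, add_mul, Finset.sum_mul, Finset.sum_add_distrib, Finset.sum_sub_distrib, mul_sub, sub_mul]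
  have swap1 : ∑ x, ∑ i, dz i (Z q) * cderiv (fun x_1 => c x_1 x) q
      (crVec (c q) (Pi.single i 1)) * dz x (W q) = ∑ x, ∑ i, dz i (W q) *
      cderiv (fun x_1 => c x_1 x) q (crVec (c q) (Pi.single i 1)) * dz x (Z q) := by
    rw [Finset.sum_comm]
    refine Finset.sum_congr rfl fun A _ => Finset.sum_congr rfl fun B _ => ?_
    rw [inv A B]
    ring
  have swap2 : ∑ x, ∑ i, dzb i (Z q) * cderiv (fun x_1 => conj (c x_1 x)) q
      (star (crVec (c q) (Pi.single i 1))) * dzb x (W q) = ∑ x, ∑ i, dzb i (W q) *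
      cderiv (fun x_1 => conj (c x_1 x)) q (star (crVec (c q) (Pi.single i 1))) *
      dzb x (Z q) := by
    rw [Finset.sum_comm]
    refine Finset.sum_congr rfl fun A _ => Finset.sum_congr rfl fun B _ => ?_
    rw [inv' A B]
    ring
  have comm1 : ∀ Z W : (Coord s r → ℂ), ∑ x, ∑ i, dz i Z * cderiv (fun x_1 => conj (c x_1 x)) q
      (crVec (c q) (Pi.single i 1)) * dzb x W = ∑ i, ∑ x, dz i Z * dzb x W *
      cderiv (fun x_1 => conj (c x_1 x)) q (crVec (c q) (Pi.single i 1)) := by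
    intro Z W
    rw [Finset.sum_comm]
    exact Finset.sum_congr rfl fun A _ => Finset.sum_congr rfl fun B _ => by ring
  have comm2 : ∀ Z W : (Coord s r → ℂ), ∑ x, ∑ i, dzb i Z * cderiv (fun x_1 => c x_1 x) q
      (star (crVec (c q) (Pi.single i 1))) * dz x W = ∑ x, ∑ i, dz x W * dzb i Z *
      cderiv (fun x_1 => c x_1 x) q (star (crVec (c q) (Pi.single i 1))) := by
    intro Z W
    exact Finset.sum_congr rfl fun A _ => Finset.sum_congr rfl fun B _ => by ring
  rw [swap1, swap2, comm1, comm1, comm2, comm2]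
  ring

/-- The Levi matrix is skew-Hermitian because conjugation reverses the bracket `[L_A, L̄_B]` while
`∂_u` is real. -/
lemma lev_conj (c : (Coord s r → ℝ) → Fin s ⊕ Fin r → ℂ) (q : Coord s r → ℝ) (A B) :
    conj (lev c q A B) = -lev c q B A := by
  simp only [lev, map_sub, cderiv_conj, Complex.conj_conj]
  ring

lemma IsCRAt.section_theta (h : IsCRAt H c q) {X : (Coord s r → ℝ) → Coord s r → ℂ}
    (hX : IsSectionNear H q X) : ∀ᶠ x in 𝓝 q, theta (c x) (X x) = 0 := by
  filter_upwards [hX, h.eventually] with x h1 h2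
  exact (h2.mem_iff.1 h1.2).2

lemma IsCRAt.section_dzb (h : IsCRAt H c q) {X : (Coord s r → ℝ) → Coord s r → ℂ}
    (hX : IsSectionNear H q X) (A) : ∀ᶠ x in 𝓝 q, dzb A (X x) = 0 := by
  filter_upwards [hX, h.eventually] with x h1 h2
  exact (h2.mem_iff.1 h1.2).1 A

lemma IsCRAt.conj_section_theta (h : IsCRAt H c q) {X : (Coord s r → ℝ) → Coord s r → ℂ}
    (hX : IsSectionNear (fun x => conjSub (H x)) q X) : ∀ᶠ x in 𝓝 q, theta (c x) (X x) = 0 := by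
  filter_upwards [hX, h.eventually] with x h1 h2
  exact (h2.mem_conj_iff.1 h1.2).2

lemma IsCRAt.conj_section_dz (h : IsCRAt H c q) {X : (Coord s r → ℝ) → Coord s r → ℂ}
    (hX : IsSectionNear (fun x => conjSub (H x)) q X) (A) : ∀ᶠ x in 𝓝 q, dz A (X x) = 0 := by
  filter_upwards [hX, h.eventually] with x h1 h2
  exact (h2.mem_conj_iff.1 h1.2).1 A

lemma IsCRAt.theta_bracket_conj (h : IsCRAt H c q) {X Y : (Coord s r → ℝ) → Coord s r → ℂ}
    (hX : IsSectionNear H q X) (hY : IsSectionNear (fun x => conjSub (H x)) q Y) :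
    theta (c q) (bracket X Y q) = ∑ A, ∑ B, dz A (X q) * dzb B (Y q) * lev c q A B := by
  rw [h.theta_bracket hX.differentiableAt hY.differentiableAt (h.section_theta hX)
    (h.conj_section_theta hY)]
  simp [(h.conj_section_dz hY _).self_of_nhds]

/-- The contact form of a bracket of a `(1,0)` and a `(0,1)` section depends only on the values at
`q`, so fields with constant components suffice, both as test fields and as an extension of `v`. -/
lemma IsCRAt.mem_leviKernel_iff (h : IsCRAt H c q) {v : Coord s r → ℂ} :
    v ∈ leviKernel H q ↔ v ∈ H q ∧ ∀ B, ∑ A, dz A v * lev c q A B = 0 := by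
  constructor
  · rintro ⟨X, hX, rfl, hXY⟩
    refine ⟨hX.self_of_nhds.2, fun B => ?_⟩
    have hY := h.isSection_crVec_const (Pi.single B 1)
    have := h.mem_leviDist_iff.1 (hXY _ hY)
    rw [h.theta_bracket_conj hX hY.star] at this
    simpa [dzb_star, Pi.single_apply] using this
  · rintro ⟨hv, hB⟩
    refine ⟨_, h.isSection_crVec_const fun A => dz A v, (h.eq_crVec hv).symm, fun Y hY => ?_⟩
    rw [h.mem_leviDist_iff, h.theta_bracket_conj (h.isSection_crVec_const _) hY.star,
      Finset.sum_comm]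
    refine Finset.sum_eq_zero fun B _ => ?_
    have := congrArg (· * dzb B (star (Y q))) (hB B)
    simp only [zero_mul, Finset.sum_mul] at this
    rw [← this]
    refine Finset.sum_congr rfl fun A _ => ?_
    simp
    ring

end CRCalculus

/-! ### The Levi kernel as a graph -/

section LeviKernel

variable {s r : ℕ}

/-- The component along `L_j` modulo the Levi kernel, for vectors of type `(1,0)`. -/
def redz (k : Fin r → Fin s → ℂ) (j : Fin s) : (Coord s r → ℂ) →ₗ[ℂ] ℂ :=
  dz (.inl j) - ∑ α, k α j • dz (.inr α)

/-- The conjugate of `redz`. -/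
def redzb (k : Fin r → Fin s → ℂ) (j : Fin s) : (Coord s r → ℂ) →ₗ[ℂ] ℂ :=
  dzb (.inl j) - ∑ α, conj (k α j) • dzb (.inr α)

lemma redz_apply (k : Fin r → Fin s → ℂ) (j : Fin s) (v : Coord s r → ℂ) :
    redz k j v = dz (.inl j) v - ∑ α, k α j * dz (.inr α) v := by
  simp [redz]

lemma redzb_apply (k : Fin r → Fin s → ℂ) (j : Fin s) (v : Coord s r → ℂ) :
    redzb k j v = dzb (.inl j) v - ∑ α, conj (k α j) * dzb (.inr α) v := by
  simp [redzb]

lemma redz_star (k : Fin r → Fin s → ℂ) (j : Fin s) (v : Coord s r → ℂ) :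
    redz k j (star v) = conj (redzb k j v) := by
  simp [redz_apply, redzb_apply, dz_star]

lemma redzb_star (k : Fin r → Fin s → ℂ) (j : Fin s) (v : Coord s r → ℂ) :
    redzb k j (star v) = conj (redz k j v) := by
  simp [redz_apply, redzb_apply, dzb_star]

/-- Near `q`, the Levi kernel of the CR structure is the graph of `k`. -/
def IsLeviAt (H : (Coord s r → ℝ) → Submodule ℂ (Coord s r → ℂ))
    (c : (Coord s r → ℝ) → Fin s ⊕ Fin r → ℂ) (k : (Coord s r → ℝ) → Fin r → Fin s → ℂ)
    (q : Coord s r → ℝ) : Prop :=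
  IsCRAt H c q ∧ ∀ᶠ x in 𝓝 q,
    (∀ v, v ∈ leviKernel H x ↔ v ∈ H x ∧ ∀ j, redz (k x) j v = 0) ∧
    ∀ α j, AnalyticAt ℝ (fun y => k y α j) x

/-- The element of the Levi kernel with given `ζ` components. -/
def kerVec (c : Fin s ⊕ Fin r → ℂ) (k : Fin r → Fin s → ℂ) (a : Fin r → ℂ) : Coord s r → ℂ :=
  crVec c (Sum.elim (fun j => ∑ α, k α j * a α) a)

@[simp] lemma dz_inl_kerVec (c : Fin s ⊕ Fin r → ℂ) (k : Fin r → Fin s → ℂ) (a : Fin r → ℂ)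
    (j : Fin s) : dz (.inl j) (kerVec c k a) = ∑ α, k α j * a α := by simp [kerVec]

@[simp] lemma dz_inr_kerVec (c : Fin s ⊕ Fin r → ℂ) (k : Fin r → Fin s → ℂ) (a : Fin r → ℂ)
    (α : Fin r) : dz (.inr α) (kerVec c k a) = a α := by simp [kerVec]

@[simp] lemma dzb_kerVec (c : Fin s ⊕ Fin r → ℂ) (k : Fin r → Fin s → ℂ) (a : Fin r → ℂ)
    (A) : dzb A (kerVec c k a) = 0 := by simp [kerVec]

@[simp] lemma redz_kerVec (c : Fin s ⊕ Fin r → ℂ) (k : Fin r → Fin s → ℂ) (a : Fin r → ℂ)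
    (j : Fin s) : redz k j (kerVec c k a) = 0 := by simp [redz_apply]

/-- `kerVec` as a linear map. -/
def kerMap (c : Fin s ⊕ Fin r → ℂ) (k : Fin r → Fin s → ℂ) :
    (Fin r → ℂ) →ₗ[ℂ] (Coord s r → ℂ) where
  toFun := kerVec c k
  map_add' a b := by
    refine vec_ext (fun A => ?_) (fun A => by simp) ?_
    · rcases A with j | α <;> simp [mul_add, Finset.sum_add_distrib]
    · simp [kerVec, mul_add, Finset.sum_add_distrib]
      ring
  map_smul' t a := by
    refine vec_ext (fun A => ?_) (fun A => by simp) ?_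
    · rcases A with j | α <;> simp [Finset.mul_sum, mul_left_comm]
    · simp [kerVec, Finset.mul_sum, mul_add, mul_left_comm]

@[simp] lemma kerMap_apply (c : Fin s ⊕ Fin r → ℂ) (k : Fin r → Fin s → ℂ) (a : Fin r → ℂ) :
    kerMap c k a = kerVec c k a := rfl

lemma kerMap_injective (c : Fin s ⊕ Fin r → ℂ) (k : Fin r → Fin s → ℂ) :
    Function.Injective (kerMap c k) := by
  intro a b h
  funext α
  simpa using congrArg (dz (.inr α)) h

lemma finrank_range_kerMap (c : Fin s ⊕ Fin r → ℂ) (k : Fin r → Fin s → ℂ) :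
    Module.finrank ℂ (LinearMap.range (kerMap c k)) = r := by
  rw [LinearMap.finrank_range_of_inj (kerMap_injective c k)]
  simp

variable {H : (Coord s r → ℝ) → Submodule ℂ (Coord s r → ℂ)}
  {c : (Coord s r → ℝ) → Fin s ⊕ Fin r → ℂ} {k : (Coord s r → ℝ) → Fin r → Fin s → ℂ}
  {q : Coord s r → ℝ}

lemma IsCRAt.mem_range_kerMap_iff (h : IsCRAt H c q) {k : Fin r → Fin s → ℂ}
    {v : Coord s r → ℂ} :
    v ∈ LinearMap.range (kerMap (c q) k) ↔ v ∈ H q ∧ ∀ j, redz k j v = 0 := by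
  constructor
  · rintro ⟨a, rfl⟩
    exact ⟨h.crVec_mem _, by simp⟩
  · rintro ⟨hv, hj⟩
    refine ⟨fun α => dz (.inr α) v, ?_⟩
    rw [kerMap_apply, h.eq_crVec hv, kerVec]
    congr 1
    funext A
    rcases A with j | α
    · have := hj j
      rw [redz_apply, sub_eq_zero] at this
      simp [this]
    · simp

/-- The Schur complement of the Levi form. -/
def schur (c : (Coord s r → ℝ) → Fin s ⊕ Fin r → ℂ) (k : (Coord s r → ℝ) → Fin r → Fin s → ℂ)
    (q : Coord s r → ℝ) (α β : Fin r) : ℂ :=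
  lev c q (.inr α) (.inr β) + ∑ j, k q α j * lev c q (.inl j) (.inr β)

/-- `k` is the solution of the first block of equations for the Levi kernel. -/
def SolvesKernel (c : (Coord s r → ℝ) → Fin s ⊕ Fin r → ℂ)
    (k : (Coord s r → ℝ) → Fin r → Fin s → ℂ) (q : Coord s r → ℝ) : Prop :=
  ∃ N : Matrix (Fin s) (Fin s) ℂ, (Matrix.of fun i j => lev c q (.inl i) (.inl j)) * N = 1 ∧
    ∀ α j, k q α j = -∑ i, lev c q (.inr α) (.inl i) * N i j

lemma SolvesKernel.eq_zero (h : SolvesKernel c k q) (α : Fin r) (i : Fin s) :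
    lev c q (.inr α) (.inl i) + ∑ j, k q α j * lev c q (.inl j) (.inl i) = 0 := by
  obtain ⟨N, hN, hk⟩ := h
  -- The equations to be checked have `N` to the left of the Levi block.
  have hN' := mul_eq_one_comm.1 hN
  have e : ∀ l, ∑ j, N l j * lev c q (.inl j) (.inl i) = if l = i then 1 else 0 := by
    intro l
    have := congrFun (congrFun hN' l) i
    simpa [Matrix.mul_apply, Matrix.one_apply] using this
  simp only [hk, neg_mul, Finset.sum_neg_distrib, Finset.sum_mul]
  rw [Finset.sum_comm]
  simp only [mul_assoc, ← Finset.mul_sum, e]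
  simp

/-- Only the kernel equations tested against the `z̄` directions are used: the invertible block
solves them for the `z`-components. The rank of the kernel is thus at most `r` without any further
condition. -/
lemma IsCRAt.leviKernel_le (h : IsCRAt H c q) (hk : SolvesKernel c k q) :
    leviKernel H q ≤ LinearMap.range (kerMap (c q) (k q)) := by
  intro v hv
  obtain ⟨hvH, hB⟩ := h.mem_leviKernel_iff.1 hv
  refine h.mem_range_kerMap_iff.2 ⟨hvH, fun j => ?_⟩
  obtain ⟨N, hN, hkN⟩ := hk
  have e : ∀ l, ∑ i, lev c q (.inl l) (.inl i) * N i j = if l = j then 1 else 0 := by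
    intro l
    have := congrFun (congrFun hN l) j
    simpa [Matrix.mul_apply, Matrix.one_apply] using this
  have h1 : ∑ i, (∑ A, dz A v * lev c q A (.inl i)) * N i j = 0 := by
    simp only [hB, zero_mul, Finset.sum_const_zero]
  simp only [Fintype.sum_sum_type, add_mul, Finset.sum_add_distrib, Finset.sum_mul] at h1
  rw [Finset.sum_comm] at h1
  simp only [mul_assoc, ← Finset.mul_sum, e, mul_ite, mul_one, mul_zero, Finset.sum_ite_eq',
    Finset.mem_univ, if_true] at h1
  rw [redz_apply, sub_eq_add_neg, ← Finset.sum_neg_distrib]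
  rw [Finset.sum_comm] at h1
  rw [← h1]
  congr 1
  refine Finset.sum_congr rfl fun α _ => ?_
  rw [hkN, ← Finset.mul_sum]
  ring

/-- On the graph of `k` the equations in the `z̄` directions hold by construction. The equations in
the `ζ̄` directions that remain are the entries of the Schur complement. -/
lemma IsCRAt.leviKernel_eq_iff (h : IsCRAt H c q) (hk : SolvesKernel c k q) :
    leviKernel H q = LinearMap.range (kerMap (c q) (k q)) ↔ ∀ α β, schur c k q α β = 0 := by
  have key : ∀ a B, ∑ A, dz A (kerVec (c q) (k q) a) * lev c q A B =
      ∑ α, a α * (lev c q (.inr α) B + ∑ j, k q α j * lev c q (.inl j) B) := by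
    intro a B
    simp only [Fintype.sum_sum_type, dz_inl_kerVec, dz_inr_kerVec, Finset.sum_mul, mul_add,
      Finset.sum_add_distrib, Finset.mul_sum]
    rw [Finset.sum_comm, add_comm]
    congr 1
    exact Finset.sum_congr rfl fun _ _ => Finset.sum_congr rfl fun _ _ => by ring
  constructor
  · intro e α β
    have : kerVec (c q) (k q) (Pi.single α 1) ∈ leviKernel H q := by
      rw [e]
      exact ⟨_, rfl⟩
    have := (h.mem_leviKernel_iff.1 this).2 (.inr β)
    rw [key] at this
    simpa [Pi.single_apply, schur] using this
  · intro e
    refine le_antisymm (h.leviKernel_le hk) ?_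
    rintro _ ⟨a, rfl⟩
    refine h.mem_leviKernel_iff.2 ⟨h.crVec_mem _, fun B => ?_⟩
    rw [kerMap_apply, key]
    refine Finset.sum_eq_zero fun α _ => ?_
    rcases B with i | β
    · rw [hk.eq_zero, mul_zero]
    · have := e α β
      rw [schur] at this
      rw [this, mul_zero]

lemma IsLeviAt.cr (h : IsLeviAt H c k q) : IsCRAt H c q := h.1

lemma IsLeviAt.eventually (h : IsLeviAt H c k q) : ∀ᶠ x in 𝓝 q, IsLeviAt H c k x := by
  filter_upwards [h.1.eventually, h.2.eventually_nhds] with x h1 h2 using ⟨h1, h2⟩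

lemma IsLeviAt.mem_iff (h : IsLeviAt H c k q) {v : Coord s r → ℂ} :
    v ∈ leviKernel H q ↔ v ∈ H q ∧ ∀ j, redz (k q) j v = 0 := h.2.self_of_nhds.1 v

lemma IsLeviAt.leviKernel_eq (h : IsLeviAt H c k q) :
    leviKernel H q = LinearMap.range (kerMap (c q) (k q)) := by
  ext v
  rw [h.mem_iff, h.cr.mem_range_kerMap_iff]

lemma IsLeviAt.kerVec_mem (h : IsLeviAt H c k q) (a : Fin r → ℂ) :
    kerVec (c q) (k q) a ∈ leviKernel H q := by
  rw [h.leviKernel_eq]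
  exact ⟨a, rfl⟩

lemma IsLeviAt.eq_kerVec (h : IsLeviAt H c k q) {v : Coord s r → ℂ} (hv : v ∈ leviKernel H q) :
    v = kerVec (c q) (k q) fun α => dz (.inr α) v := by
  rw [h.leviKernel_eq] at hv
  obtain ⟨a, rfl⟩ := hv
  simp

lemma IsLeviAt.mem_conj_iff (h : IsLeviAt H c k q) {v : Coord s r → ℂ} :
    v ∈ conjSub (leviKernel H q) ↔ v ∈ conjSub (H q) ∧ ∀ j, redzb (k q) j v = 0 := by
  change star v ∈ leviKernel H q ↔ star v ∈ H q ∧ _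
  simp [h.mem_iff, redz_star]

lemma IsLeviAt.analyticAt (h : IsLeviAt H c k q) (α j) : AnalyticAt ℝ (fun y => k y α j) q :=
  h.2.self_of_nhds.2 α j

lemma IsLeviAt.contDiffAt (h : IsLeviAt H c k q) {n : ℕ∞ω} (α j) :
    ContDiffAt ℝ n (fun y => k y α j) q := (h.analyticAt α j).contDiffAt

lemma IsLeviAt.differentiableAt (h : IsLeviAt H c k q) (α j) :
    DifferentiableAt ℝ (fun y => k y α j) q := (h.analyticAt α j).differentiableAt

lemma IsLeviAt.isSection_kerVec (h : IsLeviAt H c k q) {a : (Coord s r → ℝ) → Fin r → ℂ}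
    (ha : ∀ᶠ x in 𝓝 q, ∀ α, ContDiffAt ℝ ∞ (fun y => a y α) x) :
    IsSectionNear (leviKernel H) q fun x => kerVec (c x) (k x) (a x) := by
  have : IsSectionNear H q fun x => kerVec (c x) (k x) (a x) := by
    refine h.cr.isSection_crVec ?_
    filter_upwards [h.eventually, ha] with x hx hax A
    rcases A with j | α
    · exact ContDiffAt.sum fun α _ => (hx.contDiffAt α j).mul (hax α)
    · exact hax α
  filter_upwards [this, h.eventually] with x h1 h2 using ⟨h1.1, h2.kerVec_mem _⟩

lemma IsLeviAt.isSection_kerVec_const (h : IsLeviAt H c k q) (a : Fin r → ℂ) :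
    IsSectionNear (leviKernel H) q fun x => kerVec (c x) (k x) a :=
  h.isSection_kerVec (a := fun _ => a) (Eventually.of_forall fun _ _ => contDiffAt_const)

lemma IsLeviAt.section_cr (h : IsLeviAt H c k q) {X : (Coord s r → ℝ) → Coord s r → ℂ}
    (hX : IsSectionNear (leviKernel H) q X) : IsSectionNear H q X := by
  filter_upwards [hX, h.eventually] with x h1 h2 using ⟨h1.1, (h2.mem_iff.1 h1.2).1⟩

lemma IsLeviAt.lev_eq_zero (h : IsLeviAt H c k q) (α : Fin r) (B : Fin s ⊕ Fin r) :
    lev c q (.inr α) B = -∑ j, k q α j * lev c q (.inl j) B := by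
  have := (h.cr.mem_leviKernel_iff.1 (h.kerVec_mem (Pi.single α 1))).2 B
  simp only [Fintype.sum_sum_type, dz_inl_kerVec, dz_inr_kerVec] at this
  simp only [Pi.single_apply, mul_ite, mul_one, mul_zero, Finset.sum_ite_eq', Finset.mem_univ,
    if_true, ite_mul, one_mul, zero_mul] at this
  linear_combination this

lemma IsLeviAt.theta_bracket_eq_zero (h : IsLeviAt H c k q)
    {X Y : (Coord s r → ℝ) → Coord s r → ℂ} (hX : IsSectionNear (leviKernel H) q X)
    (hY : IsSectionNear (fun x => conjSub (H x)) q Y) :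
    theta (c q) (bracket X Y q) = 0 := by
  rw [h.cr.theta_bracket_conj (h.section_cr hX) hY, Finset.sum_comm]
  refine Finset.sum_eq_zero fun B _ => ?_
  have := congrArg (· * dzb B (Y q)) ((h.cr.mem_leviKernel_iff.1 hX.self_of_nhds.2).2 B)
  simp only [zero_mul, Finset.sum_mul] at this
  rw [← this]
  exact Finset.sum_congr rfl fun A _ => by ring

lemma IsLeviAt.section_dz (h : IsLeviAt H c k q) {X : (Coord s r → ℝ) → Coord s r → ℂ}
    (hX : IsSectionNear (leviKernel H) q X) (j : Fin s) :
    ∀ᶠ x in 𝓝 q, dz (.inl j) (X x) = ∑ α, k x α j * dz (.inr α) (X x) := by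
  filter_upwards [hX, h.eventually] with x h1 h2
  have := (h2.mem_iff.1 h1.2).2 j
  rwa [redz_apply, sub_eq_zero] at this

/-- The reduced component of a bracket of a section of the Levi kernel with a field of type
`(0,1)`. -/
lemma IsLeviAt.redz_bracket (h : IsLeviAt H c k q) {X Y : (Coord s r → ℝ) → Coord s r → ℂ}
    (hX : IsSectionNear (leviKernel H) q X) (hY : IsSectionNear (fun x => conjSub (H x)) q Y)
    (j : Fin s) :
    redz (k q) j (bracket X Y q) =
      -∑ α, dz (.inr α) (X q) * cderiv (fun x => k x α j) q (Y q) := by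
  have hXd := hX.differentiableAt
  have hYd := hY.differentiableAt
  -- The `dz` components of a `(0,1)` field are identically zero, so only the derivatives of the
  -- components of `X` contribute.
  have e0 : ∀ A, cderiv (fun x => dz A (Y x)) q (X q) = 0 := fun A => by
    rw [cderiv_congr (h.cr.conj_section_dz hY A), cderiv_const]
  have d : ∀ α, DifferentiableAt ℝ (fun x => dz (.inr α) (X x)) q := fun α =>
    differentiableAt_linear _ hXd
  -- In the derivative of `dz_j(X) = ∑ k_αj dz_α(X)`, the derivatives of the coefficients `dz_α(X)`
  -- cancel against the correction in `redz`. Only the derivative of `k` is left, which makes the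
  -- bracket tensorial in `X`.
  have e1 : cderiv (fun x => dz (.inl j) (X x)) q (Y q) = ∑ α,
      (cderiv (fun x => k x α j) q (Y q) * dz (.inr α) (X q) +
        k q α j * cderiv (fun x => dz (.inr α) (X x)) q (Y q)) := by
    rw [cderiv_congr (h.section_dz hX j), cderiv_sum _ fun α _ =>
      (h.differentiableAt α j).fun_mul (d α)]
    exact Finset.sum_congr rfl fun α _ => cderiv_mul (h.differentiableAt α j) (d α) _
  rw [redz_apply]
  simp only [map_bracket _ hXd hYd, e0, e1, zero_sub, Finset.sum_add_distrib, mul_neg,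
    Finset.sum_neg_distrib, mul_comm (dz _ _)]
  ring

lemma IsLeviAt.redzb_bracket (h : IsLeviAt H c k q) {X Y : (Coord s r → ℝ) → Coord s r → ℂ}
    (hX : IsSectionNear (leviKernel H) q X) (hY : IsSectionNear H q Y) (j : Fin s) :
    redzb (k q) j (bracket (fun x => star (X x)) Y q) =
      -∑ α, conj (dz (.inr α) (X q)) * cderiv (fun x => conj (k x α j)) q (Y q) := by
  have hYs := hY.star
  have e := star_bracket hX.differentiableAt hYs.differentiableAt
  simp only [star_star] at e
  rw [← e, redzb_star, h.redz_bracket hX hYs]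
  simp [cderiv_conj]

lemma differentiableAt_bracket {ι : Type} [Fintype ι] [DecidableEq ι] {V W : (ι → ℝ) → ι → ℂ}
    {p : ι → ℝ} (hV : ContDiffAt ℝ ∞ V p) (hW : ContDiffAt ℝ ∞ W p) :
    DifferentiableAt ℝ (bracket V W) p := by
  have hV2 := hV.of_le (m := 2) (WithTop.coe_le_coe.2 (le_top : (2 : ℕ∞) ≤ ⊤))
  have hW2 := hW.of_le (m := 2) (WithTop.coe_le_coe.2 (le_top : (2 : ℕ∞) ≤ ⊤))
  have hV' : ∀ᶠ x in 𝓝 p, DifferentiableAt ℝ V x := by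
    filter_upwards [hV2.eventually (by simp)] with x hx using hx.differentiableAt (by simp)
  have hW' : ∀ᶠ x in 𝓝 p, DifferentiableAt ℝ W x := by
    filter_upwards [hW2.eventually (by simp)] with x hx using hx.differentiableAt (by simp)
  refine differentiableAt_pi.2 fun i => ?_
  have e : (fun x => bracket V W x i) =ᶠ[𝓝 p] fun x =>
      cderiv (fun y => W y i) x (V x) - cderiv (fun y => V y i) x (W x) := by
    filter_upwards [hV', hW'] with x h1 h2
    simp [bracket, cderiv_pi_apply h1, cderiv_pi_apply h2]
  refine DifferentiableAt.congr_of_eventuallyEq ?_ e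
  refine DifferentiableAt.fun_sub ?_ ?_
  · exact (contDiffAt_cderiv (n := 1) (contDiffAt_pi.1 hW2 i)
      (hV2.of_le (by norm_num))).differentiableAt (by simp)
  · exact (contDiffAt_cderiv (n := 1) (contDiffAt_pi.1 hV2 i)
      (hW2.of_le (by norm_num))).differentiableAt (by simp)

/-- Since `X` is a section of `K₂`, the field `[X, Ȳ]` stays in `H ⊕ H̄` near `q`. The outer bracket
then pairs its `(1,0)` part with `Y'` by the Levi form. Vanishing for all `Y'` means that this part
lies in `K₂`, which `redz_bracket` expresses through the derivatives of `k`. -/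
lemma IsLeviAt.theta_double_bracket_iff (h : IsLeviAt H c k q)
    {X : (Coord s r → ℝ) → Coord s r → ℂ} (hX : IsSectionNear (leviKernel H) q X)
    {Y : (Coord s r → ℝ) → Coord s r → ℂ} (hY : IsSectionNear H q Y) :
    (∀ Y', IsSectionNear H q Y' → bracket (bracket X (fun x => star (Y x)))
      (fun x => star (Y' x)) q ∈ leviDist H q) ↔
    ∀ j, ∑ α, dz (.inr α) (X q) * cderiv (fun x => k x α j) q (star (Y q)) = 0 := by
  set Z := bracket X (fun x => star (Y x)) with hZ
  have hYs := hY.star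
  have hZd : DifferentiableAt ℝ Z q :=
    differentiableAt_bracket hX.self_of_nhds.1 hYs.self_of_nhds.1
  have hZ0 : ∀ᶠ x in 𝓝 q, theta (c x) (Z x) = 0 := by
    filter_upwards [h.eventually, hX.eventually_nhds, hYs.eventually_nhds] with x h1 h2 h3
    exact h1.theta_bracket_eq_zero h2 h3
  have hth : ∀ Y', IsSectionNear H q Y' → theta (c q) (bracket Z (fun x => star (Y' x)) q) =
      ∑ A, ∑ B, dz A (Z q) * dzb B (star (Y' q)) * lev c q A B := by
    intro Y' hY'
    have hYs' := hY'.star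
    rw [h.cr.theta_bracket hZd hYs'.differentiableAt hZ0 (h.cr.conj_section_theta hYs')]
    simp [(h.cr.conj_section_dz hYs' _).self_of_nhds]
  have hker : (∀ Y', IsSectionNear H q Y' → bracket Z (fun x => star (Y' x)) q ∈ leviDist H q) ↔
      ∀ B, ∑ A, dz A (Z q) * lev c q A B = 0 := by
    constructor
    · intro hall B
      have := h.cr.mem_leviDist_iff.1 (hall _ (h.cr.isSection_crVec_const (Pi.single B 1)))
      rw [hth _ (h.cr.isSection_crVec_const (Pi.single B 1))] at this
      simpa [dzb_star, Pi.single_apply] using this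
    · intro hB Y' hY'
      rw [h.cr.mem_leviDist_iff, hth _ hY', Finset.sum_comm]
      refine Finset.sum_eq_zero fun B _ => ?_
      have := congrArg (· * dzb B (star (Y' q))) (hB B)
      simp only [zero_mul, Finset.sum_mul] at this
      rw [← this]
      exact Finset.sum_congr rfl fun A _ => by ring
  have hcr : (∀ B, ∑ A, dz A (Z q) * lev c q A B = 0) ↔ ∀ j, redz (k q) j (Z q) = 0 := by
    have := h.cr.mem_leviKernel_iff (v := crVec (c q) fun A => dz A (Z q))
    rw [h.mem_iff] at this
    simp only [h.cr.crVec_mem, true_and, dz_crVec, redz_apply] at this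
    simp only [redz_apply]
    exact this.symm
  rw [hker, hcr]
  simp only [hZ, h.redz_bracket hX hYs, neg_eq_zero]

/-- The third term of the Freeman filtration. -/
lemma IsLeviAt.mem_freemanThree_iff (h : IsLeviAt H c k q) {v : Coord s r → ℂ} :
    v ∈ freemanThree H q ↔ v ∈ leviKernel H q ∧ ∀ C j, ∑ α, dz (.inr α) v *
      cderiv (fun x => k x α j) q (star (crVec (c q) (Pi.single C 1))) = 0 := by
  constructor
  · rintro ⟨X, hX, rfl, hXY⟩
    refine ⟨hX.self_of_nhds.2, fun C => ?_⟩
    have hY := h.cr.isSection_crVec_const (Pi.single C 1)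
    exact (h.theta_double_bracket_iff hX hY).1 fun Y' => hXY _ _ hY
  · rintro ⟨hv, hC⟩
    have hX := h.isSection_kerVec_const fun α => dz (.inr α) v
    refine ⟨_, hX, (h.eq_kerVec hv).symm, fun Y Y' hY => ?_⟩
    refine (h.theta_double_bracket_iff hX hY).2 (fun j => ?_) Y'
    have hYH := h.cr.eq_crVec hY.self_of_nhds.2
    have hth : theta (c q) (star (Y q)) = 0 := by
      rw [theta_star, (h.cr.section_theta hY).self_of_nhds, map_zero]
    have h0 : ∀ A, dz A (star (Y q)) = 0 := fun A => by
      rw [dz_star, (h.cr.section_dzb hY A).self_of_nhds, map_zero]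
    simp only [cderiv_of_theta_eq_zero hth, h0, zero_mul, Finset.sum_const_zero, zero_add,
      dz_inr_kerVec, Finset.mul_sum]
    rw [Finset.sum_comm]
    refine Finset.sum_eq_zero fun C _ => ?_
    have := congrArg (dzb C (star (Y q)) * ·) (hC C j)
    simp only [mul_zero, Finset.mul_sum] at this
    rw [← this]
    exact Finset.sum_congr rfl fun A _ => by ring

end LeviKernel

/-! ### Orders of vanishing of analytic families -/

section Order

/-- The bound is convenient for sums and products, the analytic order for differentiation in `t`.
The bound is taken on the punctured neighborhood so that powers of `t` can be divided out. -/
lemma isBigO_pow_iff_le_analyticOrderAt {h : ℝ → ℂ} (hh : AnalyticAt ℝ h 0) (n : ℕ) :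
    h =O[𝓝[≠] 0] (fun t => t ^ n) ↔ (n : ℕ∞) ≤ analyticOrderAt h 0 := by
  constructor
  · intro hO
    by_contra hlt
    rw [not_le] at hlt
    obtain ⟨m, hm⟩ := ENat.ne_top_iff_exists.1 (ne_top_of_lt hlt)
    obtain ⟨g, hg, hg0, hfg⟩ := (hh.analyticOrderAt_eq_natCast (n := m)).1 hm.symm
    have hmn : m < n := by rw [← hm] at hlt; exact_mod_cast hlt
    have h1 : Tendsto g (𝓝[≠] 0) (𝓝 (g 0)) := hg.continuousAt.tendsto.mono_left nhdsWithin_le_nhds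
    have h2 : g =O[𝓝[≠] 0] fun t : ℝ => t ^ (n - m) := by
      obtain ⟨C, hC⟩ := hO.bound
      refine IsBigO.of_bound C ?_
      filter_upwards [hC, hfg.filter_mono nhdsWithin_le_nhds, self_mem_nhdsWithin] with t h3 h4 h5
      have h5' : (0 : ℝ) < ‖t‖ ^ m := pow_pos (norm_pos_iff.2 h5) m
      rw [h4, sub_zero, norm_smul, norm_pow, norm_pow, show n = m + (n - m) by omega, pow_add] at h3
      rw [norm_pow]
      refine le_of_mul_le_mul_left (h3.trans (le_of_eq ?_)) h5'
      ring
    have h3 : Tendsto (fun t : ℝ => t ^ (n - m)) (𝓝[≠] 0) (𝓝 0) := by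
      have : Tendsto (fun t : ℝ => t ^ (n - m)) (𝓝 0) (𝓝 (0 ^ (n - m))) :=
        (continuous_pow _).tendsto 0
      rw [zero_pow (by omega)] at this
      exact this.mono_left nhdsWithin_le_nhds
    exact hg0 (tendsto_nhds_unique h1 (h2.trans_tendsto h3))
  · intro hn
    obtain ⟨g, hg, hfg⟩ := (natCast_le_analyticOrderAt hh).1 hn
    have h1 : g =O[𝓝[≠] 0] fun _ => (1 : ℝ) :=
      (hg.continuousAt.tendsto.mono_left nhdsWithin_le_nhds).isBigO_one ℝ
    have h2 : h =ᶠ[𝓝[≠] 0] fun t => (t ^ n) • g t := by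
      filter_upwards [hfg.filter_mono nhdsWithin_le_nhds] with t ht
      rw [ht, sub_zero]
    refine h2.trans_isBigO ?_
    simpa using (isBigO_refl (fun t : ℝ => t ^ n) _).smul h1

variable {E : Type} [NormedAddCommGroup E] [NormedSpace ℝ E]

lemma fderiv_partial_right {G : ℝ × E → ℂ} {t : ℝ} {x : E} (hG : DifferentiableAt ℝ G (t, x))
    (e : E) : fderiv ℝ (fun y => G (t, y)) x e = fderiv ℝ G (t, x) (0, e) := by
  have := (hG.hasFDerivAt.comp x (hasFDerivAt_prodMk_right t x)).fderiv
  rw [show (fun y => G (t, y)) = G ∘ fun y => (t, y) from rfl, this]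
  simp

lemma deriv_partial_left {G : ℝ × E → ℂ} {t : ℝ} {x : E} (hG : DifferentiableAt ℝ G (t, x)) :
    deriv (fun u => G (u, x)) t = fderiv ℝ G (t, x) (1, 0) := by
  have h := HasFDerivAt.comp (g := G) (f := fun u : ℝ => (u, x)) t hG.hasFDerivAt
    (hasFDerivAt_prodMk_left t x)
  have := h.hasDerivAt.deriv
  rw [show (fun u => G (u, x)) = G ∘ fun u => (u, x) from rfl, this]
  simp

lemma analyticAt_partial_left {G : ℝ × E → ℂ} {t : ℝ} {x : E} (hG : AnalyticAt ℝ G (t, x)) :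
    AnalyticAt ℝ (fun u => G (u, x)) t :=
  AnalyticAt.fun_comp (g := G) (f := fun u : ℝ => (u, x)) hG (analyticAt_id.prod analyticAt_const)

/-- Differentiation in the parameters preserves the order of vanishing of an analytic family. -/
lemma isBigO_fderiv_param {x₀ : E} (e : E) (n : ℕ) :
    ∀ G : ℝ × E → ℂ, AnalyticAt ℝ G (0, x₀) →
    (∀ᶠ x in 𝓝 x₀, (fun t => G (t, x)) =O[𝓝[≠] 0] fun t => t ^ n) →
    (fun t => fderiv ℝ G (t, x₀) (0, e)) =O[𝓝[≠] 0] fun t => t ^ n := by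
  have app : ∀ (G : ℝ × E → ℂ) (p v : ℝ × E), AnalyticAt ℝ G p →
      AnalyticAt ℝ (fun y => fderiv ℝ G y v) p := fun G p v hG =>
    ((ContinuousLinearMap.apply ℝ ℂ v).analyticAt _).comp hG.fderiv
  have ev : ∀ P : ℝ × E → Prop, (∀ᶠ p in 𝓝 ((0 : ℝ), x₀), P p) →
      (∀ᶠ x in 𝓝 x₀, ∀ᶠ t in 𝓝 (0 : ℝ), P (t, x)) := by
    intro P hP
    have := hP.eventually_nhds
    have c : Tendsto (fun x : E => ((0 : ℝ), x)) (𝓝 x₀) (𝓝 (0, x₀)) :=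
      (Continuous.prodMk_right (0 : ℝ)).tendsto x₀
    filter_upwards [c.eventually this] with x hx
    have c' : Tendsto (fun t : ℝ => (t, x)) (𝓝 0) (𝓝 (0, x)) :=
      (Continuous.prodMk_left x).tendsto 0
    exact c'.eventually hx
  -- If `G(·, x)` has order `n + 1` at `0` for all `x` near `x₀`, then `∂_t G(·, x)` has order `n`,
  -- and by induction so does its parameter derivative at `x₀`. Symmetry of second derivatives turns
  -- that into the `t`-derivative of `∂_e G`. As `G(0, ·)` vanishes near `x₀`, the function `∂_e G`
  -- vanishes at `t = 0` and regains the lost order. The constants in the bounds need not be uniform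
  -- in `x`.
  induction n with
  | zero =>
    intro G hG _
    simpa using ((analyticAt_partial_left (app G _ (0, e) hG)).continuousAt.tendsto.mono_left
      nhdsWithin_le_nhds).isBigO_one ℝ
  | succ n ih =>
    intro G hG hO
    have hGev := ev _ hG.eventually_analyticAt
    have hord : ∀ᶠ x in 𝓝 x₀, ((n + 1 : ℕ) : ℕ∞) ≤ analyticOrderAt (fun t => G (t, x)) 0 := by
      filter_upwards [hO, hGev] with x h1 h2
      exact (isBigO_pow_iff_le_analyticOrderAt (analyticAt_partial_left h2.self_of_nhds) _).1 h1
    have hzero : ∀ᶠ x in 𝓝 x₀, G (0, x) = 0 := by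
      filter_upwards [hord] with x h1
      by_contra hne
      have : analyticOrderAt (fun t => G (t, x)) 0 = 0 := analyticOrderAt_eq_zero.2 (Or.inr hne)
      rw [this] at h1
      simp at h1
    have hG1 := app G _ (1, 0) hG
    have hO1 : ∀ᶠ x in 𝓝 x₀, (fun t => fderiv ℝ G (t, x) (1, 0)) =O[𝓝[≠] 0] fun t => t ^ n := by
      filter_upwards [hord, hzero, hGev] with x h1 h2 h3
      have a := analyticAt_partial_left h3.self_of_nhds
      have h4 := (analyticOrderAt_deriv_ge_iff a h2 (n := n)).2 (by exact_mod_cast h1)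
      have h5 := (isBigO_pow_iff_le_analyticOrderAt a.deriv n).2 h4
      refine (EventuallyEq.filter_mono ?_ nhdsWithin_le_nhds).trans_isBigO h5
      filter_upwards [h3] with t ht
      exact (deriv_partial_left ht.differentiableAt).symm
    have hI := ih _ hG1 hO1
    have ha := analyticAt_partial_left (app G _ (0, e) hG)
    have ha0 : fderiv ℝ G (0, x₀) (0, e) = 0 := by
      have hz : (fun x => G (0, x)) =ᶠ[𝓝 x₀] fun _ => 0 := hzero
      rw [← fderiv_partial_right hG.differentiableAt, hz.fderiv_eq]
      simp
    refine (isBigO_pow_iff_le_analyticOrderAt ha (n + 1)).2 ?_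
    push_cast
    refine (analyticOrderAt_deriv_ge_iff ha ha0 (n := n)).1 ?_
    refine (isBigO_pow_iff_le_analyticOrderAt ha.deriv n).1 ?_
    refine (EventuallyEq.filter_mono ?_ nhdsWithin_le_nhds).trans_isBigO hI
    filter_upwards [hGev.self_of_nhds] with t ht
    rw [deriv_partial_left (app G _ (0, e) ht).differentiableAt]
    have hd : DifferentiableAt ℝ (fderiv ℝ G) (t, x₀) := ht.fderiv.differentiableAt
    have hs : IsSymmSndFDerivAt ℝ G (t, x₀) :=
      ContDiffAt.isSymmSndFDerivAt (n := 2) ht.contDiffAt (by simp)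
    rw [fderiv_clm_apply hd (differentiableAt_const _),
      fderiv_clm_apply hd (differentiableAt_const _)]
    simpa using hs.eq (1, 0) (0, e)

end Order

/-! ### Weights -/

section Weights

variable {s r : ℕ}

/-- The weights of the coordinates. -/
def wt : Coord s r → ℕ
  | .inl _ => 1
  | .inr (.inl _) => 0
  | .inr (.inr _) => 2

/-- At `t = 0` the convention `0 ^ 0 = 1` keeps the `ζ` coordinates, so `dilation 0` is the
projection onto the leaf `z = 0`, `Im w = 0`. -/
lemma dilation_apply (t : ℝ) (x : Coord s r → ℝ) (i : Coord s r) :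
    dilation t x i = t ^ wt i * x i := by
  rcases i with i | (i | i)
  · simp [dilation, wt]
  · simp [dilation, wt]
  · simp [dilation, wt]

/-- The dilation as a continuous linear map. -/
def dilationL (t : ℝ) : (Coord s r → ℝ) →L[ℝ] (Coord s r → ℝ) :=
  ContinuousLinearMap.pi fun i => (t ^ wt i) • ContinuousLinearMap.proj i

lemma dilationL_apply (t : ℝ) (x : Coord s r → ℝ) : dilationL t x = dilation t x := by
  funext i
  simp [dilationL, dilation_apply]

lemma dilation_single (t : ℝ) (i : Coord s r) :
    dilation t (Pi.single i 1) = t ^ wt i • (Pi.single i 1 : Coord s r → ℝ) := by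
  funext j
  rcases eq_or_ne j i with rfl | h <;> simp [dilation_apply, *]

lemma analyticAt_dilation (p : ℝ × (Coord s r → ℝ)) :
    AnalyticAt ℝ (fun p : ℝ × (Coord s r → ℝ) => dilation p.1 p.2) p := by
  refine ContDiffAt.analyticAt ?_
  refine contDiffAt_pi.2 fun i => ?_
  simp only [dilation_apply]
  exact (contDiffAt_fst.pow _).mul (contDiffAt_snd.comp p contDiffAt_id |> contDiffAt_pi.1 <| i)

@[simp] lemma dilation_zero (t : ℝ) : dilation t (0 : Coord s r → ℝ) = 0 := by
  rw [← dilationL_apply, map_zero]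

lemma tendsto_dilation : Tendsto (fun p : ℝ × (Coord s r → ℝ) => dilation p.1 p.2) (𝓝 (0, 0))
    (𝓝 0) := by
  have := (analyticAt_dilation ((0 : ℝ), (0 : Coord s r → ℝ))).continuousAt.tendsto
  simpa using this

/-- The inner neighborhood contains `t = 0`, so this also yields properties at the leaf points
`dilation 0 x`. -/
lemma eventually_dilation {P : (Coord s r → ℝ) → Prop} (hP : ∀ᶠ x in 𝓝 0, P x) :
    ∀ᶠ x in 𝓝 (0 : Coord s r → ℝ), ∀ᶠ t in 𝓝 (0 : ℝ), P (dilation t x) := by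
  have h := (tendsto_dilation.eventually hP).eventually_nhds
  have c : Tendsto (fun x : Coord s r → ℝ => ((0 : ℝ), x)) (𝓝 0) (𝓝 (0, 0)) :=
    (Continuous.prodMk_right (0 : ℝ)).tendsto 0
  filter_upwards [c.eventually h] with x hx
  have c' : Tendsto (fun t : ℝ => (t, x)) (𝓝 0) (𝓝 (0, x)) :=
    (Continuous.prodMk_left x).tendsto 0
  exact c'.eventually hx

/-- All terms of the power series of `f` at `0` have weighted degree at least `n`. -/
def Wt (n : ℕ) (f : (Coord s r → ℝ) → ℂ) : Prop :=
  ∀ᶠ x in 𝓝 0, (fun t : ℝ => f (dilation t x)) =O[𝓝[≠] 0] fun t => t ^ n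

variable {f g : (Coord s r → ℝ) → ℂ} {m n : ℕ} {i : Coord s r}

lemma Wt.congr (h : Wt n f) (e : f =ᶠ[𝓝 0] g) : Wt n g := by
  filter_upwards [h, eventually_dilation e] with x h1 h2
  refine (EventuallyEq.filter_mono ?_ nhdsWithin_le_nhds).trans_isBigO h1
  filter_upwards [h2] with t ht using ht.symm

lemma Wt.add (hf : Wt n f) (hg : Wt n g) : Wt n fun x => f x + g x := by
  filter_upwards [hf, hg] with x h1 h2 using h1.add h2

lemma Wt.sub (hf : Wt n f) (hg : Wt n g) : Wt n fun x => f x - g x := by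
  filter_upwards [hf, hg] with x h1 h2 using h1.sub h2

lemma Wt.neg (hf : Wt n f) : Wt n fun x => -f x := by
  filter_upwards [hf] with x h1 using h1.neg_left

lemma Wt.zero (n : ℕ) : Wt n fun _ : Coord s r → ℝ => 0 :=
  Eventually.of_forall fun _ => isBigO_zero _ _

lemma Wt.sum {κ : Type} (S : Finset κ) {f : κ → (Coord s r → ℝ) → ℂ}
    (hf : ∀ j ∈ S, Wt n (f j)) : Wt n fun x => ∑ j ∈ S, f j x := by
  classical
  induction S using Finset.induction_on with
  | empty => simpa using Wt.zero n
  | insert a S ha ih =>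
    simp only [Finset.sum_insert ha]
    exact (hf a (by simp)).add (ih fun j hj => hf j (by simp [hj]))

lemma Wt.mul (hf : Wt m f) (hg : Wt n g) : Wt (m + n) fun x => f x * g x := by
  filter_upwards [hf, hg] with x h1 h2
  simpa only [pow_add] using h1.mul h2

lemma Wt.conj (hf : Wt n f) : Wt n fun x => conj (f x) := by
  filter_upwards [hf] with x h1
  exact (IsBigO.of_norm_left (h1.norm_left.congr_left fun t => by simp))

lemma Wt.mono (hf : Wt n f) (h : m ≤ n) : Wt m f := by
  filter_upwards [hf] with x h1
  refine h1.trans (IsBigO.of_bound 1 ?_)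
  have : ∀ᶠ t : ℝ in 𝓝[≠] 0, ‖t‖ < 1 :=
    (continuous_norm.tendsto' (0 : ℝ) 0 (by simp)).eventually (gt_mem_nhds one_pos) |>.filter_mono
      nhdsWithin_le_nhds
  filter_upwards [this] with t ht
  rw [norm_pow, norm_pow, one_mul]
  exact pow_le_pow_of_le_one (norm_nonneg _) ht.le h

lemma Wt.of_analyticAt (hf : AnalyticAt ℝ f 0) : Wt 0 f := by
  filter_upwards [eventually_dilation hf.eventually_analyticAt] with x h1
  have h2 : ContinuousAt (fun t : ℝ => f (dilation t x)) 0 :=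
    (analyticAt_partial_left (G := fun p => f (dilation p.1 p.2))
      (AnalyticAt.fun_comp h1.self_of_nhds (analyticAt_dilation (0, x)))).continuousAt
  simpa using (h2.tendsto.mono_left nhdsWithin_le_nhds).isBigO_one ℝ

lemma Wt.mul_analyticAt (hf : Wt n f) (hg : AnalyticAt ℝ g 0) : Wt n fun x => f x * g x :=
  hf.mul (Wt.of_analyticAt hg)

lemma Wt.analyticAt_mul (hf : AnalyticAt ℝ f 0) (hg : Wt n g) : Wt n fun x => f x * g x := by
  simpa using (Wt.of_analyticAt hf).mul hg

/-- Functions of positive weight vanish on the leaf `z = 0`, `Im w = 0`. -/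
lemma Wt.eq_zero (h : Wt (n + 1) f) (hf : AnalyticAt ℝ f 0) :
    ∀ᶠ x in 𝓝 0, f (dilation 0 x) = 0 := by
  filter_upwards [h, eventually_dilation hf.eventually_analyticAt] with x h1 h2
  have h3 : ContinuousAt (fun t : ℝ => f (dilation t x)) 0 :=
    (analyticAt_partial_left (G := fun p => f (dilation p.1 p.2))
      (AnalyticAt.fun_comp h2.self_of_nhds (analyticAt_dilation (0, x)))).continuousAt
  have h4 : Tendsto (fun t : ℝ => t ^ (n + 1)) (𝓝[≠] 0) (𝓝 0) :=
    ((continuous_pow (n + 1)).tendsto' (0 : ℝ) 0 (by simp)).mono_left nhdsWithin_le_nhds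
  exact tendsto_nhds_unique (h3.tendsto.mono_left nhdsWithin_le_nhds) (h1.trans_tendsto h4)


/-- By the chain rule `∂_i (f ∘ δ_t) = t ^ wt i • (∂_i f) ∘ δ_t`. The left side keeps the order of
vanishing of `f ∘ δ_t` by `isBigO_fderiv_param`, and the factor `t ^ wt i` is divided out for `t ≠
0`. -/
lemma Wt.cderiv_single (h : Wt (n + wt i) f) (hf : AnalyticAt ℝ f 0) :
    Wt n fun x => cderiv f x (Pi.single i 1) := by
  filter_upwards [h.eventually_nhds, eventually_dilation hf.eventually_analyticAt] with x h1 h2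
  have hG : AnalyticAt ℝ (fun p : ℝ × (Coord s r → ℝ) => f (dilation p.1 p.2)) (0, x) :=
    AnalyticAt.fun_comp h2.self_of_nhds (analyticAt_dilation (0, x))
  have hO := isBigO_fderiv_param (Pi.single i 1) _ _ hG h1
  obtain ⟨C, hC⟩ := hO.bound
  refine IsBigO.of_bound C ?_
  filter_upwards [hC, h2.filter_mono nhdsWithin_le_nhds, self_mem_nhdsWithin] with t h3 h4 h5
  have hGt : AnalyticAt ℝ (fun p : ℝ × (Coord s r → ℝ) => f (dilation p.1 p.2)) (t, x) :=
    AnalyticAt.fun_comp h4 (analyticAt_dilation (t, x))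
  rw [← fderiv_partial_right hGt.differentiableAt] at h3
  have e : fderiv ℝ (fun y => f (dilation t y)) x (Pi.single i 1) =
      (t : ℂ) ^ wt i * cderiv f (dilation t x) (Pi.single i 1) := by
    have := cderiv_comp_clm f (dilationL t) (q := x)
      (by rw [dilationL_apply]; exact h4.differentiableAt) i
    simp only [dilationL_apply, dilation_single, map_smul, cderiv_ofReal_apply] at this
    rw [this, cderiv_ofReal_apply]
    simp
  simp only [e, norm_mul, norm_pow, Complex.norm_real] at h3
  have h5' : (0 : ℝ) < ‖t‖ ^ wt i := pow_pos (norm_pos_iff.2 h5) _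
  rw [pow_add] at h3
  rw [norm_pow]
  refine le_of_mul_le_mul_left (h3.trans (le_of_eq ?_)) h5'
  ring

lemma Wt.cderiv (h : Wt (n + m) f) (hf : AnalyticAt ℝ f 0) {v : Coord s r → ℂ}
    (hv : ∀ i, v i ≠ 0 → wt i ≤ m) : Wt n fun x => cderiv f x v := by
  have e : (fun x => CRSymbol.cderiv f x v) =
      fun x => ∑ i, v i * CRSymbol.cderiv f x (Pi.single i 1) := by
    funext x
    simp only [cderiv_ofReal_apply]
    simp [cderiv_apply, -Fintype.sum_sum_type]
  rw [e]
  refine Wt.sum _ fun i _ => ?_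
  by_cases hi : v i = 0
  · simpa [hi] using Wt.zero n
  · exact Wt.analyticAt_mul analyticAt_const
      (Wt.cderiv_single (h.mono (by have := hv i hi; omega)) hf)

lemma vecWt_holz (j : Fin s) (i : Coord s r) (h : hol (.inl j) i ≠ 0) : wt i = 1 := by
  rcases i with (i | i) | ((i | i) | i) <;> simp_all [hol, vecOf, wt]

lemma vecWt_holζ (α : Fin r) (i : Coord s r) (h : hol (.inr α) i ≠ 0) : wt i = 0 := by
  rcases i with (i | i) | ((i | i) | i) <;> simp_all [hol, vecOf, wt]

lemma vecWt_uvec (i : Coord s r) (h : uvec i ≠ 0) : wt i = 2 := by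
  rcases i with (i | i) | ((i | i) | i) <;> simp_all [uvec, vecOf, wt]

/-- The weights of the holomorphic coordinates. -/
def holWt : Fin s ⊕ Fin r → ℕ
  | .inl _ => 1
  | .inr _ => 0

lemma vecWt_hol (A : Fin s ⊕ Fin r) (i : Coord s r) (h : hol A i ≠ 0) : wt i = holWt A := by
  rcases A with j | α
  · exact vecWt_holz j i h
  · exact vecWt_holζ α i h

lemma vecWt_star_hol (A : Fin s ⊕ Fin r) (i : Coord s r) (h : star (hol A) i ≠ 0) :
    wt i = holWt A := vecWt_hol A i fun h' => h (by simp [h'])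

lemma Wt.hol (A : Fin s ⊕ Fin r) (h : Wt (n + holWt A) f) (hf : AnalyticAt ℝ f 0) :
    Wt n fun x => CRSymbol.cderiv f x (hol A) := h.cderiv hf fun i hi => (vecWt_hol A i hi).le

lemma Wt.star_hol (A : Fin s ⊕ Fin r) (h : Wt (n + holWt A) f) (hf : AnalyticAt ℝ f 0) :
    Wt n fun x => CRSymbol.cderiv f x (star (CRSymbol.hol A)) :=
  h.cderiv hf fun i hi => (vecWt_star_hol A i hi).le

lemma Wt.uvec (h : Wt (n + 2) f) (hf : AnalyticAt ℝ f 0) :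
    Wt n fun x => CRSymbol.cderiv f x uvec := h.cderiv hf fun i hi => (vecWt_uvec i hi).le

/-! ### Homogeneous functions -/

/-- `f` is weighted homogeneous of degree `n`. -/
def Homog (n : ℤ) (f : (Coord s r → ℝ) → ℂ) : Prop :=
  ∀ᶠ x in 𝓝 0, ∀ t ∈ Set.Ioc (0 : ℝ) 1, f (dilation t x) = (t : ℂ) ^ n * f x

lemma norm_dilation_le {t : ℝ} (h0 : 0 ≤ t) (h1 : t ≤ 1) (x : Coord s r → ℝ) :
    ‖dilation t x‖ ≤ ‖x‖ := by
  refine (pi_norm_le_iff_of_nonneg (norm_nonneg _)).2 fun i => ?_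
  rw [dilation_apply, norm_mul, norm_pow, Real.norm_of_nonneg h0]
  calc t ^ wt i * ‖x i‖ ≤ 1 * ‖x i‖ := by
        gcongr
        exact pow_le_one₀ h0 h1
    _ ≤ ‖x‖ := by rw [one_mul]; exact norm_le_pi_norm x i

/-- Dilations with `t ≤ 1` do not increase the sup norm, so balls are stable under them. For this
reason `Homog` only asks for `t` in `(0, 1]`. -/
lemma eventually_forall_dilation {P : (Coord s r → ℝ) → Prop} (hP : ∀ᶠ x in 𝓝 0, P x) :
    ∀ᶠ x in 𝓝 (0 : Coord s r → ℝ), ∀ t ∈ Set.Icc (0 : ℝ) 1, P (dilation t x) := by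
  obtain ⟨ε, hε, h⟩ := Metric.eventually_nhds_iff_ball.1 hP
  filter_upwards [Metric.ball_mem_nhds 0 hε] with x hx t ht
  refine h _ ?_
  rw [mem_ball_zero_iff] at hx ⊢
  exact (norm_dilation_le ht.1 ht.2 x).trans_lt hx

variable {a b : ℤ}

lemma Homog.mul (hf : Homog a f) (hg : Homog b g) : Homog (a + b) fun x => f x * g x := by
  filter_upwards [hf, hg] with x h1 h2 t ht
  rw [h1 t ht, h2 t ht, zpow_add₀ (by exact_mod_cast ht.1.ne')]
  ring

lemma Homog.add (hf : Homog a f) (hg : Homog a g) : Homog a fun x => f x + g x := by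
  filter_upwards [hf, hg] with x h1 h2 t ht
  rw [h1 t ht, h2 t ht, mul_add]

lemma Homog.sub (hf : Homog a f) (hg : Homog a g) : Homog a fun x => f x - g x := by
  filter_upwards [hf, hg] with x h1 h2 t ht
  rw [h1 t ht, h2 t ht, mul_sub]

lemma Homog.neg (hf : Homog a f) : Homog a fun x => -f x := by
  filter_upwards [hf] with x h1 t ht
  rw [h1 t ht, mul_neg]

lemma Homog.const (z : ℂ) : Homog 0 fun _ : Coord s r → ℝ => z :=
  Eventually.of_forall fun _ _ _ => by simp

lemma Homog.zero (a : ℤ) : Homog a fun _ : Coord s r → ℝ => 0 :=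
  Eventually.of_forall fun _ _ _ => by simp

lemma Homog.sum {κ : Type} (S : Finset κ) {f : κ → (Coord s r → ℝ) → ℂ}
    (hf : ∀ j ∈ S, Homog a (f j)) : Homog a fun x => ∑ j ∈ S, f j x := by
  classical
  induction S using Finset.induction_on with
  | empty => simpa using Homog.zero a
  | insert b S ha ih =>
    simp only [Finset.sum_insert ha]
    exact (hf b (by simp)).add (ih fun j hj => hf j (by simp [hj]))

lemma Homog.conj (hf : Homog a f) : Homog a fun x => conj (f x) := by
  filter_upwards [hf] with x h1 t ht
  rw [h1 t ht, map_mul, map_zpow₀, Complex.conj_ofReal]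

lemma Homog.inv (hf : Homog a f) : Homog (-a) fun x => (f x)⁻¹ := by
  filter_upwards [hf] with x h1 t ht
  rw [h1 t ht, mul_inv, zpow_neg]

/-- Unlike for `Wt`, all coordinates that occur in `v` must have exactly the weight `m`. Degrees are
integers so that this subtraction never truncates. -/
lemma Homog.cderiv (h : Homog a f) (hf : AnalyticAt ℝ f 0) {v : Coord s r → ℂ}
    (hv : ∀ i, v i ≠ 0 → wt i = m) : Homog (a - m) fun x => cderiv f x v := by
  filter_upwards [h.eventually_nhds, eventually_forall_dilation hf.eventually_analyticAt]
    with x h1 h2 t ht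
  have ht0 : (t : ℂ) ≠ 0 := by exact_mod_cast ht.1.ne'
  have key : ∀ i, v i * CRSymbol.cderiv f (dilation t x) (Pi.single i 1) =
      (t : ℂ) ^ (a - m) * (v i * CRSymbol.cderiv f x (Pi.single i 1)) := by
    intro i
    by_cases hi : v i = 0
    · simp [hi]
    have e1 := cderiv_comp_clm f (dilationL t) (q := x) (by
      rw [dilationL_apply]; exact (h2 t ⟨ht.1.le, ht.2⟩).differentiableAt) i
    simp only [dilationL_apply, dilation_single, map_smul, hv i hi] at e1
    rw [← cderiv_ofReal_apply] at e1
    have e2 : (fun y => f (dilation t y)) =ᶠ[𝓝 x] fun y => (t : ℂ) ^ a * f y := by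
      filter_upwards [h1] with y hy using hy t ht
    have hfx : DifferentiableAt ℝ f x := by
      have := h2 1 ⟨zero_le_one, le_rfl⟩
      have h1x : dilation 1 x = x := by funext i; simp [dilation_apply]
      rw [h1x] at this
      exact this.differentiableAt
    rw [cderiv_congr e2, cderiv_mul (differentiableAt_const _) hfx, cderiv_const, zero_mul,
      zero_add] at e1
    rw [zpow_sub₀ ht0, zpow_natCast]
    have e3 : (t ^ m : ℝ) • CRSymbol.cderiv f (dilation t x) (Pi.single i 1) =
        (t : ℂ) ^ m * CRSymbol.cderiv f (dilation t x) (Pi.single i 1) := by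
      rw [Complex.real_smul]
      push_cast
      rfl
    rw [e3] at e1
    field_simp
    linear_combination -e1
  have e : ∀ y, CRSymbol.cderiv f y v = ∑ i, v i * CRSymbol.cderiv f y (Pi.single i 1) := by
    intro y
    simp only [cderiv_ofReal_apply]
    simp [cderiv_apply, -Fintype.sum_sum_type]
  rw [e, e, Finset.mul_sum]
  exact Finset.sum_congr rfl fun i _ => key i

/-- A homogeneous function of higher weight than its degree vanishes. -/
lemma Homog.eq_zero (h : Homog n f) (hw : Wt (n + 1) f) : ∀ᶠ x in 𝓝 0, f x = 0 := by
  filter_upwards [h, hw] with x h1 h2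
  obtain ⟨C, hC⟩ := h2.bound
  have hC' := hC.filter_mono (nhdsGT_le_nhdsNE (0 : ℝ))
  -- Homogeneity gives `t ^ n * ‖f x‖ = ‖f (dilation t x)‖`, which is bounded by `C * t ^ (n + 1)`.
  have h3 : ∀ᶠ t : ℝ in 𝓝[>] 0, ‖f x‖ ≤ C * t := by
    filter_upwards [hC', Ioc_mem_nhdsGT (one_pos : (0 : ℝ) < 1)] with t h4 h5
    have h6 : (0 : ℝ) < t ^ n := pow_pos h5.1 n
    rw [h1 t h5, zpow_natCast, norm_mul, norm_pow, norm_pow, Complex.norm_real,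
      Real.norm_of_nonneg h5.1.le, pow_succ] at h4
    refine le_of_mul_le_mul_left (h4.trans (le_of_eq ?_)) h6
    ring
  have h4 : Tendsto (fun t : ℝ => C * t) (𝓝[>] 0) (𝓝 0) :=
    ((continuous_const.mul continuous_id).tendsto' (0 : ℝ) 0 (by simp)).mono_left
      nhdsWithin_le_nhds
  exact norm_le_zero_iff.1 (ge_of_tendsto h4 h3)

lemma WeightedOrderGtTwo.wt {Q : (Coord s r → ℝ) → ℝ} (h : WeightedOrderGtTwo Q) :
    Wt 3 fun x => (Q x : ℂ) := by
  filter_upwards [h] with x h1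
  exact IsBigO.of_norm_left
    ((h1.mono nhdsWithin_le_nhds).norm_left.congr_left fun t => by simp)

end Weights

/-! ### The CR structure of a graph -/

section GraphStructure

variable {s r : ℕ}

/-- The coefficients `F_A / (i - F_u)` of the CR structure of the graph of `F`. -/
def graphC (F : (Coord s r → ℝ) → ℝ) (x : Coord s r → ℝ) (A : Fin s ⊕ Fin r) : ℂ :=
  cderiv (fun y => (F y : ℂ)) x (hol A) * (Complex.I - cderiv (fun y => (F y : ℂ)) x uvec)⁻¹

lemma analyticAt_ofReal {F : (Coord s r → ℝ) → ℝ} {x : Coord s r → ℝ} (hF : AnalyticAt ℝ F x) :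
    AnalyticAt ℝ (fun y => (F y : ℂ)) x :=
  (Complex.ofRealCLM.analyticAt _).comp hF

lemma cderiv_ofReal_star (F : (Coord s r → ℝ) → ℝ) (x : Coord s r → ℝ) (v : Coord s r → ℂ) :
    cderiv (fun y => (F y : ℂ)) x (star v) = conj (cderiv (fun y => (F y : ℂ)) x v) := by
  have := cderiv_conj (fun y => (F y : ℂ)) x (star v)
  simpa using this

lemma star_uvec : star (uvec : Coord s r → ℂ) = uvec := by
  rw [uvec, star_vecOf]
  simp

/-- `F` is real valued and `∂_u` is a real direction, so the denominator has imaginary part 1. -/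
lemma graph_denom_ne_zero (F : (Coord s r → ℝ) → ℝ) (x : Coord s r → ℝ) :
    Complex.I - cderiv (fun y => (F y : ℂ)) x uvec ≠ 0 := by
  have h := cderiv_ofReal_star F x uvec
  rw [star_uvec] at h
  have h2 : (cderiv (fun y => (F y : ℂ)) x uvec).im = 0 := Complex.conj_eq_iff_im.1 h.symm
  intro h0
  have := congrArg Complex.im h0
  simp [h2] at this

lemma analyticAt_graphC {F : (Coord s r → ℝ) → ℝ} {x : Coord s r → ℝ} (hF : AnalyticAt ℝ F x)
    (A) : AnalyticAt ℝ (fun y => graphC F y A) x :=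
  (analyticAt_cderiv (analyticAt_ofReal hF) _).mul
    ((analyticAt_const.sub (analyticAt_cderiv (analyticAt_ofReal hF) _)).inv
      (graph_denom_ne_zero F x))

lemma cderiv_linear (l : (Coord s r → ℂ) →ₗ[ℂ] ℂ) (x : Coord s r → ℝ) (v : Coord s r → ℂ) :
    cderiv (fun y : Coord s r → ℝ => l fun i => (y i : ℂ)) x v = l v := by
  have hd : DifferentiableAt ℝ (fun (y : Coord s r → ℝ) (i : Coord s r) => (y i : ℂ)) x :=
    differentiableAt_pi.2 fun i => (Complex.ofRealCLM.differentiableAt).comp x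
      (differentiableAt_apply i x)
  rw [← map_cderiv l hd]
  congr 1
  funext i
  rw [cderiv_pi_apply hd]
  have h : fderiv ℝ (fun y : Coord s r → ℝ => (y i : ℂ)) x =
      Complex.ofRealCLM.comp (ContinuousLinearMap.proj i) :=
    (Complex.ofRealCLM.comp (ContinuousLinearMap.proj (R := ℝ) (φ := fun _ => ℝ) i)).fderiv
  rw [cderiv_apply, h, Finset.sum_eq_single i]
  · simp
  · intro j _ hj
    simp [hj.symm]
  · simp

lemma zCoord_eq (x : Coord s r → ℝ) (j : Fin s) :
    zCoord x j = dz (.inl j) fun i => (x i : ℂ) := by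
  apply Complex.ext <;> simp [zCoord, dz, reIx, imIx]

lemma ζCoord_eq (x : Coord s r → ℝ) (α : Fin r) :
    ζCoord x α = dz (.inr α) fun i => (x i : ℂ) := by
  apply Complex.ext <;> simp [ζCoord, dz, reIx, imIx]

lemma star_ofReal_vec (x : Coord s r → ℝ) :
    star (fun i => (x i : ℂ)) = fun i => (x i : ℂ) := by
  funext i
  simp

lemma conj_zCoord_eq (x : Coord s r → ℝ) (j : Fin s) :
    conj (zCoord x j) = dzb (.inl j) fun i => (x i : ℂ) := by
  rw [zCoord_eq, ← dzb_star, star_ofReal_vec]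

lemma conj_ζCoord_eq (x : Coord s r → ℝ) (α : Fin r) :
    conj (ζCoord x α) = dzb (.inr α) fun i => (x i : ℂ) := by
  rw [ζCoord_eq, ← dzb_star, star_ofReal_vec]

lemma conj_w_eq (F : (Coord s r → ℝ) → ℝ) (x : Coord s r → ℝ) :
    conj (graphEmbedding F x (.inl ())) =
      (F x : ℂ) - Complex.I * du (s := s) (r := r) fun i => (x i : ℂ) := by
  apply Complex.ext <;> simp [graphEmbedding, imW, du]

lemma contDiff_linear_ofReal (l : (Coord s r → ℂ) →ₗ[ℂ] ℂ) {n : ℕ∞ω} :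
    ContDiff ℝ n fun y : Coord s r → ℝ => l fun i => (y i : ℂ) := by
  refine contDiff_iff_contDiffAt.2 fun x => contDiffAt_linear l ?_
  exact contDiffAt_pi.2 fun i => Complex.ofRealCLM.contDiff.contDiffAt.comp x
    (contDiff_apply ℝ ℝ i).contDiffAt

lemma cderiv_conj_w {F : (Coord s r → ℝ) → ℝ} {x : Coord s r → ℝ} (hF : AnalyticAt ℝ F x)
    (v : Coord s r → ℂ) :
    cderiv (fun y => conj (graphEmbedding F y (.inl ()))) x v =
      cderiv (fun y => (F y : ℂ)) x v - Complex.I * du v := by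
  have hl : DifferentiableAt ℝ (fun y : Coord s r → ℝ =>
      du (s := s) (r := r) fun i => (y i : ℂ)) x :=
    (contDiff_linear_ofReal (n := 1) du).contDiffAt.differentiableAt (by simp)
  simp only [conj_w_eq]
  rw [cderiv_sub (analyticAt_ofReal hF).differentiableAt ((differentiableAt_const _).fun_mul hl),
    cderiv_mul (differentiableAt_const _) hl, cderiv_const, cderiv_linear]
  ring

lemma contDiffAt_conj_w {F : (Coord s r → ℝ) → ℝ} {x : Coord s r → ℝ} (hF : AnalyticAt ℝ F x)
    {n : ℕ∞ω} : ContDiffAt ℝ n (fun y => conj (graphEmbedding F y (.inl ()))) x := by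
  simp only [conj_w_eq]
  exact (analyticAt_ofReal hF).contDiffAt.sub
    (contDiffAt_const.mul (contDiff_linear_ofReal _).contDiffAt)

lemma mem_graphCR_iff {F : (Coord s r → ℝ) → ℝ} {x : Coord s r → ℝ} (hF : AnalyticAt ℝ F x)
    (v : Coord s r → ℂ) :
    v ∈ graphCR F x ↔ (∀ A, dzb A v = 0) ∧ cderiv (fun y => (F y : ℂ)) x v = Complex.I * du v := by
  have hd : DifferentiableAt ℝ (fun y j => conj (graphEmbedding F y j)) x := by
    refine differentiableAt_pi.2 fun j => ?_
    rcases j with u | j | α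
    · exact (contDiffAt_conj_w hF (n := 1)).differentiableAt (by simp)
    · simp only [graphEmbedding, conj_zCoord_eq]
      exact (contDiff_linear_ofReal (n := 1) _).contDiffAt.differentiableAt (by simp)
    · simp only [graphEmbedding, conj_ζCoord_eq]
      exact (contDiff_linear_ofReal (n := 1) _).contDiffAt.differentiableAt (by simp)
  rw [graphCR, crStructure, LinearMap.mem_ker, funext_iff]
  simp only [cderiv_pi_apply hd, Pi.zero_apply]
  have hz : ∀ j, cderiv (fun y => conj (graphEmbedding F y (.inr (.inl j)))) x v =
      dzb (.inl j) v := fun j => by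
    simp only [graphEmbedding, conj_zCoord_eq, cderiv_linear]
  have hζ : ∀ α, cderiv (fun y => conj (graphEmbedding F y (.inr (.inr α)))) x v =
      dzb (.inr α) v := fun α => by
    simp only [graphEmbedding, conj_ζCoord_eq, cderiv_linear]
  constructor
  · intro h
    refine ⟨fun A => ?_, ?_⟩
    · rcases A with j | α
      · rw [← hz]; exact h _
      · rw [← hζ]; exact h _
    · have := h (.inl ())
      rw [cderiv_conj_w hF] at this
      linear_combination this
  · rintro ⟨h1, h2⟩ (u | j | α)
    · rw [cderiv_conj_w hF, h2, sub_self]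
    · rw [hz, h1]
    · rw [hζ, h1]

lemma mem_graphCR_iff_theta {F : (Coord s r → ℝ) → ℝ} {x : Coord s r → ℝ}
    (hF : AnalyticAt ℝ F x) (v : Coord s r → ℂ) :
    v ∈ graphCR F x ↔ (∀ A, dzb A v = 0) ∧ theta (graphC F x) v = 0 := by
  rw [mem_graphCR_iff hF]
  refine and_congr_right fun hv => ?_
  have hne := graph_denom_ne_zero F x
  rw [apply_eq_components (cderiv (fun y => (F y : ℂ)) x) v, theta_apply]
  simp only [hv, zero_mul, mul_zero, Finset.sum_const_zero, add_zero, sub_zero, smul_eq_mul]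
  have e : ∑ A, graphC F x A * dz A v = (∑ A, dz A v * cderiv (fun y => (F y : ℂ)) x (hol A)) *
      (Complex.I - cderiv (fun y => (F y : ℂ)) x uvec)⁻¹ := by
    rw [Finset.sum_mul]
    exact Finset.sum_congr rfl fun A _ => by rw [graphC]; ring
  rw [e]
  constructor
  · intro h
    rw [sub_eq_zero, eq_mul_inv_iff_mul_eq₀ hne]
    linear_combination -h
  · intro h
    rw [sub_eq_zero, eq_mul_inv_iff_mul_eq₀ hne] at h
    linear_combination -h

/-- The fields `L_A` annihilate the conjugate coordinates, hence so do their brackets, which are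
therefore again of type `(1,0)`. But a bracket of two `L_A` has only a `∂_u` component, and a
`(1,0)` vector without `dz` components is zero. This is the symmetry of `L_A c_B`. -/
lemma isCRAt_graphCR {F : (Coord s r → ℝ) → ℝ} {x : Coord s r → ℝ} (hF : AnalyticAt ℝ F x) :
    IsCRAt (graphCR F) (graphC F) x := by
  filter_upwards [hF.eventually_analyticAt.eventually_nhds] with x hx
  have hF := hx.self_of_nhds
  refine ⟨mem_graphCR_iff_theta hF, analyticAt_graphC hF, fun A B => ?_⟩
  set L : Fin s ⊕ Fin r → (Coord s r → ℝ) → Coord s r → ℂ :=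
    fun A y => crVec (graphC F y) (Pi.single A 1) with hL
  have hLd : ∀ A, DifferentiableAt ℝ (L A) x := by
    intro A
    refine (contDiffAt_vecOf (q := x) (a := fun _ => Pi.single A 1) (b := fun _ => 0) (n := 1)
      (fun _ => contDiffAt_const) (fun _ => contDiffAt_const)
      ?_).differentiableAt (by simp)
    exact ContDiffAt.sum fun B _ => (analyticAt_graphC hF B).contDiffAt.mul contDiffAt_const
  have hann : ∀ A, (fun y => cderiv (fun y => conj (graphEmbedding F y (.inl ()))) y (L A y))
      =ᶠ[𝓝 x] fun _ => 0 := by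
    intro A
    filter_upwards [hx] with y hy
    have : L A y ∈ graphCR F y := by
      rw [mem_graphCR_iff_theta hy]
      simp [hL]
    rw [cderiv_conj_w hy, ((mem_graphCR_iff hy _).1 this).2, sub_self]
  have hb := cderiv_bracket (contDiffAt_conj_w hF) (hLd A) (hLd B)
  rw [cderiv_congr (hann A), cderiv_congr (hann B), cderiv_const, cderiv_const, sub_zero,
    cderiv_conj_w hF, sub_eq_zero] at hb
  have hz : ∀ C, dz C (bracket (L A) (L B) x) = 0 := by
    intro C
    rw [map_bracket _ (hLd A) (hLd B)]
    simp only [hL, dz_crVec, cderiv_const, sub_zero]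
  have hzb : ∀ C, dzb C (bracket (L A) (L B) x) = 0 := by
    intro C
    rw [map_bracket _ (hLd A) (hLd B)]
    simp only [hL, dzb_crVec, cderiv_const, sub_zero]
  have hth := ((mem_graphCR_iff_theta hF _).1 ((mem_graphCR_iff hF _).2 ⟨hzb, hb⟩)).2
  rw [theta_apply] at hth
  simp only [hz, hzb, mul_zero, Finset.sum_const_zero, sub_zero] at hth
  rw [map_bracket _ (hLd A) (hLd B)] at hth
  simp only [hL, du_crVec] at hth
  have e : ∀ C, (fun y => ∑ D, graphC F y D * (Pi.single C 1 : Fin s ⊕ Fin r → ℂ) D) =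
      fun y => graphC F y C := by
    intro C
    funext y
    simp [Pi.single_apply, -Fintype.sum_sum_type]
  rw [e, e] at hth
  linear_combination hth

end GraphStructure

/-! ### Inverse matrices -/

section Inverse

variable {E : Type} [NormedAddCommGroup E] [NormedSpace ℝ E] {n : ℕ∞ω} {m : ℕ}

lemma contDiffAt_det {M : E → Matrix (Fin m) (Fin m) ℂ} {x : E}
    (hM : ∀ i j, ContDiffAt ℝ n (fun y => M y i j) x) :
    ContDiffAt ℝ n (fun y => (M y).det) x := by
  simp only [Matrix.det_apply]
  refine ContDiffAt.sum fun σ _ => ?_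
  exact (contDiffAt_prod fun i _ => hM _ _).const_smul _

/-- Cramer's rule. The smoothness exponent is arbitrary so that `ω` gives analyticity. -/
lemma contDiffAt_matrix_inv {M : E → Matrix (Fin m) (Fin m) ℂ} {x : E}
    (hM : ∀ i j, ContDiffAt ℝ n (fun y => M y i j) x) (hdet : (M x).det ≠ 0) (i j : Fin m) :
    ContDiffAt ℝ n (fun y => (M y)⁻¹ i j) x := by
  simp only [Matrix.inv_def, Matrix.smul_apply, Ring.inverse_eq_inv', smul_eq_mul,
    Matrix.adjugate_apply]
  refine ((contDiffAt_det hM).inv hdet).mul (contDiffAt_det fun k l => ?_)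
  by_cases h : k = j
  · subst h
    simp only [Matrix.updateRow_self]
    exact contDiffAt_const
  · simp only [Matrix.updateRow_ne h]
    exact hM k l

lemma eventually_det_ne_zero {M : E → Matrix (Fin m) (Fin m) ℂ} {x : E}
    (hM : ∀ i j, ContDiffAt ℝ n (fun y => M y i j) x) (hdet : (M x).det ≠ 0) :
    ∀ᶠ y in 𝓝 x, (M y).det ≠ 0 :=
  (contDiffAt_det hM).continuousAt.eventually_ne hdet

end Inverse

/-! ### Weight estimates for the Levi form -/

section LeviWeights

variable {s r : ℕ} {c c' : (Coord s r → ℝ) → Fin s ⊕ Fin r → ℂ}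

lemma crVec_single (c : Fin s ⊕ Fin r → ℂ) (A) :
    crVec c (Pi.single A 1) = hol A + c A • uvec := by
  refine vec_ext (fun B => ?_) (fun B => ?_) ?_ <;>
    simp [hol, uvec, Pi.single_apply, -Fintype.sum_sum_type]

lemma lev_eq (c : (Coord s r → ℝ) → Fin s ⊕ Fin r → ℂ) (x : Coord s r → ℝ) (A B) :
    lev c x A B = cderiv (fun y => conj (c y B)) x (hol A) +
      c x A * cderiv (fun y => conj (c y B)) x uvec -
      (cderiv (fun y => c y A) x (star (hol B)) +
        conj (c x B) * cderiv (fun y => c y A) x uvec) := by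
  simp only [lev, crVec_single, map_add, map_smul, star_add, star_smul, star_uvec, smul_eq_mul]
  rfl

lemma analyticAt_conj {f : (Coord s r → ℝ) → ℂ} {x : Coord s r → ℝ} (hf : AnalyticAt ℝ f x) :
    AnalyticAt ℝ (fun y => conj (f y)) x :=
  ((Complex.conjCLE : ℂ →L[ℝ] ℂ).analyticAt _).comp hf

lemma analyticAt_lev {x : Coord s r → ℝ} (hc : ∀ A, AnalyticAt ℝ (fun y => c y A) x) (A B) :
    AnalyticAt ℝ (fun y => lev c y A B) x := by
  simp only [lev_eq]
  have h1 := analyticAt_conj (hc B)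
  exact ((analyticAt_cderiv h1 _).add ((hc A).mul (analyticAt_cderiv h1 _))).sub
    ((analyticAt_cderiv (hc A) _).add (h1.mul (analyticAt_cderiv (hc A) _)))

/-- The block of the Levi form along `z`. -/
def levZ (c : (Coord s r → ℝ) → Fin s ⊕ Fin r → ℂ) (x : Coord s r → ℝ) :
    Matrix (Fin s) (Fin s) ℂ := Matrix.of fun i j => lev c x (.inl i) (.inl j)

/-- The solution of the first block of equations for the Levi kernel. -/
def levK (c : (Coord s r → ℝ) → Fin s ⊕ Fin r → ℂ) (x : Coord s r → ℝ) (α : Fin r)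
    (j : Fin s) : ℂ := -∑ i, lev c x (.inr α) (.inl i) * (levZ c x)⁻¹ i j

lemma holWt_le (A : Fin s ⊕ Fin r) : holWt A ≤ 1 := by
  rcases A with j | α <;> simp [holWt]

/-- The function `c_A` has weight `2 - wt A`, and differentiating along the other index costs the
weight of that index. The terms with `∂_u` lose nothing that matters: even the undifferentiated
factor alone has enough weight. Since `holWt ≤ 1`, the natural subtractions do not truncate. -/
lemma wt_lev (hc : ∀ A, AnalyticAt ℝ (fun y => c y A) 0)
    (hw : ∀ A, Wt (2 - holWt A) fun y => c y A) (A B) :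
    Wt (2 - holWt A - holWt B) fun y => lev c y A B := by
  have hA := holWt_le A
  have hB := holWt_le B
  simp only [lev_eq]
  have h1 := analyticAt_conj (hc B)
  refine Wt.sub (Wt.add ?_ ?_) (Wt.add ?_ ?_)
  · exact Wt.hol A ((hw B).conj.mono (by omega)) h1
  · exact ((hw A).mul_analyticAt (analyticAt_cderiv h1 _)).mono (by omega)
  · exact Wt.star_hol B ((hw A).mono (by omega)) (hc A)
  · exact ((hw B).conj.mul_analyticAt (analyticAt_cderiv (hc A) _)).mono (by omega)

/-- Each product is compared by changing one factor at a time. The weight gained by the difference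
of the `c` survives even `∂_u`: there `3 - wt B` drops to `1 - wt B`, and the other factor
contributes `2 - wt A`. -/
lemma wt_lev_sub (hc : ∀ A, AnalyticAt ℝ (fun y => c y A) 0)
    (hc' : ∀ A, AnalyticAt ℝ (fun y => c' y A) 0)
    (hw' : ∀ A, Wt (2 - holWt A) fun y => c' y A)
    (hw : ∀ A, Wt (3 - holWt A) fun y => c y A - c' y A) (A B) :
    Wt (3 - holWt A - holWt B) fun y => lev c y A B - lev c' y A B := by
  have hA := holWt_le A
  have hB := holWt_le B
  have h1 := analyticAt_conj (hc B)
  have h1' := analyticAt_conj (hc' B)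
  have hs : ∀ (f g : (Coord s r → ℝ) → ℂ), AnalyticAt ℝ f 0 → AnalyticAt ℝ g 0 →
      ∀ v, (fun y => cderiv (fun z => f z - g z) y v) =ᶠ[𝓝 0]
        fun y => cderiv f y v - cderiv g y v := by
    intro f g hf hg v
    filter_upwards [hf.eventually_analyticAt, hg.eventually_analyticAt] with y h2 h3
    exact cderiv_sub h2.differentiableAt h3.differentiableAt v
  have hwb : Wt (3 - holWt B) fun y => conj (c y B) - conj (c' y B) := by
    simpa only [map_sub] using (hw B).conj
  have hcs := (hc A).sub (hc' A)
  have hbs := h1.sub h1'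
  have e : (fun y => lev c y A B - lev c' y A B) = fun y =>
      (cderiv (fun y => conj (c y B)) y (hol A) - cderiv (fun y => conj (c' y B)) y (hol A)) +
      ((c y A - c' y A) * cderiv (fun y => conj (c y B)) y uvec +
        c' y A * (cderiv (fun y => conj (c y B)) y uvec -
          cderiv (fun y => conj (c' y B)) y uvec)) -
      ((cderiv (fun y => c y A) y (star (hol B)) - cderiv (fun y => c' y A) y (star (hol B))) +
      ((conj (c y B) - conj (c' y B)) * cderiv (fun y => c y A) y uvec +
        conj (c' y B) * (cderiv (fun y => c y A) y uvec - cderiv (fun y => c' y A) y uvec))) := by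
    funext y
    simp only [lev_eq]
    ring
  rw [e]
  refine Wt.sub (Wt.add ?_ (Wt.add ?_ ?_)) (Wt.add ?_ (Wt.add ?_ ?_))
  · exact (Wt.hol A (hwb.mono (by omega)) hbs).congr (hs _ _ h1 h1' _)
  · exact ((hw A).mul_analyticAt (analyticAt_cderiv h1 _)).mono (by omega)
  · exact ((hw' A).mul ((Wt.uvec (n := 1 - holWt B) (hwb.mono (by omega)) hbs).congr
      (hs _ _ h1 h1' _))).mono (by omega)
  · exact (Wt.star_hol B ((hw A).mono (by omega)) hcs).congr (hs _ _ (hc A) (hc' A) _)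
  · exact (hwb.mul_analyticAt (analyticAt_cderiv (hc A) _)).mono (by omega)
  · exact ((hw' B).conj.mul ((Wt.uvec (n := 1 - holWt A) ((hw A).mono (by omega)) hcs).congr
      (hs _ _ (hc A) (hc' A) _))).mono (by omega)

lemma analyticAt_levInv {x : Coord s r → ℝ} (hc : ∀ A, AnalyticAt ℝ (fun y => c y A) x)
    (hd : (levZ c x).det ≠ 0) (i j) : AnalyticAt ℝ (fun y => (levZ c y)⁻¹ i j) x :=
  (contDiffAt_matrix_inv (n := ω) (fun _ _ => (analyticAt_lev hc _ _).contDiffAt) hd i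
    j).analyticAt

lemma analyticAt_levK {x : Coord s r → ℝ} (hc : ∀ A, AnalyticAt ℝ (fun y => c y A) x)
    (hd : (levZ c x).det ≠ 0) (α j) : AnalyticAt ℝ (fun y => levK c y α j) x :=
  (Finset.analyticAt_fun_sum _ fun i _ =>
    (analyticAt_lev hc _ _).mul (analyticAt_levInv hc hd i j)).neg

lemma analyticAt_schur {x : Coord s r → ℝ} (hc : ∀ A, AnalyticAt ℝ (fun y => c y A) x)
    (hd : (levZ c x).det ≠ 0) (α β) : AnalyticAt ℝ (fun y => schur c (levK c) y α β) x :=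
  (analyticAt_lev hc _ _).add (Finset.analyticAt_fun_sum _ fun j _ =>
    (analyticAt_levK hc hd α j).mul (analyticAt_lev hc _ _))

lemma eventually_levZ_det (hc : ∀ A, AnalyticAt ℝ (fun y => c y A) 0)
    (hd : (levZ c 0).det ≠ 0) : ∀ᶠ x in 𝓝 0, (levZ c x).det ≠ 0 :=
  eventually_det_ne_zero (n := ω) (fun _ _ => (analyticAt_lev hc _ _).contDiffAt) hd

lemma solvesKernel_levK {x : Coord s r → ℝ} (hd : (levZ c x).det ≠ 0) :
    SolvesKernel c (levK c) x :=
  ⟨(levZ c x)⁻¹, Matrix.mul_nonsing_inv _ (isUnit_iff_ne_zero.2 hd), fun _ _ => rfl⟩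

lemma wt_levK (hc : ∀ A, AnalyticAt ℝ (fun y => c y A) 0)
    (hw : ∀ A, Wt (2 - holWt A) fun y => c y A) (hd : (levZ c 0).det ≠ 0) (α j) :
    Wt 1 fun y => levK c y α j :=
  (Wt.sum _ fun i _ => (wt_lev hc hw (.inr α) (.inl i)).mul_analyticAt
    (analyticAt_levInv hc hd i j)).neg

/-- Resolvent identity `X⁻¹ - Y⁻¹ = -X⁻¹ (X - Y) Y⁻¹`, in which the difference of the two `z`-blocks
has weight `3 - 1 - 1`. -/
lemma wt_levInv_sub (hc : ∀ A, AnalyticAt ℝ (fun y => c y A) 0)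
    (hc' : ∀ A, AnalyticAt ℝ (fun y => c' y A) 0)
    (hw' : ∀ A, Wt (2 - holWt A) fun y => c' y A)
    (hw : ∀ A, Wt (3 - holWt A) fun y => c y A - c' y A)
    (hd : (levZ c 0).det ≠ 0) (hd' : (levZ c' 0).det ≠ 0) (i j) :
    Wt 1 fun y => (levZ c y)⁻¹ i j - (levZ c' y)⁻¹ i j := by
  have h : Wt 1 fun y => -∑ l, (∑ k, (levZ c y)⁻¹ i k *
      (lev c y (.inl k) (.inl l) - lev c' y (.inl k) (.inl l))) * (levZ c' y)⁻¹ l j := by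
    refine (Wt.sum _ fun l _ => Wt.mul_analyticAt (Wt.sum _ fun k _ => ?_)
      (analyticAt_levInv hc' hd' l j)).neg
    exact Wt.analyticAt_mul (analyticAt_levInv hc hd i k)
      (wt_lev_sub hc hc' hw' hw (.inl k) (.inl l))
  refine h.congr ?_
  filter_upwards [eventually_levZ_det hc hd, eventually_levZ_det hc' hd'] with y h1 h2
  have e : -((levZ c y)⁻¹ * (levZ c y - levZ c' y) * (levZ c' y)⁻¹) =
      (levZ c y)⁻¹ - (levZ c' y)⁻¹ := by
    rw [Matrix.mul_sub, Matrix.sub_mul, Matrix.nonsing_inv_mul _ (isUnit_iff_ne_zero.2 h1),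
      Matrix.mul_assoc, Matrix.mul_nonsing_inv _ (isUnit_iff_ne_zero.2 h2)]
    simp
  have := congrFun (congrFun e i) j
  simpa [Matrix.mul_apply, levZ] using this

/-- The mixed Levi block has weight 1 and changes by weight 2, while the inverse block has weight 0
and changes by weight 1. Weight 2 is what makes the `z` and `z̄` derivatives of `k` agree on the
leaf. -/
lemma wt_levK_sub (hc : ∀ A, AnalyticAt ℝ (fun y => c y A) 0)
    (hc' : ∀ A, AnalyticAt ℝ (fun y => c' y A) 0)
    (hw' : ∀ A, Wt (2 - holWt A) fun y => c' y A)
    (hw : ∀ A, Wt (3 - holWt A) fun y => c y A - c' y A)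
    (hd : (levZ c 0).det ≠ 0) (hd' : (levZ c' 0).det ≠ 0) (α j) :
    Wt 2 fun y => levK c y α j - levK c' y α j := by
  have e : (fun y => levK c y α j - levK c' y α j) = fun y => -∑ i,
      ((lev c y (.inr α) (.inl i) - lev c' y (.inr α) (.inl i)) * (levZ c y)⁻¹ i j +
        lev c' y (.inr α) (.inl i) * ((levZ c y)⁻¹ i j - (levZ c' y)⁻¹ i j)) := by
    funext y
    simp only [levK, mul_sub, sub_mul, Finset.sum_add_distrib, Finset.sum_sub_distrib]
    ring
  rw [e]
  refine (Wt.sum _ fun i _ => Wt.add ?_ ?_).neg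
  · exact (wt_lev_sub hc hc' hw' hw (.inr α) (.inl i)).mul_analyticAt (analyticAt_levInv hc hd i j)
  · exact (wt_lev hc' hw' (.inr α) (.inl i)).mul (wt_levInv_sub hc hc' hw' hw hd hd' i j)

lemma wt_schur (hc : ∀ A, AnalyticAt ℝ (fun y => c y A) 0)
    (hw : ∀ A, Wt (2 - holWt A) fun y => c y A) (hd : (levZ c 0).det ≠ 0) (α β) :
    Wt 2 fun y => schur c (levK c) y α β :=
  (wt_lev hc hw (.inr α) (.inr β)).add (Wt.sum _ fun j _ =>
    (wt_levK hc hw hd α j).mul (wt_lev hc hw (.inl j) (.inr β)))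

/-- One weight more than `wt_schur` gives. This excess is what eliminates the homogeneous Schur
complement of the model. -/
lemma wt_schur_sub (hc : ∀ A, AnalyticAt ℝ (fun y => c y A) 0)
    (hc' : ∀ A, AnalyticAt ℝ (fun y => c' y A) 0)
    (hw' : ∀ A, Wt (2 - holWt A) fun y => c' y A)
    (hw : ∀ A, Wt (3 - holWt A) fun y => c y A - c' y A)
    (hd : (levZ c 0).det ≠ 0) (hd' : (levZ c' 0).det ≠ 0) (α β) :
    Wt 3 fun y => schur c (levK c) y α β - schur c' (levK c') y α β := by
  have hwc : ∀ A, Wt (2 - holWt A) fun y => c y A := fun A => by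
    have := ((hw A).mono (m := 2 - holWt A) (by omega)).add (hw' A)
    simpa using this
  have e : (fun y => schur c (levK c) y α β - schur c' (levK c') y α β) = fun y =>
      (lev c y (.inr α) (.inr β) - lev c' y (.inr α) (.inr β)) + ∑ j,
      ((levK c y α j - levK c' y α j) * lev c y (.inl j) (.inr β) +
        levK c' y α j * (lev c y (.inl j) (.inr β) - lev c' y (.inl j) (.inr β))) := by
    funext y
    simp only [schur, mul_sub, sub_mul, Finset.sum_add_distrib, Finset.sum_sub_distrib]
    ring
  rw [e]
  refine (wt_lev_sub hc hc' hw' hw (.inr α) (.inr β)).add (Wt.sum _ fun j _ => Wt.add ?_ ?_)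
  · exact (wt_levK_sub hc hc' hw' hw hd hd' α j).mul (wt_lev hc hwc (.inl j) (.inr β))
  · exact (wt_levK hc' hw' hd' α j).mul (wt_lev_sub hc hc' hw' hw (.inl j) (.inr β))

lemma homog_lev (hc : ∀ A, AnalyticAt ℝ (fun y => c y A) 0)
    (hh : ∀ A, Homog (2 - holWt A) fun y => c y A) (A B) :
    Homog (2 - holWt A - holWt B) fun y => lev c y A B := by
  simp only [lev_eq]
  have h1 := analyticAt_conj (hc B)
  refine Homog.sub (Homog.add ?_ ?_) (Homog.add ?_ ?_)
  · have := (hh B).conj.cderiv h1 (vecWt_hol A)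
    rwa [sub_right_comm] at this
  · have := (hh A).mul ((hh B).conj.cderiv h1 vecWt_uvec)
    convert this using 1
    push_cast
    ring
  · exact (hh A).cderiv (hc A) (vecWt_star_hol B)
  · have := (hh B).conj.mul ((hh A).cderiv (hc A) vecWt_uvec)
    convert this using 1
    push_cast
    ring

/-- The `z`-block is homogeneous of degree 0, so it is literally the same matrix at `x` and at
`dilation t x`, and so is its inverse. -/
lemma homog_levInv (hc : ∀ A, AnalyticAt ℝ (fun y => c y A) 0)
    (hh : ∀ A, Homog (2 - holWt A) fun y => c y A) (i j) :
    Homog 0 fun y => (levZ c y)⁻¹ i j := by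
  have h : ∀ᶠ x in 𝓝 0, ∀ k l, ∀ t ∈ Set.Ioc (0 : ℝ) 1,
      levZ c (dilation t x) k l = levZ c x k l := by
    refine eventually_all.2 fun k => eventually_all.2 fun l => ?_
    filter_upwards [homog_lev hc hh (.inl k) (.inl l)] with x hx t ht
    simpa [holWt, levZ] using hx t ht
  filter_upwards [h] with x hx t ht
  have : levZ c (dilation t x) = levZ c x := by
    ext k l
    exact hx k l t ht
  simp [this]

lemma homog_schur (hc : ∀ A, AnalyticAt ℝ (fun y => c y A) 0)
    (hh : ∀ A, Homog (2 - holWt A) fun y => c y A) (α β) :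
    Homog 2 fun y => schur c (levK c) y α β := by
  refine Homog.add (by simpa [holWt] using homog_lev hc hh (.inr α) (.inr β))
    (Homog.sum _ fun j _ => ?_)
  have h1 : Homog 1 fun y => lev c y (.inl j) (.inr β) := by
    simpa [holWt] using homog_lev hc hh (.inl j) (.inr β)
  have h2 : Homog 1 fun y => levK c y α j := by
    refine (Homog.sum _ fun i _ => ?_).neg
    have h3 : Homog 1 fun y => lev c y (.inr α) (.inl i) := by
      simpa [holWt] using homog_lev hc hh (.inr α) (.inl i)
    simpa using h3.mul (homog_levInv hc hh i j)
  exact h2.mul h1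

end LeviWeights

/-! ### Comparison of two graphs -/

section GraphWeights

variable {s r : ℕ} {F F' : (Coord s r → ℝ) → ℝ}

lemma analyticAt_graph_denom_inv {x : Coord s r → ℝ} (hF : AnalyticAt ℝ F x) :
    AnalyticAt ℝ (fun y => (Complex.I - cderiv (fun y => (F y : ℂ)) y uvec)⁻¹) x :=
  (analyticAt_const.sub (analyticAt_cderiv (analyticAt_ofReal hF) _)).inv
    (graph_denom_ne_zero F x)

lemma wt_graphC (hF : AnalyticAt ℝ F 0) (hw : Wt 2 fun x => (F x : ℂ)) (A) :
    Wt (2 - holWt A) fun x => graphC F x A := by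
  have hA := holWt_le A
  exact (Wt.hol A (hw.mono (by omega)) (analyticAt_ofReal hF)).mul_analyticAt
    (analyticAt_graph_denom_inv hF)

/-- The numerators differ by weight `3 - wt A`. The denominators differ only by weight 1, but that
difference is multiplied by a numerator of weight `2 - wt A`. -/
lemma wt_graphC_sub (hF : AnalyticAt ℝ F 0) (hF' : AnalyticAt ℝ F' 0)
    (hw' : Wt 2 fun x => (F' x : ℂ)) (hw : Wt 3 fun x => (F x : ℂ) - (F' x : ℂ)) (A) :
    Wt (3 - holWt A) fun x => graphC F x A - graphC F' x A := by
  have hA := holWt_le A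
  have a := analyticAt_ofReal hF
  have a' := analyticAt_ofReal hF'
  have hs : ∀ v, (fun y => cderiv (fun z => (F z : ℂ) - (F' z : ℂ)) y v) =ᶠ[𝓝 0]
      fun y => cderiv (fun z => (F z : ℂ)) y v - cderiv (fun z => (F' z : ℂ)) y v := by
    intro v
    filter_upwards [a.eventually_analyticAt, a'.eventually_analyticAt] with y h2 h3
    exact cderiv_sub h2.differentiableAt h3.differentiableAt v
  have e : (fun x => graphC F x A - graphC F' x A) = fun x =>
      (cderiv (fun z => (F z : ℂ)) x (hol A) - cderiv (fun z => (F' z : ℂ)) x (hol A)) *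
        (Complex.I - cderiv (fun y => (F y : ℂ)) x uvec)⁻¹ +
      cderiv (fun z => (F' z : ℂ)) x (hol A) *
        ((cderiv (fun z => (F z : ℂ)) x uvec - cderiv (fun z => (F' z : ℂ)) x uvec) *
        ((Complex.I - cderiv (fun y => (F y : ℂ)) x uvec)⁻¹ *
        (Complex.I - cderiv (fun y => (F' y : ℂ)) x uvec)⁻¹)) := by
    funext x
    have h1 := graph_denom_ne_zero F x
    have h2 := graph_denom_ne_zero F' x
    simp only [graphC]
    field_simp
    ring
  rw [e]
  refine Wt.add ?_ ?_
  · exact ((Wt.hol A (hw.mono (by omega)) (a.sub a')).congr (hs _)).mul_analyticAt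
      (analyticAt_graph_denom_inv hF)
  · have h1 : Wt (2 - holWt A) fun x => cderiv (fun z => (F' z : ℂ)) x (hol A) :=
      Wt.hol A (hw'.mono (by omega)) a'
    have h2 := ((Wt.uvec (n := 1) hw (a.sub a')).congr (hs _)).mul_analyticAt
      ((analyticAt_graph_denom_inv hF).mul (analyticAt_graph_denom_inv hF'))
    exact (h1.mul h2).mono (by omega)

lemma homog_graphC (hF : AnalyticAt ℝ F 0) (hh : Homog 2 fun x => (F x : ℂ)) (A) :
    Homog (2 - holWt A) fun x => graphC F x A := by
  have a := analyticAt_ofReal hF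
  have h1 := hh.cderiv a (vecWt_hol A)
  have h2 : Homog 0 fun x => cderiv (fun z => (F z : ℂ)) x uvec := hh.cderiv a vecWt_uvec
  have h3 := h1.mul ((Homog.const Complex.I).sub h2).inv
  simpa [graphC] using h3

end GraphWeights

/-! ### The model -/

section Model

variable {s r : ℕ} {H S : (Fin r → ℂ) → Matrix (Fin s) (Fin s) ℂ}

lemma modelFun_dilation (t : ℝ) (x : Coord s r → ℝ) :
    modelFun H S (dilation t x) = t ^ 2 * modelFun H S x := by
  have hz : zCoord (dilation t x) = (t : ℂ) • zCoord x := by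
    funext j
    apply Complex.ext <;> simp [zCoord, dilation]
  have hζ : ζCoord (dilation t x) = ζCoord x := by
    funext j
    apply Complex.ext <;> simp [ζCoord, dilation]
  simp only [modelFun, hz, hζ, star_smul, Matrix.mulVec_smul, dotProduct_smul, smul_dotProduct,
    smul_eq_mul]
  have e : star (t : ℂ) = t := Complex.conj_ofReal t
  rw [e]
  have e2 : ∀ w : ℂ, ((t : ℂ) * ((t : ℂ) * w)).re = t ^ 2 * w.re := by
    intro w
    simp
    ring
  rw [e2, e2]
  ring

lemma wt_modelFun : Wt 2 fun x => (modelFun H S x : ℂ) := by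
  refine Eventually.of_forall fun x => ?_
  simp only [modelFun_dilation]
  refine IsBigO.of_bound ‖modelFun H S x‖ (Eventually.of_forall fun t => ?_)
  simp [mul_comm]

lemma homog_modelFun : Homog 2 fun x => (modelFun H S x : ℂ) := by
  refine Eventually.of_forall fun x t _ => ?_
  simp only [modelFun_dilation]
  push_cast
  rfl

/-- Writing each real part as half the sum with its conjugate gives a polynomial in `z`, `z̄` with
coefficients depending on `ζ`. Analyticity and the second derivatives are read off from it. -/
lemma modelFun_eq (x : Coord s r → ℝ) : (modelFun H S x : ℂ) = ∑ i, ∑ j,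
    (H (ζCoord x) i j / 2 * (zCoord x i * conj (zCoord x j)) +
      conj (H (ζCoord x) i j) / 2 * (conj (zCoord x i) * zCoord x j) +
      S (ζCoord x) i j / 2 * (conj (zCoord x i) * conj (zCoord x j)) +
      conj (S (ζCoord x) i j) / 2 * (zCoord x i * zCoord x j)) := by
  simp only [modelFun, Complex.ofReal_add, Complex.re_eq_add_conj, Finset.sum_add_distrib]
  simp only [dotProduct, Matrix.mulVec, Finset.mul_sum, Pi.star_apply, RCLike.star_def, map_sum,
    map_mul, Complex.conj_conj, add_div, Finset.sum_div]
  have e1 : ∀ i j, zCoord x i * (H (ζCoord x) i j * conj (zCoord x j)) / 2 =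
      H (ζCoord x) i j / 2 * (zCoord x i * conj (zCoord x j)) := fun i j => by ring
  have e2 : ∀ i j, conj (zCoord x i) * (conj (H (ζCoord x) i j) * zCoord x j) / 2 =
      conj (H (ζCoord x) i j) / 2 * (conj (zCoord x i) * zCoord x j) := fun i j => by ring
  have e3 : ∀ i j, conj (zCoord x i) * (S (ζCoord x) i j * conj (zCoord x j)) / 2 =
      S (ζCoord x) i j / 2 * (conj (zCoord x i) * conj (zCoord x j)) := fun i j => by ring
  have e4 : ∀ i j, zCoord x i * (conj (S (ζCoord x) i j) * zCoord x j) / 2 =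
      conj (S (ζCoord x) i j) / 2 * (zCoord x i * zCoord x j) := fun i j => by ring
  simp only [e1, e2, e3, e4]
  ring

lemma analyticAt_linear_ofReal (l : (Coord s r → ℂ) →ₗ[ℂ] ℂ) (x : Coord s r → ℝ) :
    AnalyticAt ℝ (fun y : Coord s r → ℝ => l fun i => (y i : ℂ)) x :=
  (contDiff_linear_ofReal (n := ω) l).contDiffAt.analyticAt

lemma analyticAt_zCoord (x : Coord s r → ℝ) (j) : AnalyticAt ℝ (fun y => zCoord y j) x := by
  simp only [zCoord_eq]
  exact analyticAt_linear_ofReal _ x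

lemma analyticAt_comp_ζCoord {f : (Fin r → ℂ) → ℂ} (hf : AnalyticAt ℝ f 0) :
    AnalyticAt ℝ (fun x : Coord s r → ℝ => f (ζCoord x)) 0 := by
  have h0 : ζCoord (0 : Coord s r → ℝ) = 0 := by
    funext α
    apply Complex.ext <;> simp [ζCoord]
  have h1 : AnalyticAt ℝ (fun x : Coord s r → ℝ => ζCoord x) 0 := by
    refine ContDiffAt.analyticAt (contDiffAt_pi.2 fun α => ?_)
    simp only [ζCoord_eq]
    exact (contDiff_linear_ofReal _).contDiffAt
  exact AnalyticAt.fun_comp (g := f) (by rwa [h0]) h1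

lemma analyticAt_modelFun (hH : ∀ i j, AnalyticAt ℝ (fun ζ => H ζ i j) 0)
    (hS : ∀ i j, AnalyticAt ℝ (fun ζ => S ζ i j) 0) :
    AnalyticAt ℝ (modelFun H S : (Coord s r → ℝ) → ℝ) 0 := by
  have h : AnalyticAt ℝ (fun x : Coord s r → ℝ => (modelFun H S x : ℂ)) 0 := by
    simp only [modelFun_eq]
    refine Finset.analyticAt_fun_sum _ fun i _ => Finset.analyticAt_fun_sum _ fun j _ => ?_
    have h1 := analyticAt_comp_ζCoord (s := s) (hH i j)
    have h2 := analyticAt_comp_ζCoord (s := s) (hS i j)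
    have zi := analyticAt_zCoord (s := s) (r := r) 0 i
    have zj := analyticAt_zCoord (s := s) (r := r) 0 j
    exact (((h1.div_const.mul (zi.mul (analyticAt_conj zj))).add
      ((analyticAt_conj h1).div_const.mul ((analyticAt_conj zi).mul zj))).add
      (h2.div_const.mul ((analyticAt_conj zi).mul (analyticAt_conj zj)))).add
      ((analyticAt_conj h2).div_const.mul (zi.mul zj))
  exact (Complex.reCLM.analyticAt _).comp h

/-- Both linear factors vanish at the origin, so each of the two derivatives has to fall on one of
them. -/
lemma cderiv_cderiv_quadratic {g : (Coord s r → ℝ) → ℂ} (hg : AnalyticAt ℝ g 0)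
    (l₁ l₂ : (Coord s r → ℂ) →ₗ[ℂ] ℂ) (v w : Coord s r → ℂ) :
    cderiv (fun x => cderiv (fun y => g y * (l₁ (fun i => (y i : ℂ)) * l₂ (fun i => (y i : ℂ))))
      x v) 0 w = g 0 * (l₁ v * l₂ w + l₁ w * l₂ v) := by
  have d : ∀ (l : (Coord s r → ℂ) →ₗ[ℂ] ℂ) x,
      DifferentiableAt ℝ (fun y : Coord s r → ℝ => l fun i => (y i : ℂ)) x := fun l x =>
    (analyticAt_linear_ofReal l x).differentiableAt
  have h0 : ∀ l : (Coord s r → ℂ) →ₗ[ℂ] ℂ, (l fun i => (((0 : Coord s r → ℝ) i : ℝ) : ℂ)) = 0 :=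
    fun l => by
      have : (fun i => (((0 : Coord s r → ℝ) i : ℝ) : ℂ)) = 0 := by funext i; simp
      rw [this, map_zero]
  have e : (fun x => cderiv (fun y => g y * (l₁ (fun i => (y i : ℂ)) *
      l₂ (fun i => (y i : ℂ)))) x v) =ᶠ[𝓝 0] fun x => cderiv g x v *
        (l₁ (fun i => (x i : ℂ)) * l₂ (fun i => (x i : ℂ))) +
        g x * (l₁ v * l₂ (fun i => (x i : ℂ)) + l₁ (fun i => (x i : ℂ)) * l₂ v) := by
    filter_upwards [hg.eventually_analyticAt] with x hx
    rw [cderiv_mul hx.differentiableAt ((d l₁ x).fun_mul (d l₂ x)), cderiv_mul (d l₁ x) (d l₂ x),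
      cderiv_linear, cderiv_linear]
  have dg := hg.differentiableAt
  have dgv := (analyticAt_cderiv hg v).differentiableAt
  have c1 : DifferentiableAt ℝ (fun x : Coord s r → ℝ => l₁ v * l₂ (fun i => (x i : ℂ))) 0 :=
    (differentiableAt_const _).fun_mul (d l₂ 0)
  have c2 : DifferentiableAt ℝ (fun x : Coord s r → ℝ => l₁ (fun i => (x i : ℂ)) * l₂ v) 0 :=
    (d l₁ 0).fun_mul (differentiableAt_const _)
  have c3 := (d l₁ 0).fun_mul (d l₂ 0)
  rw [cderiv_congr e, cderiv_add (dgv.fun_mul c3) (dg.fun_mul (c1.fun_add c2)),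
    cderiv_mul dgv c3, cderiv_mul (d l₁ 0) (d l₂ 0), cderiv_mul dg (c1.fun_add c2),
    cderiv_add c1 c2, cderiv_mul (differentiableAt_const _) (d l₂ 0),
    cderiv_mul (d l₁ 0) (differentiableAt_const _), cderiv_const, cderiv_const]
  simp only [h0, cderiv_linear]
  ring

lemma cderiv_cderiv_finset_sum {κ : Type} (I : Finset κ) {f : κ → (Coord s r → ℝ) → ℂ}
    (hf : ∀ i ∈ I, AnalyticAt ℝ (f i) 0) (v w : Coord s r → ℂ) :
    cderiv (fun x => cderiv (fun y => ∑ i ∈ I, f i y) x v) 0 w =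
      ∑ i ∈ I, cderiv (fun x => cderiv (f i) x v) 0 w := by
  have e : (fun x => cderiv (fun y => ∑ i ∈ I, f i y) x v) =ᶠ[𝓝 0]
      fun x => ∑ i ∈ I, cderiv (f i) x v := by
    have h : ∀ᶠ x in 𝓝 (0 : Coord s r → ℝ), ∀ i ∈ I, AnalyticAt ℝ (f i) x :=
      (Filter.eventually_all_finset I).2 fun i hi => (hf i hi).eventually_analyticAt
    filter_upwards [h] with x hx
    exact cderiv_sum _ (fun i hi => (hx i hi).differentiableAt) v
  rw [cderiv_congr e, cderiv_sum _ fun i hi => (analyticAt_cderiv (hf i hi) v).differentiableAt]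

/-- The mixed second derivatives of the model function at the origin. -/
lemma cderiv_cderiv_modelFun (hH : ∀ i j, AnalyticAt ℝ (fun ζ => H ζ i j) 0)
    (hS : ∀ i j, AnalyticAt ℝ (fun ζ => S ζ i j) 0) (hHerm : (H 0).IsHermitian) (k l : Fin s) :
    cderiv (fun x => cderiv (fun y : Coord s r → ℝ => (modelFun H S y : ℂ)) x (hol (.inl k))) 0
      (star (hol (.inl l))) = H 0 k l := by
  have hζ0 : ζCoord (0 : Coord s r → ℝ) = 0 := by
    funext α
    apply Complex.ext <;> simp [ζCoord]
  have hz : ∀ i j, dz (.inl i : Fin s ⊕ Fin r) (hol (.inl j)) = if i = j then 1 else 0 := by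
    intro i j
    simp [hol, Pi.single_apply]
  have hz' : ∀ i j, dz (.inl i : Fin s ⊕ Fin r) (star (hol (.inl j))) = 0 := by
    intro i j
    simp [star_hol]
  have hzb : ∀ i j, dzb (.inl i : Fin s ⊕ Fin r) (hol (.inl j)) = 0 := by
    intro i j
    simp [hol]
  have hzb' : ∀ i j, dzb (.inl i : Fin s ⊕ Fin r) (star (hol (.inl j))) =
      if i = j then 1 else 0 := by
    intro i j
    simp [star_hol, Pi.single_apply]
  -- The four kinds of terms are indexed by `Fin 4`, which gives all of them the shape of a
  -- coefficient times two linear functions.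
  have e : (fun y : Coord s r → ℝ => (modelFun H S y : ℂ)) = fun y => ∑ p : Fin s × Fin s,
      ∑ m : Fin 4, (![H (ζCoord y) p.1 p.2 / 2, conj (H (ζCoord y) p.1 p.2) / 2,
        S (ζCoord y) p.1 p.2 / 2, conj (S (ζCoord y) p.1 p.2) / 2] m) *
        ((![dz (.inl p.1), dzb (.inl p.1), dzb (.inl p.1), dz (.inl p.1)] :
          Fin 4 → (Coord s r → ℂ) →ₗ[ℂ] ℂ) m (fun i => (y i : ℂ)) *
        (![dzb (.inl p.2), dz (.inl p.2), dzb (.inl p.2), dz (.inl p.2)] :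
          Fin 4 → (Coord s r → ℂ) →ₗ[ℂ] ℂ) m (fun i => (y i : ℂ))) := by
    funext y
    rw [modelFun_eq, Fintype.sum_prod_type]
    refine Finset.sum_congr rfl fun i _ => Finset.sum_congr rfl fun j _ => ?_
    simp only [Fin.sum_univ_four, Matrix.cons_val, ← conj_zCoord_eq, ← zCoord_eq]
  have hg : ∀ (p : Fin s × Fin s) (m : Fin 4), AnalyticAt ℝ (fun y : Coord s r → ℝ =>
      ![H (ζCoord y) p.1 p.2 / 2, conj (H (ζCoord y) p.1 p.2) / 2,
        S (ζCoord y) p.1 p.2 / 2, conj (S (ζCoord y) p.1 p.2) / 2] m) 0 := by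
    intro p m
    have h1 := analyticAt_comp_ζCoord (s := s) (hH p.1 p.2)
    have h2 := analyticAt_comp_ζCoord (s := s) (hS p.1 p.2)
    fin_cases m
    · exact h1.div_const
    · exact (analyticAt_conj h1).div_const
    · exact h2.div_const
    · exact (analyticAt_conj h2).div_const
  have hgl : ∀ (p : Fin s × Fin s) (m : Fin 4), AnalyticAt ℝ (fun y : Coord s r → ℝ =>
      (![H (ζCoord y) p.1 p.2 / 2, conj (H (ζCoord y) p.1 p.2) / 2,
        S (ζCoord y) p.1 p.2 / 2, conj (S (ζCoord y) p.1 p.2) / 2] m) *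
        ((![dz (.inl p.1), dzb (.inl p.1), dzb (.inl p.1), dz (.inl p.1)] :
          Fin 4 → (Coord s r → ℂ) →ₗ[ℂ] ℂ) m (fun i => (y i : ℂ)) *
        (![dzb (.inl p.2), dz (.inl p.2), dzb (.inl p.2), dz (.inl p.2)] :
          Fin 4 → (Coord s r → ℂ) →ₗ[ℂ] ℂ) m (fun i => (y i : ℂ)))) 0 := fun p m =>
    (hg p m).mul ((analyticAt_linear_ofReal _ 0).mul (analyticAt_linear_ofReal _ 0))
  rw [e, cderiv_cderiv_finset_sum _ fun p _ => Finset.analyticAt_fun_sum _ fun m _ => hgl p m]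
  have key : ∀ p : Fin s × Fin s, _ = _ := fun p =>
    cderiv_cderiv_finset_sum Finset.univ (fun m _ => hgl p m) (hol (.inl k)) (star (hol (.inl l)))
  rw [Finset.sum_congr rfl fun p _ => key p]
  simp only [cderiv_cderiv_quadratic (hg _ _)]
  simp only [Fin.sum_univ_four, Matrix.cons_val, hz, hz', hzb, hzb', hζ0, Fintype.sum_prod_type]
  -- Of the four terms only the two mixed ones survive. They give the mean of `H 0 k l` and the
  -- conjugate of `H 0 l k`.
  have hherm : conj (H 0 l k) = H 0 k l := hHerm.apply k l
  simp only [mul_zero, add_zero, zero_add, mul_ite, mul_one, Finset.sum_add_distrib,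
    Finset.sum_ite_eq', Finset.mem_univ, if_true, hherm]
  ring

/-- At the origin `c` and `F_k` vanish, so only second derivatives contribute and the Levi block is
`conj ρ⁻¹ - ρ⁻¹` times `M`, where `ρ = i - F_u`. This factor is nonzero because `F_u` is real. -/
lemma levZ_det_ne_zero {F : (Coord s r → ℝ) → ℝ} (hF : AnalyticAt ℝ F 0)
    (hw : Wt 2 fun x => (F x : ℂ)) {M : Matrix (Fin s) (Fin s) ℂ} (hM : M.IsHermitian)
    (hdet : IsUnit M.det)
    (h2 : ∀ k l, cderiv (fun x => cderiv (fun y => (F y : ℂ)) x (hol (.inl k))) 0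
      (star (hol (.inl l))) = M k l) : (levZ (graphC F) 0).det ≠ 0 := by
  have hc0 : ∀ k : Fin s, graphC F 0 (.inl k) = 0 := by
    intro k
    have := (Wt.eq_zero (n := 0) (wt_graphC hF hw (.inl k)) (analyticAt_graphC hF _)).self_of_nhds
    simpa using this
  have a := analyticAt_ofReal hF
  have hne := graph_denom_ne_zero F 0
  set ρ := Complex.I - cderiv (fun y => (F y : ℂ)) 0 uvec with hρ
  have hFk : ∀ k : Fin s, cderiv (fun y => (F y : ℂ)) 0 (hol (.inl k)) = 0 := by
    intro k
    have := hc0 k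
    rw [graphC, mul_eq_zero] at this
    exact this.resolve_right (inv_ne_zero hne)
  have hd : ∀ k l : Fin s, cderiv (fun x => graphC F x (.inl k)) 0 (star (hol (.inl l))) =
      M k l * ρ⁻¹ := by
    intro k l
    simp only [graphC]
    rw [cderiv_mul (analyticAt_cderiv a _).differentiableAt
      (analyticAt_graph_denom_inv hF).differentiableAt, h2, hFk, zero_mul, add_zero]
  have hlev : levZ (graphC F) 0 = (conj ρ⁻¹ - ρ⁻¹) • M := by
    ext k l
    rw [levZ, Matrix.of_apply, lev_eq, hc0, hc0, hd, cderiv_conj, hd, map_mul]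
    have := hM.apply k l
    simp only [RCLike.star_def] at this
    rw [this, Matrix.smul_apply, smul_eq_mul, map_zero]
    ring
  have hρ2 : conj ρ⁻¹ - ρ⁻¹ ≠ 0 := by
    have hreal : conj (cderiv (fun y => (F y : ℂ)) 0 uvec) = cderiv (fun y => (F y : ℂ)) 0 uvec := by
      rw [← cderiv_ofReal_star, star_uvec]
    intro h
    rw [sub_eq_zero, map_inv₀, inv_inj, hρ, map_sub, hreal, Complex.conj_I] at h
    have : Complex.I = 0 := by linear_combination -h / 2
    exact Complex.I_ne_zero this
  rw [hlev, Matrix.det_smul]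
  exact mul_ne_zero (pow_ne_zero _ hρ2) hdet.ne_zero

end Model

/-! ### The geometry along the Levi leaf -/

section Leaf

variable {s r : ℕ}

/-- The derivatives `L̄_l k_αj`, which represent the third order Levi form. -/
def thirdForm (c : (Coord s r → ℝ) → Fin s ⊕ Fin r → ℂ)
    (k : (Coord s r → ℝ) → Fin r → Fin s → ℂ) (x : Coord s r → ℝ) (α : Fin r) :
    Fin s → Fin s → ℂ :=
  fun j l => cderiv (fun y => k y α j) x (star (crVec (c x) (Pi.single (.inl l) 1)))

/-- A uniformly `2`-nondegenerate CR structure whose Levi leaf through the origin is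
`z = 0`, `Im w = 0`. -/
structure LeafModel (H : (Coord s r → ℝ) → Submodule ℂ (Coord s r → ℂ))
    (c : (Coord s r → ℝ) → Fin s ⊕ Fin r → ℂ) (k : (Coord s r → ℝ) → Fin r → Fin s → ℂ) :
    Prop where
  levi : IsLeviAt H c k 0
  c_leaf : ∀ᶠ x in 𝓝 0, ∀ A, c (dilation 0 x) A = 0
  k_leaf : ∀ᶠ x in 𝓝 0, ∀ α j, k (dilation 0 x) α j = 0
  indep : LinearIndependent ℂ (thirdForm c k 0)

/-- Two CR structures agree to the relevant order along the leaf. -/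
structure SameLeaf (c : (Coord s r → ℝ) → Fin s ⊕ Fin r → ℂ)
    (k : (Coord s r → ℝ) → Fin r → Fin s → ℂ) (c' : (Coord s r → ℝ) → Fin s ⊕ Fin r → ℂ)
    (k' : (Coord s r → ℝ) → Fin r → Fin s → ℂ) : Prop where
  levZ : ∀ᶠ x in 𝓝 0, levZ c (dilation 0 x) = levZ c' (dilation 0 x)
  dk : ∀ᶠ x in 𝓝 0, ∀ α j v, du v = 0 →
    cderiv (fun y => k y α j) (dilation 0 x) v = cderiv (fun y => k' y α j) (dilation 0 x) v

variable {H : (Coord s r → ℝ) → Submodule ℂ (Coord s r → ℂ)}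
  {c c' : (Coord s r → ℝ) → Fin s ⊕ Fin r → ℂ} {k k' : (Coord s r → ℝ) → Fin r → Fin s → ℂ}

lemma SameLeaf.symm (h : SameLeaf c k c' k') : SameLeaf c' k' c k where
  levZ := h.levZ.mono fun _ h => h.symm
  dk := h.dk.mono fun _ h α j v hv => (h α j v hv).symm

lemma LeafModel.c_zero (h : LeafModel H c k) (A) : c 0 A = 0 := by
  simpa using h.c_leaf.self_of_nhds A

lemma LeafModel.k_zero (h : LeafModel H c k) (α j) : k 0 α j = 0 := by
  simpa using h.k_leaf.self_of_nhds α j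

lemma continuousAt_thirdForm {x : Coord s r → ℝ} (h : IsLeviAt H c k x) :
    ContinuousAt (thirdForm c k) x := by
  refine continuousAt_pi.2 fun α => continuousAt_pi.2 fun j => continuousAt_pi.2 fun l => ?_
  have h1 : ContDiffAt ℝ (0 : ℕ∞) (fun y => cderiv (fun y => k y α j) y
      (star (crVec (c y) (Pi.single (.inl l) 1)))) x := by
    refine contDiffAt_cderiv (h.contDiffAt α j) ?_
    have := (h.cr.isSection_crVec_const (Pi.single (.inl l) 1)).star.self_of_nhds.1
    exact this.of_le (by simp)
  exact h1.continuousAt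

/-- Linear independence of the third order forms is an open condition. Near the origin it already
excludes a nonzero element of `K₃`, by testing with the `z̄` directions alone. -/
lemma LeafModel.uniformlyTwoNondegenerate (h : LeafModel H c k) (hr : r ≠ 0) :
    UniformlyTwoNondegenerate H 0 := by
  refine ⟨⟨r, ?_⟩, ?_⟩
  · filter_upwards [h.levi.eventually] with x hx
    rw [hx.leviKernel_eq, finrank_range_kerMap]
  · have hind := (continuousAt_thirdForm h.levi).eventually h.indep.eventually
    filter_upwards [h.levi.eventually, hind] with x hx hxi
    refine ⟨fun h0 => ?_, fun v hv => ?_⟩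
    · have := finrank_range_kerMap (c x) (k x)
      rw [← hx.leviKernel_eq, h0, finrank_bot] at this
      exact hr this.symm
    · obtain ⟨hvK, hv3⟩ := hx.mem_freemanThree_iff.1 hv
      have h0 := Fintype.linearIndependent_iff.1 hxi (fun α => dz (.inr α) v) (by
        funext j l
        simpa [thirdForm] using hv3 (.inl l) j)
      rw [hx.eq_kerVec hvK, funext h0]
      exact map_zero (kerMap (c x) (k x))

lemma crVec_zero_single (A : Fin s ⊕ Fin r) (c : Fin s ⊕ Fin r → ℂ) (hc : ∀ B, c B = 0) :
    crVec c (Pi.single A 1) = hol A := by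
  rw [crVec_single, hc, zero_smul, add_zero]

/-- All first derivatives except `∂_u` cost at most one weight, so they retain positive weight and
vanish on the leaf. The derivative `∂_u` costs two, whence the condition on `du`. -/
lemma cderiv_eq_zero_of_wt {f : (Coord s r → ℝ) → ℂ} (hf : AnalyticAt ℝ f 0) (hw : Wt 2 f) :
    ∀ᶠ x in 𝓝 0, ∀ v, du v = 0 → cderiv f (dilation 0 x) v = 0 := by
  have h1 : ∀ᶠ x in 𝓝 0, ∀ A, cderiv f (dilation 0 x) (hol A) = 0 :=
    eventually_all.2 fun A => by
      have hA := holWt_le A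
      exact Wt.eq_zero (n := 0) (Wt.hol A (hw.mono (by omega)) hf) (analyticAt_cderiv hf _)
  have h2 : ∀ᶠ x in 𝓝 0, ∀ A, cderiv f (dilation 0 x) (star (hol A)) = 0 :=
    eventually_all.2 fun A => by
      have hA := holWt_le A
      exact Wt.eq_zero (n := 0) (Wt.star_hol A (hw.mono (by omega)) hf) (analyticAt_cderiv hf _)
  filter_upwards [h1, h2] with x h1 h2 v hv
  rw [apply_eq_components]
  simp [h1, h2, hv]

/-- The weighted conditions on a graph that yield a leaf model. -/
lemma leafModel_of_weights (hcr : IsCRAt H c 0) (hw : ∀ A, Wt (2 - holWt A) fun y => c y A)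
    (hd : (levZ c 0).det ≠ 0) (hs : ∀ᶠ x in 𝓝 0, ∀ α β, schur c (levK c) x α β = 0)
    (hi : LinearIndependent ℂ (thirdForm c (levK c) 0)) : LeafModel H c (levK c) := by
  have hc := hcr.analyticAt
  refine ⟨⟨hcr, ?_⟩, ?_, ?_, hi⟩
  · filter_upwards [hcr.eventually, eventually_levZ_det hc hd, hs] with x h1 h2 h3
    refine ⟨fun v => ?_, analyticAt_levK h1.analyticAt h2⟩
    rw [(h1.leviKernel_eq_iff (solvesKernel_levK h2)).2 h3, h1.mem_range_kerMap_iff]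
  · refine eventually_all.2 fun A => ?_
    have hA := holWt_le A
    exact Wt.eq_zero (n := 0) ((hw A).mono (by omega)) (hc A)
  · exact eventually_all.2 fun α => eventually_all.2 fun j =>
      Wt.eq_zero (n := 0) (wt_levK hc hw hd α j) (analyticAt_levK hc hd α j)

/-- The Schur complement has weight 2, so it vanishes at the origin and the rank there is `r`. If
the rank is constant, it is `r` nearby, which by `leviKernel_le` is the largest possible value, and
the Levi kernel fills the graph of `k`. -/
lemma schur_eq_zero_of_uniform (hcr : IsCRAt H c 0) (hw : ∀ A, Wt (2 - holWt A) fun y => c y A)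
    (hd : (levZ c 0).det ≠ 0) (hH : UniformlyTwoNondegenerate H 0) :
    ∀ᶠ x in 𝓝 0, ∀ α β, schur c (levK c) x α β = 0 := by
  have hc := hcr.analyticAt
  obtain ⟨m, hm⟩ := hH.1
  have h0 : ∀ α β, schur c (levK c) 0 α β = 0 := by
    intro α β
    have := (Wt.eq_zero (n := 1) (wt_schur hc hw hd α β)
      (analyticAt_schur hc hd α β)).self_of_nhds
    simpa using this
  have hmr : m = r := by
    rw [← hm.self_of_nhds, (hcr.leviKernel_eq_iff (solvesKernel_levK hd)).2 h0,
      finrank_range_kerMap]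
  filter_upwards [hm, hcr.eventually, eventually_levZ_det hc hd] with x h1 h2 h3
  have hk := solvesKernel_levK (c := c) h3
  refine (h2.leviKernel_eq_iff hk).1 (Submodule.eq_of_le_of_finrank_eq (h2.leviKernel_le hk) ?_)
  rw [h1, hmr, finrank_range_kerMap]

/-- A linear relation among the third order forms gives an element of `K₃` at the origin. The `ζ̄`
directions impose nothing more, because a `ζ̄` derivative of `k` keeps its weight 1 and so vanishes
at the origin. -/
lemma thirdForm_indep_of_uniform (hcr : IsCRAt H c 0)
    (hw : ∀ A, Wt (2 - holWt A) fun y => c y A) (hd : (levZ c 0).det ≠ 0)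
    (hs : ∀ᶠ x in 𝓝 0, ∀ α β, schur c (levK c) x α β = 0) (hH : UniformlyTwoNondegenerate H 0) :
    LinearIndependent ℂ (thirdForm c (levK c) 0) := by
  have hc := hcr.analyticAt
  have hlevi : IsLeviAt H c (levK c) 0 := by
    refine ⟨hcr, ?_⟩
    filter_upwards [hcr.eventually, eventually_levZ_det hc hd, hs] with x h1 h2 h3
    refine ⟨fun v => ?_, analyticAt_levK h1.analyticAt h2⟩
    rw [(h1.leviKernel_eq_iff (solvesKernel_levK h2)).2 h3, h1.mem_range_kerMap_iff]
  have hc0 : ∀ A, c 0 A = 0 := by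
    intro A
    have hA := holWt_le A
    have := (Wt.eq_zero (n := 0) ((hw A).mono (by omega)) (hc A)).self_of_nhds
    simpa using this
  refine Fintype.linearIndependent_iff.2 fun g hg => ?_
  have hv : kerVec (c 0) (levK c 0) g ∈ freemanThree H 0 := by
    refine hlevi.mem_freemanThree_iff.2 ⟨hlevi.kerVec_mem g, fun C j => ?_⟩
    rcases C with l | β
    · have := congrFun (congrFun hg j) l
      simpa [thirdForm] using this
    · refine Finset.sum_eq_zero fun α _ => ?_
      rw [crVec_zero_single _ _ hc0]
      have hk := wt_levK hc hw hd α j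
      have := (Wt.eq_zero (n := 0) (Wt.star_hol (n := 1) (.inr β) hk (analyticAt_levK hc hd α j))
        (analyticAt_cderiv (analyticAt_levK hc hd α j) _)).self_of_nhds
      rw [dilation_zero] at this
      rw [this, mul_zero]
  have h0 := hH.2.self_of_nhds.2 _ hv
  intro α
  simpa using congrArg (dz (.inr α)) h0

lemma sameLeaf_of_weights (hc : ∀ A, AnalyticAt ℝ (fun y => c y A) 0)
    (hc' : ∀ A, AnalyticAt ℝ (fun y => c' y A) 0)
    (hw' : ∀ A, Wt (2 - holWt A) fun y => c' y A)
    (hw : ∀ A, Wt (3 - holWt A) fun y => c y A - c' y A)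
    (hd : (levZ c 0).det ≠ 0) (hd' : (levZ c' 0).det ≠ 0) :
    SameLeaf c (levK c) c' (levK c') where
  levZ := by
    have : ∀ᶠ x in 𝓝 0, ∀ i j, lev c (dilation 0 x) (.inl i) (.inl j) -
        lev c' (dilation 0 x) (.inl i) (.inl j) = 0 :=
      eventually_all.2 fun i => eventually_all.2 fun j =>
        Wt.eq_zero (n := 0) (wt_lev_sub hc hc' hw' hw (.inl i) (.inl j))
          ((analyticAt_lev hc _ _).sub (analyticAt_lev hc' _ _))
    filter_upwards [this] with x hx
    ext i j
    exact sub_eq_zero.1 (hx i j)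
  dk := by
    refine eventually_all.2 fun α => eventually_all.2 fun j => ?_
    have a := analyticAt_levK hc hd α j
    have a' := analyticAt_levK hc' hd' α j
    filter_upwards [cderiv_eq_zero_of_wt (a.sub a') (wt_levK_sub hc hc' hw' hw hd hd' α j),
      eventually_dilation a.eventually_analyticAt, eventually_dilation a'.eventually_analyticAt]
      with x h1 h2 h3 v hv
    have := h1 v hv
    have e := cderiv_sub h2.self_of_nhds.differentiableAt h3.self_of_nhds.differentiableAt v
    exact sub_eq_zero.1 (e.symm.trans this)

lemma thirdForm_eq_of_sameLeaf (h : SameLeaf c k c' k') (hc : ∀ A, c 0 A = 0)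
    (hc' : ∀ A, c' 0 A = 0) : thirdForm c k 0 = thirdForm c' k' 0 := by
  funext α j l
  have := h.dk.self_of_nhds α j (star (hol (.inl l))) (by rw [du_star]; simp [hol])
  rw [dilation_zero] at this
  rw [thirdForm, thirdForm, crVec_zero_single _ _ hc, crVec_zero_single _ _ hc', this]

/-- The hypersurface and its model are leaf models that agree along the leaf. -/
theorem exists_leafModel (H S : (Fin r → ℂ) → Matrix (Fin s) (Fin s) ℂ)
    (Q : (Coord s r → ℝ) → ℝ)
    (hH : ∀ i j, AnalyticAt ℝ (fun ζ => H ζ i j) 0)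
    (hS : ∀ i j, AnalyticAt ℝ (fun ζ => S ζ i j) 0)
    (hQ : AnalyticAt ℝ Q 0) (hHerm : (H 0).IsHermitian) (hdet : IsUnit (H 0).det)
    (hQw : WeightedOrderGtTwo Q)
    (hM2 : UniformlyTwoNondegenerate (graphCR fun x => modelFun H S x + Q x) 0) :
    r ≠ 0 ∧ ∃ c k c' k', LeafModel (graphCR fun x => modelFun H S x + Q x) c k ∧
      LeafModel (graphCR (modelFun H S)) c' k' ∧ SameLeaf c k c' k' := by
  set F : (Coord s r → ℝ) → ℝ := fun x => modelFun H S x + Q x with hF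
  set P : (Coord s r → ℝ) → ℝ := modelFun H S with hP
  have aP : AnalyticAt ℝ P 0 := analyticAt_modelFun hH hS
  have aF : AnalyticAt ℝ F 0 := aP.add hQ
  have wP : Wt 2 fun x => (P x : ℂ) := wt_modelFun
  have wQ : Wt 3 fun x => (F x : ℂ) - (P x : ℂ) := by
    have e : (fun x => (F x : ℂ) - (P x : ℂ)) = fun x => (Q x : ℂ) := by
      funext x
      simp [hF, hP]
    rw [e]
    exact hQw.wt
  have wF : Wt 2 fun x => (F x : ℂ) := by
    have := (wQ.mono (m := 2) (by omega)).add wP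
    simpa using this
  have crF := isCRAt_graphCR aF
  have crP := isCRAt_graphCR aP
  have wcF := wt_graphC aF wF
  have wcP := wt_graphC aP wP
  have wsub := wt_graphC_sub aF aP wP wQ
  have hdP : (levZ (graphC P) 0).det ≠ 0 :=
    levZ_det_ne_zero aP wP hHerm hdet (cderiv_cderiv_modelFun hH hS hHerm)
  -- The blocks differ by weight 1, so they coincide at the origin and the invertibility carries
  -- over from the model to `M`.
  have hlev : levZ (graphC F) 0 = levZ (graphC P) 0 := by
    ext i j
    have := (Wt.eq_zero (n := 0) (wt_lev_sub crF.analyticAt crP.analyticAt wcP wsub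
      (.inl i) (.inl j)) ((analyticAt_lev crF.analyticAt _ _).sub
      (analyticAt_lev crP.analyticAt _ _))).self_of_nhds
    rw [dilation_zero] at this
    exact sub_eq_zero.1 this
  have hdF : (levZ (graphC F) 0).det ≠ 0 := by rwa [hlev]
  have sF := schur_eq_zero_of_uniform crF wcF hdF hM2
  have iF := thirdForm_indep_of_uniform crF wcF hdF sF hM2
  have LF := leafModel_of_weights crF wcF hdF sF iF
  have same := sameLeaf_of_weights crF.analyticAt crP.analyticAt wcP wsub hdF hdP
  -- Since the Schur complement of `M` vanishes, that of the model is minus their difference and has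
  -- weight 3. It is also homogeneous of degree 2, so it vanishes.
  have sP : ∀ᶠ x in 𝓝 0, ∀ α β, schur (graphC P) (levK (graphC P)) x α β = 0 := by
    refine eventually_all.2 fun α => eventually_all.2 fun β => ?_
    refine Homog.eq_zero (n := 2) (homog_schur crP.analyticAt (homog_graphC aP homog_modelFun) α β) ?_
    have := (wt_schur_sub crF.analyticAt crP.analyticAt wcP wsub hdF hdP α β).neg
    refine this.congr ?_
    filter_upwards [sF] with x hx
    rw [hx]
    ring
  have c0 : ∀ (G : (Coord s r → ℝ) → ℝ), AnalyticAt ℝ G 0 → (Wt 2 fun x => (G x : ℂ)) →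
      ∀ A, graphC G 0 A = 0 := by
    intro G aG wG A
    have hA := holWt_le A
    have := (Wt.eq_zero (n := 0) ((wt_graphC aG wG A).mono (by omega))
      (analyticAt_graphC aG A)).self_of_nhds
    simpa using this
  have iP : LinearIndependent ℂ (thirdForm (graphC P) (levK (graphC P)) 0) := by
    rwa [← thirdForm_eq_of_sameLeaf same (c0 F aF wF) (c0 P aP wP)]
  refine ⟨?_, _, _, _, _, LF, leafModel_of_weights crP wcP hdP sP iP, same⟩
  -- For `r = 0` the Levi kernel would be trivial, contrary to `K₂ ≠ 0`.
  rintro rfl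
  refine hM2.2.self_of_nhds.1 ?_
  rw [LF.levi.leviKernel_eq]
  exact Submodule.finrank_eq_zero.1 (finrank_range_kerMap _ _)

end Leaf

/-! ### Graded frames in coordinates -/

section Frames

variable {s r : ℕ}

/-- Here `K` is cut out of `D` by `s` functionals. An invertible matrix of their values on `s`
vectors of `D` makes these vectors a basis of `D / K`. -/
lemma linearIndependent_mkQ_and_span {V : Type} [AddCommGroup V] [Module ℂ V]
    {K D : Submodule ℂ V} {ρ : Fin s → V →ₗ[ℂ] ℂ} (hK : ∀ v, v ∈ K ↔ v ∈ D ∧ ∀ l, ρ l v = 0)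
    {f : Fin s → V} (hf : ∀ j, f j ∈ D)
    (hd : (Matrix.of fun j l => ρ l (f j)).det ≠ 0) :
    (LinearIndependent ℂ fun j => K.mkQ (f j)) ∧ K ⊔ Submodule.span ℂ (Set.range f) = D := by
  constructor
  · refine Fintype.linearIndependent_iff.2 fun g hg => ?_
    have h1 : ∑ j, g j • f j ∈ K := by
      rw [← Submodule.ker_mkQ K, LinearMap.mem_ker, map_sum]
      simpa only [map_smul] using hg
    have h2 : g ᵥ* (Matrix.of fun j l => ρ l (f j)) = 0 := by
      funext l
      have := ((hK _).1 h1).2 l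
      simpa [Matrix.vecMul, dotProduct, map_sum] using this
    exact congrFun (Matrix.eq_zero_of_vecMul_eq_zero hd h2)
  · refine le_antisymm (sup_le (fun v hv => ((hK v).1 hv).1)
      (Submodule.span_le.2 (by rintro _ ⟨j, rfl⟩; exact hf j))) fun v hv => ?_
    set A := Matrix.of fun j l => ρ l (f j)
    set w := (fun l => ρ l v) ᵥ* A⁻¹
    have hw : w ᵥ* A = fun l => ρ l v := by
      rw [Matrix.vecMul_vecMul, Matrix.nonsing_inv_mul _ (isUnit_iff_ne_zero.2 hd),
        Matrix.vecMul_one]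
    have hs : ∑ j, w j • f j ∈ Submodule.span ℂ (Set.range f) :=
      Submodule.sum_mem _ fun j _ => Submodule.smul_mem _ _ (Submodule.subset_span ⟨j, rfl⟩)
    rw [← sub_add_cancel v (∑ j, w j • f j)]
    refine Submodule.add_mem_sup ((hK _).2 ⟨?_, fun l => ?_⟩) hs
    · exact D.sub_mem hv (Submodule.sum_mem _ fun j _ => D.smul_mem _ (hf j))
    · have := congrFun hw l
      simp only [map_sub, map_sum, map_smul, smul_eq_mul]
      rw [sub_eq_zero, ← this]
      simp [A, Matrix.vecMul, dotProduct]

/-- The components of the frame in `H / K₂`. -/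
def frameA (k : Fin r → Fin s → ℂ) (φ : GradedFrame (Coord s r) s) : Matrix (Fin s) (Fin s) ℂ :=
  Matrix.of fun j l => redz k l (φ.f j)

/-- The components of the frame in `H̄ / K̄₂`. -/
def frameB (k : Fin r → Fin s → ℂ) (φ : GradedFrame (Coord s r) s) : Matrix (Fin s) (Fin s) ℂ :=
  Matrix.of fun j l => redzb k l (φ.h j)

variable {H : (Coord s r → ℝ) → Submodule ℂ (Coord s r → ℂ)}
  {c : (Coord s r → ℝ) → Fin s ⊕ Fin r → ℂ} {k : (Coord s r → ℝ) → Fin r → Fin s → ℂ}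
  {q : Coord s r → ℝ} {φ : GradedFrame (Coord s r) s}

lemma IsLeviAt.lev_eq_zero' (h : IsLeviAt H c k q) (A : Fin s ⊕ Fin r) (β : Fin r) :
    lev c q A (.inr β) = -∑ l, conj (k q β l) * lev c q A (.inl l) := by
  have h1 := congrArg conj (h.lev_eq_zero β A)
  simp only [lev_conj, map_neg, map_sum, map_mul] at h1
  have h2 : ∑ l, conj (k q β l) * -lev c q A (.inl l) =
      -∑ l, conj (k q β l) * lev c q A (.inl l) := by simp
  rw [h2] at h1
  linear_combination -h1

/-- The Levi form descends to `H / K₂` and its conjugate, where `redz` and `redzb` are coordinates.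
-/
lemma IsLeviAt.lev_reduce (h : IsLeviAt H c k q) (u v : Coord s r → ℂ) :
    ∑ A, ∑ B, dz A u * dzb B v * lev c q A B =
      ∑ j, ∑ l, redz (k q) j u * levZ c q j l * redzb (k q) l v := by
  have h1 : ∀ B, ∑ A, dz A u * lev c q A B = ∑ j, redz (k q) j u * lev c q (.inl j) B := by
    intro B
    simp only [Fintype.sum_sum_type, h.lev_eq_zero _ B, redz_apply, sub_mul,
      Finset.sum_sub_distrib, mul_neg, Finset.sum_neg_distrib, Finset.mul_sum, Finset.sum_mul]
    rw [Finset.sum_comm (s := Finset.univ (α := Fin r)), sub_eq_add_neg]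
    congr 2
    exact Finset.sum_congr rfl fun _ _ => Finset.sum_congr rfl fun _ _ => by ring
  have h2 : ∀ A, ∑ B, dzb B v * lev c q A B =
      ∑ l, redzb (k q) l v * lev c q A (.inl l) := by
    intro A
    simp only [Fintype.sum_sum_type, h.lev_eq_zero' A, redzb_apply, sub_mul,
      Finset.sum_sub_distrib, mul_neg, Finset.sum_neg_distrib, Finset.mul_sum, Finset.sum_mul]
    rw [Finset.sum_comm (s := Finset.univ (α := Fin r)), sub_eq_add_neg]
    congr 2
    exact Finset.sum_congr rfl fun _ _ => Finset.sum_congr rfl fun _ _ => by ring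
  calc ∑ A, ∑ B, dz A u * dzb B v * lev c q A B
      = ∑ B, dzb B v * ∑ A, dz A u * lev c q A B := by
        rw [Finset.sum_comm]
        simp only [Finset.mul_sum]
        exact Finset.sum_congr rfl fun _ _ => Finset.sum_congr rfl fun _ _ => by ring
    _ = ∑ j, redz (k q) j u * ∑ B, dzb B v * lev c q (.inl j) B := by
        simp only [h1, Finset.mul_sum]
        rw [Finset.sum_comm]
        exact Finset.sum_congr rfl fun _ _ => Finset.sum_congr rfl fun _ _ => by ring
    _ = _ := by
        simp only [h2, Finset.mul_sum, levZ, Matrix.of_apply]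
        exact Finset.sum_congr rfl fun _ _ => Finset.sum_congr rfl fun _ _ => by ring

/-- The algebraic conditions that characterize a graded frame. -/
structure IsAlgFrame (H : (Coord s r → ℝ) → Submodule ℂ (Coord s r → ℂ))
    (c : (Coord s r → ℝ) → Fin s ⊕ Fin r → ℂ) (k : (Coord s r → ℝ) → Fin r → Fin s → ℂ)
    (q : Coord s r → ℝ) (φ : GradedFrame (Coord s r) s) : Prop where
  g_ne : theta (c q) φ.g ≠ 0
  f_mem : ∀ j, φ.f j ∈ H q
  h_mem : ∀ j, φ.h j ∈ conjSub (H q)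
  eq : frameA (k q) φ * levZ c q * (frameB (k q) φ)ᵀ = (2 * Complex.I * theta (c q) φ.g) • 1

/-- The right side of the frame equation is a nonzero scalar matrix, so all three factors on the
left are invertible. The frame equation thereby contains the independence and spanning conditions.
-/
lemma IsAlgFrame.det_ne (h : IsAlgFrame H c k q φ) :
    (frameA (k q) φ).det ≠ 0 ∧ (levZ c q).det ≠ 0 ∧ (frameB (k q) φ).det ≠ 0 := by
  have h1 := congrArg Matrix.det h.eq
  rw [Matrix.det_mul, Matrix.det_mul, Matrix.det_transpose, Matrix.det_smul, Matrix.det_one,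
    mul_one] at h1
  have h2 : (2 * Complex.I * theta (c q) φ.g) ^ Fintype.card (Fin s) ≠ 0 :=
    pow_ne_zero _ (mul_ne_zero (mul_ne_zero two_ne_zero Complex.I_ne_zero) h.g_ne)
  rw [← h1] at h2
  exact ⟨left_ne_zero_of_mul (left_ne_zero_of_mul h2),
    right_ne_zero_of_mul (left_ne_zero_of_mul h2), right_ne_zero_of_mul h2⟩

lemma IsCRAt.exists_conj_section (h : IsCRAt H c q) {v : Coord s r → ℂ}
    (hv : v ∈ conjSub (H q)) :
    ∃ Y, IsSectionNear (fun x => conjSub (H x)) q Y ∧ Y q = v := by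
  have hv' : star v ∈ H q := hv
  refine ⟨_, (h.isSection_crVec_const fun A => dz A (star v)).star, ?_⟩
  simp only [← h.eq_crVec hv', star_star]

lemma IsCRAt.exists_section (h : IsCRAt H c q) {v : Coord s r → ℂ} (hv : v ∈ H q) :
    ∃ X, IsSectionNear H q X ∧ X q = v :=
  ⟨_, h.isSection_crVec_const fun A => dz A v, (h.eq_crVec hv).symm⟩

/-- Membership in `H ⊕ H̄` is tested by the contact form, so the bracket condition is an equation
between numbers that do not depend on the extending sections. By `lev_reduce` these numbers are the
entries of the frame equation. -/
lemma IsLeviAt.isGradedFrame_iff (h : IsLeviAt H c k q) :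
    IsGradedFrame H q φ ↔ IsAlgFrame H c k q φ := by
  have key : ∀ j l X Y, IsSectionNear H q X → X q = φ.f j →
      IsSectionNear (fun q => conjSub (H q)) q Y → Y q = φ.h l →
      (bracket X Y q - (if j = l then 2 * Complex.I else 0) • φ.g ∈ leviDist H q ↔
        (frameA (k q) φ * levZ c q * (frameB (k q) φ)ᵀ) j l =
          ((2 * Complex.I * theta (c q) φ.g) • (1 : Matrix (Fin s) (Fin s) ℂ)) j l) := by
    intro j l X Y hX hXj hY hYl
    have e1 : (frameA (k q) φ * levZ c q * (frameB (k q) φ)ᵀ) j l =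
        theta (c q) (bracket X Y q) := by
      rw [h.cr.theta_bracket_conj hX hY, h.lev_reduce, hXj, hYl]
      simp only [Matrix.mul_apply, Matrix.transpose_apply, frameA, frameB, Matrix.of_apply,
        Finset.sum_mul]
      rw [Finset.sum_comm]
    rw [h.cr.mem_leviDist_iff, map_sub, map_smul, sub_eq_zero, e1, Matrix.smul_apply,
      Matrix.one_apply]
    split_ifs <;> simp
  constructor
  · intro hφ
    have hf : ∀ j, φ.f j ∈ H q := fun j => by
      rw [← hφ.f_span]
      exact Submodule.mem_sup_right (Submodule.subset_span ⟨j, rfl⟩)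
    have hh : ∀ j, φ.h j ∈ conjSub (H q) := fun j => by
      rw [← hφ.h_span]
      exact Submodule.mem_sup_right (Submodule.subset_span ⟨j, rfl⟩)
    refine ⟨fun h0 => hφ.g_not_mem (h.cr.mem_leviDist_iff.2 h0), hf, hh, ?_⟩
    ext j l
    obtain ⟨X, hX, hXj⟩ := h.cr.exists_section (hf j)
    obtain ⟨Y, hY, hYl⟩ := h.cr.exists_conj_section (hh l)
    exact (key j l X Y hX hXj hY hYl).1 (hφ.bracket_eq j l X Y hX hXj hY hYl)
  · intro hφ
    obtain ⟨dA, -, dB⟩ := hφ.det_ne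
    have hF := linearIndependent_mkQ_and_span (ρ := redz (k q)) (fun v => h.mem_iff) hφ.f_mem dA
    have hG := linearIndependent_mkQ_and_span (ρ := redzb (k q)) (fun v => h.mem_conj_iff)
      hφ.h_mem dB
    refine ⟨fun h0 => hφ.g_ne (h.cr.mem_leviDist_iff.1 h0), ?_, hF.1, hF.2, hG.1, hG.2, ?_⟩
    · refine eq_top_iff.2 fun v _ => ?_
      rw [← sub_add_cancel v ((theta (c q) v / theta (c q) φ.g) • φ.g)]
      refine Submodule.add_mem_sup (h.cr.mem_leviDist_iff.2 ?_)
        (Submodule.smul_mem _ _ (Submodule.mem_span_singleton_self _))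
      rw [map_sub, map_smul, smul_eq_mul, div_mul_cancel₀ _ hφ.g_ne, sub_self]
    · intro j l X Y hX hXj hY hYl
      rw [key j l X Y hX hXj hY hYl, hφ.eq]

/-- A vector killed by the contact form is the sum of its `(1,0)` and `(0,1)` parts, and `redz` sees
only the first. -/
lemma IsLeviAt.mem_kernel_sup_iff (h : IsLeviAt H c k q) {v : Coord s r → ℂ} :
    v ∈ leviKernel H q ⊔ conjSub (H q) ↔ theta (c q) v = 0 ∧ ∀ j, redz (k q) j v = 0 := by
  constructor
  · intro hv
    obtain ⟨a, ha, b, hb, rfl⟩ := Submodule.mem_sup.1 hv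
    have ha' := h.mem_iff.1 ha
    have hb' := h.cr.mem_conj_iff.1 hb
    refine ⟨by rw [map_add, (h.cr.mem_iff.1 ha'.1).2, hb'.2, add_zero], fun j => ?_⟩
    rw [map_add, ha'.2, redz_apply]
    simp [hb'.1]
  · rintro ⟨h1, h2⟩
    have e : v = crVec (c q) (fun A => dz A v) + star (crVec (c q) (fun A => conj (dzb A v))) := by
      refine vec_ext (by simp [dz_star]) (by simp [dzb_star]) ?_
      rw [theta_apply] at h1
      simp only [map_add, du_crVec, du_star, map_sum, map_mul, Complex.conj_conj]
      linear_combination h1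
    rw [e]
    refine Submodule.add_mem_sup (h.mem_iff.2 ⟨h.cr.crVec_mem _, fun j => ?_⟩)
      (star_crVec_mem (h.cr.crVec_mem _))
    have := h2 j
    rw [redz_apply] at this ⊢
    simpa using this

lemma conjSub_conjSub {ι : Type} [Fintype ι] [DecidableEq ι] (D : Submodule ℂ (ι → ℂ)) :
    conjSub (conjSub D) = D := by
  ext v
  change star (star v) ∈ D ↔ v ∈ D
  rw [star_star]

lemma conjSub_sup {ι : Type} [Fintype ι] [DecidableEq ι] (D E : Submodule ℂ (ι → ℂ)) :
    conjSub (D ⊔ E) = conjSub D ⊔ conjSub E := by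
  have mono : ∀ {D E : Submodule ℂ (ι → ℂ)}, D ≤ E → conjSub D ≤ conjSub E :=
    fun h v hv => h hv
  refine le_antisymm ?_ (sup_le (mono le_sup_left) (mono le_sup_right))
  rw [← conjSub_conjSub (conjSub D ⊔ conjSub E)]
  refine mono (sup_le ?_ ?_)
  · rw [← conjSub_conjSub D]
    exact mono (by rw [conjSub_conjSub]; exact le_sup_left)
  · rw [← conjSub_conjSub E]
    exact mono (by rw [conjSub_conjSub]; exact le_sup_right)

lemma IsLeviAt.mem_conj_kernel_sup_iff (h : IsLeviAt H c k q) {v : Coord s r → ℂ} :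
    v ∈ conjSub (leviKernel H q) ⊔ H q ↔ theta (c q) v = 0 ∧ ∀ j, redzb (k q) j v = 0 := by
  have e : conjSub (leviKernel H q) ⊔ H q = conjSub (leviKernel H q ⊔ conjSub (H q)) := by
    rw [conjSub_sup, conjSub_conjSub]
  rw [e]
  change star v ∈ leviKernel H q ⊔ conjSub (H q) ↔ _
  rw [h.mem_kernel_sup_iff]
  simp [theta_star, redz_star]

/-- The matrices of `-h_m(k_αj)`. -/
def rPlus (k : (Coord s r → ℝ) → Fin r → Fin s → ℂ) (q : Coord s r → ℝ)
    (φ : GradedFrame (Coord s r) s) (α : Fin r) : Matrix (Fin s) (Fin s) ℂ :=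
  Matrix.of fun j m => -cderiv (fun x => k x α j) q (φ.h m)

/-- The matrices of `-f_m(k̄_αj)`. -/
def rMinus (k : (Coord s r → ℝ) → Fin r → Fin s → ℂ) (q : Coord s r → ℝ)
    (φ : GradedFrame (Coord s r) s) (α : Fin r) : Matrix (Fin s) (Fin s) ℂ :=
  Matrix.of fun j m => -cderiv (fun x => conj (k x α j)) q (φ.f m)

/-- The matrix of `ι` of the section of the Levi kernel extending `∂/∂ζ_α`. -/
def sPlus (k : (Coord s r → ℝ) → Fin r → Fin s → ℂ) (q : Coord s r → ℝ)
    (φ : GradedFrame (Coord s r) s) (α : Fin r) : Matrix (Fin s) (Fin s) ℂ :=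
  (frameA (k q) φ)ᵀ⁻¹ * rPlus k q φ α

/-- The matrix of `ι` of the conjugate of the section of the Levi kernel extending `∂/∂ζ_α`. -/
def sMinus (k : (Coord s r → ℝ) → Fin r → Fin s → ℂ) (q : Coord s r → ℝ)
    (φ : GradedFrame (Coord s r) s) (α : Fin r) : Matrix (Fin s) (Fin s) ℂ :=
  (frameB (k q) φ)ᵀ⁻¹ * rMinus k q φ α

lemma transpose_mul_eq_iff {A X R : Matrix (Fin s) (Fin s) ℂ} (hA : A.det ≠ 0) :
    Aᵀ * X = R ↔ X = Aᵀ⁻¹ * R := by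
  have hu : IsUnit (Aᵀ).det := by
    rw [Matrix.det_transpose]
    exact isUnit_iff_ne_zero.2 hA
  constructor
  · rintro rfl
    rw [← Matrix.mul_assoc, Matrix.nonsing_inv_mul _ hu, Matrix.one_mul]
  · rintro rfl
    rw [← Matrix.mul_assoc, Matrix.mul_nonsing_inv _ hu, Matrix.one_mul]

/-- The contact form of the bracket vanishes because `V` lies in `K₂`. What remains, by
`redz_bracket`, is a linear system with the invertible matrix `(frameA (k q) φ)ᵀ` and right side
built from the derivatives of `k` along the `h`-part of the frame. -/
lemma IsLeviAt.isIotaPlus_iff (h : IsLeviAt H c k q) (hφ : IsGradedFrame H q φ)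
    {V : (Coord s r → ℝ) → Coord s r → ℂ} (hV : IsSectionNear (leviKernel H) q V)
    {S : Matrix (Fin s) (Fin s) ℂ} :
    IsIotaPlus H q φ V S ↔ S = ∑ α, dz (.inr α) (V q) • sPlus k q φ α := by
  have ha := h.isGradedFrame_iff.1 hφ
  have e : ∑ α, dz (.inr α) (V q) • sPlus k q φ α =
      (frameA (k q) φ)ᵀ⁻¹ * ∑ α, dz (.inr α) (V q) • rPlus k q φ α := by
    simp only [sPlus, Matrix.mul_sum, Matrix.mul_smul]
  have key : ∀ m Y, IsSectionNear (fun q => conjSub (H q)) q Y → Y q = φ.h m →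
      (bracket V Y q - ∑ l, S l m • φ.f l ∈ leviKernel H q ⊔ conjSub (H q) ↔
        ∀ j, ((frameA (k q) φ)ᵀ * S) j m = (∑ α, dz (.inr α) (V q) • rPlus k q φ α) j m) := by
    intro m Y hY hYm
    rw [h.mem_kernel_sup_iff, map_sub, h.theta_bracket_eq_zero hV hY]
    simp only [map_sum, map_smul, (h.cr.mem_iff.1 (ha.f_mem _)).2, smul_zero,
      Finset.sum_const_zero, sub_zero, true_and, map_sub, h.redz_bracket hV hY, hYm]
    refine forall_congr' fun j => ?_
    rw [sub_eq_zero, eq_comm]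
    refine iff_of_eq (congrArg₂ _ ?_ ?_)
    · simp [Matrix.mul_apply, frameA, mul_comm]
    · simp [Matrix.sum_apply, rPlus]
  rw [e, ← transpose_mul_eq_iff ha.det_ne.1]
  constructor
  · intro hS
    ext j m
    obtain ⟨Y, hY, hYm⟩ := h.cr.exists_conj_section (ha.h_mem m)
    exact (key m Y hY hYm).1 (hS m Y hY hYm) j
  · intro hS m Y hY hYm
    exact (key m Y hY hYm).2 fun j => by rw [hS]

lemma IsLeviAt.theta_star_bracket_eq_zero (h : IsLeviAt H c k q)
    {X Y : (Coord s r → ℝ) → Coord s r → ℂ} (hX : IsSectionNear (leviKernel H) q X)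
    (hY : IsSectionNear H q Y) :
    theta (c q) (bracket (fun x => star (X x)) Y q) = 0 := by
  have hYs := hY.star
  have e := star_bracket hX.differentiableAt hYs.differentiableAt
  simp only [star_star] at e
  rw [← e, theta_star, h.theta_bracket_eq_zero hX hYs, map_zero]

lemma IsLeviAt.isIotaMinus_iff (h : IsLeviAt H c k q) (hφ : IsGradedFrame H q φ)
    {V : (Coord s r → ℝ) → Coord s r → ℂ} (hV : IsSectionNear (leviKernel H) q V)
    {T : Matrix (Fin s) (Fin s) ℂ} :
    IsIotaMinus H q φ V T ↔ T = ∑ α, conj (dz (.inr α) (V q)) • sMinus k q φ α := by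
  have ha := h.isGradedFrame_iff.1 hφ
  have e : ∑ α, conj (dz (.inr α) (V q)) • sMinus k q φ α =
      (frameB (k q) φ)ᵀ⁻¹ * ∑ α, conj (dz (.inr α) (V q)) • rMinus k q φ α := by
    simp only [sMinus, Matrix.mul_sum, Matrix.mul_smul]
  have key : ∀ m Y, IsSectionNear H q Y → Y q = φ.f m →
      (bracket (fun x => star (V x)) Y q - ∑ l, T l m • φ.h l ∈
        conjSub (leviKernel H q) ⊔ H q ↔ ∀ j, ((frameB (k q) φ)ᵀ * T) j m =
        (∑ α, conj (dz (.inr α) (V q)) • rMinus k q φ α) j m) := by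
    intro m Y hY hYm
    rw [h.mem_conj_kernel_sup_iff, map_sub, h.theta_star_bracket_eq_zero hV hY]
    simp only [map_sum, map_smul, (h.cr.mem_conj_iff.1 (ha.h_mem _)).2, smul_zero,
      Finset.sum_const_zero, sub_zero, true_and, map_sub, h.redzb_bracket hV hY, hYm]
    refine forall_congr' fun j => ?_
    rw [sub_eq_zero, eq_comm]
    refine iff_of_eq (congrArg₂ _ ?_ ?_)
    · simp [Matrix.mul_apply, frameB, mul_comm]
    · simp [Matrix.sum_apply, rMinus]
  rw [e, ← transpose_mul_eq_iff ha.det_ne.2.2]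
  constructor
  · intro hT
    ext j m
    obtain ⟨Y, hY, hYm⟩ := h.cr.exists_section (ha.f_mem m)
    exact (key m Y hY hYm).1 (hT m Y hY hYm) j
  · intro hT m Y hY hYm
    exact (key m Y hY hYm).2 fun j => by rw [hT]

end Frames

/-! ### The bigraded symbol in coordinates -/

section Symbol

variable {s r : ℕ} {H H' : (Coord s r → ℝ) → Submodule ℂ (Coord s r → ℂ)}
  {c c' : (Coord s r → ℝ) → Fin s ⊕ Fin r → ℂ} {k k' : (Coord s r → ℝ) → Fin r → Fin s → ℂ}
  {q : Coord s r → ℝ} {φ : GradedFrame (Coord s r) s}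

lemma theta_eq_du {c : Fin s ⊕ Fin r → ℂ} (hc : ∀ A, c A = 0) (v : Coord s r → ℂ) :
    theta c v = du v := by
  simp [theta_apply, hc]

/-- On the leaf `c` and `k` vanish for both structures and the Levi blocks agree, so the algebraic
frame conditions are the same. The contact form is `du` there, so the frame vectors have no `∂_u`
component and the derivatives of `k` along them agree by `SameLeaf.dk`. -/
lemma leaf_agree (h : LeafModel H c k) (h' : LeafModel H' c' k') (hs : SameLeaf c k c' k') :
    ∀ᶠ x in 𝓝 0, ∀ φ : GradedFrame (Coord s r) s,
      IsGradedFrame H (dilation 0 x) φ → IsGradedFrame H' (dilation 0 x) φ ∧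
      sPlus k (dilation 0 x) φ = sPlus k' (dilation 0 x) φ ∧
      sMinus k (dilation 0 x) φ = sMinus k' (dilation 0 x) φ := by
  have tend {P : (Coord s r → ℝ) → Prop} (hP : ∀ᶠ x in 𝓝 0, P x) :
      ∀ᶠ x in 𝓝 (0 : Coord s r → ℝ), P (dilation 0 x) :=
    (eventually_dilation hP).mono fun _ hx => hx.self_of_nhds
  filter_upwards [tend h.levi.eventually, tend h'.levi.eventually, h.c_leaf, h'.c_leaf, h.k_leaf,
    h'.k_leaf, hs.levZ, hs.dk] with x h1 h2 hc hc' hk hk' hl hd φ hφ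
  set q := dilation 0 x
  have ha := h1.isGradedFrame_iff.1 hφ
  have ec : c q = c' q := by funext A; rw [hc, hc']
  have ek : k q = k' q := by funext α j; rw [hk, hk']
  have duh : ∀ m, du (φ.h m) = 0 := fun m => by
    rw [← theta_eq_du hc]
    exact (h1.cr.mem_conj_iff.1 (ha.h_mem m)).2
  have duf : ∀ m, du (φ.f m) = 0 := fun m => by
    rw [← theta_eq_du hc]
    exact (h1.cr.mem_iff.1 (ha.f_mem m)).2
  refine ⟨h2.isGradedFrame_iff.2 ⟨?_, fun j => ?_, fun j => ?_, ?_⟩, ?_, ?_⟩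
  · rw [← ec]
    exact ha.g_ne
  · rw [h2.cr.mem_iff, ← ec, ← h1.cr.mem_iff]
    exact ha.f_mem j
  · rw [h2.cr.mem_conj_iff, ← ec, ← h1.cr.mem_conj_iff]
    exact ha.h_mem j
  · rw [← ec, ← ek, ← hl]
    exact ha.eq
  · funext α
    rw [sPlus, sPlus, ek]
    congr 1
    ext j m
    simp only [rPlus, Matrix.of_apply]
    rw [hd α j _ (duh m)]
  · funext α
    rw [sMinus, sMinus, ek]
    congr 1
    ext j m
    simp only [rMinus, Matrix.of_apply, cderiv_conj]
    rw [hd α j _ (by rw [du_star, duf, map_zero])]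

/-- The bigraded symbol in coordinates. -/
def leafSymbol (k : (Coord s r → ℝ) → Fin r → Fin s → ℂ) (φ : GradedFrame (Coord s r) s) :
    BigradedSymbol s where
  eps := conj (du φ.g) / du φ.g
  inv := Matrix.fromBlocks 0 ((frameA (k 0) φ)ᵀ⁻¹ * ((frameB (k 0) φ).map conj)ᵀ)
    ((frameB (k 0) φ)ᵀ⁻¹ * ((frameA (k 0) φ).map conj)ᵀ) 0
  gMinus := Submodule.span ℂ (Set.range (sMinus k 0 φ))
  gPlus := Submodule.span ℂ (Set.range (sPlus k 0 φ))

lemma IsLeviAt.mem_leafDist_iff (h : IsLeviAt H c k q) {v : Coord s r → ℂ} :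
    v ∈ leafDist H q ↔
      theta (c q) v = 0 ∧ (∀ j, redz (k q) j v = 0) ∧ ∀ j, redzb (k q) j v = 0 := by
  constructor
  · intro hv
    obtain ⟨a, ha, b, hb, rfl⟩ := Submodule.mem_sup.1 hv
    have ha' := h.mem_iff.1 ha
    have hb' := h.mem_conj_iff.1 hb
    have ha1 := h.cr.mem_iff.1 ha'.1
    have hb1 := h.cr.mem_conj_iff.1 hb'.1
    refine ⟨by rw [map_add, ha1.2, hb1.2, add_zero], fun j => ?_, fun j => ?_⟩
    · rw [map_add, ha'.2, redz_apply]
      simp [hb1.1]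
    · rw [map_add, hb'.2, redzb_apply]
      simp [ha1.1]
  · rintro ⟨h1, h2, h3⟩
    have e : v = crVec (c q) (fun A => dz A v) + star (crVec (c q) (fun A => conj (dzb A v))) := by
      refine vec_ext (by simp [dz_star]) (by simp [dzb_star]) ?_
      rw [theta_apply] at h1
      simp only [map_add, du_crVec, du_star, map_sum, map_mul, Complex.conj_conj]
      linear_combination h1
    rw [e]
    refine Submodule.add_mem_sup (h.mem_iff.2 ⟨h.cr.crVec_mem _, fun j => ?_⟩)
      (star_crVec_mem (h.mem_iff.2 ⟨h.cr.crVec_mem _, fun j => ?_⟩))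
    · have := h2 j
      rw [redz_apply] at this ⊢
      simpa using this
    · have := congrArg conj (h3 j)
      rw [redzb_apply] at this
      rw [redz_apply]
      simpa using this

lemma IsAlgFrame.redz_h (hl : IsLeviAt H c k q) (h : IsAlgFrame H c k q φ) (j l) :
    redz (k q) j (φ.h l) = 0 := by
  have := (hl.cr.mem_conj_iff.1 (h.h_mem l)).1
  simp [redz_apply, this]

lemma IsAlgFrame.redzb_f (hl : IsLeviAt H c k q) (h : IsAlgFrame H c k q φ) (j l) :
    redzb (k q) j (φ.f l) = 0 := by
  have := (hl.cr.mem_iff.1 (h.f_mem l)).1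
  simp [redzb_apply, this]

/-- Conjugation exchanges the two types, so the diagonal blocks vanish. The other two blocks express
the conjugate of one half of the frame in the other half. -/
lemma IsLeviAt.inv_iff (h : IsLeviAt H c k q) (hφ : IsAlgFrame H c k q φ)
    (J : Matrix (Fin s ⊕ Fin s) (Fin s ⊕ Fin s) ℂ) :
    (∀ m, star (φ.vec m) - ∑ l, J l m • φ.vec l ∈ leafDist H q) ↔
      J = Matrix.fromBlocks 0 ((frameA (k q) φ)ᵀ⁻¹ * ((frameB (k q) φ).map conj)ᵀ)
        ((frameB (k q) φ)ᵀ⁻¹ * ((frameA (k q) φ).map conj)ᵀ) 0 := by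
  have thf : ∀ m, theta (c q) (φ.f m) = 0 := fun m => (h.cr.mem_iff.1 (hφ.f_mem m)).2
  have thh : ∀ m, theta (c q) (φ.h m) = 0 := fun m => (h.cr.mem_conj_iff.1 (hφ.h_mem m)).2
  obtain ⟨dA, -, dB⟩ := hφ.det_ne
  have hl : ∀ m, star (φ.f m) - ∑ l, J l (.inl m) • φ.vec l ∈ leafDist H q ↔
      (∀ j, ((frameA (k q) φ)ᵀ * J.toBlocks₁₁) j m = (0 : Matrix (Fin s) (Fin s) ℂ) j m) ∧
      ∀ j, ((frameB (k q) φ)ᵀ * J.toBlocks₂₁) j m = ((frameA (k q) φ).map conj)ᵀ j m := by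
    intro m
    rw [h.mem_leafDist_iff]
    simp only [Fintype.sum_sum_type, GradedFrame.vec, Sum.elim_inl, Sum.elim_inr, map_sub, map_add,
      map_sum, map_smul, theta_star, thf, thh, hφ.redz_h h, hφ.redzb_f h, redz_star, redzb_star,
      smul_zero, Finset.sum_const_zero, map_zero, sub_zero, add_zero, zero_add, zero_sub, true_and]
    refine and_congr (forall_congr' fun j => ?_) (forall_congr' fun j => ?_)
    · rw [neg_eq_zero]
      refine iff_of_eq (congrArg (· = 0) ?_)
      simp [Matrix.mul_apply, frameA, Matrix.toBlocks₁₁, mul_comm]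
    · rw [sub_eq_zero, eq_comm]
      refine iff_of_eq (congrArg₂ _ ?_ ?_)
      · simp [Matrix.mul_apply, frameB, Matrix.toBlocks₂₁, mul_comm]
      · simp [frameA]
  have hr : ∀ m, star (φ.h m) - ∑ l, J l (.inr m) • φ.vec l ∈ leafDist H q ↔
      (∀ j, ((frameA (k q) φ)ᵀ * J.toBlocks₁₂) j m = ((frameB (k q) φ).map conj)ᵀ j m) ∧
      ∀ j, ((frameB (k q) φ)ᵀ * J.toBlocks₂₂) j m = (0 : Matrix (Fin s) (Fin s) ℂ) j m := by
    intro m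
    rw [h.mem_leafDist_iff]
    simp only [Fintype.sum_sum_type, GradedFrame.vec, Sum.elim_inl, Sum.elim_inr, map_sub, map_add,
      map_sum, map_smul, theta_star, thf, thh, hφ.redz_h h, hφ.redzb_f h, redz_star, redzb_star,
      smul_zero, Finset.sum_const_zero, map_zero, sub_zero, add_zero, zero_add, zero_sub, true_and]
    refine and_congr (forall_congr' fun j => ?_) (forall_congr' fun j => ?_)
    · rw [sub_eq_zero, eq_comm]
      refine iff_of_eq (congrArg₂ _ ?_ ?_)
      · simp [Matrix.mul_apply, frameA, Matrix.toBlocks₁₂, mul_comm]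
      · simp [frameB]
    · rw [neg_eq_zero]
      refine iff_of_eq (congrArg (· = 0) ?_)
      simp [Matrix.mul_apply, frameB, Matrix.toBlocks₂₂, mul_comm]
  have e11 := transpose_mul_eq_iff (X := J.toBlocks₁₁) (R := 0) dA
  have e12 := transpose_mul_eq_iff (X := J.toBlocks₁₂) (R := ((frameB (k q) φ).map conj)ᵀ) dA
  have e21 := transpose_mul_eq_iff (X := J.toBlocks₂₁) (R := ((frameA (k q) φ).map conj)ᵀ) dB
  have e22 := transpose_mul_eq_iff (X := J.toBlocks₂₂) (R := 0) dB
  rw [Matrix.mul_zero] at e11 e22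
  constructor
  · intro hJ
    rw [← Matrix.fromBlocks_toBlocks J, e11.1, e12.1, e21.1, e22.1]
    · ext j m; exact ((hr m).1 (hJ (.inr m))).2 j
    · ext j m; exact ((hl m).1 (hJ (.inl m))).2 j
    · ext j m; exact ((hr m).1 (hJ (.inr m))).1 j
    · ext j m; exact ((hl m).1 (hJ (.inl m))).1 j
  · intro hJ
    have f11 : J.toBlocks₁₁ = 0 := by rw [hJ, Matrix.toBlocks_fromBlocks₁₁]
    have f12 := congrArg Matrix.toBlocks₁₂ hJ
    have f21 := congrArg Matrix.toBlocks₂₁ hJ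
    have f22 : J.toBlocks₂₂ = 0 := by rw [hJ, Matrix.toBlocks_fromBlocks₂₂]
    rw [Matrix.toBlocks_fromBlocks₁₂] at f12
    rw [Matrix.toBlocks_fromBlocks₂₁] at f21
    rintro (m | m)
    · exact (hl m).2 ⟨fun j => by rw [e11.2 f11], fun j => by rw [e21.2 f21]⟩
    · exact (hr m).2 ⟨fun j => by rw [e12.2 f12], fun j => by rw [e22.2 f22]⟩

lemma sum_dz_kerVec_single (c : Fin s ⊕ Fin r → ℂ) (k : Fin r → Fin s → ℂ)
    {M : Type} [AddCommGroup M] [Module ℂ M] (f : Fin r → M) (β : Fin r) :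
    ∑ α, dz (.inr α) (kerVec c k (Pi.single β 1)) • f α = f β := by
  simp [Pi.single_apply]

lemma IsLeviAt.span_iotaPlus (h : IsLeviAt H c k q) (hφ : IsGradedFrame H q φ) :
    Submodule.span ℂ {S | ∃ V, IsSectionNear (leviKernel H) q V ∧ IsIotaPlus H q φ V S} =
      Submodule.span ℂ (Set.range (sPlus k q φ)) := by
  refine le_antisymm (Submodule.span_le.2 ?_) (Submodule.span_mono ?_)
  · rintro S ⟨V, hV, hS⟩
    rw [(h.isIotaPlus_iff hφ hV).1 hS]
    exact Submodule.sum_mem _ fun α _ =>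
      Submodule.smul_mem _ _ (Submodule.subset_span ⟨α, rfl⟩)
  · rintro _ ⟨β, rfl⟩
    have hV := h.isSection_kerVec_const (Pi.single β 1)
    exact ⟨_, hV, (h.isIotaPlus_iff hφ hV).2 (sum_dz_kerVec_single _ _ _ β).symm⟩

lemma IsLeviAt.span_iotaMinus (h : IsLeviAt H c k q) (hφ : IsGradedFrame H q φ) :
    Submodule.span ℂ {T | ∃ V, IsSectionNear (leviKernel H) q V ∧ IsIotaMinus H q φ V T} =
      Submodule.span ℂ (Set.range (sMinus k q φ)) := by
  refine le_antisymm (Submodule.span_le.2 ?_) (Submodule.span_mono ?_)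
  · rintro S ⟨V, hV, hS⟩
    rw [(h.isIotaMinus_iff hφ hV).1 hS]
    exact Submodule.sum_mem _ fun α _ =>
      Submodule.smul_mem _ _ (Submodule.subset_span ⟨α, rfl⟩)
  · rintro _ ⟨β, rfl⟩
    have hV := h.isSection_kerVec_const (Pi.single β 1)
    refine ⟨_, hV, (h.isIotaMinus_iff hφ hV).2 ?_⟩
    simp [Pi.single_apply]

lemma LeafModel.isBigradedSymbol_iff (h : LeafModel H c k) (hφ : IsGradedFrame H 0 φ)
    (B : BigradedSymbol s) : IsBigradedSymbol H 0 φ B ↔ B = leafSymbol k φ := by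
  have ha := h.levi.isGradedFrame_iff.1 hφ
  have hg := ha.g_ne
  rw [theta_eq_du h.c_zero] at hg
  have heps : star φ.g - B.eps • φ.g ∈ leviDist H 0 ↔ B.eps = (leafSymbol k φ).eps := by
    rw [h.levi.cr.mem_leviDist_iff, theta_eq_du h.c_zero, map_sub, map_smul, du_star, sub_eq_zero,
      smul_eq_mul, leafSymbol, eq_div_iff hg, eq_comm]
  constructor
  · rintro ⟨h1, h2, h3, h4⟩
    rw [heps] at h1
    rw [h.levi.inv_iff ha] at h2
    rw [h.levi.span_iotaMinus hφ] at h3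
    rw [h.levi.span_iotaPlus hφ] at h4
    obtain ⟨e, i, g, g'⟩ := B
    simp only at h1 h2 h3 h4
    rw [h1, h2, h3, h4]
    rfl
  · intro hB
    refine ⟨heps.2 (by rw [hB]), ?_, ?_, ?_⟩
    · rw [h.levi.inv_iff ha, hB, leafSymbol]
    · rw [h.levi.span_iotaMinus hφ, hB, leafSymbol]
    · rw [h.levi.span_iotaPlus hφ, hB, leafSymbol]

lemma SameLeaf.isGradedFrame (h : LeafModel H c k) (h' : LeafModel H' c' k')
    (hs : SameLeaf c k c' k') (hφ : IsGradedFrame H 0 φ) : IsGradedFrame H' 0 φ := by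
  have := (leaf_agree h h' hs).self_of_nhds φ
  rw [dilation_zero] at this
  exact (this hφ).1

lemma SameLeaf.leafSymbol_eq (h : LeafModel H c k) (h' : LeafModel H' c' k')
    (hs : SameLeaf c k c' k') (hφ : IsGradedFrame H 0 φ) : leafSymbol k φ = leafSymbol k' φ := by
  have := (leaf_agree h h' hs).self_of_nhds φ
  rw [dilation_zero] at this
  obtain ⟨-, h1, h2⟩ := this hφ
  have hk : k 0 = k' 0 := by
    funext α j
    rw [h.k_zero, h'.k_zero]
  rw [leafSymbol, leafSymbol, h1, h2, hk]

end Symbol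

/-! ### The obstructions in coordinates -/

section Obstruction

variable {s r : ℕ} {H : (Coord s r → ℝ) → Submodule ℂ (Coord s r → ℂ)}
  {c : (Coord s r → ℝ) → Fin s ⊕ Fin r → ℂ} {k : (Coord s r → ℝ) → Fin r → Fin s → ℂ}
  {q : Coord s r → ℝ} {φ : (Coord s r → ℝ) → GradedFrame (Coord s r) s}

/-- The entrywise derivative of a matrix function. -/
def matDeriv {m n : Type} (A : (Coord s r → ℝ) → Matrix m n ℂ) (q : Coord s r → ℝ)
    (v : Coord s r → ℂ) : Matrix m n ℂ :=
  Matrix.of fun i j => cderiv (fun x => A x i j) q v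

lemma matDeriv_congr {m n : Type} {A A' : (Coord s r → ℝ) → Matrix m n ℂ}
    (h : A =ᶠ[𝓝 q] A') (v : Coord s r → ℂ) : matDeriv A q v = matDeriv A' q v := by
  ext i j
  simp only [matDeriv, Matrix.of_apply]
  rw [cderiv_congr (h.mono fun x hx => by rw [hx])]

lemma matDeriv_sum_smul {m n : Type} {a : (Coord s r → ℝ) → Fin r → ℂ}
    {S : (Coord s r → ℝ) → Fin r → Matrix m n ℂ}
    (ha : ∀ α, DifferentiableAt ℝ (fun x => a x α) q)
    (hS : ∀ α i j, DifferentiableAt ℝ (fun x => S x α i j) q) (v : Coord s r → ℂ) :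
    matDeriv (fun x => ∑ α, a x α • S x α) q v =
      ∑ α, cderiv (fun x => a x α) q v • S q α +
        ∑ α, a q α • matDeriv (fun x => S x α) q v := by
  ext i j
  simp only [matDeriv, Matrix.sum_apply, Matrix.smul_apply, Matrix.of_apply, smul_eq_mul,
    Matrix.add_apply]
  have e := cderiv_sum Finset.univ (f := fun α x => a x α * S x α i j) (q := q)
    (fun α _ => (ha α).mul (hS α i j)) v
  rw [e, ← Finset.sum_add_distrib]
  exact Finset.sum_congr rfl fun α _ => cderiv_mul (ha α) (hS α i j) v

lemma matDeriv_sum_dir {m n : Type} (A : (Coord s r → ℝ) → Matrix m n ℂ) (w : Fin r → ℂ)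
    (e : Fin r → Coord s r → ℂ) :
    matDeriv A q (∑ β, w β • e β) = ∑ β, w β • matDeriv A q (e β) := by
  ext i j
  simp [matDeriv, Matrix.sum_apply]

lemma contDiffAt_matrix_mul {m : ℕ} {n : ℕ∞ω} {A B : (Coord s r → ℝ) → Matrix (Fin m) (Fin m) ℂ}
    (hA : ∀ i j, ContDiffAt ℝ n (fun y => A y i j) q)
    (hB : ∀ i j, ContDiffAt ℝ n (fun y => B y i j) q) (i j) :
    ContDiffAt ℝ n (fun y => (A y * B y) i j) q := by
  simp only [Matrix.mul_apply]
  exact ContDiffAt.sum fun l _ => (hA i l).mul (hB l j)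

lemma contDiffAt_redz (h : IsLeviAt H c k q) {n : ℕ∞ω} {V : (Coord s r → ℝ) → Coord s r → ℂ}
    (hV : ContDiffAt ℝ n V q) (j) : ContDiffAt ℝ n (fun x => redz (k x) j (V x)) q := by
  simp only [redz_apply]
  exact (contDiffAt_linear _ hV).sub
    (ContDiffAt.sum fun α _ => (h.contDiffAt α j).mul (contDiffAt_linear _ hV))

lemma contDiffAt_redzb (h : IsLeviAt H c k q) {n : ℕ∞ω} {V : (Coord s r → ℝ) → Coord s r → ℂ}
    (hV : ContDiffAt ℝ n V q) (j) : ContDiffAt ℝ n (fun x => redzb (k x) j (V x)) q := by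
  simp only [redzb_apply]
  exact (contDiffAt_linear _ hV).sub
    (ContDiffAt.sum fun α _ => (contDiffAt_conj (h.contDiffAt α j)).mul (contDiffAt_linear _ hV))

lemma IsFrameSection.contDiffAt_vec (hφ : IsFrameSection H q φ) (m) :
    ContDiffAt ℝ ∞ (fun x => (φ x).vec m) q := by
  obtain ⟨-, hf, hh, -⟩ := hφ.self_of_nhds
  rcases m with m | m
  · exact hf m
  · exact hh m

lemma IsFrameSection.differentiableAt_vec (hφ : IsFrameSection H q φ) (m) :
    DifferentiableAt ℝ (fun x => (φ x).vec m) q :=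
  (hφ.contDiffAt_vec m).differentiableAt (by simp)

lemma IsFrameSection.differentiableAt_sPlus (h : IsLeviAt H c k q) (hφ : IsFrameSection H q φ)
    (α i j) : DifferentiableAt ℝ (fun x => sPlus k x (φ x) α i j) q := by
  have ha := h.isGradedFrame_iff.1 hφ.self_of_nhds.2.2.2
  refine ContDiffAt.differentiableAt (n := (1 : ℕ∞)) ?_ (by simp)
  refine contDiffAt_matrix_mul (A := fun x => (frameA (k x) (φ x))ᵀ⁻¹) (fun i j => ?_)
    (fun i j => ?_) i j
  · refine contDiffAt_matrix_inv (M := fun x => (frameA (k x) (φ x))ᵀ) (fun i j => ?_) ?_ i j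
    · exact contDiffAt_redz h ((hφ.contDiffAt_vec (.inl j)).of_le (by simp)) i
    · rw [Matrix.det_transpose]
      exact ha.det_ne.1
  · exact (contDiffAt_cderiv (h.contDiffAt α i)
      ((hφ.contDiffAt_vec (.inr j)).of_le (by simp))).neg

lemma IsFrameSection.differentiableAt_sMinus (h : IsLeviAt H c k q) (hφ : IsFrameSection H q φ)
    (α i j) : DifferentiableAt ℝ (fun x => sMinus k x (φ x) α i j) q := by
  have ha := h.isGradedFrame_iff.1 hφ.self_of_nhds.2.2.2
  refine ContDiffAt.differentiableAt (n := (1 : ℕ∞)) ?_ (by simp)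
  refine contDiffAt_matrix_mul (A := fun x => (frameB (k x) (φ x))ᵀ⁻¹) (fun i j => ?_)
    (fun i j => ?_) i j
  · refine contDiffAt_matrix_inv (M := fun x => (frameB (k x) (φ x))ᵀ) (fun i j => ?_) ?_ i j
    · exact contDiffAt_redzb h ((hφ.contDiffAt_vec (.inr j)).of_le (by simp)) i
    · rw [Matrix.det_transpose]
      exact ha.det_ne.2.2
  · exact (contDiffAt_cderiv (contDiffAt_conj (h.contDiffAt α i))
      ((hφ.contDiffAt_vec (.inl j)).of_le (by simp))).neg

/-- At the origin `c` and `k` vanish, so `K₂` is spanned by the coordinate fields `∂/∂ζ_β`. -/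
lemma LeafModel.mem_leviKernel_iff (h : LeafModel H c k) {v : Coord s r → ℂ} :
    v ∈ leviKernel H 0 ↔ v = ∑ β, dz (.inr β) v • hol (.inr β) := by
  have e : ∀ w : Fin r → ℂ, kerVec (c 0) (k 0) w = ∑ β, w β • hol (.inr β) := by
    intro w
    refine vec_ext (fun A => ?_) (fun A => ?_) ?_
    · rcases A with j | α
      · simp [h.k_zero, hol]
      · simp [hol, Pi.single_apply]
    · simp [hol]
    · simp [kerVec, h.c_zero, hol]
  rw [← e]
  refine ⟨fun hv => h.levi.eq_kerVec hv, fun hv => ?_⟩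
  rw [hv]
  exact h.levi.kerVec_mem _

/-- Any section of `K₂` is a combination of the standard ones. Differentiating its coefficients
produces elements of `g₀,±₂`, which vanish in the quotient, so the standard sections determine
everything. The coefficients are conjugated in the `(0,-2)` part. -/
lemma LeafModel.hasObstruction_iff (h : LeafModel H c k) (hφ : IsFrameSection H 0 φ)
    {B : BigradedSymbol s} (hP : ∀ α, sPlus k 0 (φ 0) α ∈ B.gPlus)
    (hM : ∀ α, sMinus k 0 (φ 0) α ∈ B.gMinus) (O : Obstruction B) :
    HasObstruction H 0 B φ O ↔ ∀ α β,
      O.1 ⟨_, hP β⟩ ⟨_, hM α⟩ =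
        B.gMinus.mkQ (matDeriv (fun x => sMinus k x (φ x) α) 0 (hol (.inr β))) ∧
      O.2 ⟨_, hP β⟩ ⟨_, hP α⟩ =
        B.gPlus.mkQ (matDeriv (fun x => sPlus k x (φ x) α) 0 (hol (.inr β))) := by
  have hev : ∀ᶠ x in 𝓝 0, IsLeviAt H c k x ∧ IsGradedFrame H x (φ x) :=
    h.levi.eventually.and (hφ.mono fun x hx => hx.2.2.2)
  have hφ0 := hφ.self_of_nhds.2.2.2
  constructor
  · intro hO α β
    have hs : ∀ γ : Fin r, IsSectionNear (leviKernel H) 0 fun x =>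
        kerVec (c x) (k x) (Pi.single γ 1) := fun γ => h.levi.isSection_kerVec_const _
    have key := hO _ _ (fun x => sPlus k x (φ x) α) (fun x => sMinus k x (φ x) α) ⟨_, hP β⟩
      ⟨_, hP α⟩ ⟨_, hM α⟩ (hs α) (hs β) ?_ ?_ ?_ rfl rfl
    · have e : kerVec (c 0) (k 0) (Pi.single β 1) = hol (.inr β) := by
        rw [h.mem_leviKernel_iff.1 (h.levi.kerVec_mem _)]
        exact sum_dz_kerVec_single _ _ _ β
      simp only [e] at key
      exact key
    · exact (h.levi.isIotaPlus_iff hφ0 (hs β)).2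
        (sum_dz_kerVec_single _ _ (sPlus k 0 (φ 0)) β).symm
    · filter_upwards [hev, (hs α).eventually_nhds] with x hx hsx
      exact (hx.1.isIotaPlus_iff hx.2 hsx).2 (sum_dz_kerVec_single _ _ _ α).symm
    · filter_upwards [hev, (hs α).eventually_nhds] with x hx hsx
      refine (hx.1.isIotaMinus_iff hx.2 hsx).2 ?_
      simp [Pi.single_apply]
  · intro hO V W A C x a b hV hW hx hA hC hA0 hC0
    have hVd : ∀ α, DifferentiableAt ℝ (fun x => dz (.inr α) (V x)) 0 := fun α =>
      differentiableAt_linear _ hV.differentiableAt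
    have eA : A =ᶠ[𝓝 0] fun x => ∑ α, dz (.inr α) (V x) • sPlus k x (φ x) α := by
      filter_upwards [hA, hev, hV.eventually_nhds] with x h1 h2 h3
      exact (h2.1.isIotaPlus_iff h2.2 h3).1 h1
    have eC : C =ᶠ[𝓝 0] fun x => ∑ α, conj (dz (.inr α) (V x)) • sMinus k x (φ x) α := by
      filter_upwards [hC, hev, hV.eventually_nhds] with x h1 h2 h3
      exact (h2.1.isIotaMinus_iff h2.2 h3).1 h1
    have ex := (h.levi.isIotaPlus_iff hφ0 hW).1 hx
    have ex' : x = ∑ β, dz (.inr β) (W 0) • (⟨_, hP β⟩ : B.gPlus) := Subtype.ext (by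
      rw [ex]; simp)
    have ea' : a = ∑ α, dz (.inr α) (V 0) • (⟨_, hP α⟩ : B.gPlus) := Subtype.ext (by
      rw [← hA0, eA.self_of_nhds]; simp)
    have eb' : b = ∑ α, conj (dz (.inr α) (V 0)) • (⟨_, hM α⟩ : B.gMinus) := Subtype.ext (by
      rw [← hC0, eC.self_of_nhds]; simp)
    have eW := h.mem_leviKernel_iff.1 hW.self_of_nhds.2
    -- The Leibniz terms with differentiated coefficients lie in the subspaces that are factored
    -- out.
    have hz1 : B.gMinus.mkQ (∑ α, cderiv (fun x => conj (dz (.inr α) (V x))) 0 (W 0) •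
        sMinus k 0 (φ 0) α) = 0 := (Submodule.Quotient.mk_eq_zero _).2
      (Submodule.sum_mem _ fun α _ => Submodule.smul_mem _ _ (hM α))
    have hz2 : B.gPlus.mkQ (∑ α, cderiv (fun x => dz (.inr α) (V x)) 0 (W 0) •
        sPlus k 0 (φ 0) α) = 0 := (Submodule.Quotient.mk_eq_zero _).2
      (Submodule.sum_mem _ fun α _ => Submodule.smul_mem _ _ (hP α))
    constructor
    · change _ = B.gMinus.mkQ (matDeriv C 0 (W 0))
      rw [matDeriv_congr eC, matDeriv_sum_smul (fun α => differentiableAt_conj (hVd α))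
        (fun α i j => hφ.differentiableAt_sMinus h.levi α i j), map_add, hz1, zero_add, eW]
      simp only [matDeriv_sum_dir, ex', eb', map_sum, map_smul, LinearMap.sum_apply,
        LinearMap.smul_apply]
      refine Finset.sum_congr rfl fun α _ => congrArg _ ?_
      exact Finset.sum_congr rfl fun β _ => congrArg _ (hO α β).1
    · change _ = B.gPlus.mkQ (matDeriv A 0 (W 0))
      rw [matDeriv_congr eA, matDeriv_sum_smul hVd
        (fun α i j => hφ.differentiableAt_sPlus h.levi α i j), map_add, hz2, zero_add, eW]
      simp only [matDeriv_sum_dir, ex', ea', map_sum, map_smul, LinearMap.sum_apply,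
        LinearMap.smul_apply]
      refine Finset.sum_congr rfl fun α _ => congrArg _ ?_
      exact Finset.sum_congr rfl fun β _ => congrArg _ (hO α β).2

/-! ### Independence of the matrices -/

/-- `dilation 0` is a linear projection onto the leaf, and `v` is tangent to the leaf, so the
projection fixes `v`. -/
lemma cderiv_dilation_zero {f : (Coord s r → ℝ) → ℂ} (hf : DifferentiableAt ℝ f 0)
    {v : Coord s r → ℂ} (h1 : ∀ j, dz (.inl j) v = 0) (h2 : ∀ j, dzb (.inl j) v = 0)
    (h3 : du v = 0) : cderiv (fun x => f (dilation 0 x)) 0 v = cderiv f 0 v := by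
  have hl : ∀ i, v (.inl i) = 0 := by
    rw [← vecOf_components v]
    rintro (j | j) <;> simp [vecOf, h1, h2]
  have hu : v (.inr (.inr ())) = 0 := by
    rw [← vecOf_components v]
    simp [vecOf, h3]
  have e0 : dilationL (s := s) (r := r) 0 0 = 0 := map_zero _
  have key : ∀ i, v i • cderiv (fun x => f (dilationL 0 x)) 0 (Pi.single i 1) =
      v i • cderiv f 0 (Pi.single i 1) := by
    rintro (i | i | i)
    · rw [hl, zero_smul, zero_smul]
    · congr 1
      rw [cderiv_comp_clm _ _ (by rw [e0]; exact hf), e0, cderiv_ofReal_apply]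
      congr 1
      funext j
      rw [dilationL_apply]
      rcases j with j | j | j <;> simp [dilation, Pi.single_apply]
    · rw [hu, zero_smul, zero_smul]
  have hsum : v = ∑ i, v i • Pi.single i (1 : ℂ) := by
    funext j
    simp [Pi.single_apply]
  simp only [← dilationL_apply]
  rw [hsum, map_sum, map_sum]
  simp only [map_smul]
  exact Finset.sum_congr rfl fun i _ => key i

/-- Derivatives along the leaf depend only on the values on the leaf. -/
lemma cderiv_congr_leaf {f g : (Coord s r → ℝ) → ℂ} (hf : DifferentiableAt ℝ f 0)
    (hg : DifferentiableAt ℝ g 0) (h : ∀ᶠ x in 𝓝 0, f (dilation 0 x) = g (dilation 0 x))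
    {v : Coord s r → ℂ} (h1 : ∀ j, dz (.inl j) v = 0) (h2 : ∀ j, dzb (.inl j) v = 0)
    (h3 : du v = 0) : cderiv f 0 v = cderiv g 0 v := by
  rw [← cderiv_dilation_zero hf h1 h2 h3, ← cderiv_dilation_zero hg h1 h2 h3, cderiv_congr h]

lemma LeafModel.mem_leafDist_iff (h : LeafModel H c k) {v : Coord s r → ℂ} :
    v ∈ leafDist H 0 ↔ (∀ j, dz (.inl j) v = 0) ∧ (∀ j, dzb (.inl j) v = 0) ∧ du v = 0 := by
  rw [h.levi.mem_leafDist_iff, theta_eq_du h.c_zero]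
  simp only [redz_apply, redzb_apply, h.k_zero, zero_mul, map_zero, Finset.sum_const_zero,
    sub_zero]
  tauto

lemma LeafModel.cderiv_k_eq_zero (h : LeafModel H c k) {v : Coord s r → ℂ}
    (hv : v ∈ leafDist H 0) (α j) : cderiv (fun x => k x α j) 0 v = 0 := by
  obtain ⟨h1, h2, h3⟩ := h.mem_leafDist_iff.1 hv
  rw [cderiv_congr_leaf (h.levi.differentiableAt α j) (differentiableAt_const 0)
    (h.k_leaf.mono fun x hx => hx α j) h1 h2 h3, cderiv_const]

/-- The antiholomorphic derivatives of `k` are given by the third order form. -/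
lemma LeafModel.cderiv_k (h : LeafModel H c k) {w : Coord s r → ℂ} (hw : ∀ j, dz (.inl j) w = 0)
    (hu : du w = 0) (α : Fin r) (j : Fin s) :
    cderiv (fun x => k x α j) 0 w = ∑ l, dzb (.inl l) w * thirdForm c k 0 α j l := by
  have hleaf : ∀ β, cderiv (fun x => k x α j) 0 (crVec (c 0) (Pi.single (.inr β) 1)) = 0 := by
    intro β
    refine h.cderiv_k_eq_zero (h.mem_leafDist_iff.2 ⟨fun j => ?_, fun j => ?_, ?_⟩) α j
    · simp
    · simp
    · simp [h.c_zero]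
  have hleaf' : ∀ β,
      cderiv (fun x => k x α j) 0 (star (crVec (c 0) (Pi.single (.inr β) 1))) = 0 := by
    intro β
    refine h.cderiv_k_eq_zero (h.mem_leafDist_iff.2 ⟨fun j => ?_, fun j => ?_, ?_⟩) α j
    · simp [dz_star]
    · simp [dzb_star]
    · simp [du_star, h.c_zero]
  rw [cderiv_of_theta_eq_zero ((theta_eq_du h.c_zero w).trans hu)]
  simp [hw, hleaf, hleaf', thirdForm]

/-- At the origin a frame vector of type `(0,1)` is a combination of `∂/∂z̄_l` and `∂/∂ζ̄_β`. The
latter annihilate `k`, so only the third order form remains. -/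
lemma LeafModel.rPlus_zero (h : LeafModel H c k) {φ : GradedFrame (Coord s r) s}
    (hφ : IsGradedFrame H 0 φ) (α : Fin r) :
    rPlus k 0 φ α = -((Matrix.of (thirdForm c k 0 α) : Matrix (Fin s) (Fin s) ℂ) *
      (frameB (k 0) φ)ᵀ) := by
  have ha := h.levi.isGradedFrame_iff.1 hφ
  ext j m
  have hm := h.levi.cr.mem_conj_iff.1 (ha.h_mem m)
  rw [theta_eq_du h.c_zero] at hm
  simp only [rPlus, Matrix.of_apply, Matrix.neg_apply, Matrix.mul_apply, Matrix.transpose_apply,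
    frameB]
  rw [h.cderiv_k (fun _ => hm.1 _) hm.2]
  simp [redzb_apply, h.k_zero, mul_comm]

lemma LeafModel.rMinus_zero (h : LeafModel H c k) {φ : GradedFrame (Coord s r) s}
    (hφ : IsGradedFrame H 0 φ) (α : Fin r) :
    rMinus k 0 φ α = -((Matrix.of (thirdForm c k 0 α) : Matrix (Fin s) (Fin s) ℂ).map conj *
      (frameA (k 0) φ)ᵀ) := by
  have ha := h.levi.isGradedFrame_iff.1 hφ
  ext j m
  have hm := h.levi.cr.mem_iff.1 (ha.f_mem m)
  rw [theta_eq_du h.c_zero] at hm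
  simp only [rMinus, Matrix.of_apply, Matrix.neg_apply, Matrix.mul_apply, Matrix.transpose_apply,
    frameA, Matrix.map_apply, cderiv_conj]
  rw [h.cderiv_k (fun _ => by rw [dz_star, hm.1, map_zero]) (by rw [du_star, hm.2, map_zero])]
  simp [redz_apply, h.k_zero, mul_comm, dzb_star]

lemma linearIndependent_mul_mul {ι : Type} {A B : Matrix (Fin s) (Fin s) ℂ} (hA : A.det ≠ 0)
    (hB : B.det ≠ 0) {R : ι → Matrix (Fin s) (Fin s) ℂ} (hR : LinearIndependent ℂ R) :
    LinearIndependent ℂ fun α => A * R α * B := by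
  refine hR.map_injOn (LinearMap.mulRight ℂ B ∘ₗ LinearMap.mulLeft ℂ A) ?_
  refine Function.Injective.injOn fun X Y hXY => ?_
  have uA := (Matrix.isUnit_iff_isUnit_det A).2 (isUnit_iff_ne_zero.2 hA)
  have uB := (Matrix.isUnit_iff_isUnit_det B).2 (isUnit_iff_ne_zero.2 hB)
  exact uA.mul_left_cancel (uB.mul_right_cancel hXY)

lemma linearIndependent_map_conj {ι : Type} [Fintype ι] {R : ι → Matrix (Fin s) (Fin s) ℂ}
    (hR : LinearIndependent ℂ R) : LinearIndependent ℂ fun α => (R α).map conj := by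
  refine Fintype.linearIndependent_iff.2 fun g hg α => ?_
  have h1 : ∑ β, conj (g β) • R β = 0 := by
    ext i j
    have := congrArg conj (congrFun (congrFun hg i) j)
    simpa [Matrix.sum_apply] using this
  simpa using Fintype.linearIndependent_iff.1 hR _ h1 α

lemma LeafModel.linearIndependent_thirdForm (h : LeafModel H c k) :
    LinearIndependent ℂ fun α => (Matrix.of (thirdForm c k 0 α) : Matrix (Fin s) (Fin s) ℂ) :=
  h.indep

/-- The matrix of `ι` is the third order form multiplied on both sides by invertible matrices, so
2-nondegeneracy is the injectivity of `ι`. -/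
lemma LeafModel.linearIndependent_sPlus (h : LeafModel H c k) {φ : GradedFrame (Coord s r) s}
    (hφ : IsGradedFrame H 0 φ) : LinearIndependent ℂ (sPlus k 0 φ) := by
  have ha := (h.levi.isGradedFrame_iff.1 hφ).det_ne
  have hA : (-(frameA (k 0) φ)ᵀ⁻¹).det ≠ 0 := by
    rw [Matrix.det_neg, Matrix.det_nonsing_inv, Matrix.det_transpose]
    exact mul_ne_zero (pow_ne_zero _ (by norm_num)) (by simpa using ha.1)
  have hB : (frameB (k 0) φ)ᵀ.det ≠ 0 := by
    rw [Matrix.det_transpose]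
    exact ha.2.2
  convert linearIndependent_mul_mul hA hB h.linearIndependent_thirdForm using 1
  funext α
  rw [sPlus, h.rPlus_zero hφ, Matrix.mul_neg, Matrix.neg_mul, Matrix.neg_mul, Matrix.mul_assoc]

lemma LeafModel.linearIndependent_sMinus (h : LeafModel H c k) {φ : GradedFrame (Coord s r) s}
    (hφ : IsGradedFrame H 0 φ) : LinearIndependent ℂ (sMinus k 0 φ) := by
  have ha := (h.levi.isGradedFrame_iff.1 hφ).det_ne
  have hA : (-(frameB (k 0) φ)ᵀ⁻¹).det ≠ 0 := by
    rw [Matrix.det_neg, Matrix.det_nonsing_inv, Matrix.det_transpose]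
    exact mul_ne_zero (pow_ne_zero _ (by norm_num)) (by simpa using ha.2.2)
  have hB : (frameA (k 0) φ)ᵀ.det ≠ 0 := by
    rw [Matrix.det_transpose]
    exact ha.1
  convert linearIndependent_mul_mul hA hB
    (linearIndependent_map_conj h.linearIndependent_thirdForm) using 1
  funext α
  rw [sMinus, h.rMinus_zero hφ, Matrix.mul_neg, Matrix.neg_mul, Matrix.neg_mul, Matrix.mul_assoc]

lemma exists_bilinear {ι V W U : Type} [Fintype ι] [AddCommGroup V] [Module ℂ V] [AddCommGroup W]
    [Module ℂ W] [AddCommGroup U] [Module ℂ U] (b : Module.Basis ι ℂ V) (b' : Module.Basis ι ℂ W)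
    (D : ι → ι → U) : ∃ F : V →ₗ[ℂ] W →ₗ[ℂ] U, ∀ α β, F (b β) (b' α) = D α β :=
  ⟨b.constr ℂ fun β => b'.constr ℂ fun α => D α β, fun α β => by
    rw [Module.Basis.constr_basis, Module.Basis.constr_basis]⟩

/-- The matrices `sPlus` and `sMinus` form bases of `g₀,₂` and `g₀,₋₂`, so a bilinear map may be
prescribed on them freely. Without independence the prescribed values might be inconsistent. -/
lemma LeafModel.exists_obstruction (h : LeafModel H c k) (hφ : IsFrameSection H 0 φ) :
    ∃ O, HasObstruction H 0 (leafSymbol k (φ 0)) φ O := by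
  have hφ0 := hφ.self_of_nhds.2.2.2
  have hP : ∀ α, sPlus k 0 (φ 0) α ∈ (leafSymbol k (φ 0)).gPlus := fun α =>
    Submodule.subset_span ⟨α, rfl⟩
  have hM : ∀ α, sMinus k 0 (φ 0) α ∈ (leafSymbol k (φ 0)).gMinus := fun α =>
    Submodule.subset_span ⟨α, rfl⟩
  let b : Module.Basis (Fin r) ℂ (leafSymbol k (φ 0)).gPlus :=
    Module.Basis.span (h.linearIndependent_sPlus hφ0)
  let b' : Module.Basis (Fin r) ℂ (leafSymbol k (φ 0)).gMinus :=
    Module.Basis.span (h.linearIndependent_sMinus hφ0)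
  have hb : ∀ α, b α = ⟨_, hP α⟩ := fun α => Module.Basis.span_apply _ α
  have hb' : ∀ α, b' α = ⟨_, hM α⟩ := fun α => Module.Basis.span_apply _ α
  obtain ⟨F, hF⟩ := exists_bilinear b b' fun α β => (leafSymbol k (φ 0)).gMinus.mkQ
    (matDeriv (fun x => sMinus k x (φ x) α) 0 (hol (.inr β)))
  obtain ⟨G, hG⟩ := exists_bilinear b b fun α β => (leafSymbol k (φ 0)).gPlus.mkQ
    (matDeriv (fun x => sPlus k x (φ x) α) 0 (hol (.inr β)))
  refine ⟨(F, G), (h.hasObstruction_iff hφ hP hM _).2 fun α β => ⟨?_, ?_⟩⟩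
  · rw [← hb, ← hb']
    exact hF α β
  · rw [← hb, ← hb]
    exact hG α β

end Obstruction

/-! ### Extension of frames to sections -/

section Extension

variable {s r : ℕ} {H : (Coord s r → ℝ) → Submodule ℂ (Coord s r → ℂ)}
  {c : (Coord s r → ℝ) → Fin s ⊕ Fin r → ℂ} {k : (Coord s r → ℝ) → Fin r → Fin s → ℂ}
  {q : Coord s r → ℝ} {ψ : (Coord s r → ℝ) → GradedFrame (Coord s r) s}

/-- The matrix `b` that solves `a ℓ bᵀ = 2iθ(g)`, where `ℓ` is the Levi matrix. -/
def dualFrame (c : (Coord s r → ℝ) → Fin s ⊕ Fin r → ℂ)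
    (k : (Coord s r → ℝ) → Fin r → Fin s → ℂ) (q : Coord s r → ℝ)
    (φ : GradedFrame (Coord s r) s) : Matrix (Fin s) (Fin s) ℂ :=
  ((2 * Complex.I * theta (c q) φ.g) • ((levZ c q)⁻¹ * (frameA (k q) φ)⁻¹))ᵀ

/-- Corrects a field of frames to a section of the bundle of graded frames. -/
def adjustFrame (c : (Coord s r → ℝ) → Fin s ⊕ Fin r → ℂ)
    (k : (Coord s r → ℝ) → Fin r → Fin s → ℂ) (q : Coord s r → ℝ)
    (φ : GradedFrame (Coord s r) s) : GradedFrame (Coord s r) s where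
  g := φ.g
  f j := crVec (c q) fun A => dz A (φ.f j)
  h j := star (crVec (c q) (Sum.elim
    (fun l => conj (dualFrame c k q φ j l) + ∑ α, k q α l * conj (dzb (.inr α) (φ.h j)))
    fun α => conj (dzb (.inr α) (φ.h j))))

lemma frameA_adjustFrame (φ : GradedFrame (Coord s r) s) :
    frameA (k q) (adjustFrame c k q φ) = frameA (k q) φ := by
  ext j l
  simp [frameA, adjustFrame, redz_apply]

/-- The `ζ̄` components are kept, and the summand with `k` in `adjustFrame` is there to cancel in
`redzb`, which leaves exactly the block that solves the frame equation. -/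
lemma frameB_adjustFrame (φ : GradedFrame (Coord s r) s) :
    frameB (k q) (adjustFrame c k q φ) = dualFrame c k q φ := by
  ext j l
  simp [frameB, adjustFrame, redzb_apply, dzb_star]

lemma IsLeviAt.isGradedFrame_adjustFrame (h : IsLeviAt H c k q) {φ : GradedFrame (Coord s r) s}
    (hg : theta (c q) φ.g ≠ 0) (hA : (frameA (k q) φ).det ≠ 0) (hL : (levZ c q).det ≠ 0) :
    IsGradedFrame H q (adjustFrame c k q φ) := by
  refine h.isGradedFrame_iff.2 ⟨hg, fun j => h.cr.crVec_mem fun A => dz A (φ.f j),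
    fun j => star_crVec_mem (h.cr.crVec_mem _), ?_⟩
  rw [frameA_adjustFrame, frameB_adjustFrame, dualFrame, Matrix.transpose_transpose,
    Matrix.mul_smul, Matrix.mul_assoc, Matrix.mul_nonsing_inv_cancel_left _ _
    (isUnit_iff_ne_zero.2 hL), Matrix.mul_nonsing_inv _ (isUnit_iff_ne_zero.2 hA)]
  rfl

/-- The frame equation determines the `H̄`-block from `g` and the `H`-block, so nothing is changed
where the equation already holds. A field can thus be corrected off the leaf without touching its
values on the leaf. -/
lemma IsLeviAt.adjustFrame_eq (h : IsLeviAt H c k q) {φ : GradedFrame (Coord s r) s}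
    (hφ : IsGradedFrame H q φ) : adjustFrame c k q φ = φ := by
  have ha := h.isGradedFrame_iff.1 hφ
  obtain ⟨hA, hL, -⟩ := ha.det_ne
  have hb : dualFrame c k q φ = frameB (k q) φ := by
    have e := congrArg (fun M => (levZ c q)⁻¹ * ((frameA (k q) φ)⁻¹ * M)) ha.eq
    simp only [Matrix.mul_assoc] at e
    rw [Matrix.nonsing_inv_mul_cancel_left _ _ (isUnit_iff_ne_zero.2 hA),
      Matrix.nonsing_inv_mul_cancel_left _ _ (isUnit_iff_ne_zero.2 hL), Matrix.mul_smul,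
      Matrix.mul_smul, Matrix.mul_one] at e
    rw [dualFrame, ← e, Matrix.transpose_transpose]
  have hf : (adjustFrame c k q φ).f = φ.f := by
    funext j
    exact (h.cr.eq_crVec (ha.f_mem j)).symm
  have hh : (adjustFrame c k q φ).h = φ.h := by
    funext j
    have hj : star (φ.h j) ∈ H q := ha.h_mem j
    rw [← star_star (φ.h j), h.cr.eq_crVec hj]
    simp only [adjustFrame]
    congr 2
    funext A
    rcases A with l | α
    · rw [Sum.elim_inl, hb, frameB, Matrix.of_apply, redzb_apply, dz_star]
      simp
    · simp [dz_star]
  calc adjustFrame c k q φ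
      = ⟨φ.g, (adjustFrame c k q φ).f, (adjustFrame c k q φ).h⟩ := rfl
    _ = φ := by rw [hf, hh]

/-- A smooth field of vectors, not necessarily in the frame bundle. -/
def IsSmoothField (q : Coord s r → ℝ) (ψ : (Coord s r → ℝ) → GradedFrame (Coord s r) s) : Prop :=
  ∀ᶠ x in 𝓝 q, ContDiffAt ℝ ∞ (fun x => (ψ x).g) x ∧ (∀ j, ContDiffAt ℝ ∞ (fun x => (ψ x).f j) x) ∧
    ∀ j, ContDiffAt ℝ ∞ (fun x => (ψ x).h j) x

lemma IsFrameSection.isSmoothField (hψ : IsFrameSection H q ψ) : IsSmoothField q ψ :=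
  hψ.mono fun _ hx => ⟨hx.1, hx.2.1, hx.2.2.1⟩

lemma contDiffAt_theta (h : IsCRAt H c q) {n : ℕ∞ω} {V : (Coord s r → ℝ) → Coord s r → ℂ}
    (hV : ContDiffAt ℝ n V q) : ContDiffAt ℝ n (fun x => theta (c x) (V x)) q := by
  simp only [theta_apply]
  exact ((contDiffAt_linear _ hV).sub
    (ContDiffAt.sum fun A _ => (h.contDiffAt A).mul (contDiffAt_linear _ hV))).sub
    (ContDiffAt.sum fun A _ => (contDiffAt_conj (h.contDiffAt A)).mul (contDiffAt_linear _ hV))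

lemma contDiffAt_crVec (h : IsCRAt H c q) {n : ℕ∞ω} {a : (Coord s r → ℝ) → Fin s ⊕ Fin r → ℂ}
    (ha : ∀ A, ContDiffAt ℝ n (fun y => a y A) q) :
    ContDiffAt ℝ n (fun x => crVec (c x) (a x)) q := by
  refine contDiffAt_vecOf ha (fun A => contDiffAt_const) ?_
  exact ContDiffAt.sum fun A _ => (h.contDiffAt A).mul (ha A)

lemma contDiffAt_star {n : ℕ∞ω} {V : (Coord s r → ℝ) → Coord s r → ℂ} (hV : ContDiffAt ℝ n V q) :
    ContDiffAt ℝ n (fun x => star (V x)) q :=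
  contDiffAt_pi.2 fun i => contDiffAt_conj (contDiffAt_pi.1 hV i)

/-- The correction needs only `θ(g) ≠ 0` and two nonzero determinants. These hold at `q` because the
field is a frame there, and they persist nearby. -/
lemma IsLeviAt.isFrameSection_adjustFrame (h : IsLeviAt H c k q) (hψ : IsSmoothField q ψ)
    (hq : IsGradedFrame H q (ψ q)) : IsFrameSection H q fun x => adjustFrame c k x (ψ x) := by
  have ha := h.isGradedFrame_iff.1 hq
  obtain ⟨sg, sf, -⟩ := hψ.self_of_nhds
  have eg : ∀ᶠ x in 𝓝 q, theta (c x) (ψ x).g ≠ 0 :=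
    (contDiffAt_theta h.cr sg).continuousAt.eventually_ne ha.g_ne
  have eA : ∀ᶠ x in 𝓝 q, (frameA (k x) (ψ x)).det ≠ 0 :=
    eventually_det_ne_zero (fun i j => contDiffAt_redz h (sf i) j) ha.det_ne.1
  have eL : ∀ᶠ x in 𝓝 q, (levZ c x).det ≠ 0 :=
    eventually_det_ne_zero (n := ∞)
      (fun i j => (analyticAt_lev h.cr.analyticAt (.inl i) (.inl j)).contDiffAt) ha.det_ne.2.1
  filter_upwards [h.eventually, eg, eA, eL, hψ] with x hx hg hA hL ⟨sg, sf, sh⟩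
  refine ⟨sg, fun j => contDiffAt_crVec hx.cr fun A => contDiffAt_linear _ (sf j), fun j => ?_,
    hx.isGradedFrame_adjustFrame hg hA hL⟩
  refine contDiffAt_star (contDiffAt_crVec hx.cr fun A => ?_)
  rcases A with l | α
  · refine ContDiffAt.add (contDiffAt_conj ?_) (ContDiffAt.sum fun α _ => (hx.contDiffAt α l).mul
      (contDiffAt_conj (contDiffAt_linear _ (sh j))))
    refine (contDiffAt_const.mul (contDiffAt_theta hx.cr sg)).mul
      (contDiffAt_matrix_mul (A := fun x => (levZ c x)⁻¹) (B := fun x => (frameA (k x) (ψ x))⁻¹)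
        ?_ ?_ l j)
    · exact contDiffAt_matrix_inv
        (fun i j => (analyticAt_lev hx.cr.analyticAt (.inl i) (.inl j)).contDiffAt) hL
    · exact contDiffAt_matrix_inv (fun i j => contDiffAt_redz hx (sf i) j) hA
  · exact contDiffAt_conj (contDiffAt_linear _ (sh j))

/-- A smooth field of vectors that is a frame at `q` agrees with a section of the frame bundle
wherever it is a frame. -/
lemma IsLeviAt.exists_isFrameSection (h : IsLeviAt H c k q) (hψ : IsSmoothField q ψ)
    (hq : IsGradedFrame H q (ψ q)) : ∃ φ, IsFrameSection H q φ ∧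
      ∀ᶠ x in 𝓝 q, IsGradedFrame H x (ψ x) → φ x = ψ x :=
  ⟨_, h.isFrameSection_adjustFrame hψ hq, h.eventually.mono fun _ hx hf => hx.adjustFrame_eq hf⟩

lemma IsLeviAt.exists_isFrameSection_through (h : IsLeviAt H c k q)
    {φ₀ : GradedFrame (Coord s r) s} (hq : IsGradedFrame H q φ₀) :
    ∃ φ, IsFrameSection H q φ ∧ φ q = φ₀ := by
  obtain ⟨φ, hφ, he⟩ := h.exists_isFrameSection (ψ := fun _ => φ₀)
    (Filter.Eventually.of_forall fun x => ⟨contDiffAt_const, fun _ => contDiffAt_const,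
      fun _ => contDiffAt_const⟩) hq
  exact ⟨φ, hφ, he.self_of_nhds hq⟩

end Extension

/-! ### The derivative of a frame along the leaf -/

section IotaAlong

variable {s r : ℕ} {H : (Coord s r → ℝ) → Submodule ℂ (Coord s r → ℂ)}
  {c : (Coord s r → ℝ) → Fin s ⊕ Fin r → ℂ} {k : (Coord s r → ℝ) → Fin r → Fin s → ℂ}
  {q : Coord s r → ℝ} {φ : (Coord s r → ℝ) → GradedFrame (Coord s r) s} {v : Coord s r → ℂ}

/-- The transposed derivative of the `H / K₂` components of a frame, relative to the Levi leaf. -/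
def leafDerivA (k : (Coord s r → ℝ) → Fin r → Fin s → ℂ)
    (φ : (Coord s r → ℝ) → GradedFrame (Coord s r) s) (v : Coord s r → ℂ) :
    Matrix (Fin s) (Fin s) ℂ :=
  (matDeriv (fun x => frameA (k x) (φ x)) 0 v)ᵀ -
    ∑ α, dz (.inr α) v • Matrix.of fun j m => cderiv (fun x => k x α j) 0 ((φ 0).f m)

/-- The transposed derivative of the `H̄ / K̄₂` components of a frame, relative to the Levi leaf. -/
def leafDerivB (k : (Coord s r → ℝ) → Fin r → Fin s → ℂ)
    (φ : (Coord s r → ℝ) → GradedFrame (Coord s r) s) (v : Coord s r → ℂ) :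
    Matrix (Fin s) (Fin s) ℂ :=
  (matDeriv (fun x => frameB (k x) (φ x)) 0 v)ᵀ -
    ∑ α, dzb (.inr α) v • Matrix.of fun j m => cderiv (fun x => conj (k x α j)) 0 ((φ 0).h m)

/-- The matrix of `ι_φ̃(v)` in coordinates. -/
def iotaMat (k : (Coord s r → ℝ) → Fin r → Fin s → ℂ)
    (φ : (Coord s r → ℝ) → GradedFrame (Coord s r) s) (v : Coord s r → ℂ) :
    Matrix (Fin s ⊕ Fin s) (Fin s ⊕ Fin s) ℂ :=
  Matrix.fromBlocks ((frameA (k 0) (φ 0))ᵀ⁻¹ * leafDerivA k φ v)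
    (∑ α, dz (.inr α) v • sPlus k 0 (φ 0) α) (∑ α, dzb (.inr α) v • sMinus k 0 (φ 0) α)
    ((frameB (k 0) (φ 0))ᵀ⁻¹ * leafDerivB k φ v)

lemma eq_fromBlocks_iff {A B : Matrix (Fin s) (Fin s) ℂ} (hA : A.det ≠ 0) (hB : B.det ≠ 0)
    {J : Matrix (Fin s ⊕ Fin s) (Fin s ⊕ Fin s) ℂ} {R₁₁ R₁₂ R₂₁ R₂₂ : Matrix (Fin s) (Fin s) ℂ} :
    J = Matrix.fromBlocks (Aᵀ⁻¹ * R₁₁) (Aᵀ⁻¹ * R₁₂) (Bᵀ⁻¹ * R₂₁) (Bᵀ⁻¹ * R₂₂) ↔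
      (Aᵀ * J.toBlocks₁₁ = R₁₁ ∧ Aᵀ * J.toBlocks₁₂ = R₁₂) ∧
        Bᵀ * J.toBlocks₂₁ = R₂₁ ∧ Bᵀ * J.toBlocks₂₂ = R₂₂ := by
  rw [transpose_mul_eq_iff hA, transpose_mul_eq_iff hA, transpose_mul_eq_iff hB,
    transpose_mul_eq_iff hB]
  conv_lhs => rw [← Matrix.fromBlocks_toBlocks J, Matrix.fromBlocks_inj]
  tauto

/-- The section of the leaf distribution with constant coefficients. -/
def leafField (c : (Coord s r → ℝ) → Fin s ⊕ Fin r → ℂ)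
    (k : (Coord s r → ℝ) → Fin r → Fin s → ℂ) (v : Coord s r → ℂ) (x : Coord s r → ℝ) :
    Coord s r → ℂ :=
  kerVec (c x) (k x) (fun α => dz (.inr α) v) +
    star (kerVec (c x) (k x) fun α => conj (dzb (.inr α) v))

lemma dz_inl_leafField (x : Coord s r → ℝ) (j : Fin s) :
    dz (.inl j) (leafField c k v x) = ∑ α, dz (.inr α) v * k x α j := by
  simp [leafField, dz_star, mul_comm]

lemma dzb_inl_leafField (x : Coord s r → ℝ) (j : Fin s) :
    dzb (.inl j) (leafField c k v x) = ∑ α, dzb (.inr α) v * conj (k x α j) := by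
  simp [leafField, dzb_star, mul_comm]

lemma IsLeviAt.leafField_mem (h : IsLeviAt H c k q) : leafField c k v q ∈ leafDist H q :=
  Submodule.add_mem_sup (h.kerVec_mem _) (star_crVec_mem (h.kerVec_mem _))

lemma IsLeviAt.differentiableAt_leafField (h : IsLeviAt H c k q) :
    DifferentiableAt ℝ (leafField c k v) q :=
  (h.isSection_kerVec_const _).differentiableAt.add
    (h.isSection_kerVec_const _).star.differentiableAt

lemma LeafModel.leafField_zero (h : LeafModel H c k) (hv : v ∈ leafDist H 0) :
    leafField c k v 0 = v := by
  obtain ⟨h1, h2, h3⟩ := h.mem_leafDist_iff.1 hv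
  refine vec_ext (fun A => ?_) (fun A => ?_) ?_
  · rcases A with j | α
    · simp [dz_inl_leafField, h.k_zero, h1]
    · simp [leafField, dz_star]
  · rcases A with j | α
    · simp [dzb_inl_leafField, h.k_zero, h2]
    · simp [leafField, dzb_star]
  · rw [(h.mem_leafDist_iff.1 h.levi.leafField_mem).2.2, h3]

/-- The leaf field `V` satisfies `π_* V = 0`, hence `π_* [V, W] = V (π_* W)`. The defining equation
becomes a congruence modulo the kernel of `π_*`, which is the leaf distribution, and `π` disappears
from it. -/
lemma IsLeafProjection.isIotaAlong_iff {π : (Coord s r → ℝ) → Fin (2 * s + 1) → ℝ}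
    (hπ : IsLeafProjection H 0 π) (h : LeafModel H c k) (hφ : IsFrameSection H 0 φ)
    (hv : v ∈ leafDist H 0) (X : Matrix (Fin s ⊕ Fin s) (Fin s ⊕ Fin s) ℂ) :
    IsIotaAlong π 0 φ v X ↔ ∀ m, bracket (leafField c k v) (fun x => (φ x).vec m) 0 -
      ∑ l, X l m • (φ 0).vec l ∈ leafDist H 0 := by
  refine forall_congr' fun m => ?_
  obtain ⟨hd, hk, -⟩ := hπ.self_of_nhds
  have hW := hφ.differentiableAt_vec m
  have hc : ∀ i, ContDiffAt ℝ 2 (fun x => complexify π x i) 0 := fun i =>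
    (Complex.ofRealCLM.contDiff.contDiffAt.comp (0 : Coord s r → ℝ)
      (contDiffAt_pi.1 (contDiffAt_infty.1 hd 2) i) :)
  have hdiff : ∀ᶠ x in 𝓝 0, DifferentiableAt ℝ (complexify π) x := by
    filter_upwards [hπ] with x hx
    refine differentiableAt_pi.2 fun i => ?_
    exact (Complex.ofRealCLM.differentiableAt.comp x
      (differentiableAt_pi.1 (hx.1.differentiableAt (by simp)) i) :)
  have hdd : DifferentiableAt ℝ (fun q => cderiv (complexify π) q ((φ q).vec m)) 0 := by
    refine differentiableAt_pi.2 fun i => ?_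
    have e : (fun q => cderiv (complexify π) q ((φ q).vec m) i) =ᶠ[𝓝 0]
        fun q => cderiv (fun x => complexify π x i) q ((φ q).vec m) :=
      hdiff.mono fun x hx => cderiv_pi_apply hx _ _
    refine DifferentiableAt.congr_of_eventuallyEq ?_ e
    exact (contDiffAt_cderiv (n := 1) (by exact_mod_cast hc i)
      ((hφ.contDiffAt_vec m).of_le (by simp))).differentiableAt (by simp)
  have key : cderiv (complexify π) 0 (bracket (leafField c k v) (fun x => (φ x).vec m) 0) =
      cderiv (fun q => cderiv (complexify π) q ((φ q).vec m)) 0 v := by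
    funext i
    rw [cderiv_pi_apply hdiff.self_of_nhds, cderiv_pi_apply hdd,
      cderiv_bracket (hc i) h.levi.differentiableAt_leafField hW, h.leafField_zero hv]
    have e1 : (fun x => cderiv (fun x => complexify π x i) x (leafField c k v x)) =ᶠ[𝓝 0]
        fun _ => 0 := by
      filter_upwards [hπ, hdiff, h.levi.eventually] with x hx hx' hl
      rw [← cderiv_pi_apply hx', LinearMap.mem_ker.1 (hx.2.1.symm ▸ hl.leafField_mem)]
      rfl
    have e2 : (fun x => cderiv (fun x => complexify π x i) x ((φ x).vec m)) =ᶠ[𝓝 0]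
        fun q => cderiv (complexify π) q ((φ q).vec m) i :=
      hdiff.mono fun x hx => (cderiv_pi_apply hx _ _).symm
    rw [cderiv_congr e1, cderiv_const, sub_zero, cderiv_congr e2]
  rw [← hk, LinearMap.mem_ker, map_sub, key, map_sum, sub_eq_zero]
  simp only [map_smul]

lemma IsFrameSection.theta_vec (h : IsLeviAt H c k q) (hφ : IsFrameSection H q φ) (m) :
    ∀ᶠ x in 𝓝 q, theta (c x) ((φ x).vec m) = 0 := by
  filter_upwards [hφ, h.eventually] with x hx hl
  have ha := hl.isGradedFrame_iff.1 hx.2.2.2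
  rcases m with m | m
  · exact (hl.cr.mem_iff.1 (ha.f_mem m)).2
  · exact (hl.cr.mem_conj_iff.1 (ha.h_mem m)).2

/-- At the origin the Levi form vanishes as soon as one index is a `ζ` index, and `v` has no `z`
components. -/
lemma LeafModel.theta_bracket_leafField (h : LeafModel H c k) (hφ : IsFrameSection H 0 φ)
    (hv : v ∈ leafDist H 0) (m) :
    theta (c 0) (bracket (leafField c k v) (fun x => (φ x).vec m) 0) = 0 := by
  obtain ⟨h1, h2, -⟩ := h.mem_leafDist_iff.1 hv
  rw [h.levi.cr.theta_bracket h.levi.differentiableAt_leafField (hφ.differentiableAt_vec m)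
    (h.levi.eventually.mono fun x hx => (hx.mem_leafDist_iff.1 hx.leafField_mem).1)
    (hφ.theta_vec h.levi m), h.leafField_zero hv]
  refine Finset.sum_eq_zero fun A _ => Finset.sum_eq_zero fun B _ => ?_
  have l1 : ∀ α B, lev c 0 (.inr α) B = 0 := fun α B => by
    rw [h.levi.lev_eq_zero]
    simp [h.k_zero]
  have l2 : ∀ α B, lev c 0 B (.inr α) = 0 := fun α B => by
    rw [h.levi.lev_eq_zero']
    simp [h.k_zero]
  rcases A with i | α
  · rcases B with j | β
    · rw [h1, h2]
      ring
    · rw [l2, mul_zero]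
  · rw [l1, mul_zero]

/-- Since `k` vanishes on the leaf and `v` is tangent to it, `dz_j` may be replaced by `redz` under
the derivative. The subtracted sum is the derivative of the `z`-component of the leaf field. -/
lemma LeafModel.dz_bracket_leafField (h : LeafModel H c k) (hφ : IsFrameSection H 0 φ)
    (hv : v ∈ leafDist H 0) (j m) :
    dz (.inl j) (bracket (leafField c k v) (fun x => (φ x).vec m) 0) =
      cderiv (fun x => redz (k x) j ((φ x).vec m)) 0 v -
        ∑ α, dz (.inr α) v * cderiv (fun x => k x α j) 0 ((φ 0).vec m) := by
  obtain ⟨h1, h2, h3⟩ := h.mem_leafDist_iff.1 hv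
  rw [map_bracket _ h.levi.differentiableAt_leafField (hφ.differentiableAt_vec m),
    h.leafField_zero hv]
  simp only [dz_inl_leafField]
  congr 1
  · refine cderiv_congr_leaf (differentiableAt_linear _ (hφ.differentiableAt_vec m))
      ((contDiffAt_redz h.levi (hφ.contDiffAt_vec m) j).differentiableAt (by simp)) ?_ h1 h2 h3
    filter_upwards [h.k_leaf] with x hx
    simp [redz_apply, hx]
  · have e := cderiv_sum Finset.univ (f := fun α x => dz (.inr α) v * k x α j) (q := 0)
      (fun α _ => (h.levi.differentiableAt α j).const_mul _) ((φ 0).vec m)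
    rw [e]
    refine Finset.sum_congr rfl fun α _ => ?_
    rw [cderiv_mul (differentiableAt_const _) (h.levi.differentiableAt α j), cderiv_const]
    ring

lemma LeafModel.dzb_bracket_leafField (h : LeafModel H c k) (hφ : IsFrameSection H 0 φ)
    (hv : v ∈ leafDist H 0) (j m) :
    dzb (.inl j) (bracket (leafField c k v) (fun x => (φ x).vec m) 0) =
      cderiv (fun x => redzb (k x) j ((φ x).vec m)) 0 v -
        ∑ α, dzb (.inr α) v * cderiv (fun x => conj (k x α j)) 0 ((φ 0).vec m) := by
  obtain ⟨h1, h2, h3⟩ := h.mem_leafDist_iff.1 hv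
  have hkd := fun α => differentiableAt_conj (h.levi.differentiableAt α j)
  rw [map_bracket _ h.levi.differentiableAt_leafField (hφ.differentiableAt_vec m),
    h.leafField_zero hv]
  simp only [dzb_inl_leafField]
  congr 1
  · refine cderiv_congr_leaf (differentiableAt_linear _ (hφ.differentiableAt_vec m))
      ((contDiffAt_redzb h.levi (hφ.contDiffAt_vec m) j).differentiableAt (by simp)) ?_ h1 h2 h3
    filter_upwards [h.k_leaf] with x hx
    simp [redzb_apply, hx]
  · have e := cderiv_sum Finset.univ (f := fun α x => dzb (.inr α) v * conj (k x α j)) (q := 0)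
      (fun α _ => (hkd α).const_mul _) ((φ 0).vec m)
    rw [e]
    refine Finset.sum_congr rfl fun α _ => ?_
    rw [cderiv_mul (differentiableAt_const _) (hkd α), cderiv_const]
    ring

lemma IsFrameSection.cderiv_redz_h (h : IsLeviAt H c k q) (hφ : IsFrameSection H q φ) (j m) :
    cderiv (fun x => redz (k x) j ((φ x).h m)) q v = 0 := by
  rw [cderiv_congr (g := fun _ => 0), cderiv_const]
  filter_upwards [hφ, h.eventually] with x hx hl
  exact (hl.isGradedFrame_iff.1 hx.2.2.2).redz_h hl j m

lemma IsFrameSection.cderiv_redzb_f (h : IsLeviAt H c k q) (hφ : IsFrameSection H q φ) (j m) :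
    cderiv (fun x => redzb (k x) j ((φ x).f m)) q v = 0 := by
  rw [cderiv_congr (g := fun _ => 0), cderiv_const]
  filter_upwards [hφ, h.eventually] with x hx hl
  exact (hl.isGradedFrame_iff.1 hx.2.2.2).redzb_f hl j m

/-- The off-diagonal blocks are the matrices of `ι`, since the `redz` components of `h` and the
`redzb` components of `f` vanish identically. Only the diagonal blocks involve derivatives of the
section. The formula shows that `ι_φ̃(v)` exists, is unique and does not depend on `π`. -/
lemma LeafModel.isIotaAlong_iff (h : LeafModel H c k) {π : (Coord s r → ℝ) → Fin (2 * s + 1) → ℝ}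
    (hπ : IsLeafProjection H 0 π) (hφ : IsFrameSection H 0 φ) (hv : v ∈ leafDist H 0)
    {X : Matrix (Fin s ⊕ Fin s) (Fin s ⊕ Fin s) ℂ} :
    IsIotaAlong π 0 φ v X ↔ X = iotaMat k φ v := by
  have ha := h.levi.isGradedFrame_iff.1 hφ.self_of_nhds.2.2.2
  have e12 : ∑ α, dz (.inr α) v • sPlus k 0 (φ 0) α =
      (frameA (k 0) (φ 0))ᵀ⁻¹ * ∑ α, dz (.inr α) v • rPlus k 0 (φ 0) α := by
    simp only [sPlus, Matrix.mul_sum, Matrix.mul_smul]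
  have e21 : ∑ α, dzb (.inr α) v • sMinus k 0 (φ 0) α =
      (frameB (k 0) (φ 0))ᵀ⁻¹ * ∑ α, dzb (.inr α) v • rMinus k 0 (φ 0) α := by
    simp only [sMinus, Matrix.mul_sum, Matrix.mul_smul]
  have hmem : ∀ m, bracket (leafField c k v) (fun x => (φ x).vec m) 0 -
      ∑ l, X l m • (φ 0).vec l ∈ leafDist H 0 ↔
      (∀ j, ∑ l, X l m * redz (k 0) j ((φ 0).vec l) =
        cderiv (fun x => redz (k x) j ((φ x).vec m)) 0 v -
          ∑ α, dz (.inr α) v * cderiv (fun x => k x α j) 0 ((φ 0).vec m)) ∧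
      ∀ j, ∑ l, X l m * redzb (k 0) j ((φ 0).vec l) =
        cderiv (fun x => redzb (k x) j ((φ x).vec m)) 0 v -
          ∑ α, dzb (.inr α) v * cderiv (fun x => conj (k x α j)) 0 ((φ 0).vec m) := by
    intro m
    have hz : ∀ j (w : Coord s r → ℂ), redz (k 0) j w = dz (.inl j) w := fun j w => by
      simp [redz_apply, h.k_zero]
    have hzb : ∀ j (w : Coord s r → ℂ), redzb (k 0) j w = dzb (.inl j) w := fun j w => by
      simp [redzb_apply, h.k_zero]
    rw [h.levi.mem_leafDist_iff, map_sub, h.theta_bracket_leafField hφ hv m]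
    simp only [map_sum, map_smul, (hφ.theta_vec h.levi _).self_of_nhds, mul_zero,
      Finset.sum_const_zero, sub_zero, true_and, map_sub, hz, hzb, h.dz_bracket_leafField hφ hv,
      h.dzb_bracket_leafField hφ hv, smul_eq_mul]
    refine and_congr (forall_congr' fun j => ?_) (forall_congr' fun j => ?_)
    · rw [sub_eq_zero, eq_comm]
    · rw [sub_eq_zero, eq_comm]
  rw [hπ.isIotaAlong_iff h hφ hv, iotaMat, e12, e21, eq_fromBlocks_iff ha.det_ne.1 ha.det_ne.2.2]
  simp only [hmem]
  simp only [Sum.forall, Fintype.sum_sum_type, GradedFrame.vec, Sum.elim_inl, Sum.elim_inr,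
    ha.redz_h h.levi, ha.redzb_f h.levi, hφ.cderiv_redz_h h.levi, hφ.cderiv_redzb_f h.levi,
    mul_zero, Finset.sum_const_zero, add_zero, zero_add, zero_sub, forall_and]
  refine and_congr (and_congr ?_ ?_) (and_congr ?_ ?_)
  all_goals
    rw [← Matrix.ext_iff, forall_comm]
    refine forall_congr' fun j => forall_congr' fun m => iff_of_eq (congrArg₂ _ ?_ ?_)
  all_goals
    simp [Matrix.mul_apply, frameA, frameB, Matrix.toBlocks₁₁, Matrix.toBlocks₁₂,
      Matrix.toBlocks₂₁, Matrix.toBlocks₂₂, mul_comm, leafDerivA, leafDerivB, matDeriv,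
      Matrix.sum_apply, rPlus, rMinus]

end IotaAlong

/-! ### The involution on the degree zero part -/

section Involution

variable {s r : ℕ} {B : BigradedSymbol s}

lemma BigradedSymbol.conjEnd_add (B : BigradedSymbol s)
    (X Y : Matrix (Fin s ⊕ Fin s) (Fin s ⊕ Fin s) ℂ) :
    B.conjEnd (X + Y) = B.conjEnd X + B.conjEnd Y := by
  rw [conjEnd, conjEnd, conjEnd, ← Matrix.add_mul, ← Matrix.mul_add]
  congr 2
  ext i j
  simp

lemma BigradedSymbol.conjEnd_sub (B : BigradedSymbol s)
    (X Y : Matrix (Fin s ⊕ Fin s) (Fin s ⊕ Fin s) ℂ) :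
    B.conjEnd (X - Y) = B.conjEnd X - B.conjEnd Y := by
  rw [eq_sub_iff_add_eq, ← conjEnd_add, sub_add_cancel]

lemma BigradedSymbol.conjEnd_smul (B : BigradedSymbol s) (t : ℂ)
    (X : Matrix (Fin s ⊕ Fin s) (Fin s ⊕ Fin s) ℂ) :
    B.conjEnd (t • X) = conj t • B.conjEnd X := by
  rw [conjEnd, conjEnd, ← Matrix.smul_mul, ← Matrix.mul_smul]
  congr 2
  ext i j
  simp

lemma map_conj_mul {l m n : Type} [Fintype m] (X : Matrix l m ℂ) (Y : Matrix m n ℂ) :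
    (X * Y).map conj = X.map conj * Y.map conj :=
  Matrix.map_mul

lemma map_conj_map_conj {m n : Type} (X : Matrix m n ℂ) : (X.map conj).map conj = X := by
  ext i j
  simp

lemma map_conj_transpose {m n : Type} (X : Matrix m n ℂ) : Xᵀ.map conj = (X.map conj)ᵀ := rfl

lemma map_conj_add {m n : Type} (X Y : Matrix m n ℂ) :
    (X + Y).map conj = X.map conj + Y.map conj := by
  ext i j
  simp

lemma map_conj_smul {m n : Type} (a : ℂ) (X : Matrix m n ℂ) :
    (a • X).map conj = conj a • X.map conj := by
  ext i j
  simp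

lemma map_conj_neg {m n : Type} (X : Matrix m n ℂ) : (-X).map conj = -X.map conj := by
  ext i j
  simp

lemma BigradedSymbol.conjEnd_mul (hI : B.inv * B.inv.map conj = 1)
    (X Y : Matrix (Fin s ⊕ Fin s) (Fin s ⊕ Fin s) ℂ) :
    B.conjEnd (X * Y) = B.conjEnd X * B.conjEnd Y := by
  have hI' := mul_eq_one_comm.1 hI
  calc B.conjEnd (X * Y)
      = B.inv * X.map conj * 1 * Y.map conj * B.inv.map conj := by
        rw [conjEnd, map_conj_mul, Matrix.mul_one]
        simp only [Matrix.mul_assoc]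
    _ = B.conjEnd X * B.conjEnd Y := by
        rw [← hI', conjEnd, conjEnd]
        simp only [Matrix.mul_assoc]

lemma BigradedSymbol.conjEnd_conjEnd (hI : B.inv * B.inv.map conj = 1)
    (X : Matrix (Fin s ⊕ Fin s) (Fin s ⊕ Fin s) ℂ) : B.conjEnd (B.conjEnd X) = X := by
  calc B.conjEnd (B.conjEnd X)
      = (B.inv * B.inv.map conj) * X * (B.inv * B.inv.map conj) := by
        rw [conjEnd, conjEnd, map_conj_mul, map_conj_mul, map_conj_map_conj, map_conj_map_conj]
        simp only [Matrix.mul_assoc]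
    _ = X := by rw [hI, Matrix.one_mul, Matrix.mul_one]

lemma map_conj_sympl : (sympl s).map conj = sympl s := by
  rw [sympl, Matrix.fromBlocks_map]
  congr 1 <;> ext i j <;> simp [Matrix.one_apply, apply_ite]

/-- The involution rescales the symplectic form, which has real entries, so conjugation by it
preserves infinitesimal conformal symplectic maps. The scalar changes to its conjugate, as `conj μ`
is the inverse of `μ` unless `s = 0`. -/
lemma BigradedSymbol.conjEnd_mem_csp (hI : B.inv * B.inv.map conj = 1) {μ : ℂ}
    (hΩ : B.invᵀ * sympl s * B.inv = μ • sympl s)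
    {Y : Matrix (Fin s ⊕ Fin s) (Fin s ⊕ Fin s) ℂ} (hY : Y ∈ csp s) : B.conjEnd Y ∈ csp s := by
  obtain ⟨a, ha⟩ := hY
  set I := B.inv
  set J := B.inv.map conj
  have hJI : (J)ᵀ * Iᵀ = 1 := by rw [← Matrix.transpose_mul, hI, Matrix.transpose_one]
  have e1 : Iᵀ * sympl s = μ • (sympl s * J) := by
    calc Iᵀ * sympl s = Iᵀ * sympl s * (I * J) := by rw [hI, Matrix.mul_one]
      _ = (Iᵀ * sympl s * I) * J := by simp only [Matrix.mul_assoc]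
      _ = _ := by rw [hΩ, Matrix.smul_mul]
  have e2 : sympl s * I = μ • (Jᵀ * sympl s) := by
    calc sympl s * I = Jᵀ * Iᵀ * (sympl s * I) := by rw [hJI, Matrix.one_mul]
      _ = Jᵀ * (Iᵀ * sympl s * I) := by simp only [Matrix.mul_assoc]
      _ = _ := by rw [hΩ, Matrix.mul_smul]
  have e3 : Jᵀ * sympl s * J = conj μ • sympl s := by
    have := congrArg (fun X => X.map conj) hΩ
    simp only [map_conj_mul, map_conj_sympl, map_conj_smul, map_conj_transpose] at this
    exact this
  have e4 : (Y.map conj)ᵀ * sympl s + sympl s * Y.map conj = conj a • sympl s := by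
    have := congrArg (fun X => X.map conj) ha
    simp only [map_conj_mul, map_conj_sympl, map_conj_smul, map_conj_transpose,
      map_conj_add] at this
    exact this
  refine ⟨μ * (conj a * conj μ), ?_⟩
  calc (B.conjEnd Y)ᵀ * sympl s + sympl s * B.conjEnd Y
      = Jᵀ * (Y.map conj)ᵀ * (Iᵀ * sympl s) + (sympl s * I) * Y.map conj * J := by
        rw [conjEnd, Matrix.transpose_mul, Matrix.transpose_mul]
        simp only [Matrix.mul_assoc, I, J]
    _ = μ • (Jᵀ * ((Y.map conj)ᵀ * sympl s + sympl s * Y.map conj) * J) := by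
        rw [e1, e2, Matrix.mul_add, Matrix.add_mul, smul_add]
        simp only [Matrix.mul_smul, Matrix.smul_mul, Matrix.mul_assoc]
    _ = _ := by
        rw [e4, Matrix.mul_smul, Matrix.smul_mul, e3, smul_smul, smul_smul, mul_assoc]

/-- An antidiagonal involution keeps block diagonal maps block diagonal. It is compatible with
products and exchanges `g₀,₂` with `g₀,₋₂`, so it carries each of the two commutator conditions into
the other. -/
lemma BigradedSymbol.conjEnd_mem_gZero (hI : B.inv * B.inv.map conj = 1) {μ : ℂ}
    (hΩ : B.invᵀ * sympl s * B.inv = μ • sympl s) {J K : Matrix (Fin s) (Fin s) ℂ}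
    (hJK : B.inv = Matrix.fromBlocks 0 J K 0)
    (hP : ∀ S ∈ B.gPlus, ∃ T ∈ B.gMinus, B.conjEnd (plusBlock S) = minusBlock T)
    (hM : ∀ T ∈ B.gMinus, ∃ S ∈ B.gPlus, B.conjEnd (minusBlock T) = plusBlock S)
    {Y : Matrix (Fin s ⊕ Fin s) (Fin s ⊕ Fin s) ℂ} (hY : Y ∈ B.gZero) : B.conjEnd Y ∈ B.gZero := by
  obtain ⟨h1, h2, h3, h4, h5⟩ := hY
  have hd : B.conjEnd Y = Matrix.fromBlocks (J * Y.toBlocks₂₂.map conj * K.map conj) 0 0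
      (K * Y.toBlocks₁₁.map conj * J.map conj) := by
    rw [conjEnd, hJK]
    conv_lhs => rw [← Matrix.fromBlocks_toBlocks Y, h2, h3]
    simp [Matrix.fromBlocks_map, Matrix.fromBlocks_multiply]
  refine ⟨conjEnd_mem_csp hI hΩ h1, ?_, ?_, fun S hS => ?_, fun T hT => ?_⟩
  · rw [hd, Matrix.toBlocks_fromBlocks₁₂]
  · rw [hd, Matrix.toBlocks_fromBlocks₂₁]
  · obtain ⟨T, hT, e⟩ := hP S hS
    obtain ⟨T', hT', e'⟩ := h5 T hT
    obtain ⟨S', hS', e''⟩ := hM T' hT'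
    refine ⟨S', hS', ?_⟩
    rw [← e'', ← e', conjEnd_sub, conjEnd_mul hI, conjEnd_mul hI, ← e, conjEnd_conjEnd hI]
  · obtain ⟨S, hS, e⟩ := hM T hT
    obtain ⟨S', hS', e'⟩ := h4 S hS
    obtain ⟨T', hT', e''⟩ := hP S' hS'
    refine ⟨T', hT', ?_⟩
    rw [← e'', ← e', conjEnd_sub, conjEnd_mul hI, conjEnd_mul hI, ← e, conjEnd_conjEnd hI]

variable {H : (Coord s r → ℝ) → Submodule ℂ (Coord s r → ℂ)}
  {c : (Coord s r → ℝ) → Fin s ⊕ Fin r → ℂ} {k : (Coord s r → ℝ) → Fin r → Fin s → ℂ}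
  {q : Coord s r → ℝ} {φ : GradedFrame (Coord s r) s}

lemma levZ_map_conj (c : (Coord s r → ℝ) → Fin s ⊕ Fin r → ℂ) (q : Coord s r → ℝ) :
    (levZ c q).map conj = -(levZ c q)ᵀ := by
  ext i j
  exact lev_conj c q _ _

lemma map_conj_inv (A : Matrix (Fin s) (Fin s) ℂ) : A⁻¹.map conj = (A.map conj)⁻¹ := by
  have := Matrix.conjTranspose_nonsing_inv A
  have e := congrArg Matrix.transpose this
  rw [Matrix.transpose_nonsing_inv] at e
  exact e

lemma map_conj_det_ne {A : Matrix (Fin s) (Fin s) ℂ} (hA : A.det ≠ 0) :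
    (A.map conj).det ≠ 0 := by
  have : (A.map conj).det = conj A.det := ((starRingEnd ℂ).map_det A).symm
  rw [this]
  simpa using hA

/-- The off-diagonal block of the antilinear involution. -/
def invBlock (A B : Matrix (Fin s) (Fin s) ℂ) : Matrix (Fin s) (Fin s) ℂ :=
  Aᵀ⁻¹ * (B.map conj)ᵀ

lemma invBlock_mul_map_conj {A B : Matrix (Fin s) (Fin s) ℂ} (hA : A.det ≠ 0) (hB : B.det ≠ 0) :
    invBlock A B * (invBlock B A).map conj = 1 := by
  have uB := isUnit_iff_ne_zero.2 (map_conj_det_ne hB)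
  have uA := isUnit_iff_ne_zero.2 hA
  rw [← Matrix.det_transpose] at uA uB
  rw [invBlock, invBlock, map_conj_mul, map_conj_inv, map_conj_transpose, map_conj_transpose,
    map_conj_map_conj, Matrix.mul_assoc,
    Matrix.mul_nonsing_inv_cancel_left _ _ uB, Matrix.nonsing_inv_mul _ uA]

/-- The Levi block is skew-Hermitian, so the conjugate transpose of the frame equation is a second
equation, now with the conjugate scalar. Multiplying `A ℓ Āᵀ` by `Jᵀ` on the left and by `J̄` on the
right and comparing the two scalars gives the relation. -/
lemma IsAlgFrame.invBlock_transpose (h : IsAlgFrame H c k q φ) :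
    theta (c q) φ.g • (invBlock (frameA (k q) φ) (frameB (k q) φ))ᵀ =
      conj (theta (c q) φ.g) •
        (invBlock (frameA (k q) φ) (frameB (k q) φ)).map conj := by
  obtain ⟨dA, -, -⟩ := h.det_ne
  set A := frameA (k q) φ
  set B := frameB (k q) φ
  set J := invBlock A B
  have eJ : Aᵀ * J = (B.map conj)ᵀ := (transpose_mul_eq_iff dA).2 rfl
  have eJ1 : Jᵀ * A = B.map conj := by
    have := congrArg Matrix.transpose eJ
    rwa [Matrix.transpose_mul, Matrix.transpose_transpose, Matrix.transpose_transpose] at this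
  have eJ2 : (A.map conj)ᵀ * J.map conj = Bᵀ := by
    have := congrArg (fun X => X.map conj) eJ
    simp only [map_conj_mul, map_conj_transpose, map_conj_map_conj] at this
    exact this
  have e1 : A * levZ c q * (A.map conj)ᵀ * J.map conj =
      (2 * Complex.I * theta (c q) φ.g) • 1 := by
    rw [Matrix.mul_assoc, eJ2, h.eq]
  have e2 : Jᵀ * (A * levZ c q * (A.map conj)ᵀ) =
      (2 * Complex.I * conj (theta (c q) φ.g)) • 1 := by
    have := congrArg (fun X => (X.map conj)ᵀ) h.eq
    simp only [map_conj_mul, levZ_map_conj, Matrix.transpose_mul, Matrix.transpose_neg,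
      Matrix.transpose_transpose, map_conj_transpose, map_conj_smul] at this
    calc Jᵀ * (A * levZ c q * (A.map conj)ᵀ)
        = -(B.map conj * (-levZ c q * (A.map conj)ᵀ)) := by
          rw [← eJ1]
          simp only [Matrix.mul_assoc, Matrix.neg_mul, Matrix.mul_neg, neg_neg]
      _ = _ := by
          rw [this]
          simp [Matrix.map_one, Complex.conj_ofNat]
  have e3 := congrArg (fun X => Jᵀ * X) e1
  simp only [← Matrix.mul_assoc] at e3
  simp only [← Matrix.mul_assoc] at e2
  rw [e2, Matrix.smul_mul, Matrix.one_mul, Matrix.mul_smul, Matrix.mul_one,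
    mul_smul (2 * Complex.I), mul_smul (2 * Complex.I)] at e3
  exact (smul_right_injective _ (mul_ne_zero two_ne_zero Complex.I_ne_zero) e3).symm

lemma leafSymbol_inv (φ : GradedFrame (Coord s r) s) : (leafSymbol k φ).inv =
    Matrix.fromBlocks 0 (invBlock (frameA (k 0) φ) (frameB (k 0) φ))
      (invBlock (frameB (k 0) φ) (frameA (k 0) φ)) 0 := rfl

lemma IsAlgFrame.inv_mul_map_conj (h : IsAlgFrame H c k 0 φ) :
    (leafSymbol k φ).inv * (leafSymbol k φ).inv.map conj = 1 := by
  obtain ⟨dA, -, dB⟩ := h.det_ne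
  rw [leafSymbol_inv, Matrix.fromBlocks_map, Matrix.fromBlocks_multiply,
    invBlock_mul_map_conj dA dB, invBlock_mul_map_conj dB dA]
  simp

/-- This expresses that complex conjugation respects the Heisenberg bracket. The scalar records its
action in degree `-2` and the sign from conjugating `2i`. -/
lemma IsAlgFrame.inv_sympl (h : IsAlgFrame H c k 0 φ) :
    (leafSymbol k φ).invᵀ * sympl s * (leafSymbol k φ).inv =
      (-(conj (theta (c 0) φ.g) / theta (c 0) φ.g)) • sympl s := by
  obtain ⟨dA, -, dB⟩ := h.det_ne
  have hg := h.g_ne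
  have e := h.invBlock_transpose
  rw [leafSymbol_inv]
  set J := invBlock (frameA (k 0) φ) (frameB (k 0) φ)
  set K := invBlock (frameB (k 0) φ) (frameA (k 0) φ)
  have eKJ : K * J.map conj = 1 := invBlock_mul_map_conj dB dA
  have eJ : Jᵀ = (conj (theta (c 0) φ.g) / theta (c 0) φ.g) • J.map conj := by
    rw [div_eq_inv_mul, mul_smul, ← e, smul_smul, inv_mul_cancel₀ hg, one_smul]
  have e1 : Jᵀ * K = (conj (theta (c 0) φ.g) / theta (c 0) φ.g) • 1 := by
    rw [eJ, Matrix.smul_mul, mul_eq_one_comm.1 eKJ]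
  have e2 : Kᵀ * J = (conj (theta (c 0) φ.g) / theta (c 0) φ.g) • 1 := by
    have := congrArg Matrix.transpose e1
    rwa [Matrix.transpose_mul, Matrix.transpose_transpose, Matrix.transpose_smul,
      Matrix.transpose_one] at this
  rw [sympl, Matrix.fromBlocks_transpose, Matrix.fromBlocks_multiply,
    Matrix.fromBlocks_multiply, Matrix.fromBlocks_smul]
  simp [e1, e2]

lemma LeafModel.sPlus_eq (h : LeafModel H c k) (hφ : IsGradedFrame H 0 φ) (α : Fin r) :
    sPlus k 0 φ α = -((frameA (k 0) φ)ᵀ⁻¹ *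
      (Matrix.of (thirdForm c k 0 α) : Matrix (Fin s) (Fin s) ℂ) * (frameB (k 0) φ)ᵀ) := by
  rw [sPlus, h.rPlus_zero hφ, Matrix.mul_neg, Matrix.mul_assoc]

lemma LeafModel.sMinus_eq (h : LeafModel H c k) (hφ : IsGradedFrame H 0 φ) (α : Fin r) :
    sMinus k 0 φ α = -((frameB (k 0) φ)ᵀ⁻¹ *
      (Matrix.of (thirdForm c k 0 α) : Matrix (Fin s) (Fin s) ℂ).map conj *
        (frameA (k 0) φ)ᵀ) := by
  rw [sMinus, h.rMinus_zero hφ, Matrix.mul_neg, Matrix.mul_assoc]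

lemma invBlock_conj_mul {A B X : Matrix (Fin s) (Fin s) ℂ} (hA : A.det ≠ 0) (hB : B.det ≠ 0) :
    invBlock B A * (-(Aᵀ⁻¹ * X * Bᵀ)).map conj * (invBlock B A).map conj =
      -(Bᵀ⁻¹ * X.map conj * Aᵀ) := by
  have uA := isUnit_iff_ne_zero.2 (map_conj_det_ne hA)
  have uB := isUnit_iff_ne_zero.2 (map_conj_det_ne hB)
  rw [← Matrix.det_transpose] at uA uB
  rw [map_conj_neg, map_conj_mul, map_conj_mul, map_conj_inv, invBlock, map_conj_mul, map_conj_inv]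
  simp only [map_conj_transpose, map_conj_map_conj]
  simp only [Matrix.mul_neg, Matrix.neg_mul, Matrix.mul_assoc]
  rw [Matrix.mul_nonsing_inv_cancel_left _ _ uA, Matrix.mul_nonsing_inv_cancel_left _ _ uB]

/-- Conjugation replaces the third order form by its conjugate and exchanges the two frame blocks,
which is exactly how `sPlus` and `sMinus` differ. -/
lemma LeafModel.conjEnd_plusBlock (h : LeafModel H c k) (hφ : IsGradedFrame H 0 φ) (α : Fin r) :
    (leafSymbol k φ).conjEnd (plusBlock (sPlus k 0 φ α)) = minusBlock (sMinus k 0 φ α) := by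
  obtain ⟨dA, -, dB⟩ := (h.levi.isGradedFrame_iff.1 hφ).det_ne
  rw [BigradedSymbol.conjEnd, leafSymbol_inv, plusBlock, minusBlock, Matrix.fromBlocks_map,
    Matrix.fromBlocks_map, Matrix.fromBlocks_multiply, Matrix.fromBlocks_multiply,
    h.sMinus_eq hφ, ← invBlock_conj_mul dA dB, ← h.sPlus_eq hφ]
  simp

lemma conjEnd_gPlus {B : BigradedSymbol s} {S T : Fin r → Matrix (Fin s) (Fin s) ℂ}
    (hP : B.gPlus = Submodule.span ℂ (Set.range S)) (hM : B.gMinus = Submodule.span ℂ (Set.range T))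
    (hST : ∀ α, B.conjEnd (plusBlock (S α)) = minusBlock (T α)) :
    ∀ S ∈ B.gPlus, ∃ T ∈ B.gMinus, B.conjEnd (plusBlock S) = minusBlock T := by
  intro X hX
  rw [hP] at hX
  rw [hM]
  obtain ⟨a, rfl⟩ := (Submodule.mem_span_range_iff_exists_fun ℂ).1 hX
  refine ⟨∑ α, conj (a α) • T α, Submodule.sum_mem _ fun α _ =>
    Submodule.smul_mem _ _ (Submodule.subset_span ⟨α, rfl⟩), ?_⟩
  let F : Matrix (Fin s) (Fin s) ℂ →+ Matrix (Fin s ⊕ Fin s) (Fin s ⊕ Fin s) ℂ :=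
    { toFun := fun X => B.conjEnd (plusBlock X)
      map_zero' := by simp [plusBlock, BigradedSymbol.conjEnd]
      map_add' := fun X Y => by
        rw [← B.conjEnd_add]
        simp [plusBlock, Matrix.fromBlocks_add] }
  let G : Matrix (Fin s) (Fin s) ℂ →+ Matrix (Fin s ⊕ Fin s) (Fin s ⊕ Fin s) ℂ :=
    { toFun := minusBlock
      map_zero' := by simp [minusBlock]
      map_add' := fun X Y => by simp [minusBlock, Matrix.fromBlocks_add] }
  change F _ = G _
  rw [map_sum, map_sum]
  refine Finset.sum_congr rfl fun α _ => ?_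
  have e : minusBlock (conj (a α) • T α) = conj (a α) • minusBlock (T α) := by
    simp [minusBlock, Matrix.fromBlocks_smul]
  have e' : plusBlock (a α • S α) = a α • plusBlock (S α) := by
    simp [plusBlock, Matrix.fromBlocks_smul]
  change B.conjEnd (plusBlock (a α • S α)) = minusBlock (conj (a α) • T α)
  rw [e, e', B.conjEnd_smul, hST]

lemma conjEnd_gMinus {B : BigradedSymbol s} {S T : Fin r → Matrix (Fin s) (Fin s) ℂ}
    (hP : B.gPlus = Submodule.span ℂ (Set.range S)) (hM : B.gMinus = Submodule.span ℂ (Set.range T))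
    (hTS : ∀ α, B.conjEnd (minusBlock (T α)) = plusBlock (S α)) :
    ∀ T ∈ B.gMinus, ∃ S ∈ B.gPlus, B.conjEnd (minusBlock T) = plusBlock S := by
  intro X hX
  rw [hM] at hX
  rw [hP]
  obtain ⟨a, rfl⟩ := (Submodule.mem_span_range_iff_exists_fun ℂ).1 hX
  refine ⟨∑ α, conj (a α) • S α, Submodule.sum_mem _ fun α _ =>
    Submodule.smul_mem _ _ (Submodule.subset_span ⟨α, rfl⟩), ?_⟩
  let F : Matrix (Fin s) (Fin s) ℂ →+ Matrix (Fin s ⊕ Fin s) (Fin s ⊕ Fin s) ℂ :=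
    { toFun := fun X => B.conjEnd (minusBlock X)
      map_zero' := by simp [minusBlock, BigradedSymbol.conjEnd]
      map_add' := fun X Y => by
        rw [← B.conjEnd_add]
        simp [minusBlock, Matrix.fromBlocks_add] }
  let G : Matrix (Fin s) (Fin s) ℂ →+ Matrix (Fin s ⊕ Fin s) (Fin s ⊕ Fin s) ℂ :=
    { toFun := plusBlock
      map_zero' := by simp [plusBlock]
      map_add' := fun X Y => by simp [plusBlock, Matrix.fromBlocks_add] }
  change F _ = G _
  rw [map_sum, map_sum]
  refine Finset.sum_congr rfl fun α _ => ?_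
  have e : plusBlock (conj (a α) • S α) = conj (a α) • plusBlock (S α) := by
    simp [plusBlock, Matrix.fromBlocks_smul]
  have e' : minusBlock (a α • T α) = a α • minusBlock (T α) := by
    simp [minusBlock, Matrix.fromBlocks_smul]
  change B.conjEnd (minusBlock (a α • T α)) = plusBlock (conj (a α) • S α)
  rw [e, e', B.conjEnd_smul, hTS]

/-- The degree zero part of the bigraded symbol is invariant under the involution. -/
lemma LeafModel.conjEnd_mem_gZero (h : LeafModel H c k) (hφ : IsGradedFrame H 0 φ)
    {Y : Matrix (Fin s ⊕ Fin s) (Fin s ⊕ Fin s) ℂ} (hY : Y ∈ (leafSymbol k φ).gZero) :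
    (leafSymbol k φ).conjEnd Y ∈ (leafSymbol k φ).gZero := by
  have ha := h.levi.isGradedFrame_iff.1 hφ
  refine BigradedSymbol.conjEnd_mem_gZero ha.inv_mul_map_conj ha.inv_sympl (leafSymbol_inv φ)
    (conjEnd_gPlus (S := sPlus k 0 φ) (T := sMinus k 0 φ) rfl rfl (h.conjEnd_plusBlock hφ))
    (conjEnd_gMinus (S := sPlus k 0 φ) (T := sMinus k 0 φ) rfl rfl fun α => ?_) hY
  rw [← h.conjEnd_plusBlock hφ, BigradedSymbol.conjEnd_conjEnd ha.inv_mul_map_conj]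

end Involution

/-! ### Comparison of normalized sections -/

section Compare

variable {s r : ℕ} {H H' : (Coord s r → ℝ) → Submodule ℂ (Coord s r → ℂ)}
  {c c' : (Coord s r → ℝ) → Fin s ⊕ Fin r → ℂ} {k k' : (Coord s r → ℝ) → Fin r → Fin s → ℂ}
  {φ φ' : (Coord s r → ℝ) → GradedFrame (Coord s r) s} {v : Coord s r → ℂ}

lemma matDeriv_mul {q : Coord s r → ℝ} {A B : (Coord s r → ℝ) → Matrix (Fin s) (Fin s) ℂ}
    (hA : ∀ i j, DifferentiableAt ℝ (fun x => A x i j) q)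
    (hB : ∀ i j, DifferentiableAt ℝ (fun x => B x i j) q) (v : Coord s r → ℂ) :
    matDeriv (fun x => A x * B x) q v = matDeriv A q v * B q + A q * matDeriv B q v := by
  ext i j
  simp only [matDeriv, Matrix.of_apply, Matrix.mul_apply, Matrix.add_apply]
  have e := cderiv_sum Finset.univ (f := fun l x => A x i l * B x l j) (q := q)
    (fun l _ => (hA i l).mul (hB l j)) v
  rw [e, ← Finset.sum_add_distrib]
  exact Finset.sum_congr rfl fun l _ => cderiv_mul (hA i l) (hB l j) v

lemma IsFrameSection.differentiableAt_frameA (h : IsLeviAt H c k 0) (hφ : IsFrameSection H 0 φ)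
    (i j) : DifferentiableAt ℝ (fun x => frameA (k x) (φ x) i j) 0 :=
  (contDiffAt_redz h (hφ.contDiffAt_vec (.inl i)) j).differentiableAt (by simp)

lemma IsFrameSection.differentiableAt_frameB (h : IsLeviAt H c k 0) (hφ : IsFrameSection H 0 φ)
    (i j) : DifferentiableAt ℝ (fun x => frameB (k x) (φ x) i j) 0 :=
  (contDiffAt_redzb h (hφ.contDiffAt_vec (.inr i)) j).differentiableAt (by simp)

/-- Derivative of the frame equation. The middle term depends only on the value of the frame at `0`,
so it cancels between two sections with the same value. -/
lemma LeafModel.matDeriv_frame (h : LeafModel H c k) (hφ : IsFrameSection H 0 φ)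
    (v : Coord s r → ℂ) :
    matDeriv (fun x => frameA (k x) (φ x)) 0 v * levZ c 0 * (frameB (k 0) (φ 0))ᵀ +
      frameA (k 0) (φ 0) * matDeriv (levZ c) 0 v * (frameB (k 0) (φ 0))ᵀ +
      frameA (k 0) (φ 0) * levZ c 0 * (matDeriv (fun x => frameB (k x) (φ x)) 0 v)ᵀ =
    (2 * Complex.I * cderiv (fun x => theta (c x) (φ x).g) 0 v) • 1 := by
  have hA := hφ.differentiableAt_frameA h.levi
  have hB := hφ.differentiableAt_frameB h.levi
  have hL : ∀ i j, DifferentiableAt ℝ (fun x => levZ c x i j) 0 := fun i j =>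
    (analyticAt_lev h.levi.cr.analyticAt (.inl i) (.inl j)).differentiableAt
  have hAL : ∀ i j, DifferentiableAt ℝ (fun x => (frameA (k x) (φ x) * levZ c x) i j) 0 := by
    intro i j
    simp only [Matrix.mul_apply]
    exact DifferentiableAt.fun_sum fun l _ => (hA i l).mul (hL l j)
  have hg : DifferentiableAt ℝ (fun x => theta (c x) (φ x).g) 0 :=
    (contDiffAt_theta h.levi.cr hφ.self_of_nhds.1).differentiableAt (by simp)
  have e : (fun x => frameA (k x) (φ x) * levZ c x * (frameB (k x) (φ x))ᵀ) =ᶠ[𝓝 0]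
      fun x => (2 * Complex.I * theta (c x) (φ x).g) • 1 := by
    filter_upwards [hφ, h.levi.eventually] with x hx hl
    exact (hl.isGradedFrame_iff.1 hx.2.2.2).eq
  have e1 := matDeriv_congr e v
  rw [matDeriv_mul (A := fun x => frameA (k x) (φ x) * levZ c x)
    (B := fun x => (frameB (k x) (φ x))ᵀ) hAL (fun i j => hB j i), matDeriv_mul hA hL,
    Matrix.add_mul] at e1
  refine e1.trans ?_
  ext i j
  simp only [matDeriv, Matrix.of_apply, Matrix.smul_apply, smul_eq_mul]
  have e2 := cderiv_mul hg
    (differentiableAt_const (2 * Complex.I * (1 : Matrix (Fin s) (Fin s) ℂ) i j)) v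
  rw [cderiv_const] at e2
  have e3 : (fun x => 2 * Complex.I * theta (c x) (φ x).g * (1 : Matrix (Fin s) (Fin s) ℂ) i j) =
      fun x => theta (c x) (φ x).g * (2 * Complex.I * (1 : Matrix (Fin s) (Fin s) ℂ) i j) := by
    funext x
    ring
  rw [e3, e2]
  ring

lemma cderiv_sub_vec_eq_zero {l : (Coord s r → ℂ) →ₗ[ℂ] ℂ} {V V' : (Coord s r → ℝ) → Coord s r → ℂ}
    (hV : DifferentiableAt ℝ V 0) (hV' : DifferentiableAt ℝ V' 0)
    (he : ∀ᶠ x in 𝓝 0, l (V (dilation 0 x)) = l (V' (dilation 0 x)))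
    (h1 : ∀ j, dz (.inl j) v = 0) (h2 : ∀ j, dzb (.inl j) v = 0) (h3 : du v = 0) :
    l (cderiv V 0 v - cderiv V' 0 v) = 0 := by
  rw [map_sub, map_cderiv l hV, map_cderiv l hV', sub_eq_zero]
  exact cderiv_congr_leaf (differentiableAt_linear l hV) (differentiableAt_linear l hV') he h1 h2 h3

lemma IsFrameSection.eventually_leaf_algFrame (h : LeafModel H c k) (hφ : IsFrameSection H 0 φ) :
    ∀ᶠ x in 𝓝 0, IsLeviAt H c k (dilation 0 x) ∧
      IsAlgFrame H c k (dilation 0 x) (φ (dilation 0 x)) := by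
  filter_upwards [eventually_dilation h.levi.eventually, eventually_dilation hφ] with x h1 h2
  exact ⟨h1.self_of_nhds, h1.self_of_nhds.isGradedFrame_iff.1 h2.self_of_nhds.2.2.2⟩

lemma LeafModel.matDeriv_rPlus_sub (h : LeafModel H c k) (hφ : IsFrameSection H 0 φ)
    (hφ' : IsFrameSection H 0 φ') (he : φ 0 = φ' 0) (hv : v ∈ leafDist H 0) (α : Fin r) :
    matDeriv (fun x => rPlus k x (φ x) α) 0 v - matDeriv (fun x => rPlus k x (φ' x) α) 0 v =
      -((Matrix.of (thirdForm c k 0 α) : Matrix (Fin s) (Fin s) ℂ) *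
        (matDeriv (fun x => frameB (k x) (φ x)) 0 v -
          matDeriv (fun x => frameB (k x) (φ' x)) 0 v)ᵀ) := by
  obtain ⟨h1, h2, h3⟩ := h.mem_leafDist_iff.1 hv
  have hk : ∀ j, ContDiffAt ℝ 2 (fun x => k x α j) 0 := h.levi.contDiffAt α
  ext j m
  have hd := hφ.differentiableAt_vec (.inr m)
  have hd' := hφ'.differentiableAt_vec (.inr m)
  -- Along the leaf both frame vectors are of type `(0,1)` without `∂_u` component, hence so is the
  -- difference `w` of their derivatives. The second derivatives of `k` occur with equal frozen
  -- vectors and cancel, and `cderiv_k` evaluates `k` on `w`.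
  set w := cderiv (fun x => (φ x).vec (.inr m)) 0 v - cderiv (fun x => (φ' x).vec (.inr m)) 0 v
  have hw : ∀ l, dz (.inl l) w = 0 := fun l => by
    refine cderiv_sub_vec_eq_zero hd hd' ?_ h1 h2 h3
    filter_upwards [hφ.eventually_leaf_algFrame h, hφ'.eventually_leaf_algFrame h] with x hx hx'
    exact ((hx.1.cr.mem_conj_iff.1 (hx.2.h_mem m)).1 _).trans
      ((hx'.1.cr.mem_conj_iff.1 (hx'.2.h_mem m)).1 _).symm
  have hu : du w = 0 := by
    refine cderiv_sub_vec_eq_zero hd hd' ?_ h1 h2 h3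
    filter_upwards [hφ.eventually_leaf_algFrame h, hφ'.eventually_leaf_algFrame h, h.c_leaf]
      with x hx hx' hc
    rw [← theta_eq_du hc, ← theta_eq_du hc]
    exact ((hx.1.cr.mem_conj_iff.1 (hx.2.h_mem m)).2).trans
      ((hx'.1.cr.mem_conj_iff.1 (hx'.2.h_mem m)).2).symm
  have hb : ∀ l, dzb (.inl l) w = matDeriv (fun x => frameB (k x) (φ x)) 0 v m l -
      matDeriv (fun x => frameB (k x) (φ' x)) 0 v m l := by
    intro l
    rw [map_sub, map_cderiv _ hd, map_cderiv _ hd']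
    simp only [matDeriv, Matrix.of_apply]
    congr 1
    · refine cderiv_congr_leaf (differentiableAt_linear _ hd)
        (hφ.differentiableAt_frameB h.levi m l) ?_ h1 h2 h3
      filter_upwards [h.k_leaf] with x hx
      simp [frameB, redzb_apply, hx, GradedFrame.vec]
    · refine cderiv_congr_leaf (differentiableAt_linear _ hd')
        (hφ'.differentiableAt_frameB h.levi m l) ?_ h1 h2 h3
      filter_upwards [h.k_leaf] with x hx
      simp [frameB, redzb_apply, hx, GradedFrame.vec]
  have e1 := cderiv_cderiv_field (hk j) hd v
  have e2 := cderiv_cderiv_field (hk j) hd' v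
  have e0 : (φ 0).vec (.inr m) = (φ' 0).vec (.inr m) := by rw [he]
  simp only [e0] at e1
  have e3 := h.cderiv_k hw hu α j
  rw [map_sub] at e3
  have e4 : ∀ ψ : (Coord s r → ℝ) → GradedFrame (Coord s r) s,
      matDeriv (fun x => rPlus k x (ψ x) α) 0 v j m =
        -cderiv (fun x => cderiv (fun y => k y α j) x ((ψ x).vec (.inr m))) 0 v := by
    intro ψ
    simp only [matDeriv, rPlus, Matrix.of_apply]
    exact cderiv_neg v
  rw [Matrix.sub_apply, e4, e4, e1, e2, Matrix.neg_apply, Matrix.mul_apply]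
  simp only [Matrix.transpose_apply, Matrix.sub_apply, Matrix.of_apply, ← hb,
    mul_comm (thirdForm c k 0 α j _)]
  rw [← e3]
  ring

lemma LeafModel.matDeriv_rMinus_sub (h : LeafModel H c k) (hφ : IsFrameSection H 0 φ)
    (hφ' : IsFrameSection H 0 φ') (he : φ 0 = φ' 0) (hv : v ∈ leafDist H 0) (α : Fin r) :
    matDeriv (fun x => rMinus k x (φ x) α) 0 v - matDeriv (fun x => rMinus k x (φ' x) α) 0 v =
      -((Matrix.of (thirdForm c k 0 α) : Matrix (Fin s) (Fin s) ℂ).map conj *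
        (matDeriv (fun x => frameA (k x) (φ x)) 0 v -
          matDeriv (fun x => frameA (k x) (φ' x)) 0 v)ᵀ) := by
  obtain ⟨h1, h2, h3⟩ := h.mem_leafDist_iff.1 hv
  have hk : ∀ j, ContDiffAt ℝ 2 (fun x => conj (k x α j)) 0 := fun j =>
    contDiffAt_conj (h.levi.contDiffAt α j)
  ext j m
  have hd := hφ.differentiableAt_vec (.inl m)
  have hd' := hφ'.differentiableAt_vec (.inl m)
  set w := cderiv (fun x => (φ x).vec (.inl m)) 0 v - cderiv (fun x => (φ' x).vec (.inl m)) 0 v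
  have hw : ∀ l, dz (.inl l) (star w) = 0 := fun l => by
    rw [dz_star, map_eq_zero]
    refine cderiv_sub_vec_eq_zero hd hd' ?_ h1 h2 h3
    filter_upwards [hφ.eventually_leaf_algFrame h, hφ'.eventually_leaf_algFrame h] with x hx hx'
    exact ((hx.1.cr.mem_iff.1 (hx.2.f_mem m)).1 _).trans
      ((hx'.1.cr.mem_iff.1 (hx'.2.f_mem m)).1 _).symm
  have hu : du (star w) = 0 := by
    rw [du_star, map_eq_zero]
    refine cderiv_sub_vec_eq_zero hd hd' ?_ h1 h2 h3
    filter_upwards [hφ.eventually_leaf_algFrame h, hφ'.eventually_leaf_algFrame h, h.c_leaf]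
      with x hx hx' hc
    rw [← theta_eq_du hc, ← theta_eq_du hc]
    exact ((hx.1.cr.mem_iff.1 (hx.2.f_mem m)).2).trans
      ((hx'.1.cr.mem_iff.1 (hx'.2.f_mem m)).2).symm
  have hb : ∀ l, dz (.inl l) w = matDeriv (fun x => frameA (k x) (φ x)) 0 v m l -
      matDeriv (fun x => frameA (k x) (φ' x)) 0 v m l := by
    intro l
    rw [map_sub, map_cderiv _ hd, map_cderiv _ hd']
    simp only [matDeriv, Matrix.of_apply]
    congr 1
    · refine cderiv_congr_leaf (differentiableAt_linear _ hd)
        (hφ.differentiableAt_frameA h.levi m l) ?_ h1 h2 h3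
      filter_upwards [h.k_leaf] with x hx
      simp [frameA, redz_apply, hx, GradedFrame.vec]
    · refine cderiv_congr_leaf (differentiableAt_linear _ hd')
        (hφ'.differentiableAt_frameA h.levi m l) ?_ h1 h2 h3
      filter_upwards [h.k_leaf] with x hx
      simp [frameA, redz_apply, hx, GradedFrame.vec]
  have e1 := cderiv_cderiv_field (hk j) hd v
  have e2 := cderiv_cderiv_field (hk j) hd' v
  have e0 : (φ 0).vec (.inl m) = (φ' 0).vec (.inl m) := by rw [he]
  simp only [e0] at e1
  have e3 : cderiv (fun x => conj (k x α j)) 0 w =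
      ∑ l, dz (.inl l) w * conj (thirdForm c k 0 α j l) := by
    rw [cderiv_conj, h.cderiv_k hw hu α j]
    simp [dzb_star]
  rw [map_sub] at e3
  have e4 : ∀ ψ : (Coord s r → ℝ) → GradedFrame (Coord s r) s,
      matDeriv (fun x => rMinus k x (ψ x) α) 0 v j m =
        -cderiv (fun x => cderiv (fun y => conj (k y α j)) x ((ψ x).vec (.inl m))) 0 v := by
    intro ψ
    simp only [matDeriv, rMinus, Matrix.of_apply]
    exact cderiv_neg v
  rw [Matrix.sub_apply, e4, e4, e1, e2, Matrix.neg_apply, Matrix.mul_apply]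
  simp only [Matrix.transpose_apply, Matrix.sub_apply, Matrix.of_apply, ← hb, Matrix.map_apply,
    mul_comm (conj (thirdForm c k 0 α j _))]
  rw [← e3]
  ring

end Compare

/-! ### Uniqueness of normalized sections modulo `g₀,₀`. -/

section Normalized

variable {s r : ℕ} {H H' : (Coord s r → ℝ) → Submodule ℂ (Coord s r → ℂ)}
  {c c' : (Coord s r → ℝ) → Fin s ⊕ Fin r → ℂ} {k k' : (Coord s r → ℝ) → Fin r → Fin s → ℂ}
  {φ φ' : (Coord s r → ℝ) → GradedFrame (Coord s r) s} {v : Coord s r → ℂ}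

/-- The difference of the logarithmic derivatives of two `H / K₂` frames. -/
def frameDiffA (k : (Coord s r → ℝ) → Fin r → Fin s → ℂ)
    (φ φ' : (Coord s r → ℝ) → GradedFrame (Coord s r) s) (v : Coord s r → ℂ) :
    Matrix (Fin s) (Fin s) ℂ :=
  (frameA (k 0) (φ 0))ᵀ⁻¹ * (matDeriv (fun x => frameA (k x) (φ x)) 0 v -
    matDeriv (fun x => frameA (k x) (φ' x)) 0 v)ᵀ

/-- The difference of the logarithmic derivatives of two `H̄ / K̄₂` frames. -/
def frameDiffB (k : (Coord s r → ℝ) → Fin r → Fin s → ℂ)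
    (φ φ' : (Coord s r → ℝ) → GradedFrame (Coord s r) s) (v : Coord s r → ℂ) :
    Matrix (Fin s) (Fin s) ℂ :=
  (frameB (k 0) (φ 0))ᵀ⁻¹ * (matDeriv (fun x => frameB (k x) (φ x)) 0 v -
    matDeriv (fun x => frameB (k x) (φ' x)) 0 v)ᵀ

/-- The off-diagonal blocks and the derivatives of `k` depend only on the value of the frame at `0`.
-/
lemma iotaMat_sub (he : φ 0 = φ' 0) : iotaMat k φ v - iotaMat k φ' v =
    Matrix.fromBlocks (frameDiffA k φ φ' v) 0 0 (frameDiffB k φ φ' v) := by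
  have e1 : leafDerivA k φ v - leafDerivA k φ' v = (matDeriv (fun x => frameA (k x) (φ x)) 0 v -
      matDeriv (fun x => frameA (k x) (φ' x)) 0 v)ᵀ := by
    rw [leafDerivA, leafDerivA, he, Matrix.transpose_sub, sub_sub_sub_cancel_right]
  have e2 : leafDerivB k φ v - leafDerivB k φ' v = (matDeriv (fun x => frameB (k x) (φ x)) 0 v -
      matDeriv (fun x => frameB (k x) (φ' x)) 0 v)ᵀ := by
    rw [leafDerivB, leafDerivB, he, Matrix.transpose_sub, sub_sub_sub_cancel_right]
  rw [iotaMat, iotaMat, ← he, sub_eq_add_neg, Matrix.fromBlocks_neg, Matrix.fromBlocks_add,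
    frameDiffA, frameDiffB, ← e1, ← e2, Matrix.mul_sub, Matrix.mul_sub]
  simp [sub_eq_add_neg]

/-- Subtracting the differentiated frame equations of the two sections leaves a nonzero multiple of
`pᵀ + q` on one side and a scalar matrix on the other. -/
lemma LeafModel.frameDiff_csp (h : LeafModel H c k) (hφ : IsFrameSection H 0 φ)
    (hφ' : IsFrameSection H 0 φ') (he : φ 0 = φ' 0) (v : Coord s r → ℂ) :
    ∃ a : ℂ, (frameDiffA k φ φ' v)ᵀ + frameDiffB k φ φ' v = a • 1 := by
  have ha := h.levi.isGradedFrame_iff.1 hφ.self_of_nhds.2.2.2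
  obtain ⟨dA, -, dB⟩ := ha.det_ne
  have f1 := h.matDeriv_frame hφ v
  have f2 := h.matDeriv_frame hφ' v
  rw [← he] at f2
  have pA := (transpose_mul_eq_iff dA).2 (rfl : frameDiffA k φ φ' v = _)
  have qB := (transpose_mul_eq_iff dB).2 (rfl : frameDiffB k φ φ' v = _)
  set p := frameDiffA k φ φ' v
  set q := frameDiffB k φ φ' v
  set A := frameA (k 0) (φ 0)
  set B := frameB (k 0) (φ 0)
  set t := 2 * Complex.I * theta (c 0) (φ 0).g
  have ht : t ≠ 0 := mul_ne_zero (mul_ne_zero two_ne_zero Complex.I_ne_zero) ha.g_ne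
  have pA' := congrArg Matrix.transpose pA
  rw [Matrix.transpose_mul, Matrix.transpose_transpose, Matrix.transpose_transpose] at pA'
  have e1 : t • (pᵀ + q) = (2 * Complex.I * cderiv (fun x => theta (c x) (φ x).g) 0 v -
      2 * Complex.I * cderiv (fun x => theta (c x) (φ' x).g) 0 v) • 1 := by
    rw [sub_smul, ← f1, ← f2]
    calc t • (pᵀ + q) = pᵀ * (t • 1) + (t • 1) * q := by
          rw [Matrix.mul_smul, Matrix.smul_mul, Matrix.mul_one, Matrix.one_mul, smul_add]
      _ = (pᵀ * A) * levZ c 0 * Bᵀ + A * levZ c 0 * (Bᵀ * q) := by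
          rw [← ha.eq]
          simp only [Matrix.mul_assoc, A, B]
      _ = _ := by
          rw [pA', qB, Matrix.transpose_sub, Matrix.mul_sub, Matrix.sub_mul, Matrix.sub_mul]
          abel
  refine ⟨t⁻¹ * (2 * Complex.I * cderiv (fun x => theta (c x) (φ x).g) 0 v -
    2 * Complex.I * cderiv (fun x => theta (c x) (φ' x).g) 0 v), ?_⟩
  rw [mul_smul, ← e1, smul_smul, inv_mul_cancel₀ ht, one_smul]

lemma fromBlocks_mem_csp {p q : Matrix (Fin s) (Fin s) ℂ} {a : ℂ} (h : pᵀ + q = a • 1) :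
    Matrix.fromBlocks p 0 0 q ∈ csp s := by
  refine ⟨a, ?_⟩
  have h' : qᵀ + p = a • 1 := by
    have := congrArg Matrix.transpose h
    rwa [Matrix.transpose_add, Matrix.transpose_transpose, Matrix.transpose_smul,
      Matrix.transpose_one, add_comm] at this
  rw [sympl, Matrix.fromBlocks_transpose, Matrix.fromBlocks_multiply, Matrix.fromBlocks_multiply,
    Matrix.fromBlocks_add, Matrix.fromBlocks_smul]
  simp [h, ← h', add_comm]

/-- Differentiate `Aᵀ S = R`. The change of `A` contributes the term with `frameDiffA` on the left
of `S`. The change of `R`, caused by the motion of the `H̄` frame, contributes the term with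
`frameDiffB` on the right. -/
lemma LeafModel.matDeriv_sPlus_sub (h : LeafModel H c k) (hφ : IsFrameSection H 0 φ)
    (hφ' : IsFrameSection H 0 φ') (he : φ 0 = φ' 0) (hv : v ∈ leafDist H 0) (α : Fin r) :
    matDeriv (fun x => sPlus k x (φ x) α) 0 v - matDeriv (fun x => sPlus k x (φ' x) α) 0 v =
      sPlus k 0 (φ 0) α * frameDiffB k φ φ' v - frameDiffA k φ φ' v * sPlus k 0 (φ 0) α := by
  have hφ0 := hφ.self_of_nhds.2.2.2
  obtain ⟨dA, -, dB⟩ := (h.levi.isGradedFrame_iff.1 hφ0).det_ne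
  have hR := h.matDeriv_rPlus_sub hφ hφ' he hv α
  have e : ∀ {ψ : (Coord s r → ℝ) → GradedFrame (Coord s r) s}, IsFrameSection H 0 ψ →
      (matDeriv (fun x => frameA (k x) (ψ x)) 0 v)ᵀ * sPlus k 0 (ψ 0) α +
        (frameA (k 0) (ψ 0))ᵀ * matDeriv (fun x => sPlus k x (ψ x) α) 0 v =
      matDeriv (fun x => rPlus k x (ψ x) α) 0 v := by
    intro ψ hψ
    have ee : (fun x => (frameA (k x) (ψ x))ᵀ * sPlus k x (ψ x) α) =ᶠ[𝓝 0]
        fun x => rPlus k x (ψ x) α := by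
      filter_upwards [hψ, h.levi.eventually] with x hx hl
      exact (transpose_mul_eq_iff (hl.isGradedFrame_iff.1 hx.2.2.2).det_ne.1).2 rfl
    rw [← matDeriv_congr ee, matDeriv_mul (A := fun x => (frameA (k x) (ψ x))ᵀ)
      (fun i j => hψ.differentiableAt_frameA h.levi j i)
      (fun i j => hψ.differentiableAt_sPlus h.levi α i j)]
    rfl
  have e1 := e hφ
  have e2 := e hφ'
  rw [← he] at e2
  have pA := (transpose_mul_eq_iff dA).2 (rfl : frameDiffA k φ φ' v = _)
  have qB := (transpose_mul_eq_iff dB).2 (rfl : frameDiffB k φ φ' v = _)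
  have hS := (transpose_mul_eq_iff dA).2 (rfl : sPlus k 0 (φ 0) α = _)
  rw [h.rPlus_zero hφ0] at hS
  refine ((Matrix.isUnit_iff_isUnit_det _).2 (isUnit_iff_ne_zero.2 ?_)).mul_left_cancel
    (a := (frameA (k 0) (φ 0))ᵀ) ?_
  · rwa [Matrix.det_transpose]
  · rw [Matrix.mul_sub, Matrix.mul_sub, ← Matrix.mul_assoc, ← Matrix.mul_assoc, hS, pA,
      Matrix.neg_mul, Matrix.mul_assoc, qB, ← hR, ← e1, ← e2, Matrix.transpose_sub, Matrix.sub_mul]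
    abel

lemma LeafModel.matDeriv_sMinus_sub (h : LeafModel H c k) (hφ : IsFrameSection H 0 φ)
    (hφ' : IsFrameSection H 0 φ') (he : φ 0 = φ' 0) (hv : v ∈ leafDist H 0) (α : Fin r) :
    matDeriv (fun x => sMinus k x (φ x) α) 0 v - matDeriv (fun x => sMinus k x (φ' x) α) 0 v =
      sMinus k 0 (φ 0) α * frameDiffA k φ φ' v - frameDiffB k φ φ' v * sMinus k 0 (φ 0) α := by
  have hφ0 := hφ.self_of_nhds.2.2.2
  obtain ⟨dA, -, dB⟩ := (h.levi.isGradedFrame_iff.1 hφ0).det_ne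
  have hR := h.matDeriv_rMinus_sub hφ hφ' he hv α
  have e : ∀ {ψ : (Coord s r → ℝ) → GradedFrame (Coord s r) s}, IsFrameSection H 0 ψ →
      (matDeriv (fun x => frameB (k x) (ψ x)) 0 v)ᵀ * sMinus k 0 (ψ 0) α +
        (frameB (k 0) (ψ 0))ᵀ * matDeriv (fun x => sMinus k x (ψ x) α) 0 v =
      matDeriv (fun x => rMinus k x (ψ x) α) 0 v := by
    intro ψ hψ
    have ee : (fun x => (frameB (k x) (ψ x))ᵀ * sMinus k x (ψ x) α) =ᶠ[𝓝 0]
        fun x => rMinus k x (ψ x) α := by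
      filter_upwards [hψ, h.levi.eventually] with x hx hl
      exact (transpose_mul_eq_iff (hl.isGradedFrame_iff.1 hx.2.2.2).det_ne.2.2).2 rfl
    rw [← matDeriv_congr ee, matDeriv_mul (A := fun x => (frameB (k x) (ψ x))ᵀ)
      (fun i j => hψ.differentiableAt_frameB h.levi j i)
      (fun i j => hψ.differentiableAt_sMinus h.levi α i j)]
    rfl
  have e1 := e hφ
  have e2 := e hφ'
  rw [← he] at e2
  have pA := (transpose_mul_eq_iff dA).2 (rfl : frameDiffA k φ φ' v = _)
  have qB := (transpose_mul_eq_iff dB).2 (rfl : frameDiffB k φ φ' v = _)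
  have hS := (transpose_mul_eq_iff dB).2 (rfl : sMinus k 0 (φ 0) α = _)
  rw [h.rMinus_zero hφ0] at hS
  refine ((Matrix.isUnit_iff_isUnit_det _).2 (isUnit_iff_ne_zero.2 ?_)).mul_left_cancel
    (a := (frameB (k 0) (φ 0))ᵀ) ?_
  · rwa [Matrix.det_transpose]
  · rw [Matrix.mul_sub, Matrix.mul_sub, ← Matrix.mul_assoc, ← Matrix.mul_assoc, hS, qB,
      Matrix.neg_mul, Matrix.mul_assoc, pA, ← hR, ← e1, ← e2, Matrix.transpose_sub, Matrix.sub_mul]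
    abel

lemma mul_sub_mul_mem_span {S : Fin r → Matrix (Fin s) (Fin s) ℂ} {p q : Matrix (Fin s) (Fin s) ℂ}
    (hS : ∀ α, S α * q - p * S α ∈ Submodule.span ℂ (Set.range S)) :
    ∀ X ∈ Submodule.span ℂ (Set.range S), p * X - X * q ∈ Submodule.span ℂ (Set.range S) := by
  have : Submodule.span ℂ (Set.range S) ≤ (Submodule.span ℂ (Set.range S)).comap
      (LinearMap.mulLeft ℂ p - LinearMap.mulRight ℂ q) := by
    refine Submodule.span_le.2 ?_
    rintro _ ⟨α, rfl⟩
    have := Submodule.neg_mem _ (hS α)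
    rw [neg_sub] at this
    exact this
  exact fun X hX => this hX

/-- The commutators of the block diagonal difference with the elements of `g₀,±₂` are, up to sign
and linear extension, the differences of the derivatives in the hypotheses. -/
lemma LeafModel.iotaMat_sub_mem_gZero (h : LeafModel H c k) (hφ : IsFrameSection H 0 φ)
    (hφ' : IsFrameSection H 0 φ') (he : φ 0 = φ' 0) (hv : v ∈ leafDist H 0)
    (hS : ∀ α, matDeriv (fun x => sPlus k x (φ x) α) 0 v -
      matDeriv (fun x => sPlus k x (φ' x) α) 0 v ∈ (leafSymbol k (φ 0)).gPlus)
    (hT : ∀ α, matDeriv (fun x => sMinus k x (φ x) α) 0 v -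
      matDeriv (fun x => sMinus k x (φ' x) α) 0 v ∈ (leafSymbol k (φ 0)).gMinus) :
    iotaMat k φ v - iotaMat k φ' v ∈ (leafSymbol k (φ 0)).gZero := by
  obtain ⟨a, ha⟩ := h.frameDiff_csp hφ hφ' he v
  simp only [h.matDeriv_sPlus_sub hφ hφ' he hv] at hS
  simp only [h.matDeriv_sMinus_sub hφ hφ' he hv] at hT
  rw [iotaMat_sub he]
  refine ⟨fromBlocks_mem_csp ha, rfl, rfl, fun S hX => ⟨_, mul_sub_mul_mem_span hS S hX, ?_⟩,
    fun T hX => ⟨_, mul_sub_mul_mem_span hT T hX, ?_⟩⟩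
  · simp [plusBlock, Matrix.fromBlocks_multiply, sub_eq_add_neg, Matrix.fromBlocks_neg,
      Matrix.fromBlocks_add]
  · simp [minusBlock, Matrix.fromBlocks_multiply, sub_eq_add_neg, Matrix.fromBlocks_neg,
      Matrix.fromBlocks_add]

lemma leviKernel_le_leafDist (H : (Coord s r → ℝ) → Submodule ℂ (Coord s r → ℂ)) :
    leviKernel H 0 ≤ leafDist H 0 := le_sup_left

/-- Normalized sections with the same value have the same derivatives modulo `g₀,₀`. -/
lemma LeafModel.iotaMat_sub_mem_of_obstruction (h : LeafModel H c k) (hφ : IsFrameSection H 0 φ)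
    (hφ' : IsFrameSection H 0 φ') (he : φ 0 = φ' 0) (hv : v ∈ leviKernel H 0)
    {O : Obstruction (leafSymbol k (φ 0))} (hO : HasObstruction H 0 _ φ O)
    (hO' : HasObstruction H 0 _ φ' O) :
    iotaMat k φ v - iotaMat k φ' v ∈ (leafSymbol k (φ 0)).gZero := by
  have hP : ∀ α, sPlus k 0 (φ 0) α ∈ (leafSymbol k (φ 0)).gPlus := fun α =>
    Submodule.subset_span ⟨α, rfl⟩
  have hM : ∀ α, sMinus k 0 (φ 0) α ∈ (leafSymbol k (φ 0)).gMinus := fun α =>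
    Submodule.subset_span ⟨α, rfl⟩
  have h1 := (h.hasObstruction_iff hφ hP hM O).1 hO
  have h2 := (h.hasObstruction_iff hφ' (he ▸ hP) (he ▸ hM) O).1 hO'
  -- For `v` in `K₂` the derivative is a combination of the derivatives along `∂/∂ζ_β`, the only
  -- directions that the obstructions record.
  have hsum := h.mem_leviKernel_iff.1 hv
  refine h.iotaMat_sub_mem_gZero hφ hφ' he (leviKernel_le_leafDist H hv)
    (fun α => ?_) fun α => ?_
  · rw [hsum, matDeriv_sum_dir, matDeriv_sum_dir, ← Finset.sum_sub_distrib]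
    refine Submodule.sum_mem _ fun β _ => ?_
    rw [← smul_sub]
    refine Submodule.smul_mem _ _ ((Submodule.Quotient.eq _).1 ?_)
    refine (h1 α β).2.symm.trans (Eq.trans ?_ (h2 α β).2)
    simp only [he]
  · rw [hsum, matDeriv_sum_dir, matDeriv_sum_dir, ← Finset.sum_sub_distrib]
    refine Submodule.sum_mem _ fun β _ => ?_
    rw [← smul_sub]
    refine Submodule.smul_mem _ _ ((Submodule.Quotient.eq _).1 ?_)
    refine (h1 α β).1.symm.trans (Eq.trans ?_ (h2 α β).1)
    simp only [he]

end Normalized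

/-! ### Modified symbols -/

section ModifiedSymbols

variable {s r : ℕ} {H H' : (Coord s r → ℝ) → Submodule ℂ (Coord s r → ℂ)}
  {c c' : (Coord s r → ℝ) → Fin s ⊕ Fin r → ℂ} {k k' : (Coord s r → ℝ) → Fin r → Fin s → ℂ}
  {φ φ' : (Coord s r → ℝ) → GradedFrame (Coord s r) s} {v : Coord s r → ℂ}
  {π π' : (Coord s r → ℝ) → Fin (2 * s + 1) → ℝ}

lemma LeafModel.iotaImage_eq (h : LeafModel H c k) (hπ : IsLeafProjection H 0 π)
    (hφ : IsFrameSection H 0 φ) {D : Submodule ℂ (Coord s r → ℂ)} (hD : D ≤ leafDist H 0) :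
    iotaImage π 0 φ D = Submodule.span ℂ (iotaMat k φ '' D) := by
  refine congrArg _ (Set.ext fun X => ⟨?_, ?_⟩)
  · rintro ⟨v, hv, hX⟩
    exact ⟨v, hv, ((h.isIotaAlong_iff hπ hφ (hD hv)).1 hX).symm⟩
  · rintro ⟨v, hv, rfl⟩
    exact ⟨v, hv, (h.isIotaAlong_iff hπ hφ (hD hv)).2 rfl⟩

lemma LeafModel.leafDist_eq (h : LeafModel H c k) (h' : LeafModel H' c' k') :
    leafDist H 0 = leafDist H' 0 := by
  ext v
  rw [h.mem_leafDist_iff, h'.mem_leafDist_iff]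

lemma LeafModel.leviKernel_eq (h : LeafModel H c k) (h' : LeafModel H' c' k') :
    leviKernel H 0 = leviKernel H' 0 := by
  ext v
  rw [h.mem_leviKernel_iff, h'.mem_leviKernel_iff]

/-! #### Sections with the same values on the leaf -/

/-- A section for one structure consists, on the leaf, of frames for the other. Correcting it to a
section for the other structure therefore leaves its values on the leaf unchanged. -/
lemma SameLeaf.exists_section (h : LeafModel H c k) (h' : LeafModel H' c' k')
    (hs : SameLeaf c k c' k') (hφ : IsFrameSection H 0 φ) :
    ∃ φ', IsFrameSection H' 0 φ' ∧ ∀ᶠ x in 𝓝 0, φ' (dilation 0 x) = φ (dilation 0 x) := by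
  obtain ⟨φ', hφ', he⟩ := h'.levi.exists_isFrameSection hφ.isSmoothField
    (hs.isGradedFrame h h' hφ.self_of_nhds.2.2.2)
  refine ⟨φ', hφ', ?_⟩
  filter_upwards [eventually_dilation he, eventually_dilation hφ, leaf_agree h h' hs]
    with x h1 h2 h3
  exact h1.self_of_nhds (h3 _ h2.self_of_nhds.2.2.2).1

lemma matDeriv_congr_leaf {m n : Type} {A A' : (Coord s r → ℝ) → Matrix m n ℂ}
    (hA : ∀ i j, DifferentiableAt ℝ (fun x => A x i j) 0)
    (hA' : ∀ i j, DifferentiableAt ℝ (fun x => A' x i j) 0)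
    (he : ∀ᶠ x in 𝓝 0, A (dilation 0 x) = A' (dilation 0 x)) (h1 : ∀ j, dz (.inl j) v = 0)
    (h2 : ∀ j, dzb (.inl j) v = 0) (h3 : du v = 0) : matDeriv A 0 v = matDeriv A' 0 v := by
  ext i j
  exact cderiv_congr_leaf (hA i j) (hA' i j) (he.mono fun x hx => by rw [hx]) h1 h2 h3

lemma SameLeaf.matDeriv_sPlus (h : LeafModel H c k) (h' : LeafModel H' c' k')
    (hs : SameLeaf c k c' k') (hφ : IsFrameSection H 0 φ) (hφ' : IsFrameSection H' 0 φ')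
    (he : ∀ᶠ x in 𝓝 0, φ' (dilation 0 x) = φ (dilation 0 x)) (hv : v ∈ leafDist H 0) (α : Fin r) :
    matDeriv (fun x => sPlus k x (φ x) α) 0 v = matDeriv (fun x => sPlus k' x (φ' x) α) 0 v := by
  obtain ⟨h1, h2, h3⟩ := h.mem_leafDist_iff.1 hv
  refine matDeriv_congr_leaf (hφ.differentiableAt_sPlus h.levi α)
    (hφ'.differentiableAt_sPlus h'.levi α) ?_ h1 h2 h3
  filter_upwards [leaf_agree h h' hs, eventually_dilation hφ, he] with x hx hf e
  rw [e, (hx _ hf.self_of_nhds.2.2.2).2.1]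

lemma SameLeaf.matDeriv_sMinus (h : LeafModel H c k) (h' : LeafModel H' c' k')
    (hs : SameLeaf c k c' k') (hφ : IsFrameSection H 0 φ) (hφ' : IsFrameSection H' 0 φ')
    (he : ∀ᶠ x in 𝓝 0, φ' (dilation 0 x) = φ (dilation 0 x)) (hv : v ∈ leafDist H 0) (α : Fin r) :
    matDeriv (fun x => sMinus k x (φ x) α) 0 v = matDeriv (fun x => sMinus k' x (φ' x) α) 0 v := by
  obtain ⟨h1, h2, h3⟩ := h.mem_leafDist_iff.1 hv
  refine matDeriv_congr_leaf (hφ.differentiableAt_sMinus h.levi α)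
    (hφ'.differentiableAt_sMinus h'.levi α) ?_ h1 h2 h3
  filter_upwards [leaf_agree h h' hs, eventually_dilation hφ, he] with x hx hf e
  rw [e, (hx _ hf.self_of_nhds.2.2.2).2.2]

/-- The frame matrices are differentiated only along the leaf, where the sections agree. The
derivatives of `k` are taken along frame vectors, which have no `∂_u` component at the origin. -/
lemma SameLeaf.iotaMat_eq (h : LeafModel H c k) (h' : LeafModel H' c' k')
    (hs : SameLeaf c k c' k') (hφ : IsFrameSection H 0 φ) (hφ' : IsFrameSection H' 0 φ')
    (he : ∀ᶠ x in 𝓝 0, φ' (dilation 0 x) = φ (dilation 0 x)) (hv : v ∈ leafDist H 0) :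
    iotaMat k φ v = iotaMat k' φ' v := by
  obtain ⟨h1, h2, h3⟩ := h.mem_leafDist_iff.1 hv
  have he0 : φ' 0 = φ 0 := by simpa using he.self_of_nhds
  have hφ0 := hφ.self_of_nhds.2.2.2
  have ha := h.levi.isGradedFrame_iff.1 hφ0
  have hk0 : k 0 = k' 0 := by
    funext α j
    rw [h.k_zero, h'.k_zero]
  have hdk := hs.dk.self_of_nhds
  have hag := (leaf_agree h h' hs).self_of_nhds (φ 0)
  rw [dilation_zero] at hdk hag
  have hsp := (hag hφ0).2.1
  have hsm := (hag hφ0).2.2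
  have ek : ∀ᶠ x in 𝓝 0, k (dilation 0 x) = k' (dilation 0 x) := by
    filter_upwards [h.k_leaf, h'.k_leaf] with x hx hx'
    funext α j
    rw [hx, hx']
  have eA : matDeriv (fun x => frameA (k x) (φ x)) 0 v =
      matDeriv (fun x => frameA (k' x) (φ' x)) 0 v := by
    refine matDeriv_congr_leaf (hφ.differentiableAt_frameA h.levi)
      (hφ'.differentiableAt_frameA h'.levi) ?_ h1 h2 h3
    filter_upwards [ek, he] with x hx e
    rw [hx, e]
  have eB : matDeriv (fun x => frameB (k x) (φ x)) 0 v =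
      matDeriv (fun x => frameB (k' x) (φ' x)) 0 v := by
    refine matDeriv_congr_leaf (hφ.differentiableAt_frameB h.levi)
      (hφ'.differentiableAt_frameB h'.levi) ?_ h1 h2 h3
    filter_upwards [ek, he] with x hx e
    rw [hx, e]
  have duf : ∀ m, du ((φ 0).f m) = 0 := fun m => by
    rw [← theta_eq_du h.c_zero]
    exact (h.levi.cr.mem_iff.1 (ha.f_mem m)).2
  have duh : ∀ m, du ((φ 0).h m) = 0 := fun m => by
    rw [← theta_eq_du h.c_zero]
    exact (h.levi.cr.mem_conj_iff.1 (ha.h_mem m)).2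
  have lA : leafDerivA k φ v = leafDerivA k' φ' v := by
    rw [leafDerivA, leafDerivA, eA, he0]
    simp only [hdk _ _ _ (duf _)]
  have lB : leafDerivB k φ v = leafDerivB k' φ' v := by
    rw [leafDerivB, leafDerivB, eB, he0]
    have : ∀ m, du (star ((φ 0).h m)) = 0 := fun m => by rw [du_star, duh, map_zero]
    simp only [cderiv_conj, hdk _ _ _ (this _)]
  rw [iotaMat, iotaMat, lA, lB, he0, ← hk0, hsp, hsm]

/-- By `hasObstruction_iff` the obstruction is a derivative, along the leaf, of matrices that depend
only on data common to both structures there. -/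
lemma SameLeaf.hasObstruction (h : LeafModel H c k) (h' : LeafModel H' c' k')
    (hs : SameLeaf c k c' k') (hφ : IsFrameSection H 0 φ) (hφ' : IsFrameSection H' 0 φ')
    (he : ∀ᶠ x in 𝓝 0, φ' (dilation 0 x) = φ (dilation 0 x)) {B : BigradedSymbol s}
    (hB : B = leafSymbol k (φ 0)) {O : Obstruction B} (hO : HasObstruction H 0 B φ O) :
    HasObstruction H' 0 B φ' O := by
  have he0 : φ' 0 = φ 0 := by simpa using he.self_of_nhds
  have hφ0 := hφ.self_of_nhds.2.2.2
  have hag := (leaf_agree h h' hs).self_of_nhds (φ 0)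
  rw [dilation_zero] at hag
  have hsp := (hag hφ0).2.1
  have hsm := (hag hφ0).2.2
  have hP : ∀ α, sPlus k 0 (φ 0) α ∈ B.gPlus := fun α => by
    rw [hB]
    exact Submodule.subset_span ⟨α, rfl⟩
  have hM : ∀ α, sMinus k 0 (φ 0) α ∈ B.gMinus := fun α => by
    rw [hB]
    exact Submodule.subset_span ⟨α, rfl⟩
  have hP' : ∀ α, sPlus k' 0 (φ' 0) α ∈ B.gPlus := by rwa [he0, ← hsp]
  have hM' : ∀ α, sMinus k' 0 (φ' 0) α ∈ B.gMinus := by rwa [he0, ← hsm]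
  have hl : ∀ β : Fin r, hol (s := s) (.inr β) ∈ leafDist H 0 := fun β =>
    h.mem_leafDist_iff.2 ⟨fun j => by simp [hol], fun j => by simp [hol], by simp [hol]⟩
  refine (h'.hasObstruction_iff hφ' hP' hM' O).2 fun α β => ?_
  have := (h.hasObstruction_iff hφ hP hM O).1 hO α β
  rw [hs.matDeriv_sPlus h h' hφ hφ' he (hl β), hs.matDeriv_sMinus h h' hφ hφ' he (hl β)] at this
  rw [← he0] at hsp hsm
  simp only [← he0, hsp, hsm] at this
  exact this

lemma SameLeaf.obstructionClass_subset (h : LeafModel H c k) (h' : LeafModel H' c' k')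
    (hs : SameLeaf c k c' k') {φ₀ : GradedFrame (Coord s r) s} {B : BigradedSymbol s}
    (hB : B = leafSymbol k φ₀) : obstructionClass H 0 B φ₀ ⊆ obstructionClass H' 0 B φ₀ := by
  rintro O ⟨φ, hφ, rfl, hO⟩
  obtain ⟨φ', hφ', he⟩ := hs.exists_section h h' hφ
  exact ⟨φ', hφ', by simpa using he.self_of_nhds, hs.hasObstruction h h' hφ hφ' he hB hO⟩

/-- Normalized sections of the first structure give normalized sections of the second. -/
lemma SameLeaf.exists_isNormalized (h : LeafModel H c k) (h' : LeafModel H' c' k')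
    (hs : SameLeaf c k c' k') (N : NormalizationCondition s) {B : BigradedSymbol s}
    (hB : IsBigradedSymbol H 0 (φ 0) B) (hφ : IsNormalized H N 0 B φ) :
    ∃ φ', φ' 0 = φ 0 ∧ IsBigradedSymbol H' 0 (φ 0) B ∧ IsNormalized H' N 0 B φ' ∧
      ∀ v ∈ leafDist H 0, iotaMat k φ v = iotaMat k' φ' v := by
  have hφ0 := hφ.1.self_of_nhds.2.2.2
  have hφ0' := hs.isGradedFrame h h' hφ0
  have eB := (h.isBigradedSymbol_iff hφ0 B).1 hB
  have eB' := eB.trans (hs.leafSymbol_eq h h' hφ0)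
  obtain ⟨φ', hφ', he⟩ := hs.exists_section h h' hφ.1
  have he0 : φ' 0 = φ 0 := by simpa using he.self_of_nhds
  refine ⟨φ', he0, (h'.isBigradedSymbol_iff hφ0' B).2 eB', ⟨hφ', ?_⟩,
    fun v hv => hs.iotaMat_eq h h' hφ.1 hφ' he hv⟩
  -- The inclusion in both directions makes the two obstruction classes equal, so the normalization
  -- condition chooses the same element for both structures.
  rw [he0, ← (hs.obstructionClass_subset h h' eB).antisymm
    (hs.symm.obstructionClass_subset h' h eB')]
  exact hs.hasObstruction h h' hφ.1 hφ' he eB hφ.2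

lemma SameLeaf.isModifiedSymbol (h : LeafModel H c k) (h' : LeafModel H' c' k')
    (hs : SameLeaf c k c' k') (hπ : IsLeafProjection H 0 π) (hπ' : IsLeafProjection H' 0 π')
    (N : NormalizationCondition s) {φ₀ : GradedFrame (Coord s r) s}
    {𝔤 : Submodule ℂ (SymbolSpace s)} (hg : IsModifiedSymbol H N π 0 φ₀ 𝔤) :
    IsModifiedSymbol H' N π' 0 φ₀ 𝔤 := by
  obtain ⟨B, φ, hB, rfl, hφ, rfl⟩ := hg
  obtain ⟨φ', he, hB', hφ', hi⟩ := hs.exists_isNormalized h h' N hB hφ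
  refine ⟨B, φ', hB', he, hφ', ?_⟩
  rw [modifiedSymbolAlong, modifiedSymbolAlong, h.iotaImage_eq hπ hφ.1 le_rfl,
    h'.iotaImage_eq hπ' hφ'.1 le_rfl, ← h.leafDist_eq h', Set.image_congr hi]

lemma SameLeaf.isSigmaModifiedSymbol (h : LeafModel H c k) (h' : LeafModel H' c' k')
    (hs : SameLeaf c k c' k') (hπ : IsLeafProjection H 0 π) (hπ' : IsLeafProjection H' 0 π')
    (N : NormalizationCondition s) {φ₀ : GradedFrame (Coord s r) s}
    {𝔤 : Submodule ℂ (SymbolSpace s)} (hg : IsSigmaModifiedSymbol H N π 0 φ₀ 𝔤) :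
    IsSigmaModifiedSymbol H' N π' 0 φ₀ 𝔤 := by
  obtain ⟨B, φ, hB, rfl, hφ, rfl⟩ := hg
  obtain ⟨φ', he, hB', hφ', hi⟩ := hs.exists_isNormalized h h' N hB hφ
  refine ⟨B, φ', hB', he, hφ', ?_⟩
  have hK := leviKernel_le_leafDist H
  have hK' := leviKernel_le_leafDist H'
  rw [sigmaModifiedSymbolAlong, sigmaModifiedSymbolAlong, h.iotaImage_eq hπ hφ.1 hK,
    h'.iotaImage_eq hπ' hφ'.1 hK', ← h.leviKernel_eq h',
    Set.image_congr fun v hv => hi v (hK hv)]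

/-! #### The invariant form -/

/-- A change of the generators by elements of `g₀,₀` is absorbed by that summand, also after
applying the involution. -/
lemma sup_conjEnd_le {B : BigradedSymbol s}
    {I I' : Submodule ℂ (Matrix (Fin s ⊕ Fin s) (Fin s ⊕ Fin s) ℂ)}
    (hZ : ∀ Y ∈ B.gZero, B.conjEnd Y ∈ B.gZero) (hI : I ≤ I' ⊔ B.gZero) :
    I ⊔ Submodule.span ℂ (B.conjEnd '' I) ⊔ B.gZero ≤
      I' ⊔ Submodule.span ℂ (B.conjEnd '' I') ⊔ B.gZero := by
  refine sup_le (sup_le (hI.trans (sup_le_sup_right le_sup_left _)) (Submodule.span_le.2 ?_))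
    le_sup_right
  rintro _ ⟨Y, hY, rfl⟩
  obtain ⟨Y', hY', Z, hZ', rfl⟩ := Submodule.mem_sup.1 (hI hY)
  rw [B.conjEnd_add]
  exact Submodule.add_mem_sup (Submodule.mem_sup_right (Submodule.subset_span ⟨Y', hY', rfl⟩))
    (hZ Z hZ')

lemma LeafModel.sigmaModifiedSymbolAlong_le (h : LeafModel H c k) (hπ : IsLeafProjection H 0 π)
    (hφ : IsFrameSection H 0 φ) (hφ' : IsFrameSection H 0 φ') (he : φ 0 = φ' 0)
    {B : BigradedSymbol s} (hB : B = leafSymbol k (φ 0)) {O : Obstruction B}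
    (hO : HasObstruction H 0 B φ O) (hO' : HasObstruction H 0 B φ' O) :
    sigmaModifiedSymbolAlong H π 0 B φ ≤ sigmaModifiedSymbolAlong H π 0 B φ' := by
  subst hB
  have hK := leviKernel_le_leafDist H
  refine Submodule.prod_mono le_rfl (sup_conjEnd_le
    (fun Y hY => h.conjEnd_mem_gZero hφ.self_of_nhds.2.2.2 hY) ?_)
  rw [h.iotaImage_eq hπ hφ hK, h.iotaImage_eq hπ hφ' hK]
  refine Submodule.span_le.2 ?_
  rintro _ ⟨v, hv, rfl⟩
  rw [← add_sub_cancel (iotaMat k φ' v) (iotaMat k φ v)]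
  exact Submodule.add_mem_sup (Submodule.subset_span ⟨v, hv, rfl⟩)
    (h.iotaMat_sub_mem_of_obstruction hφ hφ' he hv hO hO')

/-- Frames extend to sections and every section has an obstruction, so the class is nonempty. The
chosen element then belongs to some section through `φ₀`, which is normalized. Any other normalized
section has the same obstruction and so gives the same invariant form. -/
lemma LeafModel.existsUnique_isSigmaModifiedSymbol (h : LeafModel H c k)
    (hπ : IsLeafProjection H 0 π) (N : NormalizationCondition s)
    {φ₀ : GradedFrame (Coord s r) s} (hφ₀ : IsGradedFrame H 0 φ₀) :
    ∃ 𝔤, ∀ 𝔤', IsSigmaModifiedSymbol H N π 0 φ₀ 𝔤' ↔ 𝔤' = 𝔤 := by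
  have hne : (obstructionClass H 0 (leafSymbol k φ₀) φ₀).Nonempty := by
    obtain ⟨φ, hφ, rfl⟩ := h.levi.exists_isFrameSection_through hφ₀
    obtain ⟨O, hO⟩ := h.exists_obstruction hφ
    exact ⟨O, φ, hφ, rfl, hO⟩
  obtain ⟨φ, hφ, rfl, hO⟩ := N.choice_mem _ _ hne
  refine ⟨sigmaModifiedSymbolAlong H π 0 (leafSymbol k (φ 0)) φ, fun 𝔤' => ⟨?_, ?_⟩⟩
  · rintro ⟨B, φ', hB, he, ⟨hφ', hO'⟩, rfl⟩
    obtain rfl := (h.isBigradedSymbol_iff hφ₀ B).1 hB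
    rw [he] at hO'
    exact (h.sigmaModifiedSymbolAlong_le hπ hφ' hφ he (by rw [he]) hO' hO).antisymm
      (h.sigmaModifiedSymbolAlong_le hπ hφ hφ' he.symm rfl hO hO')
  · rintro rfl
    exact ⟨_, φ, (h.isBigradedSymbol_iff hφ₀ _).2 rfl, rfl, ⟨hφ, hO⟩, rfl⟩

end ModifiedSymbols

end CRSymbol

end

/-! ### The comparison of a hypersurface with its model. -/

theorem mainTheorem9 (s r : ℕ)
    (H S : (Fin r → ℂ) → Matrix (Fin s) (Fin s) ℂ)
    (Q : (CRSymbol.Coord s r → ℝ) → ℝ)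
    (hH : ∀ i j, AnalyticAt ℝ (fun ζ => H ζ i j) 0)
    (hS : ∀ i j, AnalyticAt ℝ (fun ζ => S ζ i j) 0)
    (hQ : AnalyticAt ℝ Q 0)
    (hHerm : ∀ᶠ ζ in 𝓝 (0 : Fin r → ℂ), (H ζ).IsHermitian)
    (hSymm : ∀ᶠ ζ in 𝓝 (0 : Fin r → ℂ), (S ζ).IsSymm)
    (hdet : IsUnit (H 0).det)
    (hQw : CRSymbol.WeightedOrderGtTwo Q)
    -- the CR structures of `Re w = P + Q` and of `Re w = P`
    (M M₀ : (CRSymbol.Coord s r → ℝ) → Submodule ℂ (CRSymbol.Coord s r → ℂ))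
    (hM : M = CRSymbol.graphCR fun x => CRSymbol.modelFun H S x + Q x)
    (hM₀ : M₀ = CRSymbol.graphCR (CRSymbol.modelFun H S))
    (hM2 : CRSymbol.UniformlyTwoNondegenerate M 0) :
    -- the model is uniformly 2-nondegenerate near the origin
    CRSymbol.UniformlyTwoNondegenerate M₀ 0 ∧
    -- the fibers of the frame bundles at the origin, and the bigraded symbols, coincide
    (∀ φ₀ : CRSymbol.GradedFrame (CRSymbol.Coord s r) s,
      (CRSymbol.IsGradedFrame M 0 φ₀ ↔ CRSymbol.IsGradedFrame M₀ 0 φ₀) ∧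
      (CRSymbol.IsGradedFrame M 0 φ₀ → ∃ B : CRSymbol.BigradedSymbol s,
        (∀ B', CRSymbol.IsBigradedSymbol M 0 φ₀ B' ↔ B' = B) ∧
        (∀ B', CRSymbol.IsBigradedSymbol M₀ 0 φ₀ B' ↔ B' = B))) ∧
    -- the modified symbols with respect to any normalization condition coincide
    (∀ π π₀ : (CRSymbol.Coord s r → ℝ) → Fin (2 * s + 1) → ℝ,
      CRSymbol.IsLeafProjection M 0 π → CRSymbol.IsLeafProjection M₀ 0 π₀ →
      ∀ (N : CRSymbol.NormalizationCondition s)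
        (φ₀ : CRSymbol.GradedFrame (CRSymbol.Coord s r) s), CRSymbol.IsGradedFrame M 0 φ₀ →
        (∀ 𝔤, CRSymbol.IsModifiedSymbol M N π 0 φ₀ 𝔤 ↔
          CRSymbol.IsModifiedSymbol M₀ N π₀ 0 φ₀ 𝔤) ∧
        (∃ 𝔤 : Submodule ℂ (CRSymbol.SymbolSpace s),
          (∀ 𝔤', CRSymbol.IsSigmaModifiedSymbol M N π 0 φ₀ 𝔤' ↔ 𝔤' = 𝔤) ∧
          (∀ 𝔤', CRSymbol.IsSigmaModifiedSymbol M₀ N π₀ 0 φ₀ 𝔤' ↔ 𝔤' = 𝔤))) := by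
  subst hM hM₀
  obtain ⟨hr, c, k, c', k', h, h', hs⟩ := CRSymbol.exists_leafModel H S Q hH hS hQ
    hHerm.self_of_nhds hdet hQw hM2
  refine ⟨h'.uniformlyTwoNondegenerate hr, fun φ₀ => ⟨⟨hs.isGradedFrame h h',
    hs.symm.isGradedFrame h' h⟩, fun hφ₀ => ⟨CRSymbol.leafSymbol k φ₀,
      h.isBigradedSymbol_iff hφ₀, ?_⟩⟩, fun π π₀ hπ hπ₀ N φ₀ hφ₀ => ⟨fun 𝔤 =>
        ⟨hs.isModifiedSymbol h h' hπ hπ₀ N, hs.symm.isModifiedSymbol h' h hπ₀ hπ N⟩, ?_⟩⟩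
  · rw [hs.leafSymbol_eq h h' hφ₀]
    exact h'.isBigradedSymbol_iff (hs.isGradedFrame h h' hφ₀)
  -- Existence and uniqueness are needed for `M` only: the transfer in both directions gives them
  -- for the model, with the same subspace.
  · obtain ⟨𝔤, hg⟩ := h.existsUnique_isSigmaModifiedSymbol hπ N hφ₀
    refine ⟨𝔤, hg, fun 𝔤' => ⟨fun h1 => (hg 𝔤').1
      (hs.symm.isSigmaModifiedSymbol h' h hπ₀ hπ N h1), fun h1 =>
      hs.isSigmaModifiedSymbol h h' hπ hπ₀ N ((hg 𝔤').2 h1)⟩⟩
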